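/- **Conventions.** All categories are small. A $*$-category is a semicategory (identity morphisms are not required) whose morphism sets $\mathbf V(X,Y)$ are complex vector spaces, with bilinear composition and an antilinear involutive contravariant operation $f\mapsto f^*$ that is the identity on objects. A $C^*$-category is a $*$-category whose morphism spaces are Banach spaces such that $\|g\circ f\|\le\|g\|\,\|f\|$, $\|f^*\circ f\|=\|f\|^2$, and $f^*\circ f$ is a positive element of the $C^*$-algebra $\mathbf V(X,X)$ for every $f\in\mathbf V(X,Y)$. It is unital if every object has an identity morphism. A multiplier morphism $X\to Y$ is a pair $(L,R)$ of uniformly bounded families of linear maps $L(Z):\mathbf V(Z,X)\to\mathbf V(Z,Y)$ and $R(Z):\mathbf V(Y,Z)\to\mathbf V(X,Z)$ with $L(W)(h\circ g)=L(Z)(h)\circ g$ for $h\in\mathbf V(Z,X)$, $g\in\mathbf V(W,Z)$, with $R(Z)(f\circ h)=f\circ R(W)(h)$ for $h\in\mathbf V(Y,W)$, $f\in\mathbf V(W,Z)$, and with $g\circ L(W)(f)=R(Z)(g)\circ f$ for $f\in\mathbf V(W,X)$, $g\in\mathbf V(Y,Z)$. Multiplier morphisms form the unital $C^*$-category $M\mathbf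 V$, with adjoint $(L,R)^*=(f\mapsto R(f^*)^*,\,f\mapsto L(f^*)^*)$. A net $m_i$ in $M\mathbf V(X,Y)$ converges strictly to $m$ if $m_i\circ f\to m\circ f$ and $h\circ m_i\to h\circ m$ in norm for all $f\in\mathbf V(W,X)$, $h\in\mathbf V(Y,Z)$. Isomorphisms, isometries ($\iota^*\iota=\mathrm{id}$) and projections are taken in $M\mathbf V$; an object $U$ is a subobject of $X$ if there is an isometry $U\to X$. The category $\mathbf V$ is subobject complete if every projection $p\in M\mathbf V(X,X)$ is of the form $p=\iota\iota^*$ for an isometry $\iota:U\to X$. The subobject completion $\mathrm{Split}(\mathbf V)$ has as objects the pairs $(X,p)$ with $p\in M\mathbf V(X,X)$ a projection, and as morphisms $(X,p)\to(Y,q)$ the $h\in\mathbf V(X,Y)$ with $h\circ p=h=q\circ h$. A direct sum of a family $(X_i)_{i\in I}$ is an object $D$ with multiplier morphisms $\iota_i:X_i\to D$ such that $\iota_k^*\iota_l=\delta_{kl}\,\mathrm{id}$ and $\sum_i\iota_i\iota_i^*=\mathrm{id}_D$ strictly. A $C^*$-category is *countably additive* if it is subobject complete and has all countable direct sums; it is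 *finitely additive* if it is subobject complete, unital and has all finite direct sums (in both cases the empty sum is included). A countable inductive system in $\mathbf V$ is a family $(X_i)_{i\in I}$ of objects indexed by a nonempty countable directed set with isometries $\iota_{ij}\in M\mathbf V(X_i,X_j)$ for $i\le j$, such that $\iota_{ii}=\mathrm{id}$ and $\iota_{jk}\iota_{ij}=\iota_{ik}$. A direct limit of it is an object $X$ with isometries $\iota_i\in M\mathbf V(X_i,X)$ such that $\iota_j\iota_{ij}=\iota_i$ for $i\le j$ and $\iota_i\iota_i^*\to\mathrm{id}_X$ strictly. An object $P$ of a countably additive $C^*$-category $\mathbf V$ is *finitely presentable* if the $C^*$-algebra $\mathbf V(P,P)$ is unital, and $P(\mathbf V)$ is the full subcategory of finitely presentable objects. A countably additive $\mathbf V$ is *finitely accessible* if there is a set $\mathcal P$ of finitely presentable objects such that every object of $\mathbf V$ is isomorphic to a subobject of a direct limit of some countable inductive system with objects in $\mathcal P$. For a $C^*$-category $\mathbf V$, the countable ind-category $\mathrm{ind}\,\mathbf V$ is the subobject completion of the $C^*$-category whose objects are the countable inductive systems $X=(X_i)$, $Y=(Y_j)$, … in $\mathbf V$ and whose morphism spaces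 are the Banach space inductive limits $\varinjlim_i\varinjlim_j\mathbf V(X_i,Y_j)$ along the isometric maps $f\mapsto\eta_{jl}\circ f\circ\iota_{ik}^*$ ($i\le k$, $j\le l$), where $\iota$, $\eta$ are the connecting isometries of $X$, $Y$, with composition and involution induced from $\mathbf V$. The algebraic tensor product $\mathbf V_1\boxdot\mathbf V_2$ of two $C^*$-categories is the $*$-category with objects the pairs $(V_1,V_2)$ and morphism spaces the algebraic tensor products $\mathbf V_1(V_1,W_1)\odot\mathbf V_2(V_2,W_2)$. A nondegenerate representation of a $*$-category is a linear $*$-functor $\pi$ to Hilbert spaces and bounded operators such that $\pi(\mathbf V(X,X))\pi(X)$ has dense linear span in $\pi(X)$ for every object $X$. The category $\mathbf V_1\boxdot_{\max}\mathbf V_2$ is the completion of $\mathbf V_1\boxdot\mathbf V_2$ for the norm $\sup_\pi\|\pi(f)\|$ over all nondegenerate representations $\pi$ of $\mathbf V_1\boxdot\mathbf V_2$, and $\mathbf V_1\boxdot_{\min}\mathbf V_2$ is the completion for the norm $\sup_{\pi_1,\pi_2}\|(\pi_1\otimes\pi_2)(f)\|$ over all nondegenerate representations $\pi_i$ of $\mathbf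 V_i$, where $\pi_1\otimes\pi_2$ acts on the Hilbert space tensor products (this is the norm given by any pair of faithful $\pi_1,\pi_2$). One sets $\mathbf V_1\boxtimes_{\max}\mathbf V_2=\mathrm{Split}(\mathbf V_1\boxdot_{\max}\mathbf V_2)$ and $\mathbf V_1\boxtimes_{\min}\mathbf V_2=\mathrm{Split}(\mathbf V_1\boxdot_{\min}\mathbf V_2)$. A linear $*$-functor $F:\mathbf V\to\mathbf W$ is nondegenerate if, for all $X,Y\in\mathbf V$, each of $F(\mathbf V(Y,Y))\circ\mathbf W(FX,FY)$ and $\mathbf W(FX,FY)\circ F(\mathbf V(X,X))$ has dense linear span in $\mathbf W(FX,FY)$. Two $C^*$-categories are equivalent, written $\mathbf V\simeq\mathbf W$, if there are nondegenerate linear $*$-functors $F:\mathbf V\to\mathbf W$ and $G:\mathbf W\to\mathbf V$ and natural isomorphisms $G\circ F\cong\mathrm{id}$, $F\circ G\cong\mathrm{id}$ with unitary components in $M\mathbf V$ and $M\mathbf W$ respectively. **Proposition.** Let $\mathbf V_1,\mathbf V_2$ be $C^*$-categories. 1. If $\mathbf V_1$ and $\mathbf V_2$ are finitely accessible, then $\mathbf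 V_1\boxtimes_{\max}\mathbf V_2$ is finitely accessible and $$P(\mathbf V_1\boxtimes_{\max}\mathbf V_2)\simeq P(\mathbf V_1)\boxtimes_{\max}P(\mathbf V_2).$$ 2. If $\mathbf V_1$ and $\mathbf V_2$ are finitely additive, then $$\mathrm{ind}(\mathbf V_1\boxtimes_{\max}\mathbf V_2)\simeq\mathrm{ind}(\mathbf V_1)\boxtimes_{\max}\mathrm{ind}(\mathbf V_2).$$ 3. If $\mathbf V_1$ and $\mathbf V_2$ are finitely accessible, then $\mathbf V_1\boxtimes_{\min}\mathbf V_2$ is finitely accessible and $$P(\mathbf V_1\boxtimes_{\min}\mathbf V_2)\simeq P(\mathbf V_1)\boxtimes_{\min}P(\mathbf V_2).$$ 4. If $\mathbf V_1$ and $\mathbf V_2$ are finitely additive, then $$\mathrm{ind}(\mathbf V_1\boxtimes_{\min}\mathbf V_2)\simeq\mathrm{ind}(\mathbf V_1)\boxtimes_{\min}\mathrm{ind}(\mathbf V_2).$$ -/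

import Mathlib

set_option linter.checkUnivs false

open scoped TensorProduct InnerProductSpace ComplexConjugate Topology
open Filter

universe u v u₁ u₂ v₁ v₂

noncomputable section

/-! ### `*`-categories and `C^*`-categories (semicategories: identities are not required) -/

/-- A `*`-category: a semicategory with complex vector spaces of morphisms, bilinear composition
(`comp g f` is `g ∘ f`) and an antilinear involutive contravariant `*`-operation `adj`. -/
structure StarCat where
  Obj : Type u
  Hom : Obj → Obj → Type v
  [instAddCommGroup : ∀ X Y, AddCommGroup (Hom X Y)]
  [instModule : ∀ X Y, Module ℂ (Hom X Y)]
  comp : ∀ {X Y Z : Obj}, Hom Y Z →ₗ[ℂ] Hom X Y →ₗ[ℂ] Hom X Z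
  adj : ∀ {X Y : Obj}, Hom X Y →ₗ⋆[ℂ] Hom Y X
  assoc : ∀ {W X Y Z : Obj} (h : Hom Y Z) (g : Hom X Y) (f : Hom W X),
    comp (comp h g) f = comp h (comp g f)
  adj_adj : ∀ {X Y : Obj} (f : Hom X Y), adj (adj f) = f
  adj_comp : ∀ {X Y Z : Obj} (g : Hom Y Z) (f : Hom X Y),
    adj (comp g f) = comp (adj f) (adj g)

attribute [instance] StarCat.instAddCommGroup StarCat.instModule

/-- A `*`-category enriched in Banach spaces satisfying the `C^*`-identity. -/
structure PreCStarCat where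
  Obj : Type u
  Hom : Obj → Obj → Type v
  [instNormed : ∀ X Y, NormedAddCommGroup (Hom X Y)]
  [instNormedSpace : ∀ X Y, NormedSpace ℂ (Hom X Y)]
  [instComplete : ∀ X Y, CompleteSpace (Hom X Y)]
  comp : ∀ {X Y Z : Obj}, Hom Y Z →ₗ[ℂ] Hom X Y →ₗ[ℂ] Hom X Z
  adj : ∀ {X Y : Obj}, Hom X Y →ₗ⋆[ℂ] Hom Y X
  assoc : ∀ {W X Y Z : Obj} (h : Hom Y Z) (g : Hom X Y) (f : Hom W X),
    comp (comp h g) f = comp h (comp g f)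
  adj_adj : ∀ {X Y : Obj} (f : Hom X Y), adj (adj f) = f
  adj_comp : ∀ {X Y Z : Obj} (g : Hom Y Z) (f : Hom X Y),
    adj (comp g f) = comp (adj f) (adj g)
  norm_comp_le : ∀ {X Y Z : Obj} (g : Hom Y Z) (f : Hom X Y), ‖comp g f‖ ≤ ‖g‖ * ‖f‖
  norm_adj_comp_self : ∀ {X Y : Obj} (f : Hom X Y), ‖comp (adj f) f‖ = ‖f‖ ^ 2

attribute [instance] PreCStarCat.instNormed PreCStarCat.instNormedSpace PreCStarCat.instComplete

/-- A `C^*`-category: moreover `f^* ∘ f` is a positive element of the `C^*`-algebra of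
endomorphisms of the source of `f`, that is, of the form `g^* ∘ g` with `g` an endomorphism. -/
structure CStarCat extends PreCStarCat.{u, v} where
  pos : ∀ {X Y : Obj} (f : Hom X Y), ∃ g : Hom X X, comp (adj f) f = comp (adj g) g

namespace PreCStarCat

/-- The underlying `*`-category. -/
abbrev toStarCat (V : PreCStarCat.{u, v}) : StarCat.{u, v} where
  Obj := V.Obj
  Hom := V.Hom
  comp := V.comp
  adj := V.adj
  assoc := V.assoc
  adj_adj := V.adj_adj
  adj_comp := V.adj_comp

variable (V : PreCStarCat.{u, v})

lemma norm_adj {X Y : V.Obj} (f : V.Hom X Y) : ‖V.adj f‖ = ‖f‖ := by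
  have key : ∀ {X Y : V.Obj} (f : V.Hom X Y), ‖f‖ ≤ ‖V.adj f‖ := by
    intro X Y f
    rcases (norm_nonneg f).eq_or_lt with h | h
    · rw [← h]; exact norm_nonneg _
    · have h1 := V.norm_adj_comp_self f
      have h2 := V.norm_comp_le (V.adj f) f
      nlinarith
  refine le_antisymm ?_ (key f)
  have := key (V.adj f)
  rwa [V.adj_adj] at this

/-- The endomorphism `C^*`-algebra of an object. -/
def End (X : V.Obj) : Type v := V.Hom X X

variable {V}

instance (X : V.Obj) : NormedAddCommGroup (V.End X) :=
  inferInstanceAs (NormedAddCommGroup (V.Hom X X))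

instance (X : V.Obj) : NormedSpace ℂ (V.End X) :=
  inferInstanceAs (NormedSpace ℂ (V.Hom X X))

instance (X : V.Obj) : CompleteSpace (V.End X) :=
  inferInstanceAs (CompleteSpace (V.Hom X X))

instance (X : V.Obj) : Mul (V.End X) := ⟨fun a b => V.comp (X := X) (Y := X) (Z := X) a b⟩

instance (X : V.Obj) : Star (V.End X) := ⟨fun a => V.adj (X := X) (Y := X) a⟩

instance (X : V.Obj) : NonUnitalNormedRing (V.End X) where
  __ := (inferInstance : NormedAddCommGroup (V.End X))
  left_distrib a b c := map_add (V.comp (X := X) (Y := X) (Z := X) a) b c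
  right_distrib a b c := LinearMap.map_add₂ (V.comp (X := X) (Y := X) (Z := X)) a b c
  zero_mul a := LinearMap.map_zero₂ (V.comp (X := X) (Y := X) (Z := X)) a
  mul_zero a := map_zero (V.comp (X := X) (Y := X) (Z := X) a)
  mul_assoc a b c := V.assoc (W := X) (X := X) (Y := X) (Z := X) a b c
  norm_mul_le a b := V.norm_comp_le (X := X) (Y := X) (Z := X) a b

instance (X : V.Obj) : NonUnitalCStarAlgebra (V.End X) where
  star_involutive a := V.adj_adj (X := X) (Y := X) a
  star_mul a b := V.adj_comp (X := X) (Y := X) (Z := X) a b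
  star_add a b := map_add (V.adj (X := X) (Y := X)) a b
  star_smul c a := map_smulₛₗ (V.adj (X := X) (Y := X)) c a
  smul_assoc c a b := LinearMap.map_smul₂ (V.comp (X := X) (Y := X) (Z := X)) c a b
  smul_comm c a b := (map_smul (V.comp (X := X) (Y := X) (Z := X) a) c b).symm
  norm_mul_self_le a := by
    have := V.norm_adj_comp_self (X := X) (Y := X) a
    change ‖a‖ * ‖a‖ ≤ ‖V.comp (X := X) (Y := X) (Z := X) (V.adj (X := X) (Y := X) a) a‖
    rw [this, sq]
    rfl

end PreCStarCat

/-! ### Positivity in `C^*`-algebras -/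

section Positivity

variable {A : Type*} [NonUnitalCStarAlgebra A]

lemma exists_star_mul_self_of_approx (a : A)
    (h : ∀ ε : ℝ, 0 < ε → ∃ g : A, ‖a - star g * g‖ < ε) : ∃ g : A, a = star g * g := by
  let _ := CStarAlgebra.spectralOrder A
  have _ := CStarAlgebra.spectralOrderedRing A
  rw [← CStarAlgebra.nonneg_iff_eq_star_mul_self]
  have hc : IsClosed {a : A | 0 ≤ a} := CStarAlgebra.isClosed_nonneg
  have : a ∈ closure {a : A | 0 ≤ a} := by
    rw [Metric.mem_closure_iff]
    intro ε hε
    obtain ⟨g, hg⟩ := h ε hε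
    exact ⟨star g * g, star_mul_self_nonneg g, by rwa [dist_eq_norm]⟩
  rwa [hc.closure_eq] at this

lemma exists_selfAdjoint_root (b : A) : ∃ g : A, star g = g ∧ g * g = star b * b := by
  let _ := CStarAlgebra.spectralOrder A
  have _ := CStarAlgebra.spectralOrderedRing A
  refine ⟨CFC.sqrt (star b * b), ?_, ?_⟩
  · exact (IsSelfAdjoint.of_nonneg (CFC.sqrt_nonneg _)).star_eq
  · exact CFC.sqrt_mul_sqrt_self _ (star_mul_self_nonneg b)

lemma exists_sub_mul_self (b : A) (hb : ‖star b * b‖ ≤ 1) :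
    ∃ c : A, star b * b - (star b * b) * (star b * b) = star c * c := by
  let _ := CStarAlgebra.spectralOrder A
  have _ := CStarAlgebra.spectralOrderedRing A
  rw [← CStarAlgebra.nonneg_iff_eq_star_mul_self]
  set a := star b * b with ha
  have ha0 : 0 ≤ a := star_mul_self_nonneg b
  have hsa : IsSelfAdjoint a := IsSelfAdjoint.of_nonneg ha0
  have e : a - a * a = cfcₙ (fun x : ℝ => x - x * x) a := by
    rw [cfcₙ_sub _ _ a, cfcₙ_mul _ _ a, cfcₙ_id' ℝ a]
  rw [e]
  apply cfcₙ_nonneg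
  intro x hx
  have h0 : 0 ≤ x := quasispectrum_nonneg_of_nonneg a ha0 x hx
  have h1 : x ≤ 1 := by
    have := NonUnitalIsometricContinuousFunctionalCalculus.norm_quasispectrum_le (𝕜 := ℝ) a hx hsa
    rw [Real.norm_eq_abs, abs_of_nonneg h0] at this
    exact this.trans hb
  nlinarith

/-- The negative part of a self-adjoint element. -/
lemma exists_negPart (a : A) (ha : IsSelfAdjoint a) :
    ∃ m d : A, star m = m ∧ star d = d ∧ d * d = m ∧ a * m = -(m * m) ∧
      (m = 0 → ∃ g : A, a = star g * g) := by
  let _ := CStarAlgebra.spectralOrder A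
  have _ := CStarAlgebra.spectralOrderedRing A
  have hm : 0 ≤ a⁻ := CFC.negPart_nonneg a
  refine ⟨a⁻, CFC.sqrt a⁻, (IsSelfAdjoint.of_nonneg hm).star_eq,
    (IsSelfAdjoint.of_nonneg (CFC.sqrt_nonneg _)).star_eq, CFC.sqrt_mul_sqrt_self _ hm, ?_, ?_⟩
  · have h := congrArg (· * a⁻) (CFC.posPart_sub_negPart a ha)
    simp only [sub_mul, CFC.posPart_mul_negPart, zero_sub] at h
    exact h.symm
  · intro h
    rw [← CStarAlgebra.nonneg_iff_eq_star_mul_self, ← CFC.posPart_sub_negPart a ha, h, sub_zero]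
    exact CFC.posPart_nonneg a

end Positivity

/-! ### Completion of a `*`-category with respect to a `C^*`-seminorm -/

namespace StarCat

open UniformSpace

variable (A : StarCat.{u, v})

/-- A family of seminorms on the morphism spaces which is submultiplicative and satisfies the
`C^*`-identity. -/
structure IsCStarSeminorm (p : ∀ X Y : A.Obj, Seminorm ℂ (A.Hom X Y)) : Prop where
  comp_le : ∀ {X Y Z : A.Obj} (g : A.Hom Y Z) (f : A.Hom X Y),
    p X Z (A.comp g f) ≤ p Y Z g * p X Y f
  adj_comp_self : ∀ {X Y : A.Obj} (f : A.Hom X Y), p X X (A.comp (A.adj f) f) = p X Y f ^ 2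

/-- The morphism space `A.Hom X Y` as a seminormed space with seminorm `p X Y`. -/
def SHom (_p : ∀ X Y : A.Obj, Seminorm ℂ (A.Hom X Y)) (X Y : A.Obj) : Type v := A.Hom X Y

variable {A} (p : ∀ X Y : A.Obj, Seminorm ℂ (A.Hom X Y))

instance (X Y : A.Obj) : SeminormedAddCommGroup (A.SHom p X Y) :=
  AddGroupSeminorm.toSeminormedAddCommGroup (E := A.Hom X Y) (p X Y).toAddGroupSeminorm

instance (X Y : A.Obj) : Module ℂ (A.SHom p X Y) :=
  inferInstanceAs (Module ℂ (A.Hom X Y))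

lemma SHom.norm_def {X Y : A.Obj} (f : A.SHom p X Y) : ‖f‖ = p X Y f := rfl

instance (X Y : A.Obj) : NormedSpace ℂ (A.SHom p X Y) where
  norm_smul_le c f := (map_smul_eq_mul (p X Y) c f).le

/-- The separated completion of the morphism space `A.Hom X Y` with respect to `p X Y`. -/
abbrev CHom (X Y : A.Obj) : Type v := Completion (A.SHom p X Y)

/-- The canonical map into the completion. -/
def toC {X Y : A.Obj} : A.Hom X Y →ₗ[ℂ] A.CHom p X Y where
  toFun f := Completion.coe' (α := A.SHom p X Y) f
  map_add' f g := Completion.coe_add (α := A.SHom p X Y) f g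
  map_smul' c f := Completion.coe_smul (X := A.SHom p X Y) c f

variable {p}

lemma norm_toC {X Y : A.Obj} (f : A.Hom X Y) : ‖toC p f‖ = p X Y f :=
  Completion.norm_coe (E := A.SHom p X Y) f

lemma CHom.induction {X Y : A.Obj} {P : A.CHom p X Y → Prop} (hc : IsClosed {a | P a})
    (h : ∀ f : A.Hom X Y, P (toC p f)) (a : A.CHom p X Y) : P a :=
  Completion.induction_on (α := A.SHom p X Y) a hc h

lemma CHom.induction₂ {X Y X' Y' : A.Obj} {P : A.CHom p X Y → A.CHom p X' Y' → Prop}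
    (hc : IsClosed {a : A.CHom p X Y × A.CHom p X' Y' | P a.1 a.2})
    (h : ∀ f g, P (toC p f) (toC p g)) (a : A.CHom p X Y) (b : A.CHom p X' Y') : P a b :=
  Completion.induction_on₂ (α := A.SHom p X Y) (β := A.SHom p X' Y') a b hc h

lemma CHom.ext {X Y : A.Obj} {E : Type*} [NormedAddCommGroup E] [NormedSpace ℂ E]
    {S T : A.CHom p X Y →L[ℂ] E} (h : ∀ f : A.Hom X Y, S (toC p f) = T (toC p f)) : S = T := by
  ext a
  exact CHom.induction (isClosed_eq S.continuous T.continuous) h a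

variable (hp : A.IsCStarSeminorm p)

namespace IsCStarSeminorm

lemma adj_eq (hp : A.IsCStarSeminorm p) {X Y : A.Obj} (f : A.Hom X Y) : p Y X (A.adj f) = p X Y f := by
  have key : ∀ {X Y : A.Obj} (f : A.Hom X Y), p X Y f ≤ p Y X (A.adj f) := by
    intro X Y f
    rcases (apply_nonneg (p X Y) f).eq_or_lt with h | h
    · rw [← h]; exact apply_nonneg _ _
    · have h1 := hp.adj_comp_self f
      have h2 := hp.comp_le (A.adj f) f
      nlinarith
  refine le_antisymm ?_ (key f)
  have := key (A.adj f)
  rwa [A.adj_adj] at this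

/-- Composition with a fixed morphism, extended to the completion. -/
def compAux {X Y Z : A.Obj} (g : A.Hom Y Z) : A.CHom p X Y →L[ℂ] A.CHom p X Z :=
  ContinuousLinearMap.fromCompletion (α := A.SHom p X Y)
    (LinearMap.mkContinuous (E := A.SHom p X Y) (F := A.CHom p X Z)
      (toC p ∘ₗ A.comp g) (p Y Z g)
      (fun f => (norm_toC (p := p) (A.comp g f)).trans_le (hp.comp_le g f)))

lemma compAux_toC {X Y Z : A.Obj} (g : A.Hom Y Z) (f : A.Hom X Y) :
    hp.compAux g (toC p f) = toC p (A.comp g f) :=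
  ContinuousLinearMap.fromCompletion_apply_coe (α := A.SHom p X Y) _ f

lemma norm_compAux {X Y Z : A.Obj} (g : A.Hom Y Z) (f : A.CHom p X Y) :
    ‖hp.compAux g f‖ ≤ p Y Z g * ‖f‖ := by
  refine CHom.induction (P := fun f => ‖hp.compAux g f‖ ≤ p Y Z g * ‖f‖)
    (isClosed_le (by fun_prop) (by fun_prop)) (fun f => ?_) f
  rw [compAux_toC, norm_toC, norm_toC]
  exact hp.comp_le g f

/-- `compAux` as a linear map. -/
def compAuxₗ {X Y Z : A.Obj} : A.Hom Y Z →ₗ[ℂ] (A.CHom p X Y →L[ℂ] A.CHom p X Z) where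
  toFun g := hp.compAux g
  map_add' g g' := CHom.ext fun f => by
    rw [add_apply, compAux_toC, compAux_toC, compAux_toC,
      LinearMap.map_add₂, map_add]
  map_smul' c g := CHom.ext fun f => by
    rw [smul_apply, compAux_toC, compAux_toC, LinearMap.map_smul₂, map_smul]
    rfl

/-- Composition on the completion. -/
def comp {X Y Z : A.Obj} : A.CHom p Y Z →L[ℂ] A.CHom p X Y →L[ℂ] A.CHom p X Z :=
  ContinuousLinearMap.fromCompletion (α := A.SHom p Y Z)
    (LinearMap.mkContinuous (E := A.SHom p Y Z) (F := A.CHom p X Y →L[ℂ] A.CHom p X Z)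
      hp.compAuxₗ 1 (fun g => by
        rw [one_mul]
        exact ContinuousLinearMap.opNorm_le_bound _ (norm_nonneg _) (hp.norm_compAux g)))

@[simp]
lemma comp_toC {X Y Z : A.Obj} (g : A.Hom Y Z) (f : A.Hom X Y) :
    hp.comp (toC p g) (toC p f) = toC p (A.comp g f) := by
  have h : hp.comp (toC p g) = hp.compAux (X := X) g :=
    ContinuousLinearMap.fromCompletion_apply_coe (α := A.SHom p Y Z) _ g
  rw [h, compAux_toC]

/-- The adjoint on the completion. -/
def adj {X Y : A.Obj} : A.CHom p X Y →L⋆[ℂ] A.CHom p Y X :=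
  ContinuousLinearMap.fromCompletion (α := A.SHom p X Y)
    (LinearMap.mkContinuous (E := A.SHom p X Y) (F := A.CHom p Y X) (toC p ∘ₛₗ A.adj) 1
      (fun f => by rw [one_mul]; exact ((norm_toC (p := p) (A.adj f)).trans (hp.adj_eq f)).le))

@[simp]
lemma adj_toC {X Y : A.Obj} (f : A.Hom X Y) : hp.adj (toC p f) = toC p (A.adj f) :=
  ContinuousLinearMap.fromCompletion_apply_coe (α := A.SHom p X Y) _ f

end IsCStarSeminorm

/-- The completion of a `*`-category with respect to a `C^*`-seminorm: the objects are the same and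
the morphism spaces are the separated completions. -/
def preCompletion (hp : A.IsCStarSeminorm p) : PreCStarCat.{u, v} where
  Obj := A.Obj
  Hom := A.CHom p
  comp := ContinuousLinearMap.toLinearMap₁₂ hp.comp
  adj := hp.adj.toLinearMap
  assoc {W X Y Z} h g f := by
    change hp.comp (hp.comp h g) f = hp.comp h (hp.comp g f)
    refine CHom.induction (P := fun h => hp.comp (hp.comp h g) f = hp.comp h (hp.comp g f))
      (isClosed_eq (by fun_prop) (by fun_prop)) (fun h => ?_) h
    refine CHom.induction₂
      (P := fun g f => hp.comp (hp.comp (toC p h) g) f = hp.comp (toC p h) (hp.comp g f))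
      (isClosed_eq (by fun_prop) (by fun_prop)) (fun g f => ?_) g f
    simp only [hp.comp_toC, A.assoc]
  adj_adj f := by
    change hp.adj (hp.adj f) = f
    refine CHom.induction (P := fun f => hp.adj (hp.adj f) = f)
      (isClosed_eq (by fun_prop) (by fun_prop)) (fun f => ?_) f
    simp only [hp.adj_toC, A.adj_adj]
  adj_comp g f := by
    change hp.adj (hp.comp g f) = hp.comp (hp.adj f) (hp.adj g)
    refine CHom.induction₂ (P := fun g f => hp.adj (hp.comp g f) = hp.comp (hp.adj f) (hp.adj g))
      (isClosed_eq (by fun_prop) (by fun_prop)) (fun g f => ?_) g f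
    simp only [hp.comp_toC, hp.adj_toC, A.adj_comp]
  norm_comp_le g f := by
    change ‖hp.comp g f‖ ≤ ‖g‖ * ‖f‖
    refine CHom.induction₂ (P := fun g f => ‖hp.comp g f‖ ≤ ‖g‖ * ‖f‖)
      (isClosed_le (by fun_prop) (by fun_prop)) (fun g f => ?_) g f
    simp only [hp.comp_toC, norm_toC]
    exact hp.comp_le g f
  norm_adj_comp_self f := by
    change ‖hp.comp (hp.adj f) f‖ = ‖f‖ ^ 2
    refine CHom.induction (P := fun f => ‖hp.comp (hp.adj f) f‖ = ‖f‖ ^ 2)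
      (isClosed_eq (by fun_prop) (by fun_prop)) (fun f => ?_) f
    simp only [hp.comp_toC, hp.adj_toC, norm_toC]
    exact hp.adj_comp_self f

/-- The endomorphism `C^*`-algebra of an object in the completion. -/
def EndC (hp : A.IsCStarSeminorm p) (X : A.Obj) : Type v := (A.preCompletion hp).End X

instance (X : A.Obj) : NonUnitalCStarAlgebra (EndC hp X) :=
  PreCStarCat.instNonUnitalCStarAlgebraEnd (V := A.preCompletion hp) X

/-- All `f^* ∘ f` are positive in the completion. -/
def IsPositive (hp : A.IsCStarSeminorm p) : Prop :=
  ∀ {X Y : A.Obj} (f : A.Hom X Y), ∃ g : A.CHom p X X,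
    toC p (A.comp (A.adj f) f) = hp.comp (hp.adj g) g

lemma IsPositive.approx {hp : A.IsCStarSeminorm p} (hpos : A.IsPositive hp) {X Y : A.Obj}
    (f : A.CHom p X Y) (ε : ℝ) (hε : 0 < ε) :
    ∃ g : A.CHom p X X, ‖hp.comp (hp.adj f) f - hp.comp (hp.adj g) g‖ < ε := by
  have hcont : Continuous fun f' : A.CHom p X Y => hp.comp (hp.adj f') f' := by fun_prop
  obtain ⟨δ, hδ, h⟩ := Metric.continuous_iff.1 hcont f ε hε
  obtain ⟨f', hf'⟩ : ∃ f' : A.Hom X Y, dist f (toC p f') < δ :=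
    (Completion.denseRange_coe (α := A.SHom p X Y)).exists_dist_lt f hδ
  obtain ⟨g, hg⟩ := hpos f'
  refine ⟨g, ?_⟩
  have := h (toC p f') (by rwa [dist_comm])
  rwa [hp.adj_toC, hp.comp_toC, dist_comm, dist_eq_norm, hg] at this

/-- The completion of a `*`-category with respect to a `C^*`-seminorm, as a `C^*`-category. -/
def completion (hp : A.IsCStarSeminorm p) (hpos : A.IsPositive hp) : CStarCat.{u, v} where
  toPreCStarCat := A.preCompletion hp
  pos {X Y} f :=
    exists_star_mul_self_of_approx (A := (A.preCompletion hp).End X)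
      ((A.preCompletion hp).comp ((A.preCompletion hp).adj f) f)
      (fun ε hε => hpos.approx (X := X) (Y := Y) f ε hε)

end StarCat

/-! ### Representations on Hilbert spaces -/

/-- A linear `*`-functor from a `*`-category to the category of Hilbert spaces and bounded linear
operators. -/
structure StarCat.Rep (A : StarCat.{u, v}) where
  H : A.Obj → Type v
  [instNormed : ∀ X, NormedAddCommGroup (H X)]
  [instInner : ∀ X, InnerProductSpace ℂ (H X)]
  [instComplete : ∀ X, CompleteSpace (H X)]
  map : ∀ {X Y : A.Obj}, A.Hom X Y →ₗ[ℂ] (H X →L[ℂ] H Y)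
  map_comp : ∀ {X Y Z : A.Obj} (g : A.Hom Y Z) (f : A.Hom X Y),
    map (A.comp g f) = (map g).comp (map f)
  map_adj : ∀ {X Y : A.Obj} (f : A.Hom X Y), map (A.adj f) = ContinuousLinearMap.adjoint (map f)

attribute [instance] StarCat.Rep.instNormed StarCat.Rep.instInner StarCat.Rep.instComplete

namespace StarCat

variable {A : StarCat.{u, v}}

/-- A representation is nondegenerate if the vectors `π(f) ξ`, with `f` an endomorphism of `X` and
`ξ ∈ H X`, span a dense subspace of `H X` for every object `X`. -/
def Rep.Nondegenerate (π : A.Rep) : Prop :=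
  ∀ X : A.Obj, (Submodule.span ℂ
    {η : π.H X | ∃ (f : A.Hom X X) (ξ : π.H X), π.map f ξ = η}).topologicalClosure = ⊤

lemma Rep.inner_map (π : A.Rep) {X Y : A.Obj} (f : A.Hom X Y) (ξ : π.H X) (η : π.H Y) :
    ⟪π.map (A.adj f) η, ξ⟫_ℂ = ⟪η, π.map f ξ⟫_ℂ := by
  rw [π.map_adj, ContinuousLinearMap.adjoint_inner_left]

lemma Rep.norm_map_sq (π : A.Rep) {X Y : A.Obj} (f : A.Hom X Y) :
    ‖π.map (A.comp (A.adj f) f)‖ = ‖π.map f‖ ^ 2 := by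
  rw [π.map_comp, π.map_adj, ContinuousLinearMap.norm_adjoint_comp_self, sq]

section Family

variable {ι : Type*} (S : ι → A.Rep)

/-- The norms of the images of a morphism under the members of the family are bounded. -/
def FamBdd : Prop := ∀ {X Y : A.Obj} (f : A.Hom X Y), BddAbove (Set.range fun i => ‖(S i).map f‖)

variable {S}

/-- The seminorm `f ↦ sup_i ‖π_i(f)‖` for a family of representations `π_i`. -/
def famSeminorm (hS : FamBdd S) (X Y : A.Obj) : Seminorm ℂ (A.Hom X Y) :=
  Seminorm.of (fun f => ⨆ i, ‖(S i).map f‖)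
    (fun f g => Real.iSup_le (fun i => by
        rw [map_add]
        exact (norm_add_le _ _).trans (add_le_add (le_ciSup (hS f) i) (le_ciSup (hS g) i)))
      (add_nonneg (Real.iSup_nonneg fun _ => norm_nonneg _)
        (Real.iSup_nonneg fun _ => norm_nonneg _)))
    (fun c f => by
      rw [Real.mul_iSup_of_nonneg (norm_nonneg c)]
      exact iSup_congr fun i => by rw [map_smul, norm_smul])

variable (hS : FamBdd S)

lemma famSeminorm_apply {X Y : A.Obj} (f : A.Hom X Y) :
    famSeminorm hS X Y f = ⨆ i, ‖(S i).map f‖ := rfl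

lemma le_famSeminorm (i : ι) {X Y : A.Obj} (f : A.Hom X Y) :
    ‖(S i).map f‖ ≤ famSeminorm hS X Y f := le_ciSup (hS f) i

lemma famSeminorm_isCStar : A.IsCStarSeminorm (famSeminorm hS) where
  comp_le g f := Real.iSup_le (fun i => by
      rw [(S i).map_comp]
      exact (ContinuousLinearMap.opNorm_comp_le _ _).trans
        (mul_le_mul (le_famSeminorm hS i g) (le_famSeminorm hS i f) (norm_nonneg _)
          (apply_nonneg _ _)))
    (mul_nonneg (apply_nonneg _ _) (apply_nonneg _ _))
  adj_comp_self f := by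
    rw [famSeminorm_apply]
    simp only [Rep.norm_map_sq]
    refine le_antisymm (Real.iSup_le (fun i => ?_) (sq_nonneg _)) ?_
    · exact pow_le_pow_left₀ (norm_nonneg _) (le_famSeminorm hS i f) 2
    · have hb : BddAbove (Set.range fun i => ‖(S i).map f‖ ^ 2) := by
        simpa only [Rep.norm_map_sq] using hS (A.comp (A.adj f) f)
      have h0 : 0 ≤ ⨆ i, ‖(S i).map f‖ ^ 2 := Real.iSup_nonneg fun _ => sq_nonneg _
      rw [← Real.le_sqrt (apply_nonneg _ _) h0]
      refine Real.iSup_le (fun i => ?_) (Real.sqrt_nonneg _)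
      exact Real.le_sqrt_of_sq_le (le_ciSup hb i)

/-- The extension of a member of the family to the completion. -/
def famExt (i : ι) (X Y : A.Obj) :
    A.CHom (famSeminorm hS) X Y →L[ℂ] ((S i).H X →L[ℂ] (S i).H Y) :=
  ContinuousLinearMap.fromCompletion (α := A.SHom (famSeminorm hS) X Y)
    (LinearMap.mkContinuous (E := A.SHom (famSeminorm hS) X Y) (S i).map 1
      (fun f => by rw [one_mul]; exact le_famSeminorm hS i f))

lemma famExt_toC (i : ι) {X Y : A.Obj} (f : A.Hom X Y) :
    famExt hS i X Y (toC _ f) = (S i).map f :=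
  ContinuousLinearMap.fromCompletion_apply_coe (α := A.SHom (famSeminorm hS) X Y) _ f

lemma famExt_comp (i : ι) {X Y Z : A.Obj} (g : A.CHom (famSeminorm hS) Y Z)
    (f : A.CHom (famSeminorm hS) X Y) :
    famExt hS i X Z ((famSeminorm_isCStar hS).comp g f) =
      (famExt hS i Y Z g).comp (famExt hS i X Y f) := by
  refine CHom.induction₂ (P := fun g f => famExt hS i X Z ((famSeminorm_isCStar hS).comp g f) =
    (famExt hS i Y Z g).comp (famExt hS i X Y f))
    (isClosed_eq (by fun_prop) (by fun_prop)) (fun g f => ?_) g f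
  simp only [IsCStarSeminorm.comp_toC, famExt_toC, (S i).map_comp]

lemma famExt_adj (i : ι) {X Y : A.Obj} (f : A.CHom (famSeminorm hS) X Y) :
    famExt hS i Y X ((famSeminorm_isCStar hS).adj f) =
      ContinuousLinearMap.adjoint (famExt hS i X Y f) := by
  refine CHom.induction (P := fun f => famExt hS i Y X ((famSeminorm_isCStar hS).adj f) =
    ContinuousLinearMap.adjoint (famExt hS i X Y f))
    (isClosed_eq (by fun_prop) (by fun_prop)) (fun f => ?_) f
  simp only [IsCStarSeminorm.adj_toC, famExt_toC, (S i).map_adj]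

lemma famExt_faithful {X Y : A.Obj} (f : A.CHom (famSeminorm hS) X Y)
    (h : ∀ i, famExt hS i X Y f = 0) : f = 0 := by
  have key : ∀ (C : ℝ), 0 ≤ C → (∀ i, ‖famExt hS i X Y f‖ ≤ C) → ‖f‖ ≤ C := by
    intro C hC hf
    refine le_of_forall_pos_le_add fun ε hε => ?_
    obtain ⟨f', hf'⟩ : ∃ f' : A.Hom X Y, dist f (toC (famSeminorm hS) f') < ε / 2 :=
      (UniformSpace.Completion.denseRange_coe (α := A.SHom (famSeminorm hS) X Y)).exists_dist_lt f
        (half_pos hε)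
    rw [dist_eq_norm] at hf'
    have h1 : ‖f‖ ≤ ‖toC (famSeminorm hS) f'‖ + ε / 2 := by
      have := norm_add_le (f - toC (famSeminorm hS) f') (toC (famSeminorm hS) f')
      rw [sub_add_cancel] at this
      linarith
    have h2 : ‖toC (famSeminorm hS) f'‖ ≤ C + ε / 2 := by
      rw [norm_toC, famSeminorm_apply]
      refine Real.iSup_le (fun i => ?_) (by linarith)
      have h3 : (S i).map f' = famExt hS i X Y f - famExt hS i X Y (f - toC _ f') := by
        rw [map_sub, famExt_toC, sub_sub_cancel]
      have h4 : ‖famExt hS i X Y (f - toC _ f')‖ ≤ ε / 2 := by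
        refine (ContinuousLinearMap.le_of_opNorm_le (c := 1) _ ?_ _).trans ?_
        · refine ContinuousLinearMap.opNorm_le_bound _ zero_le_one (fun g => ?_)
          refine CHom.induction (P := fun g => ‖famExt hS i X Y g‖ ≤ 1 * ‖g‖)
            (isClosed_le (by fun_prop) (by fun_prop)) (fun g => ?_) g
          rw [famExt_toC, norm_toC, one_mul]
          exact le_famSeminorm hS i g
        · rw [one_mul]; exact hf'.le
      rw [h3]
      exact (norm_sub_le _ _).trans (add_le_add (hf i) h4)
    linarith
  exact norm_le_zero_iff.1 (key 0 le_rfl fun i => by rw [h i, norm_zero])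

lemma famSeminorm_isPositive : A.IsPositive (famSeminorm_isCStar hS) := by
  intro X Y f
  have hp := famSeminorm_isCStar hS
  let a : EndC hp X := toC (famSeminorm hS) (A.comp (A.adj f) f)
  have ha : IsSelfAdjoint a := by
    change hp.adj (toC (famSeminorm hS) (A.comp (A.adj f) f)) = toC _ (A.comp (A.adj f) f)
    rw [hp.adj_toC, A.adj_comp, A.adj_adj]
  obtain ⟨m, d, hm, hd, hdm, ham, hpos⟩ := exists_negPart a ha
  refine hpos ?_
  have hmul : ∀ (i : ι) (b c : EndC hp X), famExt hS i X X (b * c : EndC hp X) =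
    (famExt hS i X X b).comp (famExt hS i X X c) := fun i b c => famExt_comp hS i b c
  have hstar : ∀ (i : ι) (b : EndC hp X), famExt hS i X X (star b : EndC hp X) =
    ContinuousLinearMap.adjoint (famExt hS i X X b) := fun i b => famExt_adj hS i b
  have hneg : ∀ (i : ι) (b : EndC hp X), famExt hS i X X (-b : EndC hp X) =
    -(famExt hS i X X b) := fun i b => map_neg (famExt hS i X X) b
  have hdm0 : d * m = 0 := by
    refine famExt_faithful hS (d * m : EndC hp X) (fun i => ?_)
    ext ξ
    set M := famExt hS i X X m with hM
    set D := famExt hS i X X d with hD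
    have hM' : ContinuousLinearMap.adjoint M = M := by rw [hM, ← hstar, hm]
    have hD' : ContinuousLinearMap.adjoint D = D := by rw [hD, ← hstar, hd]
    have e1 : famExt hS i X X a =
        (ContinuousLinearMap.adjoint ((S i).map f)).comp ((S i).map f) := by
      change famExt hS i X X (toC _ _) = _
      rw [famExt_toC, (S i).map_comp, (S i).map_adj]
    have e2 : (famExt hS i X X a).comp M = -(M.comp M) := by
      rw [hM, ← hmul, ham, hneg, hmul]
    have e3 : D.comp D = M := by rw [hD, ← hmul, hdm]
    have e4 : RCLike.re ⟪famExt hS i X X a (M ξ), M ξ⟫_ℂ = ‖(S i).map f (M ξ)‖ ^ 2 := by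
      rw [e1, ContinuousLinearMap.comp_apply, ContinuousLinearMap.adjoint_inner_left,
        inner_self_eq_norm_sq]
    have e5 : RCLike.re ⟪famExt hS i X X a (M ξ), M ξ⟫_ℂ = - ‖D (M ξ)‖ ^ 2 := by
      have h1 : famExt hS i X X a (M ξ) = - M (M ξ) := by
        have := congrArg (fun T => T ξ) e2
        simpa using this
      have h2 : M (M ξ) = D (D (M ξ)) := by
        have := congrArg (fun T => T (M ξ)) e3
        simpa using this.symm
      rw [h1, h2, inner_neg_left, map_neg]
      conv_lhs => rw [← hD', ContinuousLinearMap.adjoint_inner_left, hD']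
      rw [inner_self_eq_norm_sq]
    have e6 : ‖D (M ξ)‖ ^ 2 = 0 := by
      have := sq_nonneg ‖(S i).map f (M ξ)‖
      have := sq_nonneg ‖D (M ξ)‖
      linarith [e4.symm.trans e5]
    have e7 : D (M ξ) = 0 := by simpa using e6
    rw [hmul]
    exact e7
  have hmm : star m * m = 0 := by
    rw [hm]
    nth_rewrite 1 [← hdm]
    rw [mul_assoc, hdm0, mul_zero]
  exact CStarRing.star_mul_self_eq_zero_iff m |>.1 hmm

/-- The completion of a `*`-category with respect to a bounded family of representations. -/
def famCompletion (hS : FamBdd S) : CStarCat.{u, v} :=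
  A.completion (famSeminorm_isCStar hS) (famSeminorm_isPositive hS)

end Family

end StarCat

/-! ### Algebraic, maximal and minimal tensor products -/

/-- The algebraic tensor product of two `C^*`-categories. -/
abbrev algTensor (V₁ : CStarCat.{u₁, v}) (V₂ : CStarCat.{u₂, v}) : StarCat.{max u₁ u₂, v} where
  Obj := V₁.Obj × V₂.Obj
  Hom X Y := V₁.Hom X.1 Y.1 ⊗[ℂ] V₂.Hom X.2 Y.2
  comp := TensorProduct.map₂ V₁.comp V₂.comp
  adj := TensorProduct.map V₁.adj V₂.adj
  assoc h g f := by
    induction h with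
    | zero => simp only [map_zero, LinearMap.zero_apply]
    | add h h' hh hh' => simp only [map_add, LinearMap.add_apply, hh, hh']
    | tmul h h' =>
      induction g with
      | zero => simp only [map_zero, LinearMap.zero_apply]
      | add g g' hg hg' => simp only [map_add, LinearMap.add_apply, hg, hg']
      | tmul g g' =>
        induction f with
        | zero => simp only [map_zero]
        | add f f' hf hf' => simp only [map_add, hf, hf']
        | tmul f f' => simp only [TensorProduct.map₂_apply_tmul, TensorProduct.map_tmul, V₁.assoc, V₂.assoc]
  adj_adj f := by
    induction f with
    | zero => simp only [map_zero]
    | add f f' hf hf' => simp only [map_add, hf, hf']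
    | tmul f f' => simp only [TensorProduct.map_tmul, V₁.adj_adj, V₂.adj_adj]
  adj_comp g f := by
    induction g with
    | zero => simp only [map_zero, LinearMap.zero_apply]
    | add g g' hg hg' => simp only [map_add, LinearMap.add_apply, hg, hg']
    | tmul g g' =>
      induction f with
      | zero => simp only [map_zero, LinearMap.zero_apply]
      | add f f' hf hf' => simp only [map_add, LinearMap.add_apply, hf, hf']
      | tmul f f' =>
        simp only [TensorProduct.map₂_apply_tmul, TensorProduct.map_tmul, V₁.adj_comp,
          V₂.adj_comp]

section TensorNorms

variable {V₁ : CStarCat.{u₁, v}} {V₂ : CStarCat.{u₂, v}}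

lemma CStarCat.exists_sub (V : CStarCat.{u, v}) {X Y : V.Obj} (f : V.Hom X Y) (hf : ‖f‖ ≤ 1) :
    ∃ b c : V.Hom X X, V.comp (V.adj f) f - V.comp (V.comp (V.adj f) f) (V.comp (V.adj f) f) =
      V.comp (V.adj c) c ∧ V.comp (V.adj f) f = V.comp (V.adj b) b := by
  obtain ⟨b, hb⟩ := V.pos f
  have hn : ‖V.comp (V.adj b) b‖ ≤ 1 := by
    rw [← hb, V.norm_adj_comp_self]
    exact pow_le_one₀ (norm_nonneg _) hf
  obtain ⟨c, hc⟩ := exists_sub_mul_self (A := V.End X) b hn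
  refine ⟨b, c, ?_, hb⟩
  rw [hb]
  exact hc

/-- Every representation `π` of the algebraic tensor product satisfies
`‖π (f ⊗ g)‖ ≤ ‖f‖ * ‖g‖`. -/
lemma algTensor.norm_map_tmul_le_one (π : (algTensor V₁ V₂).Rep) {X Y : (algTensor V₁ V₂).Obj}
    (f : V₁.Hom X.1 Y.1) (g : V₂.Hom X.2 Y.2) (hf : ‖f‖ ≤ 1) (hg : ‖g‖ ≤ 1) :
    ‖π.map (X := X) (Y := Y) (f ⊗ₜ[ℂ] g)‖ ≤ 1 := by
  obtain ⟨b₁, c₁, h₁, -⟩ := V₁.exists_sub f hf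
  obtain ⟨b₂, c₂, h₂, hb₂⟩ := V₂.exists_sub g hg
  set x := V₁.comp (V₁.adj f) f with hx
  set y := V₂.comp (V₂.adj g) g with hy
  have hxs : V₁.adj x = x := by rw [hx, V₁.adj_comp, V₁.adj_adj]
  have hys : V₂.adj y = y := by rw [hy, V₂.adj_comp, V₂.adj_adj]
  let T : π.H X →L[ℂ] π.H X := π.map (X := X) (Y := X) (x ⊗ₜ[ℂ] y)
  have hTfg : (algTensor V₁ V₂).comp (X := X) (Y := Y) (Z := X)
      ((algTensor V₁ V₂).adj (X := X) (Y := Y) (f ⊗ₜ[ℂ] g)) (f ⊗ₜ[ℂ] g) = x ⊗ₜ[ℂ] y := rfl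
  have key : ∀ (a : V₁.Hom X.1 X.1) (a' : V₂.Hom X.2 X.2) (ξ : π.H X),
      0 ≤ RCLike.re ⟪π.map (X := X) (Y := X)
        (V₁.comp (V₁.adj a) a ⊗ₜ[ℂ] V₂.comp (V₂.adj a') a') ξ, ξ⟫_ℂ := by
    intro a a' ξ
    have e : (V₁.comp (V₁.adj a) a ⊗ₜ[ℂ] V₂.comp (V₂.adj a') a') =
      (algTensor V₁ V₂).comp (X := X) (Y := X) (Z := X)
        ((algTensor V₁ V₂).adj (X := X) (Y := X) (a ⊗ₜ[ℂ] a')) (a ⊗ₜ[ℂ] a') := rfl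
    rw [e, π.map_comp, ContinuousLinearMap.comp_apply, π.inner_map, inner_self_eq_norm_sq]
    positivity
  have hT : ∀ ξ, ‖T ξ‖ ^ 2 ≤ RCLike.re ⟪T ξ, ξ⟫_ℂ := by
    intro ξ
    have e1 : (x ⊗ₜ[ℂ] y : V₁.Hom X.1 X.1 ⊗[ℂ] V₂.Hom X.2 X.2) =
        (algTensor V₁ V₂).comp (X := X) (Y := X) (Z := X)
          ((algTensor V₁ V₂).adj (X := X) (Y := X) (x ⊗ₜ[ℂ] y)) (x ⊗ₜ[ℂ] y) +
        (V₁.comp (V₁.adj c₁) c₁ ⊗ₜ[ℂ] V₂.comp (V₂.adj b₂) b₂ +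
        V₁.comp (V₁.adj x) x ⊗ₜ[ℂ] V₂.comp (V₂.adj c₂) c₂) := by
      have e0 : (algTensor V₁ V₂).comp (X := X) (Y := X) (Z := X)
          ((algTensor V₁ V₂).adj (X := X) (Y := X) (x ⊗ₜ[ℂ] y)) (x ⊗ₜ[ℂ] y) =
          V₁.comp (V₁.adj x) x ⊗ₜ[ℂ] V₂.comp (V₂.adj y) y := rfl
      rw [e0, ← h₁, ← h₂, ← hb₂, hxs, hys, TensorProduct.sub_tmul, TensorProduct.tmul_sub]
      abel
    have e2 : RCLike.re ⟪T ξ, ξ⟫_ℂ = ‖T ξ‖ ^ 2 +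
        (RCLike.re ⟪π.map (X := X) (Y := X)
          (V₁.comp (V₁.adj c₁) c₁ ⊗ₜ[ℂ] V₂.comp (V₂.adj b₂) b₂) ξ, ξ⟫_ℂ +
        RCLike.re ⟪π.map (X := X) (Y := X)
          (V₁.comp (V₁.adj x) x ⊗ₜ[ℂ] V₂.comp (V₂.adj c₂) c₂) ξ, ξ⟫_ℂ) := by
      have e3 : T = π.map (X := X) (Y := X) ((algTensor V₁ V₂).comp (X := X) (Y := X) (Z := X)
          ((algTensor V₁ V₂).adj (X := X) (Y := X) (x ⊗ₜ[ℂ] y)) (x ⊗ₜ[ℂ] y)) +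
        (π.map (X := X) (Y := X) (V₁.comp (V₁.adj c₁) c₁ ⊗ₜ[ℂ] V₂.comp (V₂.adj b₂) b₂) +
        π.map (X := X) (Y := X) (V₁.comp (V₁.adj x) x ⊗ₜ[ℂ] V₂.comp (V₂.adj c₂) c₂)) := by
        have := congrArg (π.map (X := X) (Y := X)) e1
        exact this.trans ((map_add _ _ _).trans (congrArg _ (map_add _ _ _)))
      conv_lhs => rw [e3]
      rw [add_apply, add_apply, inner_add_left, inner_add_left, map_add, map_add, π.map_comp,
        ContinuousLinearMap.comp_apply, π.inner_map, inner_self_eq_norm_sq]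
    rw [e2]
    have := key c₁ b₂ ξ
    have := key x c₂ ξ
    linarith
  have hT1 : ∀ ξ, ‖T ξ‖ ≤ ‖ξ‖ := by
    intro ξ
    have h1 := hT ξ
    have h2 : RCLike.re ⟪T ξ, ξ⟫_ℂ ≤ ‖T ξ‖ * ‖ξ‖ :=
      (RCLike.re_le_norm _).trans (norm_inner_le_norm _ _)
    rcases (norm_nonneg (T ξ)).eq_or_lt with h | h
    · rw [← h]; exact norm_nonneg _
    · nlinarith
  have hT2 : ‖T‖ ≤ 1 :=
    ContinuousLinearMap.opNorm_le_bound _ zero_le_one fun ξ => by rw [one_mul]; exact hT1 ξ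
  have h3 : ‖π.map (X := X) (Y := Y) (f ⊗ₜ[ℂ] g)‖ ^ 2 = ‖T‖ := by
    rw [← π.norm_map_sq, hTfg]
  have h4 : ‖π.map (X := X) (Y := Y) (f ⊗ₜ[ℂ] g)‖ ^ 2 ≤ 1 := h3.trans_le hT2
  exact (sq_le_one_iff₀ (norm_nonneg _)).1 h4

lemma algTensor.exists_bound {X Y : (algTensor V₁ V₂).Obj} (t : (algTensor V₁ V₂).Hom X Y) :
    ∃ C : ℝ, ∀ π : (algTensor V₁ V₂).Rep, ‖π.map t‖ ≤ C := by
  induction t using TensorProduct.induction_on with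
  | zero => exact ⟨0, fun π => by rw [map_zero, norm_zero]⟩
  | add s t hs ht =>
    obtain ⟨C, hC⟩ := hs
    obtain ⟨D, hD⟩ := ht
    exact ⟨C + D, fun π => by
      rw [map_add]; exact (norm_add_le _ _).trans (add_le_add (hC π) (hD π))⟩
  | tmul f g =>
    refine ⟨(‖f‖ + 1) * (‖g‖ + 1), fun π => ?_⟩
    have hf : 0 < ‖f‖ + 1 := by positivity
    have hg : 0 < ‖g‖ + 1 := by positivity
    have h := norm_map_tmul_le_one π (X := X) (Y := Y) (((‖f‖ + 1 : ℝ) : ℂ)⁻¹ • f)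
      (((‖g‖ + 1 : ℝ) : ℂ)⁻¹ • g)
      (by
        rw [norm_smul, norm_inv, Complex.norm_real, Real.norm_of_nonneg hf.le,
          inv_mul_le_one₀ hf]
        linarith)
      (by
        rw [norm_smul, norm_inv, Complex.norm_real, Real.norm_of_nonneg hg.le,
          inv_mul_le_one₀ hg]
        linarith)
    rw [TensorProduct.smul_tmul_smul] at h
    have h' : ‖(((‖f‖ + 1 : ℝ) : ℂ)⁻¹ * ((‖g‖ + 1 : ℝ) : ℂ)⁻¹) •
        π.map (X := X) (Y := Y) (f ⊗ₜ[ℂ] g)‖ ≤ 1 := by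
      rw [← map_smul]; exact h
    rw [norm_smul, norm_mul, norm_inv, norm_inv, Complex.norm_real, Complex.norm_real,
      Real.norm_of_nonneg hf.le, Real.norm_of_nonneg hg.le, ← mul_inv,
      inv_mul_le_one₀ (by positivity)] at h'
    exact h'

lemma algTensor.famBdd {ι : Type*} (S : ι → (algTensor V₁ V₂).Rep) : StarCat.FamBdd S := by
  intro X Y t
  obtain ⟨C, hC⟩ := algTensor.exists_bound t
  exact ⟨C, by rintro _ ⟨i, rfl⟩; exact hC (S i)⟩

/-- Extending bounded operators between inner product spaces to the completions, linearly. -/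
def completionₗ (E F : Type*) [NormedAddCommGroup E] [InnerProductSpace ℂ E]
    [NormedAddCommGroup F] [InnerProductSpace ℂ F] :
    (E →L[ℂ] F) →ₗ[ℂ] (UniformSpace.Completion E →L[ℂ] UniformSpace.Completion F) where
  toFun T := ContinuousLinearMap.completion T
  map_add' S T := by
    refine ContinuousLinearMap.ext fun x => ?_
    refine UniformSpace.Completion.induction_on
      (p := fun x => (S + T).completion x = (S.completion + T.completion) x) x
      (isClosed_eq (ContinuousLinearMap.continuous _) (ContinuousLinearMap.continuous _))
      (fun x => ?_)
    rw [add_apply, ContinuousLinearMap.completion_apply_coe,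
      ContinuousLinearMap.completion_apply_coe, ContinuousLinearMap.completion_apply_coe,
      add_apply, UniformSpace.Completion.coe_add]
  map_smul' c T := by
    refine ContinuousLinearMap.ext fun x => ?_
    refine UniformSpace.Completion.induction_on
      (p := fun x => (c • T).completion x = (c • T.completion) x) x
      (isClosed_eq (ContinuousLinearMap.continuous _) (ContinuousLinearMap.continuous _))
      (fun x => ?_)
    rw [smul_apply, ContinuousLinearMap.completion_apply_coe,
      ContinuousLinearMap.completion_apply_coe, smul_apply, UniformSpace.Completion.coe_smul]

lemma completionₗ_coe {E F : Type*} [NormedAddCommGroup E] [InnerProductSpace ℂ E]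
    [NormedAddCommGroup F] [InnerProductSpace ℂ F] (T : E →L[ℂ] F) (x : E) :
    completionₗ E F T (x : UniformSpace.Completion E) = (T x : UniformSpace.Completion F) :=
  ContinuousLinearMap.completion_apply_coe _ _

lemma completionₗ_comp {E F G : Type*} [NormedAddCommGroup E] [InnerProductSpace ℂ E]
    [NormedAddCommGroup F] [InnerProductSpace ℂ F] [NormedAddCommGroup G] [InnerProductSpace ℂ G]
    (S : F →L[ℂ] G) (T : E →L[ℂ] F) :
    completionₗ E G (S.comp T) = (completionₗ F G S).comp (completionₗ E F T) := by
  refine ContinuousLinearMap.ext fun x => ?_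
  refine UniformSpace.Completion.induction_on
    (p := fun x => completionₗ E G (S.comp T) x = (completionₗ F G S).comp (completionₗ E F T) x) x
    (isClosed_eq (ContinuousLinearMap.continuous _) (ContinuousLinearMap.continuous _))
    (fun x => ?_)
  rw [ContinuousLinearMap.comp_apply, completionₗ_coe, completionₗ_coe, completionₗ_coe,
    ContinuousLinearMap.comp_apply]

lemma completionₗ_adjoint {E F : Type*} [NormedAddCommGroup E] [InnerProductSpace ℂ E]
    [NormedAddCommGroup F] [InnerProductSpace ℂ F] (S : F →L[ℂ] E) (T : E →L[ℂ] F)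
    (h : ∀ x y, ⟪S x, y⟫_ℂ = ⟪x, T y⟫_ℂ) :
    completionₗ F E S = ContinuousLinearMap.adjoint (completionₗ E F T) := by
  rw [ContinuousLinearMap.eq_adjoint_iff]
  intro x y
  refine UniformSpace.Completion.induction_on₂
    (p := fun x y => ⟪completionₗ F E S x, y⟫_ℂ = ⟪x, completionₗ E F T y⟫_ℂ) x y
    (isClosed_eq
      (((completionₗ F E S).continuous.comp continuous_fst).inner continuous_snd)
      (continuous_fst.inner ((completionₗ E F T).continuous.comp continuous_snd)))
    (fun x y => ?_)
  rw [completionₗ_coe, completionₗ_coe, UniformSpace.Completion.inner_coe,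
    UniformSpace.Completion.inner_coe, h]

/-- The linear map `f ⊗ g ↦ π₁(f) ⊗ π₂(g)` into the bounded operators between the algebraic tensor
products of the Hilbert spaces. -/
def tensorRepAux (π₁ : V₁.toStarCat.Rep) (π₂ : V₂.toStarCat.Rep) (X Y : (algTensor V₁ V₂).Obj) :
    (algTensor V₁ V₂).Hom X Y →ₗ[ℂ]
      ((π₁.H X.1 ⊗[ℂ] π₂.H X.2) →L[ℂ] (π₁.H Y.1 ⊗[ℂ] π₂.H Y.2)) :=
  TensorProduct.lift
    (LinearMap.mk₂ ℂ (fun (f : V₁.Hom X.1 Y.1) (g : V₂.Hom X.2 Y.2) =>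
      TensorProduct.mapL (π₁.map (X := X.1) (Y := Y.1) f) (π₂.map (X := X.2) (Y := Y.2) g))
      (fun f f' g => by
        rw [← TensorProduct.mapL_add_left]; exact congrArg (TensorProduct.mapL · _) (map_add _ _ _))
      (fun c f g => by
        rw [← TensorProduct.mapL_smul_left]
        exact congrArg (TensorProduct.mapL · _) (map_smul _ _ _))
      (fun f g g' => by
        rw [← TensorProduct.mapL_add_right]; exact congrArg (TensorProduct.mapL _) (map_add _ _ _))
      (fun c f g => by
        rw [← TensorProduct.mapL_smul_right]
        exact congrArg (TensorProduct.mapL _) (map_smul _ _ _)))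

lemma tensorRepAux_tmul (π₁ : V₁.toStarCat.Rep) (π₂ : V₂.toStarCat.Rep)
    (X Y : (algTensor V₁ V₂).Obj) (f : V₁.Hom X.1 Y.1) (g : V₂.Hom X.2 Y.2) :
    tensorRepAux π₁ π₂ X Y (f ⊗ₜ[ℂ] g) =
      TensorProduct.mapL (π₁.map (X := X.1) (Y := Y.1) f) (π₂.map (X := X.2) (Y := Y.2) g) := rfl

lemma tensorRepAux_comp (π₁ : V₁.toStarCat.Rep) (π₂ : V₂.toStarCat.Rep)
    {X Y Z : (algTensor V₁ V₂).Obj} (g : (algTensor V₁ V₂).Hom Y Z)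
    (f : (algTensor V₁ V₂).Hom X Y) :
    tensorRepAux π₁ π₂ X Z ((algTensor V₁ V₂).comp g f) =
      (tensorRepAux π₁ π₂ Y Z g).comp (tensorRepAux π₁ π₂ X Y f) := by
  induction g using TensorProduct.induction_on with
  | zero => simp only [map_zero, LinearMap.zero_apply, ContinuousLinearMap.zero_comp]
  | add g g' hg hg' =>
    simp only [map_add, LinearMap.add_apply, ContinuousLinearMap.add_comp, hg, hg']
  | tmul g g' =>
    induction f using TensorProduct.induction_on with
    | zero => simp only [map_zero, ContinuousLinearMap.comp_zero]
    | add f f' hf hf' => simp only [map_add, ContinuousLinearMap.comp_add, hf, hf']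
    | tmul f f' =>
      have h₁ := π₁.map_comp g f
      have h₂ := π₂.map_comp g' f'
      rw [TensorProduct.map₂_apply_tmul, TensorProduct.map_tmul, tensorRepAux_tmul,
        tensorRepAux_tmul, tensorRepAux_tmul, h₁, h₂, TensorProduct.mapL_comp]

lemma tensorRepAux_adj (π₁ : V₁.toStarCat.Rep) (π₂ : V₂.toStarCat.Rep)
    {X Y : (algTensor V₁ V₂).Obj} (f : (algTensor V₁ V₂).Hom X Y)
    (x : π₁.H Y.1 ⊗[ℂ] π₂.H Y.2) (y : π₁.H X.1 ⊗[ℂ] π₂.H X.2) :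
    ⟪tensorRepAux π₁ π₂ Y X ((algTensor V₁ V₂).adj f) x, y⟫_ℂ =
      ⟪x, tensorRepAux π₁ π₂ X Y f y⟫_ℂ := by
  induction f using TensorProduct.induction_on with
  | zero => simp
  | add f f' hf hf' =>
    simp only [map_add, add_apply, inner_add_left, inner_add_right, hf, hf']
  | tmul f f' =>
    rw [TensorProduct.map_tmul, tensorRepAux_tmul, tensorRepAux_tmul]
    induction x using TensorProduct.induction_on with
    | zero => simp
    | add x x' hx hx' => simp only [map_add, inner_add_left, hx, hx']
    | tmul x x' =>
      induction y using TensorProduct.induction_on with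
      | zero => simp
      | add y y' hy hy' => simp only [map_add, inner_add_right, hy, hy']
      | tmul y y' =>
        have h₁ := π₁.inner_map f y x
        have h₂ := π₂.inner_map f' y' x'
        rw [TensorProduct.mapL_tmul, TensorProduct.mapL_tmul, TensorProduct.inner_tmul,
          TensorProduct.inner_tmul, h₁, h₂]

/-- The exterior tensor product of representations: `(π₁ ⊗ π₂)(f ⊗ g) = π₁(f) ⊗ π₂(g)` acting on
the Hilbert space tensor products of the underlying Hilbert spaces. -/
def tensorRep (π₁ : V₁.toStarCat.Rep) (π₂ : V₂.toStarCat.Rep) : (algTensor V₁ V₂).Rep where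
  H X := UniformSpace.Completion (π₁.H X.1 ⊗[ℂ] π₂.H X.2)
  map {X Y} := completionₗ _ _ ∘ₗ tensorRepAux π₁ π₂ X Y
  map_comp g f := by
    rw [LinearMap.comp_apply, tensorRepAux_comp, completionₗ_comp]
    rfl
  map_adj f := completionₗ_adjoint _ _ (tensorRepAux_adj π₁ π₂ f)

/-- The maximal tensor product, before subobject completion. -/
def maxTensor₀ (V₁ : CStarCat.{u₁, v}) (V₂ : CStarCat.{u₂, v}) : CStarCat.{max u₁ u₂, v} :=
  StarCat.famCompletion (A := algTensor V₁ V₂)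
    (S := fun π : {π : (algTensor V₁ V₂).Rep // π.Nondegenerate} => π.1) (algTensor.famBdd _)

/-- The minimal tensor product, before subobject completion. -/
def minTensor₀ (V₁ : CStarCat.{u₁, v}) (V₂ : CStarCat.{u₂, v}) : CStarCat.{max u₁ u₂, v} :=
  StarCat.famCompletion (A := algTensor V₁ V₂)
    (S := fun π : {π : V₁.toStarCat.Rep // π.Nondegenerate} ×
      {π : V₂.toStarCat.Rep // π.Nondegenerate} => tensorRep π.1.1 π.2.1) (algTensor.famBdd _)

end TensorNorms

/-! ### Multiplier morphisms -/

/-- A multiplier morphism `X → Y`: a pair of uniformly bounded families of linear maps, the left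
multiplication maps `L Z : Hom Z X → Hom Z Y` and the right multiplication maps
`R Z : Hom Y Z → Hom X Z`. -/
@[ext]
structure Mult (V : CStarCat.{u, v}) (X Y : V.Obj) where
  L : ∀ Z : V.Obj, V.Hom Z X →ₗ[ℂ] V.Hom Z Y
  R : ∀ Z : V.Obj, V.Hom Y Z →ₗ[ℂ] V.Hom X Z
  bdd : ∃ C : ℝ, ∀ Z : V.Obj, (∀ f : V.Hom Z X, ‖L Z f‖ ≤ C * ‖f‖) ∧
    (∀ f : V.Hom Y Z, ‖R Z f‖ ≤ C * ‖f‖)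
  L_comp : ∀ {W Z : V.Obj} (h : V.Hom Z X) (g : V.Hom W Z),
    L W (V.comp h g) = V.comp (L Z h) g
  R_comp : ∀ {W Z : V.Obj} (f : V.Hom W Z) (h : V.Hom Y W),
    R Z (V.comp f h) = V.comp f (R W h)
  comp_L : ∀ {W Z : V.Obj} (g : V.Hom Y Z) (f : V.Hom W X),
    V.comp g (L W f) = V.comp (R Z g) f

namespace Mult

variable {V : CStarCat.{u, v}} {W X Y Z : V.Obj}

lemma continuous_L (m : Mult V X Y) (Z : V.Obj) : Continuous (m.L Z) := by
  obtain ⟨C, hC⟩ := m.bdd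
  exact (LinearMap.mkContinuous (m.L Z) C (hC Z).1).continuous

lemma continuous_R (m : Mult V X Y) (Z : V.Obj) : Continuous (m.R Z) := by
  obtain ⟨C, hC⟩ := m.bdd
  exact (LinearMap.mkContinuous (m.R Z) C (hC Z).2).continuous

/-- The identity multiplier. -/
def id (X : V.Obj) : Mult V X X where
  L _ := LinearMap.id
  R _ := LinearMap.id
  bdd := ⟨1, fun Z => ⟨fun f => by simp, fun f => by simp⟩⟩
  L_comp _ _ := rfl
  R_comp _ _ := rfl
  comp_L _ _ := rfl

/-- The zero multiplier. -/
def zero (X Y : V.Obj) : Mult V X Y where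
  L _ := 0
  R _ := 0
  bdd := ⟨0, fun Z => ⟨fun f => by simp, fun f => by simp⟩⟩
  L_comp _ _ := by simp
  R_comp _ _ := by simp
  comp_L _ _ := by simp

/-- Composition of multipliers, `comp n m` is `n ∘ m`. -/
def comp (n : Mult V Y Z) (m : Mult V X Y) : Mult V X Z where
  L W := n.L W ∘ₗ m.L W
  R W := m.R W ∘ₗ n.R W
  bdd := by
    obtain ⟨C, hC⟩ := m.bdd
    obtain ⟨D, hD⟩ := n.bdd
    refine ⟨|D| * |C|, fun W => ⟨fun f => ?_, fun f => ?_⟩⟩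
    · calc ‖n.L W (m.L W f)‖ ≤ D * ‖m.L W f‖ := (hD W).1 _
        _ ≤ |D| * ‖m.L W f‖ := by gcongr; exact le_abs_self D
        _ ≤ |D| * (|C| * ‖f‖) := by
          gcongr; exact ((hC W).1 f).trans (by gcongr; exact le_abs_self C)
        _ = _ := by ring
    · calc ‖m.R W (n.R W f)‖ ≤ C * ‖n.R W f‖ := (hC W).2 _
        _ ≤ |C| * ‖n.R W f‖ := by gcongr; exact le_abs_self C
        _ ≤ |C| * (|D| * ‖f‖) := by
          gcongr; exact ((hD W).2 f).trans (by gcongr; exact le_abs_self D)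
        _ = _ := by ring
  L_comp h g := by simp only [LinearMap.comp_apply, m.L_comp, n.L_comp]
  R_comp f h := by simp only [LinearMap.comp_apply, m.R_comp, n.R_comp]
  comp_L g f := by simp only [LinearMap.comp_apply, n.comp_L, m.comp_L]

/-- The adjoint multiplier. -/
def adj (m : Mult V X Y) : Mult V Y X where
  L W := V.adj ∘ₛₗ m.R W ∘ₛₗ V.adj
  R W := V.adj ∘ₛₗ m.L W ∘ₛₗ V.adj
  bdd := by
    obtain ⟨C, hC⟩ := m.bdd
    refine ⟨C, fun W => ⟨fun f => ?_, fun f => ?_⟩⟩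
    · have := (hC W).2 (V.adj f)
      rw [V.norm_adj] at this
      change ‖V.adj (m.R W (V.adj f))‖ ≤ _
      rwa [V.norm_adj]
    · have := (hC W).1 (V.adj f)
      rw [V.norm_adj] at this
      change ‖V.adj (m.L W (V.adj f))‖ ≤ _
      rwa [V.norm_adj]
  L_comp h g := by
    simp only [LinearMap.comp_apply, V.adj_comp, m.R_comp, V.adj_adj]
  R_comp f h := by
    simp only [LinearMap.comp_apply, V.adj_comp, m.L_comp, V.adj_adj]
  comp_L g f := by
    have h := congrArg V.adj (m.comp_L (V.adj f) (V.adj g))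
    simp only [V.adj_comp, V.adj_adj] at h
    exact h.symm

lemma id_L (f : V.Hom Z X) : (id X).L Z f = f := rfl

lemma id_R (f : V.Hom X Z) : (id X).R Z f = f := rfl

lemma comp_L_apply (n : Mult V Y Z) (m : Mult V X Y) (f : V.Hom W X) :
    (n.comp m).L W f = n.L W (m.L W f) := rfl

lemma comp_R_apply (n : Mult V Y Z) (m : Mult V X Y) (f : V.Hom Z W) :
    (n.comp m).R W f = m.R W (n.R W f) := rfl

lemma adj_L (m : Mult V X Y) (f : V.Hom Z Y) : m.adj.L Z f = V.adj (m.R Z (V.adj f)) := rfl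

lemma adj_R (m : Mult V X Y) (f : V.Hom X Z) : m.adj.R Z f = V.adj (m.L Z (V.adj f)) := rfl

lemma adj_adj (m : Mult V X Y) : m.adj.adj = m := by
  ext Z f
  · rw [adj_L, adj_R, V.adj_adj, V.adj_adj]
  · rw [adj_R, adj_L, V.adj_adj, V.adj_adj]

lemma adj_comp (n : Mult V Y Z) (m : Mult V X Y) : (n.comp m).adj = m.adj.comp n.adj := by
  ext W f
  · simp only [adj_L, comp_L_apply, comp_R_apply, V.adj_adj]
  · simp only [adj_R, comp_L_apply, comp_R_apply, V.adj_adj]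

lemma comp_assoc {T : V.Obj} (k : Mult V Z T) (n : Mult V Y Z) (m : Mult V X Y) :
    (k.comp n).comp m = k.comp (n.comp m) := rfl

lemma id_comp (m : Mult V X Y) : (id Y).comp m = m := rfl

lemma comp_id (m : Mult V X Y) : m.comp (id X) = m := rfl

lemma id_adj : (id X).adj = id X := by
  ext W f
  · rw [adj_L, id_R, V.adj_adj, id_L]
  · rw [adj_R, id_L, V.adj_adj, id_R]

/-- An isometry in the multiplier category. -/
def IsIsometry (m : Mult V X Y) : Prop := m.adj.comp m = id X

/-- A unitary isomorphism in the multiplier category. -/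
def IsUnitary (m : Mult V X Y) : Prop := m.adj.comp m = id X ∧ m.comp m.adj = id Y

/-- A projection in the multiplier category. -/
def IsProjection (p : Mult V X X) : Prop := p.comp p = p ∧ p.adj = p

lemma IsIsometry.comp {n : Mult V Y Z} {m : Mult V X Y} (hn : n.IsIsometry) (hm : m.IsIsometry) :
    (n.comp m).IsIsometry := by
  unfold IsIsometry at *
  rw [adj_comp, comp_assoc, ← comp_assoc n.adj n m, hn, id_comp, hm]

lemma IsIsometry.norm_L {m : Mult V X Y} (hm : m.IsIsometry) (f : V.Hom Z X) :
    ‖m.L Z f‖ = ‖f‖ := by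
  have h : V.comp (V.adj (m.L Z f)) (m.L Z f) = V.comp (V.adj f) f := by
    have h1 : V.adj (m.L Z f) = m.adj.R Z (V.adj f) := by rw [adj_R, V.adj_adj]
    rw [h1, ← m.adj.comp_L, ← comp_L_apply, hm, id_L]
  have h2 := V.norm_adj_comp_self (m.L Z f)
  rw [h, V.norm_adj_comp_self] at h2
  exact ((sq_eq_sq₀ (norm_nonneg _) (norm_nonneg _)).1 h2).symm

lemma IsIsometry.norm_adj_R {m : Mult V X Y} (hm : m.IsIsometry) (f : V.Hom X Z) :
    ‖m.adj.R Z f‖ = ‖f‖ := by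
  rw [adj_R, V.norm_adj, hm.norm_L, V.norm_adj]

lemma IsIsometry.norm_adj_L_le {m : Mult V X Y} (hm : m.IsIsometry) (f : V.Hom Z Y) :
    ‖m.adj.L Z f‖ ≤ ‖f‖ := by
  have h : V.comp (V.adj (m.adj.L Z f)) (m.adj.L Z f) =
      V.comp (V.adj f) (m.L Z (m.adj.L Z f)) := by
    rw [adj_L, V.adj_adj, ← m.comp_L]
  have h2 := V.norm_adj_comp_self (m.adj.L Z f)
  rw [h] at h2
  have h3 := V.norm_comp_le (V.adj f) (m.L Z (m.adj.L Z f))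
  rw [h2, V.norm_adj, hm.norm_L] at h3
  rcases (norm_nonneg (m.adj.L Z f)).eq_or_lt with h0 | h0
  · rw [← h0]; exact norm_nonneg _
  · nlinarith

lemma IsIsometry.norm_R_le {m : Mult V X Y} (hm : m.IsIsometry) (f : V.Hom Y Z) :
    ‖m.R Z f‖ ≤ ‖f‖ := by
  have := hm.norm_adj_L_le (V.adj f)
  rwa [adj_L, V.adj_adj, V.norm_adj, V.norm_adj] at this

end Mult

/-! ### Subobject completion -/

/-- An object of the subobject completion: an object with a multiplier projection. -/
structure SplitObj (V : CStarCat.{u, v}) where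
  X : V.Obj
  p : Mult V X X
  isProj : p.IsProjection

namespace SplitObj

variable {V : CStarCat.{u, v}}

/-- Morphisms `(X, p) → (Y, q)`: the morphisms `h : X → Y` with `h ∘ p = h = q ∘ h`. -/
def Hom (A B : SplitObj V) : Submodule ℂ (V.Hom A.X B.X) where
  carrier := {h | A.p.R B.X h = h ∧ B.p.L A.X h = h}
  add_mem' := by
    rintro a b ⟨h1, h2⟩ ⟨h3, h4⟩
    exact ⟨by rw [map_add, h1, h3], by rw [map_add, h2, h4]⟩
  zero_mem' := ⟨map_zero _, map_zero _⟩
  smul_mem' := by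
    rintro c a ⟨h1, h2⟩
    exact ⟨by rw [map_smul, h1], by rw [map_smul, h2]⟩

lemma isClosed_Hom (A B : SplitObj V) : IsClosed (A.Hom B : Set (V.Hom A.X B.X)) :=
  (isClosed_eq (A.p.continuous_R B.X) continuous_id).inter
    (isClosed_eq (B.p.continuous_L A.X) continuous_id)

lemma comp_mem {A B C : SplitObj V} {g : V.Hom B.X C.X} {f : V.Hom A.X B.X}
    (hg : g ∈ B.Hom C) (hf : f ∈ A.Hom B) : V.comp g f ∈ A.Hom C :=
  ⟨by rw [A.p.R_comp, hf.1], by rw [C.p.L_comp, hg.2]⟩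

lemma adj_mem {A B : SplitObj V} {f : V.Hom A.X B.X} (hf : f ∈ A.Hom B) : V.adj f ∈ B.Hom A := by
  constructor
  · rw [← B.isProj.2, Mult.adj_R, V.adj_adj, hf.2]
  · rw [← A.isProj.2, Mult.adj_L, V.adj_adj, hf.1]

lemma exists_pos {A B : SplitObj V} {f : V.Hom A.X B.X} (hf : f ∈ A.Hom B) :
    ∃ g ∈ A.Hom A, V.comp (V.adj f) f = V.comp (V.adj g) g := by
  obtain ⟨b, hb⟩ := V.pos f
  obtain ⟨g, hg, hgg⟩ : ∃ g : V.Hom A.X A.X, V.adj g = g ∧ V.comp g g = V.comp (V.adj b) b :=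
    exists_selfAdjoint_root (A := V.End A.X) b
  rw [← hb] at hgg
  have e1 : A.p.R A.X (V.comp (V.adj f) f) = V.comp (V.adj f) f := by
    rw [A.p.R_comp, hf.1]
  have e2 : A.p.L A.X (V.comp (V.adj f) f) = V.comp (V.adj f) f := by
    rw [A.p.L_comp, (adj_mem hf).2]
  have e3 : V.adj (A.p.R A.X g) = A.p.L A.X g := by
    conv_rhs => rw [← A.isProj.2]
    rw [Mult.adj_L, hg]
  have e4 : V.comp (V.adj (g - A.p.R A.X g)) (g - A.p.R A.X g) = 0 := by
    have e0 : V.adj (g - A.p.R A.X g) = g - A.p.L A.X g := by rw [map_sub, hg, e3]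
    rw [e0, map_sub, LinearMap.map_sub₂, LinearMap.map_sub₂, ← A.p.L_comp,
      ← A.p.R_comp, ← A.p.R_comp, ← A.p.L_comp, hgg, e2, e1]
    abel
  have e5 : A.p.R A.X g = g := by
    have := V.norm_adj_comp_self (g - A.p.R A.X g)
    rw [e4, norm_zero] at this
    have h0 : ‖g - A.p.R A.X g‖ = 0 := by
      rcases pow_eq_zero_iff (two_ne_zero) |>.1 this.symm with h
      exact h
    exact (sub_eq_zero.1 (norm_eq_zero.1 h0)).symm
  refine ⟨g, ⟨e5, ?_⟩, by rw [hg, hgg]⟩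
  rw [← e3, e5, hg]

end SplitObj

/-- The subobject completion of a `C^*`-category. -/
def Split (V : CStarCat.{u, v}) : CStarCat.{max u v, v} where
  Obj := SplitObj V
  Hom A B := A.Hom B
  instComplete A B := (SplitObj.isClosed_Hom A B).completeSpace_coe
  comp {A B C} := LinearMap.mk₂ ℂ
    (fun (g : B.Hom C) (f : A.Hom B) => (⟨V.comp g.1 f.1, SplitObj.comp_mem g.2 f.2⟩ : A.Hom C))
    (fun g g' f => Subtype.ext (LinearMap.map_add₂ V.comp g.1 g'.1 f.1))
    (fun c g f => Subtype.ext (LinearMap.map_smul₂ V.comp c g.1 f.1))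
    (fun g f f' => Subtype.ext (map_add (V.comp g.1) f.1 f'.1))
    (fun c g f => Subtype.ext (map_smul (V.comp g.1) c f.1))
  adj {A B} :=
    { toFun := fun f => ⟨V.adj f.1, SplitObj.adj_mem f.2⟩
      map_add' := fun f f' => Subtype.ext (map_add V.adj f.1 f'.1)
      map_smul' := fun c f => Subtype.ext (map_smulₛₗ V.adj c f.1) }
  assoc h g f := Subtype.ext (V.assoc h.1 g.1 f.1)
  adj_adj f := Subtype.ext (V.adj_adj f.1)
  adj_comp g f := Subtype.ext (V.adj_comp g.1 f.1)
  norm_comp_le g f := V.norm_comp_le g.1 f.1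
  norm_adj_comp_self f := V.norm_adj_comp_self f.1
  pos f := by
    obtain ⟨g, hg, h⟩ := SplitObj.exists_pos f.2
    exact ⟨⟨g, hg⟩, Subtype.ext h⟩

/-- The maximal tensor product of additive `C^*`-categories. -/
def maxTensor (V₁ : CStarCat.{u₁, v}) (V₂ : CStarCat.{u₂, v}) : CStarCat.{max u₁ u₂ v, v} :=
  Split (maxTensor₀ V₁ V₂)

/-- The minimal tensor product of additive `C^*`-categories. -/
def minTensor (V₁ : CStarCat.{u₁, v}) (V₂ : CStarCat.{u₂, v}) : CStarCat.{max u₁ u₂ v, v} :=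
  Split (minTensor₀ V₁ V₂)

/-! ### Additive and finitely accessible `C^*`-categories -/

/-- A nonempty countable directed set `I` and an inductive system over `I` in the multiplier
category, with isometric connecting morphisms. -/
structure IndSystem (V : CStarCat.{u, v}) where
  I : Type
  [instPartialOrder : PartialOrder I]
  [instDirected : IsDirectedOrder I]
  [instNonempty : Nonempty I]
  [instCountable : Countable I]
  X : I → V.Obj
  ι : ∀ {i j : I}, i ≤ j → Mult V (X i) (X j)
  isometry : ∀ {i j : I} (h : i ≤ j), (ι h).IsIsometry
  ι_refl : ∀ i : I, ι (le_refl i) = Mult.id (X i)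
  ι_comp : ∀ {i j k : I} (hij : i ≤ j) (hjk : j ≤ k),
    (ι hjk).comp (ι hij) = ι (hij.trans hjk)

attribute [instance] IndSystem.instPartialOrder IndSystem.instDirected IndSystem.instNonempty
  IndSystem.instCountable

namespace CStarCat

variable (V : CStarCat.{u, v})

/-- `D` with the multiplier morphisms `ι i` is a direct sum of the family `X`; the sum of the
projections `ι_i ∘ ι_i^*` converges to the identity in the strict topology. -/
structure IsDirectSum {I : Type} (X : I → V.Obj) (D : V.Obj) (ι : ∀ i, Mult V (X i) D) :
    Prop where
  isometry : ∀ i, (ι i).IsIsometry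
  orthogonal : ∀ i j, i ≠ j → (ι i).adj.comp (ι j) = Mult.zero (X j) (X i)
  hasSum_L : ∀ (Z : V.Obj) (f : V.Hom Z D), HasSum (fun i => ((ι i).comp (ι i).adj).L Z f) f
  hasSum_R : ∀ (Z : V.Obj) (f : V.Hom D Z), HasSum (fun i => ((ι i).comp (ι i).adj).R Z f) f

/-- Every multiplier projection splits. -/
def SubobjectComplete : Prop :=
  ∀ (X : V.Obj) (p : Mult V X X), p.IsProjection →
    ∃ (U : V.Obj) (ι : Mult V U X), ι.IsIsometry ∧ ι.comp ι.adj = p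

/-- All objects have identity morphisms. -/
def Unital : Prop :=
  ∀ X : V.Obj, ∃ e : V.Hom X X, (∀ (Y : V.Obj) (f : V.Hom X Y), V.comp f e = f) ∧
    (∀ (Y : V.Obj) (f : V.Hom Y X), V.comp e f = f)

/-- A countably additive `C^*`-category. -/
structure CountablyAdditive : Prop where
  subobjectComplete : V.SubobjectComplete
  directSums : ∀ (I : Type) [Countable I] (X : I → V.Obj),
    ∃ (D : V.Obj) (ι : ∀ i, Mult V (X i) D), V.IsDirectSum X D ι

/-- A finitely additive `C^*`-category. -/
structure FinitelyAdditive : Prop where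
  subobjectComplete : V.SubobjectComplete
  unital : V.Unital
  directSums : ∀ (I : Type) [Finite I] (X : I → V.Obj),
    ∃ (D : V.Obj) (ι : ∀ i, Mult V (X i) D), V.IsDirectSum X D ι

/-- An object is finitely presentable if its endomorphism algebra is unital. -/
def FinitelyPresentable (P : V.Obj) : Prop :=
  ∃ e : V.Hom P P, ∀ f : V.Hom P P, V.comp e f = f ∧ V.comp f e = f

/-- Unitary isomorphism of objects in the multiplier category. -/
def Isomorphic (X Y : V.Obj) : Prop := ∃ m : Mult V X Y, m.IsUnitary

/-- `U` is a subobject of `X` (via some isometry in the multiplier category). -/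
def IsSubobject (U X : V.Obj) : Prop := ∃ m : Mult V U X, m.IsIsometry

variable {V}

/-- `D` is a direct limit of the inductive system `S`: there are compatible isometries
`ι i : S.X i → D` such that `ι_i ∘ ι_i^*` converges to the identity in the strict topology. -/
def IsDirectLimit (S : IndSystem V) (D : V.Obj) : Prop :=
  ∃ ι : ∀ i, Mult V (S.X i) D, (∀ i, (ι i).IsIsometry) ∧
    (∀ {i j : S.I} (h : i ≤ j), (ι j).comp (S.ι h) = ι i) ∧
    (∀ (Z : V.Obj) (f : V.Hom Z D),
      Tendsto (fun i => ((ι i).comp (ι i).adj).L Z f) atTop (𝓝 f)) ∧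
    (∀ (Z : V.Obj) (f : V.Hom D Z),
      Tendsto (fun i => ((ι i).comp (ι i).adj).R Z f) atTop (𝓝 f))

variable (V)

/-- A countably additive `C^*`-category in which, for some set `P` of finitely presentable
objects, every object is isomorphic to a subobject of a direct limit of a countable inductive
system with objects from `P`. -/
structure FinitelyAccessible : Prop where
  countablyAdditive : V.CountablyAdditive
  exists_set : ∃ P : Set V.Obj, (∀ X ∈ P, V.FinitelyPresentable X) ∧
    ∀ X : V.Obj, ∃ (S : IndSystem V) (D U : V.Obj), (∀ i, S.X i ∈ P) ∧ IsDirectLimit S D ∧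
      V.IsSubobject U D ∧ V.Isomorphic X U

/-- The full subcategory on the objects satisfying a predicate. -/
def fullSubcategory (Q : V.Obj → Prop) : CStarCat.{u, v} where
  Obj := {X : V.Obj // Q X}
  Hom X Y := V.Hom X.1 Y.1
  comp := V.comp
  adj := V.adj
  assoc := V.assoc
  adj_adj := V.adj_adj
  adj_comp := V.adj_comp
  norm_comp_le := V.norm_comp_le
  norm_adj_comp_self := V.norm_adj_comp_self
  pos := V.pos

/-- The full subcategory of finitely presentable objects. -/
def finPres : CStarCat.{u, v} := V.fullSubcategory V.FinitelyPresentable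

end CStarCat

/-! ### Linear `*`-functors and equivalence -/

/-- A linear `*`-functor between `C^*`-categories. -/
structure StarFunctor (V : CStarCat.{u₁, v₁}) (W : CStarCat.{u₂, v₂}) where
  obj : V.Obj → W.Obj
  map : ∀ {X Y : V.Obj}, V.Hom X Y →ₗ[ℂ] W.Hom (obj X) (obj Y)
  map_comp : ∀ {X Y Z : V.Obj} (g : V.Hom Y Z) (f : V.Hom X Y),
    map (V.comp g f) = W.comp (map g) (map f)
  map_adj : ∀ {X Y : V.Obj} (f : V.Hom X Y), map (V.adj f) = W.adj (map f)

/-- A linear `*`-functor `F` is nondegenerate if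
`[F(V(Y,Y)) ∘ W(F X, F Y)] = W(F X, F Y) = [W(F X, F Y) ∘ F(V(X,X))]` for all `X, Y`, where
brackets denote closed linear spans. -/
def StarFunctor.Nondegenerate {V : CStarCat.{u₁, v₁}} {W : CStarCat.{u₂, v₂}}
    (F : StarFunctor V W) : Prop :=
  ∀ X Y : V.Obj,
    (Submodule.span ℂ {h : W.Hom (F.obj X) (F.obj Y) |
      ∃ (f : V.Hom Y Y) (g : W.Hom (F.obj X) (F.obj Y)),
        W.comp (F.map f) g = h}).topologicalClosure = ⊤ ∧
    (Submodule.span ℂ {h : W.Hom (F.obj X) (F.obj Y) |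
      ∃ (g : W.Hom (F.obj X) (F.obj Y)) (f : V.Hom X X),
        W.comp g (F.map f) = h}).topologicalClosure = ⊤

/-- `C^*`-categories `V` and `W` are equivalent: there are nondegenerate linear `*`-functors
`F : V → W` and `G : W → V` and unitary natural isomorphisms (with components in the multiplier
categories) from `G ∘ F` and `F ∘ G` to the identity functors. -/
def CStarCat.Equivalent (V : CStarCat.{u₁, v₁}) (W : CStarCat.{u₂, v₂}) : Prop :=
  ∃ (F : StarFunctor V W) (G : StarFunctor W V), F.Nondegenerate ∧ G.Nondegenerate ∧
    (∃ σ : ∀ X : V.Obj, Mult V (G.obj (F.obj X)) X, (∀ X, (σ X).IsUnitary) ∧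
      ∀ {X Y : V.Obj} (f : V.Hom X Y), (σ Y).L _ (G.map (F.map f)) = (σ X).R _ f) ∧
    (∃ τ : ∀ X : W.Obj, Mult W (F.obj (G.obj X)) X, (∀ X, (τ X).IsUnitary) ∧
      ∀ {X Y : W.Obj} (f : W.Hom X Y), (τ Y).L _ (F.map (G.map f)) = (τ X).R _ f)

/-! ### Ind-categories -/

namespace Mult

variable {V : CStarCat.{u, v}} {X Y X' Y' Z : V.Obj}

lemma L_R (n : Mult V Y Y') (m : Mult V X' X) (f : V.Hom X Y) :
    n.L X' (m.R Y f) = m.R Y' (n.L X f) := by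
  have h : ∀ (W : V.Obj) (k : V.Hom W X'),
      V.comp (n.L X' (m.R Y f) - m.R Y' (n.L X f)) k = 0 := by
    intro W k
    rw [LinearMap.map_sub₂, ← n.L_comp, ← m.comp_L, ← m.comp_L, n.L_comp, sub_self]
  have h0 := h _ (V.adj (n.L X' (m.R Y f) - m.R Y' (n.L X f)))
  have h1 := V.norm_adj_comp_self (V.adj (n.L X' (m.R Y f) - m.R Y' (n.L X f)))
  rw [V.adj_adj, h0, norm_zero, V.norm_adj] at h1
  exact sub_eq_zero.1 (norm_eq_zero.1 (pow_eq_zero_iff two_ne_zero |>.1 h1.symm))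

lemma adj_of_L (m : Mult V X Y) (f : V.Hom Z X) : V.adj (m.L Z f) = m.adj.R Z (V.adj f) := by
  rw [adj_R, V.adj_adj]

lemma adj_of_R (m : Mult V X Y) (f : V.Hom Y Z) : V.adj (m.R Z f) = m.adj.L Z (V.adj f) := by
  rw [adj_L, V.adj_adj]

end Mult

namespace IndSystem

variable {V : CStarCat.{u, v}} (S T U : IndSystem V)

/-- The transition multiplier `ι_{jm}^* ∘ ι_{im} : X i → X j` for arbitrary indices `i, j`, where
`m` is any index with `i ≤ m` and `j ≤ m`; it does not depend on `m`. It is `ι_{ij}` if `i ≤ j`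
and `ι_{ji}^*` if `j ≤ i`. -/
def w (i j : S.I) : Mult V (S.X i) (S.X j) :=
  (S.ι (exists_ge_ge i j).choose_spec.2).adj.comp (S.ι (exists_ge_ge i j).choose_spec.1)

variable {S T U}

lemma w_eq {i j m : S.I} (hi : i ≤ m) (hj : j ≤ m) : S.w i j = (S.ι hj).adj.comp (S.ι hi) := by
  have key : ∀ {m n : S.I} (hi : i ≤ m) (hj : j ≤ m) (hmn : m ≤ n),
      (S.ι hj).adj.comp (S.ι hi) = (S.ι (hj.trans hmn)).adj.comp (S.ι (hi.trans hmn)) := by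
    intro m n hi hj hmn
    rw [← S.ι_comp hi hmn, ← S.ι_comp hj hmn, Mult.adj_comp, Mult.comp_assoc,
      ← Mult.comp_assoc (S.ι hmn).adj, S.isometry hmn, Mult.id_comp]
  obtain ⟨n, h1, h2⟩ := exists_ge_ge m (exists_ge_ge i j).choose
  rw [w, key _ _ h2, key hi hj h1]

lemma w_of_le {i j : S.I} (h : i ≤ j) : S.w i j = S.ι h := by
  rw [w_eq h le_rfl, S.ι_refl, Mult.id_adj, Mult.id_comp]

lemma w_self (i : S.I) : S.w i i = Mult.id _ := by
  rw [w_of_le le_rfl, S.ι_refl]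

lemma w_adj (i j : S.I) : (S.w i j).adj = S.w j i := by
  obtain ⟨m, hi, hj⟩ := exists_ge_ge i j
  rw [w_eq hi hj, w_eq hj hi, Mult.adj_comp, Mult.adj_adj]

lemma w_comp {i j : S.I} (h : i ≤ j) (k : S.I) : (S.w j k).comp (S.w i j) = S.w i k := by
  obtain ⟨m, hj, hk⟩ := exists_ge_ge j k
  rw [w_eq hj hk, w_of_le h, w_eq (h.trans hj) hk, Mult.comp_assoc, S.ι_comp]

lemma w_comp' {j k : S.I} (h : k ≤ j) (i : S.I) : (S.w j k).comp (S.w i j) = S.w i k := by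
  rw [← w_adj k i, ← w_comp h i, Mult.adj_comp, w_adj, w_adj]

lemma norm_w_L_le (i j : S.I) {Z : V.Obj} (f : V.Hom Z (S.X i)) : ‖(S.w i j).L Z f‖ ≤ ‖f‖ := by
  rw [w, Mult.comp_L_apply]
  exact ((S.isometry _).norm_adj_L_le _).trans ((S.isometry _).norm_L _).le

lemma norm_w_R_le (i j : S.I) {Z : V.Obj} (f : V.Hom (S.X j) Z) : ‖(S.w i j).R Z f‖ ≤ ‖f‖ := by
  rw [w, Mult.comp_R_apply]
  exact ((S.isometry _).norm_R_le _).trans ((S.isometry _).norm_adj_R _).le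

variable (S T U)

/-- The direct sum of all morphism spaces `V.Hom (S.X i) (T.X j)`. An element `f` of the summand
with index `(i, j)` represents the morphism `ι_j ∘ f ∘ ι_i^*` of ind-objects. -/
abbrev PreHom : Type v := DirectSum (S.I × T.I) fun ij => V.Hom (S.X ij.1) (T.X ij.2)

open Classical in
/-- The element of `PreHom` given by a morphism at stage `(i, j)`. -/
def of (i : S.I) (j : T.I) : V.Hom (S.X i) (T.X j) →ₗ[ℂ] PreHom S T :=
  DirectSum.lof ℂ (S.I × T.I) (fun ij => V.Hom (S.X ij.1) (T.X ij.2)) (i, j)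

open Classical in
/-- Linear maps out of `PreHom`. -/
def lift {E : Type*} [AddCommGroup E] [Module ℂ E]
    (φ : ∀ i j, V.Hom (S.X i) (T.X j) →ₗ[ℂ] E) : PreHom S T →ₗ[ℂ] E :=
  DirectSum.toModule ℂ (S.I × T.I) E fun ij => φ ij.1 ij.2

variable {S T U}

@[simp]
lemma lift_of {E : Type*} [AddCommGroup E] [Module ℂ E]
    (φ : ∀ i j, V.Hom (S.X i) (T.X j) →ₗ[ℂ] E) (i : S.I) (j : T.I) (f : V.Hom (S.X i) (T.X j)) :
    lift S T φ (of S T i j f) = φ i j f := by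
  classical
  exact DirectSum.toModule_lof (M := fun ij : S.I × T.I => V.Hom (S.X ij.1) (T.X ij.2))
    (φ := fun ij : S.I × T.I => φ ij.1 ij.2) ℂ (i, j) f

lemma PreHom.induction {P : PreHom S T → Prop} (s : PreHom S T) (h0 : P 0)
    (hof : ∀ i j (f : V.Hom (S.X i) (T.X j)), P (of S T i j f))
    (hadd : ∀ s t, P s → P t → P (s + t)) : P s := by
  classical
  exact DirectSum.induction_on s h0 (fun ij f => hof ij.1 ij.2 f) hadd

/-- Composition: for `g` at stage `(j', k)` and `f` at stage `(i, j)` it is the morphism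
`g ∘ w_{j j'} ∘ f` at stage `(i, k)`. -/
def preComp : PreHom T U →ₗ[ℂ] PreHom S T →ₗ[ℂ] PreHom S U :=
  lift T U fun j' k => (lift S T fun i j =>
    ((V.comp (X := S.X i) (Y := T.X j') (Z := U.X k)).compr₂ (of S U i k)).flip ∘ₗ
      (T.w j j').L (S.X i)).flip

lemma preComp_of {i : S.I} {j j' : T.I} {k : U.I} (g : V.Hom (T.X j') (U.X k))
    (f : V.Hom (S.X i) (T.X j)) :
    preComp (of T U j' k g) (of S T i j f) =
      of S U i k (V.comp g ((T.w j j').L (S.X i) f)) := by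
  rw [preComp, lift_of, LinearMap.flip_apply, lift_of]
  rfl

open Classical in
/-- The adjoint of `f` at stage `(i, j)` is `f^*` at stage `(j, i)`. -/
def preAdjAux : PreHom S T →+ PreHom T S :=
  DirectSum.toAddMonoid fun ij => (of T S ij.2 ij.1).toAddMonoidHom.comp V.adj.toAddMonoidHom

lemma preAdjAux_of {i : S.I} {j : T.I} (f : V.Hom (S.X i) (T.X j)) :
    preAdjAux (of S T i j f) = of T S j i (V.adj f) := by
  classical
  exact DirectSum.toAddMonoid_of (β := fun ij : S.I × T.I => V.Hom (S.X ij.1) (T.X ij.2))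
    (fun ij => (of T S ij.2 ij.1).toAddMonoidHom.comp V.adj.toAddMonoidHom) (i, j) f

/-- The adjoint as a conjugate linear map. -/
def preAdj : PreHom S T →ₗ⋆[ℂ] PreHom T S where
  toFun := preAdjAux
  map_add' := map_add preAdjAux
  map_smul' c s := by
    induction s using PreHom.induction with
    | h0 => rw [smul_zero, map_zero, smul_zero]
    | hof i j f => rw [← map_smul, preAdjAux_of, preAdjAux_of, map_smulₛₗ, map_smul]
    | hadd s t hs ht => rw [smul_add, map_add, hs, ht, map_add, smul_add]

lemma preAdj_of {i : S.I} {j : T.I} (f : V.Hom (S.X i) (T.X j)) :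
    preAdj (of S T i j f) = of T S j i (V.adj f) := preAdjAux_of f

lemma PreHom.hom_ext {E : Type*} [AddCommGroup E] [Module ℂ E] {φ ψ : PreHom S T →ₗ[ℂ] E}
    (h : ∀ i j (f : V.Hom (S.X i) (T.X j)), φ (of S T i j f) = ψ (of S T i j f)) : φ = ψ := by
  ext1 s
  induction s using PreHom.induction with
  | h0 => rw [map_zero, map_zero]
  | hof i j f => exact h i j f
  | hadd s t hs ht => rw [map_add, map_add, hs, ht]

end IndSystem

open IndSystem in
/-- The `*`-category of countable inductive systems, with morphism spaces `PreHom`. -/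
abbrev indStar (V : CStarCat.{u, v}) : StarCat.{max 1 u v, v} where
  Obj := IndSystem V
  Hom S T := PreHom S T
  comp := preComp
  adj := preAdj
  assoc h g f := by
    induction h using PreHom.induction with
    | h0 => simp only [map_zero, LinearMap.zero_apply]
    | hadd h h' hh hh' => simp only [map_add, LinearMap.add_apply, hh, hh']
    | hof k' m h =>
      induction g using PreHom.induction with
      | h0 => simp only [map_zero, LinearMap.zero_apply]
      | hadd g g' hg hg' => simp only [map_add, LinearMap.add_apply, hg, hg']
      | hof j' k g =>
        induction f using PreHom.induction with
        | h0 => simp only [map_zero]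
        | hadd f f' hf hf' => simp only [map_add, hf, hf']
        | hof i j f => simp only [preComp_of, V.assoc, Mult.L_comp]
  adj_adj f := by
    induction f using PreHom.induction with
    | h0 => simp only [map_zero]
    | hadd f f' hf hf' => simp only [map_add, hf, hf']
    | hof i j f => simp only [preAdj_of, V.adj_adj]
  adj_comp g f := by
    induction g using PreHom.induction with
    | h0 => simp only [map_zero, LinearMap.zero_apply]
    | hadd g g' hg hg' => simp only [map_add, LinearMap.add_apply, hg, hg']
    | hof j' k g =>
      induction f using PreHom.induction with
      | h0 => simp only [map_zero, LinearMap.zero_apply]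
      | hadd f f' hf hf' => simp only [map_add, LinearMap.add_apply, hf, hf']
      | hof i j f =>
        simp only [preComp_of, preAdj_of, V.adj_comp, Mult.adj_of_L, w_adj]
        rw [Mult.comp_L]

namespace IndSystem

variable {V : CStarCat.{u, v}} {S T U : IndSystem V}

/-- The component `ι_l^* ∘ s ∘ ι_k : X k → Y l` of a morphism `s` of ind-objects. -/
def comp₀ (k : S.I) (l : T.I) : PreHom S T →ₗ[ℂ] V.Hom (S.X k) (T.X l) :=
  lift S T fun i j => (T.w j l).L (S.X k) ∘ₗ (S.w k i).R (T.X j)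

lemma comp₀_of (k : S.I) (l : T.I) {i : S.I} {j : T.I} (f : V.Hom (S.X i) (T.X j)) :
    comp₀ k l (of S T i j f) = (T.w j l).L (S.X k) ((S.w k i).R (T.X j) f) := by
  rw [comp₀, lift_of]
  rfl

lemma exists_bound (s : PreHom S T) : ∃ C : ℝ, ∀ k l, ‖comp₀ k l s‖ ≤ C := by
  induction s using PreHom.induction with
  | h0 => exact ⟨0, fun k l => by rw [map_zero, norm_zero]⟩
  | hof i j f =>
    refine ⟨‖f‖, fun k l => ?_⟩
    rw [comp₀_of]
    exact (norm_w_L_le _ _ _).trans (norm_w_R_le _ _ _)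
  | hadd s t hs ht =>
    obtain ⟨C, hC⟩ := hs
    obtain ⟨D, hD⟩ := ht
    exact ⟨C + D, fun k l => by
      rw [map_add]; exact (norm_add_le _ _).trans (add_le_add (hC k l) (hD k l))⟩

lemma bddAbove (s : PreHom S T) :
    BddAbove (Set.range fun kl : S.I × T.I => ‖comp₀ kl.1 kl.2 s‖) := by
  obtain ⟨C, hC⟩ := exists_bound s
  exact ⟨C, by rintro _ ⟨kl, rfl⟩; exact hC _ _⟩

/-- Every element of `PreHom` is represented by its component at any sufficiently late stage. -/
lemma exists_stage (s : PreHom S T) : ∃ i j, ∀ k, i ≤ k → ∀ l, j ≤ l → ∀ k' l',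
    comp₀ k' l' s = (T.w l l').L _ ((S.w k' k).R _ (comp₀ k l s)) := by
  induction s using PreHom.induction with
  | h0 =>
    obtain ⟨i⟩ := S.instNonempty
    obtain ⟨j⟩ := T.instNonempty
    exact ⟨i, j, fun k _ l _ k' l' => by simp only [map_zero]⟩
  | hof i j f =>
    refine ⟨i, j, fun k hk l hl k' l' => ?_⟩
    simp only [comp₀_of]
    rw [← Mult.L_R, ← Mult.comp_L_apply, w_comp hl, ← Mult.comp_R_apply, w_comp' hk]
  | hadd s t hs ht =>
    obtain ⟨i, j, h⟩ := hs
    obtain ⟨i', j', h'⟩ := ht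
    obtain ⟨i'', hi, hi'⟩ := exists_ge_ge i i'
    obtain ⟨j'', hj, hj'⟩ := exists_ge_ge j j'
    refine ⟨i'', j'', fun k hk l hl k' l' => ?_⟩
    simp only [map_add]
    rw [h k (hi.trans hk) l (hj.trans hl), h' k (hi'.trans hk) l (hj'.trans hl)]

/-- The norm of the Banach space inductive limit `lim_i lim_j V.Hom (S.X i) (T.X j)`: the supremum
of the norms of all components, which is attained at every sufficiently late stage. -/
def indSeminorm (S T : IndSystem V) : Seminorm ℂ (PreHom S T) :=
  Seminorm.of (fun s => ⨆ kl : S.I × T.I, ‖comp₀ kl.1 kl.2 s‖)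
    (fun s t => ciSup_le fun kl => by
      rw [map_add]
      exact (norm_add_le _ _).trans (add_le_add (le_ciSup (bddAbove s) kl)
        (le_ciSup (bddAbove t) kl)))
    (fun c s => by
      rw [Real.mul_iSup_of_nonneg (norm_nonneg c)]
      exact iSup_congr fun kl => by rw [map_smul, norm_smul])

lemma le_indSeminorm (s : PreHom S T) (k : S.I) (l : T.I) : ‖comp₀ k l s‖ ≤ indSeminorm S T s :=
  le_ciSup (bddAbove s) (k, l)

lemma indSeminorm_le (s : PreHom S T) {C : ℝ} (h : ∀ k l, ‖comp₀ k l s‖ ≤ C) :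
    indSeminorm S T s ≤ C := ciSup_le fun kl => h kl.1 kl.2

lemma exists_indSeminorm_eq (s : PreHom S T) : ∃ i j, ∀ k, i ≤ k → ∀ l, j ≤ l →
    indSeminorm S T s = ‖comp₀ k l s‖ := by
  obtain ⟨i, j, h⟩ := exists_stage s
  refine ⟨i, j, fun k hk l hl => le_antisymm (indSeminorm_le s fun k' l' => ?_)
    (le_indSeminorm s k l)⟩
  rw [h k hk l hl]
  exact (norm_w_L_le _ _ _).trans (norm_w_R_le _ _ _)

lemma exists_comp₀_preComp (t : PreHom T U) (s : PreHom S T) : ∃ j, ∀ l, j ≤ l → ∀ k m,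
    comp₀ k m (preComp t s) = V.comp (comp₀ l m t) (comp₀ k l s) := by
  induction t using PreHom.induction with
  | h0 =>
    obtain ⟨j⟩ := T.instNonempty
    exact ⟨j, fun l _ k m => by simp only [map_zero, LinearMap.zero_apply]⟩
  | hadd t t' ht ht' =>
    obtain ⟨j, h⟩ := ht
    obtain ⟨j', h'⟩ := ht'
    obtain ⟨j'', hj, hj'⟩ := exists_ge_ge j j'
    exact ⟨j'', fun l hl k m => by
      simp only [map_add, LinearMap.add_apply, h l (hj.trans hl), h' l (hj'.trans hl)]⟩
  | hof j' k' g =>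
    induction s using PreHom.induction with
    | h0 =>
      obtain ⟨j⟩ := T.instNonempty
      exact ⟨j, fun l _ k m => by simp only [map_zero]⟩
    | hadd s s' hs hs' =>
      obtain ⟨j, h⟩ := hs
      obtain ⟨j', h'⟩ := hs'
      obtain ⟨j'', hj, hj'⟩ := exists_ge_ge j j'
      exact ⟨j'', fun l hl k m => by
        simp only [map_add, h l (hj.trans hl), h' l (hj'.trans hl)]⟩
    | hof i j f =>
      refine ⟨j, fun l hl k m => ?_⟩
      rw [preComp_of, comp₀_of, comp₀_of, comp₀_of, ← Mult.L_comp, ← Mult.comp_L,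
        ← Mult.comp_L_apply, w_comp hl, Mult.L_R (T.w j j') (S.w k i) f, ← Mult.R_comp]

lemma comp₀_preAdj (s : PreHom S T) (k : S.I) (l : T.I) :
    comp₀ l k (preAdj s) = V.adj (comp₀ k l s) := by
  induction s using PreHom.induction with
  | h0 => simp only [map_zero]
  | hadd s t hs ht => simp only [map_add, hs, ht]
  | hof i j f =>
    rw [preAdj_of, comp₀_of, comp₀_of, Mult.adj_of_L, Mult.adj_of_R, w_adj, w_adj, Mult.L_R]

lemma indSeminorm_preAdj (s : PreHom S T) : indSeminorm T S (preAdj s) = indSeminorm S T s := by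
  refine le_antisymm (indSeminorm_le _ fun l k => ?_) (indSeminorm_le _ fun k l => ?_)
  · rw [comp₀_preAdj, V.norm_adj]; exact le_indSeminorm s k l
  · rw [← V.norm_adj, ← comp₀_preAdj]; exact le_indSeminorm _ l k

lemma indSeminorm_preComp_le (t : PreHom T U) (s : PreHom S T) :
    indSeminorm S U (preComp t s) ≤ indSeminorm T U t * indSeminorm S T s := by
  obtain ⟨j, h⟩ := exists_comp₀_preComp t s
  refine indSeminorm_le _ fun k m => ?_
  rw [h j le_rfl]
  exact (V.norm_comp_le _ _).trans (mul_le_mul (le_indSeminorm t j m) (le_indSeminorm s k j)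
    (norm_nonneg _) (apply_nonneg _ _))

lemma indSeminorm_isCStar : (indStar V).IsCStarSeminorm (fun S T => indSeminorm S T) where
  comp_le t s := indSeminorm_preComp_le t s
  adj_comp_self {S T} s := by
    refine le_antisymm ?_ ?_
    · refine (indSeminorm_preComp_le _ _).trans ?_
      rw [indSeminorm_preAdj, sq]
    · obtain ⟨i, j, h⟩ := exists_indSeminorm_eq s
      obtain ⟨j', h'⟩ := exists_comp₀_preComp (preAdj s) s
      obtain ⟨l, hl, hl'⟩ := exists_ge_ge j j'
      rw [h i le_rfl l hl, ← V.norm_adj_comp_self, ← comp₀_preAdj, ← h' l hl']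
      exact le_indSeminorm _ i i

lemma indSeminorm_isPositive : (indStar V).IsPositive (indSeminorm_isCStar (V := V)) := by
  intro S T s
  obtain ⟨i, i', h⟩ := exists_stage (preComp (preAdj s) s)
  obtain ⟨j, h'⟩ := exists_comp₀_preComp (preAdj s) s
  obtain ⟨k, hk, hk'⟩ := exists_ge_ge i i'
  obtain ⟨g, hg⟩ := V.pos (comp₀ k j s)
  refine ⟨StarCat.toC (A := indStar V) _ (of S S k k g), ?_⟩
  rw [StarCat.IsCStarSeminorm.adj_toC, StarCat.IsCStarSeminorm.comp_toC, ← sub_eq_zero, ← map_sub,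
    ← norm_eq_zero, StarCat.norm_toC]
  refine le_antisymm (indSeminorm_le _ fun a b => ?_) (apply_nonneg _ _)
  rw [map_sub, h k hk k hk' a b, h' j le_rfl, comp₀_preAdj, hg, preAdj_of, preComp_of, comp₀_of,
    w_self, Mult.id_L, sub_self, norm_zero]

end IndSystem

/-- The category of countable ind-objects, before subobject completion: the morphism spaces are the
Banach space inductive limits `lim_i lim_j V.Hom (S.X i) (T.X j)`. -/
def indCat₀ (V : CStarCat.{u, v}) : CStarCat.{max 1 u v, v} :=
  StarCat.completion IndSystem.indSeminorm_isCStar (IndSystem.indSeminorm_isPositive (V := V))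

/-- The countable ind-category of a `C^*`-category. -/
def indCat (V : CStarCat.{u, v}) : CStarCat.{max 1 u v, v} := Split (indCat₀ V)

end

/-! Everything rests on one situation: a full isometric `*`-functor `J : D → V` from a unital
category `D` such that every object of `V` is a subobject of a direct limit of objects coming from
`D` (`FullFunctor.IsIndDense`). For a finitely accessible `V` this is the inclusion of its finitely
presentable objects. For a unital `V` it is the embedding of `V` into `indCat V`, because an
inductive system is the limit, in the ind-category, of its own terms (`isIndDense_indIncl`). The
proof shows that the situation survives tensor products and that it determines both sides of each
equivalence.

Tensor norms. A full isometric functor between the tensor products exists only if the maximal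
(minimal) norm of `D₁ ⊙ D₂` is the restriction of that of `V₁ ⊙ V₂`. Restricting representations
gives one inequality; the other needs representations to be extended. Ind-density supplies morphisms
`m_i : J d_i → X` with `m_i m_i^* → 1` strictly. Given a representation `ρ` of the subcategory and
finitely many vectors `ξ_k` over an object `P`, the formal sums `∑ f_k ⊗ ξ_k` with `f_k : P → X`
carry the GNS form `∑ ⟪ξ_k, ρ(f_k^* g_l) ξ_l⟫`. It is positive as a limit of inner products of
vectors `m_i^* f`, and a morphism `t` acts boundedly because its compressions `m_j^* t m_i` do.
Restricted to the subcategory, the new representation is a subrepresentation of `ρ` containing the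
`ξ_k` (`StarCat.GNSData.exists_rep`). For the maximal norm a representation of the algebraic tensor
product is extended along one vector. For the minimal norm the two factors are extended separately,
along the finitely many vectors that occur in one algebraic tensor.

Density. Isometric multipliers have tensor products (`CrossNorm.exists_isTensor`), and a tensor
product of two direct limits is the limit over the product index set, so the tensor functor is again
ind-dense (`CrossNorm.isIndDense_tensorFunctor`).

Recognition. Let `K : E → W` be ind-dense with `E` unital. If `E` is subobject complete, then `E` is
the category of finitely presentable objects of `W` (`CStarCat.finPres_equivalent`): the identity of
such an object is a norm limit of endomorphisms factoring through the stages, so at a late stage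
polar decomposition gives an isometry into an object of `E`. If instead `W` is subobject complete
and contains orthogonal sums of sequences from `E`, then all countable systems in `E` have limits in
`W` (`exists_isLimitCone`). Taking limits is then a full isometric functor from ind-objects to `W`,
whence `indCat_split_equivalent`. Statements 1 and 3 use the first criterion, statements 2 and 4 the
second. -/

noncomputable section

/-! ### Limits of bounded nets of linear maps -/

section BoundedNets

variable {E F I : Type*} [NormedAddCommGroup E] [NormedSpace ℂ E] [NormedAddCommGroup F]
  [NormedSpace ℂ F] {l : Filter I} {T : I → E →ₗ[ℂ] F} {C : ℝ}

/-- An equicontinuity argument. It reduces strict convergence of a bounded net to a total set of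
morphisms, such as elementary tensors or morphisms represented at a finite stage. -/
lemma isClosed_setOf_exists_tendsto [CompleteSpace F] [l.NeBot]
    (hT : ∀ᶠ i in l, ∀ f, ‖T i f‖ ≤ C * ‖f‖) :
    IsClosed {f | ∃ g, Tendsto (fun i => T i f) l (𝓝 g)} := by
  rw [← closure_subset_iff_isClosed]
  intro f hf
  change ∃ g, Tendsto (fun i => T i f) l (𝓝 g)
  rw [← cauchy_map_iff_exists_tendsto, Metric.cauchy_iff]
  refine ⟨inferInstance, fun ε hε => ?_⟩
  have hK : 0 < |C| + 1 := by positivity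
  -- `|C| + 1` is positive even if `C ≤ 0`. With this radius a bounded `T i` moves `f` and `f'` to
  -- points less than `ε / 4` apart, so eventually `T i f` is within `ε / 2` of `g`.
  obtain ⟨f', ⟨g, hg⟩, hf'⟩ := Metric.mem_closure_iff.1 hf (ε / 4 / (|C| + 1)) (by positivity)
  have h1 := Metric.tendsto_nhds.1 hg (ε / 4) (by positivity)
  have h2 : ∀ᶠ i in l, dist (T i f) g < ε / 2 := by
    filter_upwards [h1, hT] with i hi hi'
    have h3 : dist (T i f) (T i f') < ε / 4 := by
      rw [dist_eq_norm, ← map_sub]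
      rw [dist_eq_norm, lt_div_iff₀ hK] at hf'
      have := hi' (f - f')
      nlinarith [norm_nonneg (f - f'), le_abs_self C]
    linarith [dist_triangle (T i f) (T i f') g]
  refine ⟨(fun i => T i f) '' {i | dist (T i f) g < ε / 2}, image_mem_map h2, ?_⟩
  rintro _ ⟨i, hi, rfl⟩ _ ⟨j, hj, rfl⟩
  simp only [Set.mem_ofPred_eq] at hi hj
  linarith [dist_triangle_right (T i f) (T j f) g]

lemma isClosed_setOf_tendsto {S : E →ₗ[ℂ] F}
    (hT : ∀ᶠ i in l, ∀ f, ‖T i f‖ ≤ C * ‖f‖) (hS : ∀ f, ‖S f‖ ≤ C * ‖f‖) :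
    IsClosed {f | Tendsto (fun i => T i f) l (𝓝 (S f))} := by
  rw [← closure_subset_iff_isClosed]
  intro f hf
  change Tendsto (fun i => T i f) l (𝓝 (S f))
  rw [Metric.tendsto_nhds]
  intro ε hε
  have hK : 0 < |C| + 1 := by positivity
  obtain ⟨f', hg, hf'⟩ := Metric.mem_closure_iff.1 hf (ε / 4 / (|C| + 1)) (by positivity)
  have h1 := Metric.tendsto_nhds.1 hg (ε / 4) (by positivity)
  filter_upwards [h1, hT] with i hi hi'
  have key : ∀ (U : E →ₗ[ℂ] F), (∀ f, ‖U f‖ ≤ C * ‖f‖) → dist (U f) (U f') < ε / 4 := by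
    intro U hU
    rw [dist_eq_norm, ← map_sub]
    rw [dist_eq_norm, lt_div_iff₀ hK] at hf'
    have := hU (f - f')
    nlinarith [norm_nonneg (f - f'), le_abs_self C]
  have h3 := key _ hi'
  have h4 := key _ hS
  have h5 := dist_triangle (T i f) (T i f') (S f)
  have h6 := dist_triangle_right (T i f') (S f) (S f')
  linarith

end BoundedNets

/-! ### Elementary facts about `C^*`-categories -/

namespace CStarCat

variable {V : CStarCat.{u, v}} {W X Y Z : V.Obj}

lemma sub_comp (g g' : V.Hom Y Z) (f : V.Hom X Y) :
    V.comp (g - g') f = V.comp g f - V.comp g' f := LinearMap.map_sub₂ _ _ _ _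

lemma comp_sub (g : V.Hom Y Z) (f f' : V.Hom X Y) :
    V.comp g (f - f') = V.comp g f - V.comp g f' := map_sub _ _ _

lemma add_comp (g g' : V.Hom Y Z) (f : V.Hom X Y) :
    V.comp (g + g') f = V.comp g f + V.comp g' f := LinearMap.map_add₂ _ _ _ _

lemma comp_add (g : V.Hom Y Z) (f f' : V.Hom X Y) :
    V.comp g (f + f') = V.comp g f + V.comp g f' := map_add _ _ _

lemma zero_comp (f : V.Hom X Y) : V.comp (0 : V.Hom Y Z) f = 0 := LinearMap.map_zero₂ _ _

lemma comp_zero (g : V.Hom Y Z) : V.comp g (0 : V.Hom X Y) = 0 := map_zero _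

lemma adj_sub (f g : V.Hom X Y) : V.adj (f - g) = V.adj f - V.adj g := map_sub _ _ _

lemma adj_add (f g : V.Hom X Y) : V.adj (f + g) = V.adj f + V.adj g := map_add _ _ _

lemma eq_zero_of_adj_comp_self {f : V.Hom X Y} (h : V.comp (V.adj f) f = 0) : f = 0 := by
  have h1 := V.norm_adj_comp_self f
  rw [h, norm_zero] at h1
  exact norm_eq_zero.1 (pow_eq_zero_iff two_ne_zero |>.1 h1.symm)

lemma eq_zero_of_comp_adj_self {f : V.Hom X Y} (h : V.comp f (V.adj f) = 0) : f = 0 := by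
  have h1 : V.adj f = 0 := eq_zero_of_adj_comp_self (by rw [V.adj_adj, h])
  rw [← V.adj_adj f, h1, map_zero]

lemma norm_comp_adj_self (f : V.Hom X Y) : ‖V.comp f (V.adj f)‖ = ‖f‖ ^ 2 := by
  have h := V.norm_adj_comp_self (V.adj f)
  rwa [V.adj_adj, V.norm_adj] at h

/-- Without identities a morphism is tested by composing it; the decisive test morphism is `(f -
g)^*`, by the `C^*`-identity. -/
lemma ext_right {f g : V.Hom X Y} (h : ∀ k : V.Hom Y X, V.comp f k = V.comp g k) : f = g := by
  refine sub_eq_zero.1 (eq_zero_of_comp_adj_self ?_)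
  rw [sub_comp, h, sub_self]

lemma continuous_adj : Continuous (V.adj : V.Hom X Y → V.Hom Y X) :=
  (AddMonoidHomClass.isometry_of_norm V.adj.toAddMonoidHom fun f => V.norm_adj f).continuous

lemma continuous_comp :
    Continuous fun p : V.Hom Y Z × V.Hom X Y => V.comp p.1 p.2 :=
  (LinearMap.mkContinuous₂ (V.comp (X := X) (Y := Y) (Z := Z)) 1
    (fun g f => by rw [one_mul]; exact V.norm_comp_le g f)).continuous₂

lemma continuous_comp_left (g : V.Hom Y Z) : Continuous fun f : V.Hom X Y => V.comp g f :=
  continuous_comp.comp (Continuous.prodMk continuous_const continuous_id)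

lemma continuous_comp_right (f : V.Hom X Y) : Continuous fun g : V.Hom Y Z => V.comp g f :=
  continuous_comp.comp (Continuous.prodMk continuous_id continuous_const)

lemma tendsto_comp {I : Type*} {l : Filter I} {a : I → V.Hom Y Z} {b : I → V.Hom X Y}
    {g : V.Hom Y Z} {f : V.Hom X Y} (ha : Tendsto a l (𝓝 g)) (hb : Tendsto b l (𝓝 f)) :
    Tendsto (fun i => V.comp (a i) (b i)) l (𝓝 (V.comp g f)) :=
  (continuous_comp.tendsto (g, f)).comp (ha.prodMk_nhds hb)

lemma tendsto_adj {I : Type*} {l : Filter I} {a : I → V.Hom X Y} {f : V.Hom X Y}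
    (ha : Tendsto a l (𝓝 f)) : Tendsto (fun i => V.adj (a i)) l (𝓝 (V.adj f)) :=
  (continuous_adj.tendsto f).comp ha

variable (V) in
-- The approximate unit of the `C^*`-algebra of endomorphisms also works for morphisms into and out
-- of `Y`. With `d = e f f^* - f f^*` one has `(e f - f)(e f - f)^* = d e^* - d`, hence `‖e f - f‖ ^
-- 2 ≤ 2 ‖d‖`; the other side is symmetric.
lemma exists_approxUnit (Y : V.Obj) : ∃ l : Filter (V.Hom Y Y), l.NeBot ∧
    (∀ᶠ e in l, ‖e‖ ≤ 1) ∧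
    (∀ Z (f : V.Hom Z Y), Tendsto (fun e => V.comp e f) l (𝓝 f)) ∧
    (∀ Z (f : V.Hom Y Z), Tendsto (fun e => V.comp f e) l (𝓝 f)) := by
  let _ := CStarAlgebra.spectralOrder (V.End Y)
  have _ := CStarAlgebra.spectralOrderedRing (V.End Y)
  have H := CStarAlgebra.increasingApproximateUnit (V.End Y)
  let l : Filter (V.Hom Y Y) := CStarAlgebra.approximateUnit (V.End Y)
  have hn : ∀ᶠ e : V.Hom Y Y in l, ‖e‖ ≤ 1 := H.eventually_norm
  have hR : ∀ a : V.Hom Y Y, Tendsto (fun e => V.comp e a) l (𝓝 a) := H.tendsto_mul_right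
  have hL : ∀ a : V.Hom Y Y, Tendsto (fun e => V.comp a e) l (𝓝 a) := H.tendsto_mul_left
  refine ⟨l, H.neBot, hn, fun Z f => ?_, fun Z f => ?_⟩
  · rw [tendsto_iff_norm_sub_tendsto_zero]
    have h0 := (hR (V.comp f (V.adj f)))
    rw [tendsto_iff_norm_sub_tendsto_zero] at h0
    have h1 := (h0.mul_const 2).sqrt
    rw [zero_mul, Real.sqrt_zero] at h1
    refine squeeze_zero' (Eventually.of_forall fun _ => norm_nonneg _) ?_ h1
    filter_upwards [hn] with e he
    refine Real.le_sqrt_of_sq_le ?_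
    set d := V.comp e (V.comp f (V.adj f)) - V.comp f (V.adj f) with hd
    have e1 : V.comp (V.comp e f - f) (V.adj (V.comp e f - f)) = V.comp d (V.adj e) - d := by
      simp only [hd, comp_sub, sub_comp, adj_sub, V.adj_comp, V.assoc]
    rw [← norm_comp_adj_self, e1]
    have h2 := V.norm_comp_le d (V.adj e)
    rw [V.norm_adj] at h2
    have h3 := norm_sub_le (V.comp d (V.adj e)) d
    nlinarith [norm_nonneg d]
  · rw [tendsto_iff_norm_sub_tendsto_zero]
    have h0 := (hL (V.comp (V.adj f) f))
    rw [tendsto_iff_norm_sub_tendsto_zero] at h0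
    have h1 := (h0.mul_const 2).sqrt
    rw [zero_mul, Real.sqrt_zero] at h1
    refine squeeze_zero' (Eventually.of_forall fun _ => norm_nonneg _) ?_ h1
    filter_upwards [hn] with e he
    refine Real.le_sqrt_of_sq_le ?_
    set d := V.comp (V.comp (V.adj f) f) e - V.comp (V.adj f) f with hd
    have e1 : V.comp (V.adj (V.comp f e - f)) (V.comp f e - f) = V.comp (V.adj e) d - d := by
      simp only [hd, comp_sub, sub_comp, adj_sub, V.adj_comp, V.assoc]
      abel
    rw [← V.norm_adj_comp_self, e1]
    have h2 := V.norm_comp_le (V.adj e) d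
    rw [V.norm_adj] at h2
    have h3 := norm_sub_le (V.comp (V.adj e) d) d
    nlinarith [norm_nonneg d]

/-- `e` is an identity morphism of `X`. -/
def IsId (e : V.Hom X X) : Prop := (∀ (Y : V.Obj) (f : V.Hom X Y), V.comp f e = f) ∧
    (∀ (Y : V.Obj) (f : V.Hom Y X), V.comp e f = f)

/-- `f^* (f e - f) = (f^* f) e - f^* f` vanishes because `f^* f` is an endomorphism, and the
`C^*`-identity then kills `f e - f`. So a unital endomorphism algebra already gives an identity
morphism, which links finite presentability to unitality. -/
lemma isId_of_end {e : V.Hom X X} (h : ∀ f : V.Hom X X, V.comp e f = f ∧ V.comp f e = f) :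
    IsId e := by
  constructor
  · intro Y f
    refine sub_eq_zero.1 (eq_zero_of_adj_comp_self ?_)
    have e1 : V.comp (V.adj f) (V.comp f e - f) = 0 := by
      rw [comp_sub, ← V.assoc, (h _).2, sub_self]
    rw [adj_sub, sub_comp, e1, V.adj_comp, V.assoc, e1, comp_zero, sub_zero]
  · intro Y f
    refine sub_eq_zero.1 (eq_zero_of_comp_adj_self ?_)
    have e1 : V.comp (V.comp e f - f) (V.adj f) = 0 := by
      rw [sub_comp, V.assoc, (h _).1, sub_self]
    rw [adj_sub, comp_sub, e1, V.adj_comp, ← V.assoc, e1, zero_comp, sub_zero]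

lemma IsId.adj_eq {e : V.Hom X X} (h : IsId e) : V.adj e = e := by
  rw [← h.1 _ (V.adj e)]
  nth_rewrite 2 [← V.adj_adj e]
  rw [← V.adj_comp, h.1, V.adj_adj]

end CStarCat

/-! ### More on multipliers -/

namespace Mult

open CStarCat

variable {V : CStarCat.{u, v}} {W X Y Z : V.Obj}

/-- The multiplier given by a morphism. -/
def ofHom (f : V.Hom X Y) : Mult V X Y where
  L Z := V.comp f
  R Z := V.comp.flip f
  bdd := ⟨‖f‖, fun Z => ⟨fun g => V.norm_comp_le f g, fun g => by
    rw [mul_comm]; exact V.norm_comp_le g f⟩⟩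
  L_comp h g := (V.assoc f h g).symm
  R_comp g h := V.assoc g h f
  comp_L g h := (V.assoc g f h).symm

lemma ofHom_L (f : V.Hom X Y) (g : V.Hom Z X) : (ofHom f).L Z g = V.comp f g := rfl

lemma ofHom_R (f : V.Hom X Y) (g : V.Hom Y Z) : (ofHom f).R Z g = V.comp g f := rfl

/-- The relation `g ∘ L f = R g ∘ f` determines `R g` against every `f`. Hence identities between
multipliers need checking on left actions only. -/
lemma R_eq_of_L_eq {m n : Mult V X Y} (h : ∀ Z (f : V.Hom Z X), m.L Z f = n.L Z f) (Z : V.Obj)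
    (g : V.Hom Y Z) : m.R Z g = n.R Z g :=
  ext_right fun k => by rw [← m.comp_L, ← n.comp_L, h]

lemma ext_L {m n : Mult V X Y} (h : ∀ Z (f : V.Hom Z X), m.L Z f = n.L Z f) : m = n :=
  Mult.ext (funext fun Z => LinearMap.ext (h Z))
    (funext fun Z => LinearMap.ext (R_eq_of_L_eq h Z))

lemma adj_L_comp (m : Mult V X Y) (f : V.Hom Z X) (g : V.Hom W Y) :
    V.comp (V.adj (m.L Z f)) g = V.comp (V.adj f) (m.adj.L W g) := by
  rw [adj_of_L, ← m.adj.comp_L]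

/-- For `f` into `X` the morphism `f f^*` is an endomorphism, so `(m f - n f) f^* = 0`. Applying the
right actions of the adjoints gives `(m f - n f)(m f - n f)^* = 0`. -/
lemma ext_end {m n : Mult V X Y} (h : ∀ f : V.Hom X X, m.L X f = n.L X f) : m = n := by
  refine ext_L fun Z f => ?_
  refine sub_eq_zero.1 (eq_zero_of_comp_adj_self ?_)
  have h2 : V.comp (m.L Z f - n.L Z f) (V.adj f) = 0 := by
    rw [sub_comp, ← m.L_comp, ← n.L_comp, h, sub_self]
  rw [adj_sub, adj_of_L, adj_of_L, comp_sub, ← m.adj.R_comp, ← n.adj.R_comp, h2, map_zero,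
    map_zero, sub_self]

/-- `‖R g‖ ^ 2 = ‖R g ∘ (R g)^*‖ = ‖g ∘ L (R g)^*‖ ≤ ‖g‖ C ‖R g‖`, so a bound for the left actions
also serves the right ones. -/
lemma norm_R_le_of_L {m : Mult V X Y} {C : ℝ} (h0 : 0 ≤ C)
    (h : ∀ Z (f : V.Hom Z X), ‖m.L Z f‖ ≤ C * ‖f‖)
    (Z : V.Obj) (g : V.Hom Y Z) : ‖m.R Z g‖ ≤ C * ‖g‖ := by
  have h1 : ‖m.R Z g‖ ^ 2 ≤ ‖g‖ * (C * ‖m.R Z g‖) := by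
    rw [← norm_comp_adj_self, ← m.comp_L, ← V.norm_adj (m.R Z g)]
    exact (V.norm_comp_le _ _).trans (by gcongr; exact h _ _)
  rcases (norm_nonneg (m.R Z g)).eq_or_lt with h2 | h2
  · rw [← h2]; positivity
  · nlinarith

lemma exists_norm_le (m : Mult V X Y) : ∃ C : ℝ, 0 ≤ C ∧ ∀ Z (f : V.Hom Z X),
    ‖m.L Z f‖ ≤ C * ‖f‖ := by
  obtain ⟨C, hC⟩ := m.bdd
  exact ⟨|C|, abs_nonneg C, fun Z f =>
    ((hC Z).1 f).trans (by gcongr; exact le_abs_self C)⟩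

/-- The sum of finitely many multipliers. -/
def sum {I : Type*} (s : Finset I) (m : I → Mult V X Y) : Mult V X Y where
  L Z := ∑ i ∈ s, (m i).L Z
  R Z := ∑ i ∈ s, (m i).R Z
  bdd := by
    choose C hC using fun i => (m i).bdd
    refine ⟨∑ i ∈ s, C i, fun Z => ⟨fun f => ?_, fun f => ?_⟩⟩
    · rw [LinearMap.sum_apply, Finset.sum_mul]
      exact norm_sum_le_of_le _ fun i _ => (hC i Z).1 f
    · rw [LinearMap.sum_apply, Finset.sum_mul]
      exact norm_sum_le_of_le _ fun i _ => (hC i Z).2 f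
  L_comp h g := by
    simp only [LinearMap.sum_apply, map_sum, L_comp]
  R_comp f h := by
    simp only [LinearMap.sum_apply, map_sum, R_comp]
  comp_L g f := by
    simp only [LinearMap.sum_apply, map_sum, comp_L]

lemma sum_L {I : Type*} (s : Finset I) (m : I → Mult V X Y) (f : V.Hom Z X) :
    (sum s m).L Z f = ∑ i ∈ s, (m i).L Z f := LinearMap.sum_apply _ _ _

lemma sum_R {I : Type*} (s : Finset I) (m : I → Mult V X Y) (f : V.Hom Y Z) :
    (sum s m).R Z f = ∑ i ∈ s, (m i).R Z f := LinearMap.sum_apply _ _ _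

/-- A bounded net of multipliers which is strictly convergent at every morphism has a strict
limit. -/
theorem exists_of_tendsto {I : Type*} {l : Filter I} [l.NeBot] (m : I → Mult V X Y) {C : ℝ}
    (h0 : 0 ≤ C) (hC : ∀ᶠ i in l, ∀ Z (f : V.Hom Z X), ‖(m i).L Z f‖ ≤ C * ‖f‖)
    (hL : ∀ Z (f : V.Hom Z X), ∃ g, Tendsto (fun i => (m i).L Z f) l (𝓝 g))
    (hR : ∀ Z (f : V.Hom Y Z), ∃ g, Tendsto (fun i => (m i).R Z f) l (𝓝 g)) :
    ∃ M : Mult V X Y, (∀ Z f, Tendsto (fun i => (m i).L Z f) l (𝓝 (M.L Z f))) ∧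
      (∀ Z f, Tendsto (fun i => (m i).R Z f) l (𝓝 (M.R Z f))) := by
  choose L hL using hL
  choose R hR using hR
  refine ⟨{ L := fun Z =>
              { toFun := L Z
                map_add' := fun f g => tendsto_nhds_unique (hL _ _) (by
                  simpa only [map_add] using (hL Z f).add (hL Z g))
                map_smul' := fun c f => tendsto_nhds_unique (hL _ _) (by
                  simpa only [map_smul, RingHom.id_apply] using (hL Z f).const_smul c) }
            R := fun Z =>
              { toFun := R Z
                map_add' := fun f g => tendsto_nhds_unique (hR _ _) (by
                  simpa only [map_add] using (hR Z f).add (hR Z g))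
                map_smul' := fun c f => tendsto_nhds_unique (hR _ _) (by
                  simpa only [map_smul, RingHom.id_apply] using (hR Z f).const_smul c) }
            bdd := ⟨C, fun Z => ⟨fun f => ?_, fun f => ?_⟩⟩
            L_comp := fun {W Z} h g => tendsto_nhds_unique (hL _ _) ?_
            R_comp := fun {W Z} f h => tendsto_nhds_unique (hR _ _) ?_
            comp_L := fun {W Z} g f => tendsto_nhds_unique
              (tendsto_comp tendsto_const_nhds (hL W f)) ?_ }, hL, hR⟩
  · exact le_of_tendsto (hL Z f).norm (hC.mono fun i hi => hi Z f)
  · exact le_of_tendsto (hR Z f).norm (hC.mono fun i hi => norm_R_le_of_L h0 hi Z f)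
  · exact (tendsto_comp (hL Z h) (tendsto_const_nhds (x := g))).congr fun i => ((m i).L_comp _ _).symm
  · exact (tendsto_comp (tendsto_const_nhds (x := f)) (hR W h)).congr fun i =>
      ((m i).R_comp _ _).symm
  · exact (tendsto_comp (hR Z g) (tendsto_const_nhds (x := f))).congr fun i =>
      ((m i).comp_L _ _).symm

/-- A multiplier is an isometry if it preserves the products `g^* ∘ f`. -/
lemma isIsometry_of_adj_comp {m : Mult V X Y}
    (h : ∀ Z (g f : V.Hom Z X), V.comp (V.adj (m.L Z g)) (m.L Z f) = V.comp (V.adj g) f) :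
    m.IsIsometry := by
  refine ext_L fun Z f => ?_
  refine sub_eq_zero.1 (eq_zero_of_adj_comp_self ?_)
  have key : ∀ g : V.Hom Z X, V.comp (V.adj g) (m.adj.L Z (m.L Z f) - f) = 0 := by
    intro g
    rw [comp_sub, ← adj_L_comp, h, sub_self]
  -- The choice `g = m^* m f - f` makes `key` the vanishing of `g^* g`.
  exact key _

lemma IsIsometry.comp_L_adj {m : Mult V X Y} (hm : m.IsIsometry) (f : V.Hom Z X) :
    m.adj.L Z (m.L Z f) = f := by
  rw [← comp_L_apply, hm, id_L]

lemma IsIsometry.comp_R_adj {m : Mult V X Y} (hm : m.IsIsometry) (f : V.Hom X Z) :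
    m.R Z (m.adj.R Z f) = f := by
  rw [← comp_R_apply, hm, id_R]

lemma IsIsometry.isProjection {m : Mult V X Y} (hm : m.IsIsometry) :
    (m.comp m.adj).IsProjection := by
  constructor
  · rw [comp_assoc, ← comp_assoc m.adj m, hm, id_comp]
  · rw [adj_comp, adj_adj]

lemma IsProjection.norm_L_le {p : Mult V X X} (hp : p.IsProjection) (f : V.Hom Z X) :
    ‖p.L Z f‖ ≤ ‖f‖ := by
  have h2 := V.norm_adj_comp_self (p.L Z f)
  rw [adj_L_comp, hp.2, ← comp_L_apply, hp.1] at h2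
  have h3 := V.norm_comp_le (V.adj f) (p.L Z f)
  rw [h2, V.norm_adj] at h3
  rcases (norm_nonneg (p.L Z f)).eq_or_lt with h0 | h0
  · rw [← h0]; exact norm_nonneg _
  · nlinarith

lemma tendsto_R_of_L {I : Type*} {l : Filter I} {m : I → Mult V X Y} {n : Mult V X Y}
    {Z : V.Obj} {f : V.Hom Y Z}
    (h : Tendsto (fun i => (m i).adj.L Z (V.adj f)) l (𝓝 (n.adj.L Z (V.adj f)))) :
    Tendsto (fun i => (m i).R Z f) l (𝓝 (n.R Z f)) := by
  simpa only [adj_L, V.adj_adj] using tendsto_adj h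

end Mult

/-! ### Full and faithful functors and multipliers -/

/-- An isometric and full linear `*`-functor. -/
structure FullFunctor (V : CStarCat.{u₁, v₁}) (W : CStarCat.{u₂, v₂}) extends
    StarFunctor V W where
  norm_map : ∀ {X Y : V.Obj} (f : V.Hom X Y), ‖map f‖ = ‖f‖
  surj : ∀ {X Y : V.Obj} (g : W.Hom (obj X) (obj Y)), ∃ f : V.Hom X Y, map f = g

namespace FullFunctor

open CStarCat

variable {V : CStarCat.{u₁, v₁}} {W : CStarCat.{u₂, v₂}} (F : FullFunctor V W)
  {X Y Z : V.Obj}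

lemma inj {f g : V.Hom X Y} (h : F.map f = F.map g) : f = g := by
  rw [← sub_eq_zero, ← norm_eq_zero, ← F.norm_map, map_sub, h, sub_self, norm_zero]

/-- The inverse of `F` on morphisms. -/
def inv : W.Hom (F.obj X) (F.obj Y) →ₗ[ℂ] V.Hom X Y :=
  (LinearEquiv.ofBijective (F.map (X := X) (Y := Y)) ⟨fun _ _ h => F.inj h, F.surj⟩).symm

@[simp]
lemma map_inv (g : W.Hom (F.obj X) (F.obj Y)) : F.map (F.inv g) = g :=
  LinearEquiv.apply_symm_apply (LinearEquiv.ofBijective (F.map (X := X) (Y := Y)) _) g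

@[simp]
lemma inv_map (f : V.Hom X Y) : F.inv (F.map f) = f := F.inj (F.map_inv _)

lemma norm_inv (g : W.Hom (F.obj X) (F.obj Y)) : ‖F.inv g‖ = ‖g‖ := by
  rw [← F.norm_map, map_inv]

lemma inv_comp (g : W.Hom (F.obj Y) (F.obj Z)) (f : W.Hom (F.obj X) (F.obj Y)) :
    F.inv (W.comp g f) = V.comp (F.inv g) (F.inv f) :=
  F.inj (by rw [F.map_comp, map_inv, map_inv, map_inv])

lemma inv_adj (g : W.Hom (F.obj X) (F.obj Y)) : F.inv (W.adj g) = V.adj (F.inv g) :=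
  F.inj (by rw [F.map_adj, map_inv, map_inv])

lemma continuous_map : Continuous (F.map (X := X) (Y := Y)) :=
  (AddMonoidHomClass.isometry_of_norm (F.map (X := X) (Y := Y)) F.norm_map).continuous

lemma continuous_inv : Continuous (F.inv (X := X) (Y := Y)) :=
  (AddMonoidHomClass.isometry_of_norm (F.inv (X := X) (Y := Y)) F.norm_inv).continuous

/-- By fullness an approximate unit of the endomorphisms of `F X` lies in the image of `F`. Here `Z`
is any object of `W`, not only one in the image. -/
lemma mem_closure_left {Z : W.Obj} (f : W.Hom Z (F.obj X)) :
    f ∈ closure {h | ∃ (a : V.Hom X X) (g : W.Hom Z (F.obj X)), W.comp (F.map a) g = h} := by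
  obtain ⟨l, hl, -, h1, -⟩ := exists_approxUnit W (F.obj X)
  exact mem_closure_of_tendsto (h1 Z f) (Eventually.of_forall fun e =>
    ⟨F.inv e, f, by rw [map_inv]⟩)

lemma mem_closure_right {Z : W.Obj} (f : W.Hom (F.obj X) Z) :
    f ∈ closure {h | ∃ (a : V.Hom X X) (g : W.Hom (F.obj X) Z), W.comp g (F.map a) = h} := by
  obtain ⟨l, hl, -, -, h1⟩ := exists_approxUnit W (F.obj X)
  exact mem_closure_of_tendsto (h1 Z f) (Eventually.of_forall fun e =>
    ⟨F.inv e, f, by rw [map_inv]⟩)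

theorem nondegenerate : F.Nondegenerate := by
  intro X Y
  constructor
  · rw [eq_top_iff]
    rintro f -
    rw [← SetLike.mem_coe, Submodule.topologicalClosure_coe]
    exact closure_mono Submodule.subset_span (F.mem_closure_left f)
  · rw [eq_top_iff]
    rintro f -
    rw [← SetLike.mem_coe, Submodule.topologicalClosure_coe]
    refine closure_mono (Set.Subset.trans ?_ Submodule.subset_span) (F.mem_closure_right f)
    rintro _ ⟨a, g, rfl⟩
    exact ⟨g, a, rfl⟩

/-- `M` is the strict limit of the morphisms `F (m e)` along an approximate unit `e` of `X`.
Convergence is clear on morphisms factoring through the image of an endomorphism, and these are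
dense at every test object of `W`. -/
lemma exists_mapMult (m : Mult V X Y) : ∃ M : Mult W (F.obj X) (F.obj Y),
    ∀ Z (f : V.Hom Z X), M.L _ (F.map f) = F.map (m.L Z f) := by
  obtain ⟨l, hl, hn, h1, h2⟩ := exists_approxUnit V X
  obtain ⟨C, hC0, hC⟩ := m.exists_norm_le
  let n : V.Hom X X → Mult W (F.obj X) (F.obj Y) := fun e => Mult.ofHom (F.map (m.L X e))
  have hb : ∀ᶠ e in l, ‖F.map (m.L X e)‖ ≤ C := by
    filter_upwards [hn] with e he
    rw [F.norm_map]
    exact (hC _ _).trans (by nlinarith)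
  have hbL : ∀ᶠ e in l, ∀ Z (f : W.Hom Z (F.obj X)), ‖(n e).L Z f‖ ≤ C * ‖f‖ := by
    filter_upwards [hb] with e he Z f
    exact (W.norm_comp_le _ _).trans (by gcongr)
  have hbR : ∀ᶠ e in l, ∀ Z (f : W.Hom (F.obj Y) Z), ‖(n e).R Z f‖ ≤ C * ‖f‖ := by
    filter_upwards [hbL] with e he Z f using Mult.norm_R_le_of_L hC0 he Z f
  have tL : ∀ Z (f : V.Hom Z X), Tendsto (fun e => (n e).L _ (F.map f)) l
      (𝓝 (F.map (m.L Z f))) := by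
    intro Z f
    have h3 := ((F.continuous_map.comp (m.continuous_L Z)).tendsto f).comp (h1 Z f)
    refine h3.congr fun e => ?_
    simp only [Function.comp_apply, n, Mult.ofHom_L, ← F.map_comp, m.L_comp]
  obtain ⟨M, hM, -⟩ := Mult.exists_of_tendsto (l := l) n hC0 hbL (fun Z f => by
    refine (isClosed_setOf_exists_tendsto (T := fun e => (n e).L Z)
      (hbL.mono fun e he => he Z)).closure_subset_iff.2 ?_ (F.mem_closure_left f)
    rintro _ ⟨a, g, rfl⟩
    refine ⟨W.comp (F.map (m.L X a)) g, ?_⟩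
    simpa only [Mult.L_comp] using tendsto_comp (tL _ a) (tendsto_const_nhds (x := g)))
    (fun Z f => by
    refine (isClosed_setOf_exists_tendsto (T := fun e => (n e).R Z)
      (hbR.mono fun e he => he Z)).closure_subset_iff.2 ?_ (F.mem_closure_right f)
    rintro _ ⟨a, g, rfl⟩
    refine ⟨W.comp g (F.map (m.R Y a)), ?_⟩
    have h3 := tendsto_comp (tendsto_const_nhds (x := g))
      ((F.continuous_map.tendsto _).comp (h2 _ (m.R Y a)))
    refine h3.congr fun e => ?_
    simp only [Function.comp_apply, n, Mult.ofHom_R, ← m.comp_L, F.map_comp, W.assoc])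
  exact ⟨M, fun Z f => tendsto_nhds_unique (hM _ _) (tL Z f)⟩

/-- The extension of a full functor to multipliers. -/
def mapMult (m : Mult V X Y) : Mult W (F.obj X) (F.obj Y) := (F.exists_mapMult m).choose

lemma mapMult_L (m : Mult V X Y) (f : V.Hom Z X) :
    (F.mapMult m).L _ (F.map f) = F.map (m.L Z f) := (F.exists_mapMult m).choose_spec Z f

lemma mapMult_R (m : Mult V X Y) (f : V.Hom Y Z) :
    (F.mapMult m).R _ (F.map f) = F.map (m.R Z f) := by
  refine ext_right fun k => ?_
  rw [← Mult.comp_L, ← F.map_inv k, mapMult_L, ← F.map_comp, ← F.map_comp, m.comp_L]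

/-- Endomorphisms of `F X` are all of the form `F f`, so `Mult.ext_end` applies. Most identities for
`mapMult` reduce to this. -/
lemma mult_ext {Y : W.Obj} {M N : Mult W (F.obj X) Y}
    (h : ∀ f : V.Hom X X, M.L _ (F.map f) = N.L _ (F.map f)) : M = N :=
  Mult.ext_end fun f => by rw [← F.map_inv f, h]

lemma mapMult_comp (n : Mult V Y Z) (m : Mult V X Y) :
    F.mapMult (n.comp m) = (F.mapMult n).comp (F.mapMult m) :=
  F.mult_ext fun f => by
    rw [Mult.comp_L_apply, mapMult_L, mapMult_L, mapMult_L, Mult.comp_L_apply]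

lemma mapMult_adj (m : Mult V X Y) : F.mapMult m.adj = (F.mapMult m).adj :=
  F.mult_ext fun f => by
    rw [mapMult_L, Mult.adj_L, Mult.adj_L, F.map_adj, ← F.map_adj f, mapMult_R]

lemma mapMult_id : F.mapMult (Mult.id X) = Mult.id (F.obj X) :=
  F.mult_ext fun f => by rw [mapMult_L, Mult.id_L, Mult.id_L]

lemma mapMult_ofHom (f : V.Hom X Y) : F.mapMult (Mult.ofHom f) = Mult.ofHom (F.map f) :=
  F.mult_ext fun g => by rw [mapMult_L, Mult.ofHom_L, Mult.ofHom_L, F.map_comp]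

lemma mapMult_isIsometry {m : Mult V X Y} (h : m.IsIsometry) : (F.mapMult m).IsIsometry := by
  rw [Mult.IsIsometry, ← mapMult_adj, ← mapMult_comp, h, mapMult_id]

lemma mapMult_isProjection {m : Mult V X X} (h : m.IsProjection) :
    (F.mapMult m).IsProjection :=
  ⟨by rw [← mapMult_comp, h.1], by rw [← mapMult_adj, h.2]⟩

/-- The multiplier of the source category corresponding to a multiplier of the target. -/
def comapMult (M : Mult W (F.obj X) (F.obj Y)) : Mult V X Y where
  L Z := F.inv ∘ₗ M.L (F.obj Z) ∘ₗ F.map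
  R Z := F.inv ∘ₗ M.R (F.obj Z) ∘ₗ F.map
  bdd := by
    obtain ⟨C, hC⟩ := M.bdd
    refine ⟨C, fun Z => ⟨fun f => ?_, fun f => ?_⟩⟩
    · simpa only [LinearMap.comp_apply, norm_inv, F.norm_map] using (hC (F.obj Z)).1 (F.map f)
    · simpa only [LinearMap.comp_apply, norm_inv, F.norm_map] using (hC (F.obj Z)).2 (F.map f)
  L_comp h g := by
    simp only [LinearMap.comp_apply, F.map_comp, M.L_comp, inv_comp, inv_map]
  R_comp h g := by
    simp only [LinearMap.comp_apply, F.map_comp, M.R_comp, inv_comp, inv_map]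
  comp_L g f := F.inj (by
    simp only [LinearMap.comp_apply, F.map_comp, map_inv, M.comp_L])

lemma comapMult_L (M : Mult W (F.obj X) (F.obj Y)) (f : V.Hom Z X) :
    F.map ((F.comapMult M).L Z f) = M.L _ (F.map f) := F.map_inv _

lemma comapMult_R (M : Mult W (F.obj X) (F.obj Y)) (f : V.Hom Y Z) :
    F.map ((F.comapMult M).R Z f) = M.R _ (F.map f) := F.map_inv _

/-- Together with `comapMult_mapMult`: a full functor is bijective on multipliers, although those of
`W` act on more test objects. Projections, isometries and unitaries can therefore be moved in both
directions. -/
lemma mapMult_comapMult (M : Mult W (F.obj X) (F.obj Y)) : F.mapMult (F.comapMult M) = M :=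
  F.mult_ext fun f => by rw [mapMult_L, comapMult_L]

lemma comapMult_mapMult (m : Mult V X Y) : F.comapMult (F.mapMult m) = m :=
  Mult.ext_L fun Z f => F.inj (by rw [comapMult_L, mapMult_L])

lemma mapMult_inj {m n : Mult V X Y} (h : F.mapMult m = F.mapMult n) : m = n := by
  rw [← F.comapMult_mapMult m, h, comapMult_mapMult]

lemma comapMult_isProjection {M : Mult W (F.obj X) (F.obj X)} (h : M.IsProjection) :
    (F.comapMult M).IsProjection :=
  ⟨F.mapMult_inj (by rw [mapMult_comp, mapMult_comapMult, h.1]),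
    F.mapMult_inj (by rw [mapMult_adj, mapMult_comapMult, h.2])⟩

lemma isUnitary_of_mapMult {m : Mult V X Y} (h : (F.mapMult m).IsUnitary) : m.IsUnitary :=
  ⟨F.mapMult_inj (by rw [mapMult_comp, mapMult_adj, h.1, mapMult_id]),
    F.mapMult_inj (by rw [mapMult_comp, mapMult_adj, h.2, mapMult_id])⟩

lemma isIsometry_of_mapMult {m : Mult V X Y} (h : (F.mapMult m).IsIsometry) : m.IsIsometry :=
  F.mapMult_inj (by rw [mapMult_comp, mapMult_adj, h, mapMult_id])

end FullFunctor

end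

noncomputable section

open CStarCat

/-! ### Equivalences -/

lemma CStarCat.Equivalent.symm {V : CStarCat.{u₁, v₁}} {W : CStarCat.{u₂, v₂}}
    (h : V.Equivalent W) : W.Equivalent V := by
  obtain ⟨F, G, hF, hG, hσ, hτ⟩ := h
  exact ⟨G, F, hG, hF, hτ, hσ⟩

namespace Mult

variable {V : CStarCat.{u, v}} {W X Y Z : V.Obj}

lemma IsUnitary.isIsometry {m : Mult V X Y} (h : m.IsUnitary) : m.IsIsometry := h.1

lemma IsUnitary.adj {m : Mult V X Y} (h : m.IsUnitary) : m.adj.IsUnitary :=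
  ⟨by rw [adj_adj, h.2], by rw [adj_adj, h.1]⟩

/-- Two isometries splitting the same projection differ by a unitary. This produces the isomorphisms
in `split_equivalent` and `finPres_equivalent`. -/
lemma isUnitary_adj_comp {m : Mult V X Z} {s : Mult V Y Z} (hm : m.IsIsometry)
    (hs : s.IsIsometry) (h : s.comp s.adj = m.comp m.adj) : (m.adj.comp s).IsUnitary := by
  constructor
  · rw [Mult.adj_comp, Mult.adj_adj, Mult.comp_assoc, ← Mult.comp_assoc m, ← h, Mult.comp_assoc s,
      hs, Mult.comp_id, hs]
  · rw [Mult.adj_comp, Mult.adj_adj, Mult.comp_assoc, ← Mult.comp_assoc s, h, Mult.comp_assoc m,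
      hm, Mult.comp_id, hm]

lemma IsUnitary.L_adj_L {m : Mult V X Y} (h : m.IsUnitary) (f : V.Hom Z Y) :
    m.L Z (m.adj.L Z f) = f := by
  rw [← comp_L_apply, h.2, id_L]

end Mult

/-- Choose unitaries `t_Y : F (g Y) → Y` and let the quasi-inverse send `f` to the preimage under
`F` of `t_Y^* f t_X`. The `t_Y` are one natural isomorphism; their preimages at the objects `F X`
are the other. Nondegeneracy is automatic for full functors. -/
theorem FullFunctor.equivalent {V : CStarCat.{u₁, v₁}} {W : CStarCat.{u₂, v₂}}
    (F : FullFunctor V W) (h : ∀ Y : W.Obj, ∃ X : V.Obj, W.Isomorphic (F.obj X) Y) :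
    V.Equivalent W := by
  choose g t ht using h
  let G₀ : FullFunctor W V :=
    { obj := g
      map := fun {X Y} => F.inv ∘ₗ (t Y).adj.L (F.obj (g X)) ∘ₗ (t X).R Y
      map_comp := fun {X Y Z} k f => F.inj (by
        simp only [LinearMap.comp_apply, F.map_comp, F.map_inv]
        rw [(t X).R_comp k, ← (t Z).adj.L_comp, ← (t Y).comp_L, (ht Y).L_adj_L])
      map_adj := fun {X Y} f => F.inj (by
        simp only [LinearMap.comp_apply, F.map_adj, F.map_inv]
        rw [Mult.adj_of_L, Mult.adj_of_R, Mult.adj_adj, Mult.L_R])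
      norm_map := fun {X Y} f => by
        simp only [LinearMap.comp_apply, F.norm_inv]
        rw [(ht Y).adj.isIsometry.norm_L, ← (t X).adj_adj, (ht X).adj.isIsometry.norm_adj_R]
      surj := fun {X Y} f => ⟨(t Y).L _ ((t X).adj.R _ (F.map f)), F.inj (by
        simp only [LinearMap.comp_apply, F.map_inv]
        rw [← Mult.L_R, (ht Y).isIsometry.comp_L_adj, (ht X).isIsometry.comp_R_adj])⟩ }
  have hG : ∀ {X Y : W.Obj} (f : W.Hom X Y), F.map (G₀.map f) = (t Y).adj.L _ ((t X).R _ f) :=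
    fun f => F.map_inv _
  refine ⟨F.toStarFunctor, G₀.toStarFunctor, F.nondegenerate, G₀.nondegenerate,
    ⟨fun X => F.comapMult (t (F.obj X)), fun X => F.isUnitary_of_mapMult ?_, fun {X Y} f =>
      F.inj ?_⟩, ⟨t, ht, fun {X Y} f => ?_⟩⟩
  · rw [F.mapMult_comapMult]; exact ht _
  · rw [F.comapMult_L, F.comapMult_R, hG, (ht _).L_adj_L]
  · change (t Y).L _ (F.map (G₀.map f)) = _
    rw [hG, (ht _).L_adj_L]

/-! ### The subobject completion -/

namespace SplitObj

variable {V : CStarCat.{u, v}} {A B C : SplitObj V}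

lemma R_mem {g : V.Hom A.X B.X} (h : B.p.L A.X g = g) : A.p.R B.X g ∈ A.Hom B :=
  ⟨by rw [← Mult.comp_R_apply, A.isProj.1], by rw [Mult.L_R, h]⟩

lemma comp_R {f : V.Hom A.X B.X} (hf : f ∈ A.Hom B) (g : V.Hom B.X C.X) :
    V.comp g f = V.comp (B.p.R C.X g) f := by
  rw [← B.p.comp_L, hf.2]

lemma adj_R_adj (f : V.Hom B.X A.X) : V.adj (A.p.R B.X (V.adj f)) = A.p.L B.X f := by
  rw [Mult.adj_of_R, V.adj_adj, A.isProj.2]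

lemma norm_R_le (g : V.Hom A.X B.X) : ‖A.p.R B.X g‖ ≤ 1 * ‖g‖ :=
  Mult.norm_R_le_of_L zero_le_one
    (fun Z f => by rw [one_mul]; exact A.isProj.norm_L_le (Z := Z) f) _ g

end SplitObj

namespace Split

variable {V : CStarCat.{u, v}} {A B C D : (Split V).Obj}

/-- The underlying object of an object of the subobject completion. -/
def ob (A : (Split V).Obj) : V.Obj := SplitObj.X A

/-- The projection of an object of the subobject completion. -/
def pr (A : (Split V).Obj) : Mult V (ob A) (ob A) := SplitObj.p A

lemma pr_isProjection (A : (Split V).Obj) : (pr A).IsProjection := SplitObj.isProj A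

/-- The object of the subobject completion given by an object of the category. -/
def of (X : V.Obj) : (Split V).Obj := (⟨X, Mult.id X, rfl, Mult.id_adj⟩ : SplitObj V)

/-- The morphism of the subobject completion given by a morphism of the category. -/
def ofHom (X Y : V.Obj) : V.Hom X Y →ₗ[ℂ] (Split V).Hom (of X) (of Y) where
  toFun f := ⟨f, rfl, rfl⟩
  map_add' _ _ := rfl
  map_smul' _ _ := rfl

variable (V) in
/-- The inclusion of a category into its subobject completion. -/
def incl : FullFunctor V (Split V) where
  obj := of
  map {X Y} := ofHom X Y
  map_comp _ _ := rfl
  map_adj _ := rfl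
  norm_map _ := rfl
  surj g := ⟨g.1, rfl⟩

/-- The canonical isometry `(X, p) → (X, id)`. -/
def ι (A : (Split V).Obj) : Mult (Split V) A ((incl V).obj (ob A)) where
  L _ :=
    { toFun := fun f => ⟨f.1, f.2.1, rfl⟩
      map_add' := fun _ _ => rfl
      map_smul' := fun _ _ => rfl }
  -- A morphism out of `(X, id)` need not satisfy `f p = f`, so restricting it to `(X, p)` means
  -- composing with `p`; on the left nothing has to be changed.
  R Z :=
    { toFun := fun f => ⟨SplitObj.p A |>.R _ f.1, SplitObj.R_mem (B := Z) f.2.2⟩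
      map_add' := fun f g => Subtype.ext (map_add ((SplitObj.p A).R _) f.1 g.1)
      map_smul' := fun c f => Subtype.ext (map_smul ((SplitObj.p A).R _) c f.1) }
  bdd := ⟨1, fun Z => ⟨fun _ => (one_mul _).ge,
    fun f => SplitObj.norm_R_le (A := A) (B := Z) f.1⟩⟩
  L_comp _ _ := rfl
  R_comp f h := Subtype.ext ((SplitObj.p A).R_comp f.1 h.1)
  comp_L {W Z} g f := Subtype.ext (SplitObj.comp_R (A := W) (B := A) (C := Z) f.2 g.1)

lemma ι_isIsometry (A : (Split V).Obj) : (ι A).IsIsometry :=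
  Mult.ext_L fun Z f => Subtype.ext
    ((SplitObj.adj_R_adj (A := A) (B := Z) f.1).trans f.2.2)

lemma ι_comp_adj (A : (Split V).Obj) : (ι A).comp (ι A).adj = (incl V).mapMult (pr A) :=
  (incl V).mult_ext fun f => by
    rw [FullFunctor.mapMult_L]
    exact Subtype.ext (SplitObj.adj_R_adj (A := A) (B := (incl V).obj (ob A)) f)

/-- A projection of a category splits in its subobject completion. -/
lemma exists_split {X : V.Obj} (p : Mult V X X) (hp : p.IsProjection) :
    ∃ (U : (Split V).Obj) (j : Mult (Split V) U ((incl V).obj X)), j.IsIsometry ∧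
      j.comp j.adj = (incl V).mapMult p := by
  let U : (Split V).Obj := (⟨X, p, hp⟩ : SplitObj V)
  exact ⟨U, ι U, ι_isIsometry U, ι_comp_adj U⟩

/-- A projection `M` on `(X, p)` gives the projection `ι M ι^*` on `(X, id)`, which by fullness of
the inclusion comes from a projection of `V` on `X` and so splits. The splitting isometry lands in
the range of `ι`, so `ι^*` can be composed with it. -/
theorem subobjectComplete (V : CStarCat.{u, v}) : (Split V).SubobjectComplete := by
  intro A M hM
  let N := (ι A).comp (M.comp (ι A).adj)
  have hN : N.IsProjection := by
    constructor
    · simp only [N, Mult.comp_assoc]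
      rw [← Mult.comp_assoc (ι A).adj (ι A), ι_isIsometry, Mult.id_comp, ← Mult.comp_assoc M, hM.1]
    · simp only [N, Mult.adj_comp, Mult.adj_adj, hM.2, Mult.comp_assoc]
  obtain ⟨U, j, hj, hjN⟩ := exists_split _ ((incl V).comapMult_isProjection hN)
  rw [(incl V).mapMult_comapMult] at hjN
  have hNj : N.comp j = j := by
    rw [← hjN, Mult.comp_assoc, hj, Mult.comp_id]
  have hA : (ι A).comp ((ι A).adj.comp N) = N := by
    simp only [N]
    rw [← Mult.comp_assoc (ι A).adj (ι A), ι_isIsometry, Mult.id_comp]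
  have hAj : (ι A).comp ((ι A).adj.comp j) = j := by
    rw [← hNj, ← Mult.comp_assoc (ι A).adj, ← Mult.comp_assoc (ι A), hA]
  refine ⟨U, (ι A).adj.comp j, ?_, ?_⟩
  · rw [Mult.IsIsometry, Mult.adj_comp, Mult.adj_adj, Mult.comp_assoc, hAj, hj]
  · rw [Mult.adj_comp, Mult.adj_adj, Mult.comp_assoc, ← Mult.comp_assoc j, hjN]
    simp only [N, Mult.comp_assoc]
    rw [ι_isIsometry, Mult.comp_id, ← Mult.comp_assoc, ι_isIsometry, Mult.id_comp]

/-- A morphism from a general object `A` of the completion is precomposed with `ι^*` to start at an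
object of `V`, acted on there, and restricted back along `ι`. This carries strict convergence from
`V` to its completion. -/
lemma incl_mapMult_L {Y Z : V.Obj} (m : Mult V Y Z) (f : (Split V).Hom A ((incl V).obj Y)) :
    ((incl V).mapMult m).L A f = (ι A).R _ ((incl V).map
      (m.L _ ((incl V).inv ((ι A).adj.R _ f)))) := by
  rw [← FullFunctor.mapMult_L, FullFunctor.map_inv, ← Mult.L_R, (ι_isIsometry A).comp_R_adj]

lemma tendsto_incl_mapMult_L {I : Type*} {l : Filter I} {Y Z : V.Obj} {m : I → Mult V Y Z}
    {n : Mult V Y Z}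
    (h : ∀ X (f : V.Hom X Y), Tendsto (fun i => (m i).L X f) l (𝓝 (n.L X f)))
    (f : (Split V).Hom A ((incl V).obj Y)) :
    Tendsto (fun i => ((incl V).mapMult (m i)).L A f) l (𝓝 (((incl V).mapMult n).L A f)) := by
  simp only [incl_mapMult_L]
  exact ((ι A).continuous_R _).tendsto _ |>.comp (((incl V).continuous_map.tendsto _).comp (h _ _))

/-- The underlying morphism of a morphism of the subobject completion. -/
def val : (Split V).Hom A B →ₗ[ℂ] V.Hom (ob A) (ob B) :=
  (incl V).inv ∘ₗ (ι B).L _ ∘ₗ (ι A).adj.R _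

lemma incl_val (f : (Split V).Hom A B) :
    (incl V).map (val f) = (ι B).L _ ((ι A).adj.R _ f) := (incl V).map_inv _

lemma val_eq (f : (Split V).Hom A B) : val f = f.1 :=
  (incl V).inj ((incl_val f).trans (Subtype.ext (V.adj_adj f.1)))

lemma val_comp (g : (Split V).Hom B C) (f : (Split V).Hom A B) :
    val ((Split V).comp g f) = V.comp (val g) (val f) :=
  (incl V).inj (by
    rw [(incl V).map_comp, incl_val, incl_val, incl_val, ← Mult.L_comp, ← Mult.comp_L,
      (ι_isIsometry B).comp_L_adj, Mult.R_comp])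

lemma val_adj (f : (Split V).Hom A B) : val ((Split V).adj f) = V.adj (val f) :=
  (incl V).inj (by
    rw [(incl V).map_adj, incl_val, incl_val, Mult.adj_of_L, Mult.adj_of_R, Mult.adj_adj,
      Mult.L_R])

lemma norm_val (f : (Split V).Hom A B) : ‖val f‖ = ‖f‖ := by
  rw [← (incl V).norm_map, incl_val, (ι_isIsometry B).norm_L, (ι_isIsometry A).norm_adj_R]

lemma pr_L_val (f : (Split V).Hom A B) : (pr B).L _ (val f) = val f :=
  (incl V).inj (by
    rw [← (incl V).mapMult_L, ← ι_comp_adj, incl_val, Mult.comp_L_apply,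
      (ι_isIsometry B).comp_L_adj])

lemma pr_R_val (f : (Split V).Hom A B) : (pr A).R _ (val f) = val f :=
  (incl V).inj (by
    rw [← (incl V).mapMult_R, ← ι_comp_adj, incl_val, Mult.comp_R_apply, ← Mult.L_R (ι B),
      (ι_isIsometry A).comp_R_adj, Mult.L_R])

/-- The preimage is `ι_B^* f ι_A`; the two hypotheses say that cutting by the projections loses
nothing. -/
lemma exists_val_eq {f : V.Hom (ob A) (ob B)} (hL : (pr B).L _ f = f) (hR : (pr A).R _ f = f) :
    ∃ g : (Split V).Hom A B, val g = f := by
  refine ⟨(ι B).adj.L _ ((ι A).R _ ((incl V).map f)), (incl V).inj ?_⟩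
  rw [incl_val, ← Mult.L_R, ← Mult.comp_L_apply, ι_comp_adj, ← Mult.comp_R_apply, ι_comp_adj,
    FullFunctor.mapMult_R, FullFunctor.mapMult_L, hR, hL]

end Split

/-! ### Extension of functors to the subobject completion -/

namespace FullFunctor

variable {V : CStarCat.{u₁, v₁}} {W : CStarCat.{u₂, v₂}} (F : FullFunctor V W)
  (hW : W.SubobjectComplete)

/-- The splitting of the image of a projection. -/
def splitObj (A : (Split V).Obj) : W.Obj :=
  (hW _ _ (F.mapMult_isProjection (Split.pr_isProjection A))).choose

/-- The isometry of the splitting of the image of a projection. -/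
def splitIso (A : (Split V).Obj) : Mult W (F.splitObj hW A) (F.obj (Split.ob A)) :=
  (hW _ _ (F.mapMult_isProjection (Split.pr_isProjection A))).choose_spec.choose

lemma splitIso_isIsometry (A : (Split V).Obj) : (F.splitIso hW A).IsIsometry :=
  (hW _ _ (F.mapMult_isProjection (Split.pr_isProjection A))).choose_spec.choose_spec.1

lemma splitIso_comp_adj (A : (Split V).Obj) :
    (F.splitIso hW A).comp (F.splitIso hW A).adj = F.mapMult (Split.pr A) :=
  (hW _ _ (F.mapMult_isProjection (Split.pr_isProjection A))).choose_spec.choose_spec.2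

lemma splitIso_L_adj {A B : (Split V).Obj} (f : (Split V).Hom A B) :
    (F.splitIso hW B).L _ ((F.splitIso hW B).adj.L _ (F.map (Split.val f))) =
      F.map (Split.val f) := by
  rw [← Mult.comp_L_apply, splitIso_comp_adj, mapMult_L, Split.pr_L_val]

lemma splitIso_adj_R {A B : (Split V).Obj} (f : (Split V).Hom A B) :
    (F.splitIso hW A).adj.R _ ((F.splitIso hW A).R _ (F.map (Split.val f))) =
      F.map (Split.val f) := by
  rw [← Mult.comp_R_apply, splitIso_comp_adj, mapMult_R, Split.pr_R_val]

/-- The extension of a full functor to the subobject completion. -/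
def splitExt : FullFunctor (Split V) W where
  obj := F.splitObj hW
  map {A B} := (F.splitIso hW B).adj.L _ ∘ₗ (F.splitIso hW A).R _ ∘ₗ F.map ∘ₗ Split.val
  map_comp {A B C} g f := by
    simp only [LinearMap.comp_apply, Split.val_comp, F.map_comp]
    rw [← (F.splitIso hW C).adj.L_comp, ← Mult.comp_L,
      Mult.L_R (F.splitIso hW B).adj (F.splitIso hW A),
      Mult.L_R (F.splitIso hW B) (F.splitIso hW A), splitIso_L_adj,
      Mult.R_comp]
  map_adj {A B} f := by
    simp only [LinearMap.comp_apply, Split.val_adj, F.map_adj]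
    rw [Mult.adj_of_L, Mult.adj_of_R, Mult.adj_adj, Mult.L_R]
  norm_map {A B} f := by
    simp only [LinearMap.comp_apply]
    rw [← (F.splitIso_isIsometry hW B).norm_L, Mult.L_R, Mult.L_R, splitIso_L_adj,
      ← (F.splitIso_isIsometry hW A).norm_adj_R, splitIso_adj_R, F.norm_map, Split.norm_val]
  surj {A B} g := by
    have hB := F.splitIso_isIsometry hW B
    have hA := F.splitIso_isIsometry hW A
    obtain ⟨f, hf⟩ := F.surj ((F.splitIso hW B).L _ ((F.splitIso hW A).adj.R _ g))
    obtain ⟨h, rfl⟩ := Split.exists_val_eq (A := A) (B := B) (f := f)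
      (F.inj (by rw [← mapMult_L, ← F.splitIso_comp_adj hW, hf, Mult.comp_L_apply, hB.comp_L_adj]))
      (F.inj (by rw [← mapMult_R, ← F.splitIso_comp_adj hW, hf, Mult.comp_R_apply, ← Mult.L_R,
        hA.comp_R_adj, Mult.L_R]))
    refine ⟨h, ?_⟩
    simp only [LinearMap.comp_apply, hf]
    rw [← Mult.L_R, hB.comp_L_adj, hA.comp_R_adj]

/-- The isometry of the splitting of the image of a projection. -/
def splitι (A : (Split V).Obj) : Mult W ((F.splitExt hW).obj A) (F.obj (Split.ob A)) :=
  F.splitIso hW A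

lemma splitι_isIsometry (A : (Split V).Obj) : (F.splitι hW A).IsIsometry :=
  F.splitIso_isIsometry hW A

lemma splitι_comp_adj (A : (Split V).Obj) :
    (F.splitι hW A).comp (F.splitι hW A).adj = F.mapMult (Split.pr A) :=
  F.splitIso_comp_adj hW A

lemma splitExt_map {A B : (Split V).Obj} (f : (Split V).Hom A B) :
    (F.splitExt hW).map f =
      (F.splitι hW B).adj.L _ ((F.splitι hW A).R _ (F.map (Split.val f))) := rfl

lemma splitι_L_splitExt_map {A B : (Split V).Obj} (f : (Split V).Hom A B) :
    (F.splitι hW B).L _ ((F.splitExt hW).map f) = (F.splitι hW A).R _ (F.map (Split.val f)) := by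
  rw [splitExt_map, Mult.L_R, Mult.L_R, ← Mult.comp_L_apply, splitι_comp_adj, mapMult_L,
    Split.pr_L_val]

/-- The extension to the subobject completion of a functor extends the functor. -/
def splitInclι (X : V.Obj) : Mult W ((F.splitExt hW).obj ((Split.incl V).obj X)) (F.obj X) :=
  F.splitι hW ((Split.incl V).obj X)

lemma splitInclι_isUnitary (X : V.Obj) : (F.splitInclι hW X).IsUnitary :=
  ⟨F.splitι_isIsometry hW _, (F.splitι_comp_adj hW _).trans F.mapMult_id⟩

lemma splitInclι_L_map {X Y : V.Obj} (f : V.Hom X Y) :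
    (F.splitInclι hW Y).L _ ((F.splitExt hW).map ((Split.incl V).map f)) =
      (F.splitInclι hW X).R _ (F.map f) :=
  (F.splitι_L_splitExt_map hW ((Split.incl V).map f)).trans
    (congrArg (fun g => (F.splitInclι hW X).R _ (F.map g))
      (Split.val_eq ((Split.incl V).map f)))

/-- A full functor to a subobject complete category such that every object is a subobject of an
object in its image induces an equivalence with the subobject completion. -/
theorem split_equivalent (hW : W.SubobjectComplete)
    (h : ∀ Y : W.Obj, ∃ X : V.Obj, W.IsSubobject Y (F.obj X)) :
    (Split V).Equivalent W := by
  refine (F.splitExt hW).equivalent fun Y => ?_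
  obtain ⟨X, m, hm⟩ := h Y
  -- The range projection `m m^*` lives on `F X`, so by fullness it comes from a projection on `X`.
  -- Then `m` and the isometry of `splitExt` at `A` split the same projection of `W`.
  let A : (Split V).Obj :=
    (⟨X, F.comapMult (m.comp m.adj), F.comapMult_isProjection hm.isProjection⟩ : SplitObj V)
  exact ⟨A, m.adj.comp (F.splitι hW A), Mult.isUnitary_adj_comp hm (F.splitι_isIsometry hW A)
    ((F.splitι_comp_adj hW A).trans (F.mapMult_comapMult _))⟩

end FullFunctor

end

noncomputable section

open CStarCat

/-! ### Orthogonal sums of projections -/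

namespace Mult

variable {V : CStarCat.{u, v}} {W X Y Z : V.Obj}

lemma zero_L (f : V.Hom Z X) : (zero X Y).L Z f = 0 := rfl

lemma comp_zero (m : Mult V Y Z) : m.comp (zero X Y) = zero X Z :=
  ext_L fun W f => by rw [comp_L_apply, zero_L, zero_L, map_zero]

lemma zero_comp (m : Mult V X Y) : (zero Y Z).comp m = zero X Z :=
  ext_L fun _ _ => rfl

variable {I : Type*} {p q : I → Mult V X X}

lemma isProjection_sum (hp : ∀ i, (p i).IsProjection)
    (ho : ∀ i j, i ≠ j → (p i).comp (p j) = zero X X) (s : Finset I) :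
    (sum s p).IsProjection := by
  classical
  constructor
  · refine ext_L fun Z f => ?_
    rw [comp_L_apply, sum_L, sum_L]
    refine Finset.sum_congr rfl fun i hi => ?_
    rw [map_sum, Finset.sum_eq_single_of_mem i hi, ← comp_L_apply, (hp i).1]
    intro j _ hj
    rw [← comp_L_apply, ho i j hj.symm, zero_L]
  · refine ext_L fun Z f => ?_
    rw [adj_L, sum_R, sum_L, map_sum]
    refine Finset.sum_congr rfl fun i _ => ?_
    rw [← adj_L, (hp i).2]

/-- As `q_i p_j = 0` for `i ≠ j`, a partial sum of the `q_i f` is the projection `∑ q_i` applied to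
the same partial sum of the `p_i f`. Projections are contractive, so the Cauchy criterion passes
from `p` to `q`. -/
lemma summable_of_le (hp' : ∀ i, (p i).IsProjection) (hp : ∀ i j, i ≠ j → (p i).comp (p j) = zero X X)
    (hq : ∀ i, (q i).IsProjection) (hqp : ∀ i, (q i).comp (p i) = q i) {f : V.Hom Z X}
    (hf : Summable fun i => (p i).L Z f) : Summable fun i => (q i).L Z f := by
  classical
  have hqp' : ∀ i j, i ≠ j → (q i).comp (p j) = zero X X := fun i j h => by
    rw [← hqp i, comp_assoc, hp i j h, comp_zero]
  have hq' : ∀ i j, i ≠ j → (q i).comp (q j) = zero X X := fun i j h => by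
    have h1 : (p j).comp (q j) = q j := by
      rw [← (hp' j).2, ← (hq j).2, ← adj_comp, hqp]
    rw [← h1, ← comp_assoc, hqp' i j h, zero_comp]
  rw [summable_iff_vanishing_norm] at hf ⊢
  intro ε hε
  obtain ⟨s, hs⟩ := hf ε hε
  refine ⟨s, fun t ht => lt_of_le_of_lt ?_ (hs t ht)⟩
  have e : ∑ i ∈ t, (q i).L Z f = (sum t q).L Z (∑ i ∈ t, (p i).L Z f) := by
    rw [sum_L]
    refine Finset.sum_congr rfl fun i hi => ?_
    rw [map_sum, Finset.sum_eq_single_of_mem i hi, ← comp_L_apply, hqp i]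
    intro j _ hj
    rw [← comp_L_apply, hqp' i j hj.symm, zero_L]
  rw [e]
  exact (isProjection_sum hq hq' t).norm_L_le _

end Mult

/-- A strictly convergent increasing net of projections in a subobject complete category. -/
lemma CStarCat.SubobjectComplete.exists_isometry {V : CStarCat.{u, v}} (hV : V.SubobjectComplete)
    {I : Type*} {l : Filter I} [l.NeBot] {Y : V.Obj} {p : I → Mult V Y Y}
    (hp : ∀ i, (p i).IsProjection) (hinc : ∀ i, ∀ᶠ k in l, (p i).comp (p k) = p i)
    (h : ∀ Z (f : V.Hom Z Y), ∃ g, Tendsto (fun i => (p i).L Z f) l (𝓝 g)) :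
    ∃ (U : V.Obj) (u : Mult V U Y), u.IsIsometry ∧
      (∀ Z (f : V.Hom Z Y),
        Tendsto (fun i => (p i).L Z f) l (𝓝 ((u.comp u.adj).L Z f))) ∧
      ∀ i, (u.comp u.adj).comp (p i) = p i := by
  have hR : ∀ i Z (f : V.Hom Y Z), (p i).R Z f = V.adj ((p i).L Z (V.adj f)) := fun i Z f => by
    rw [Mult.adj_of_L, (hp i).2, V.adj_adj]
  obtain ⟨P, hPL, hPR⟩ := Mult.exists_of_tendsto (l := l) p zero_le_one
    (Eventually.of_forall fun i Z f => by rw [one_mul]; exact (hp i).norm_L_le f) h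
    (fun Z f => by
      obtain ⟨g, hg⟩ := h Z (V.adj f)
      exact ⟨V.adj g, by simpa only [hR] using tendsto_adj hg⟩)
  have hPadj : P.adj = P := Mult.ext_L fun Z f => by
    refine tendsto_nhds_unique ?_ (hPL Z f)
    rw [Mult.adj_L]
    refine (tendsto_adj (hPR Z (V.adj f))).congr fun i => ?_
    rw [← Mult.adj_L, (hp i).2]
  -- Each `p i` absorbs all late `p k`, hence also their strict limit `P`. Then `P P = lim p_i P =
  -- lim p_i = P`.
  have h1 : ∀ i, (p i).comp P = p i := fun i => Mult.ext_L fun Z f => by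
    refine tendsto_nhds_unique (((p i).continuous_L Z).tendsto _ |>.comp (hPL Z f)) ?_
    refine tendsto_const_nhds.congr' ?_
    filter_upwards [hinc i] with k hk
    rw [Function.comp_apply, ← Mult.comp_L_apply, hk]
  have hPP : P.comp P = P := Mult.ext_L fun Z f => by
    refine tendsto_nhds_unique (hPL Z (P.L Z f)) ((hPL Z f).congr fun i => ?_)
    rw [← Mult.comp_L_apply, h1]
  obtain ⟨U, u, hu, huP⟩ := hV Y P ⟨hPP, hPadj⟩
  refine ⟨U, u, hu, by rwa [huP], fun i => ?_⟩
  rw [huP, ← hPadj, ← (hp i).2, ← Mult.adj_comp, h1]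

/-- Orthogonal isometries into an object `Y` whose range projections are strictly summable. -/
structure IsOrthFamily {V : CStarCat.{u, v}} {I : Type*} {X : I → V.Obj} {Y : V.Obj}
    (j : ∀ i, Mult V (X i) Y) : Prop where
  isometry : ∀ i, (j i).IsIsometry
  orthogonal : ∀ i k, i ≠ k → (j i).adj.comp (j k) = Mult.zero (X k) (X i)
  summable : ∀ Z (f : V.Hom Z Y), Summable fun i => ((j i).comp (j i).adj).L Z f

namespace IsOrthFamily

variable {V : CStarCat.{u, v}} {I : Type*} {X : I → V.Obj} {Y : V.Obj}
  {j : ∀ i, Mult V (X i) Y}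

lemma orthogonal_proj (hj : IsOrthFamily j) (i k : I) (h : i ≠ k) :
    ((j i).comp (j i).adj).comp ((j k).comp (j k).adj) = Mult.zero Y Y := by
  rw [Mult.comp_assoc, ← Mult.comp_assoc (j i).adj, hj.orthogonal i k h, Mult.zero_comp,
    Mult.comp_zero]

/-- Precomposition with isometries. -/
lemma comp (hj : IsOrthFamily j) {X' : I → V.Obj} {s : ∀ i, Mult V (X' i) (X i)}
    (hs : ∀ i, (s i).IsIsometry) : IsOrthFamily fun i => (j i).comp (s i) where
  isometry i := (hj.isometry i).comp (hs i)
  orthogonal i k h := by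
    rw [Mult.adj_comp, Mult.comp_assoc, ← Mult.comp_assoc (j i).adj, hj.orthogonal i k h,
      Mult.zero_comp, Mult.comp_zero]
  summable Z f := by
    refine Mult.summable_of_le (fun i => (hj.isometry i).isProjection) hj.orthogonal_proj
      (fun i => ((hj.isometry i).comp (hs i)).isProjection) (fun i => ?_) (hj.summable Z f)
    simp only [Mult.adj_comp, Mult.comp_assoc]
    rw [← Mult.comp_assoc (j i).adj (j i), hj.isometry i, Mult.id_comp]

/-- Finite sums of the range projections form an increasing strictly convergent net on `Y`. The
subobject `u` splitting its limit contains every `j i`, and the `u^* j_i` exhibit it as the direct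
sum. -/
lemma exists_isDirectSum {I : Type} {X : I → V.Obj} {j : ∀ i, Mult V (X i) Y}
    (hj : IsOrthFamily j) (hV : V.SubobjectComplete) :
    ∃ (D : V.Obj) (ι : ∀ i, Mult V (X i) D), V.IsDirectSum X D ι := by
  classical
  let p : I → Mult V Y Y := fun i => (j i).comp (j i).adj
  have hp : ∀ i, (p i).IsProjection := fun i => (hj.isometry i).isProjection
  have hP := Mult.isProjection_sum hp hj.orthogonal_proj
  have hps : ∀ (s : Finset I) i, i ∈ s → (p i).comp (Mult.sum s p) = p i := fun s i hi =>
    Mult.ext_L fun Z f => by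
      rw [Mult.comp_L_apply, Mult.sum_L, map_sum, Finset.sum_eq_single_of_mem i hi,
        ← Mult.comp_L_apply, (hp i).1]
      intro k _ hk
      rw [← Mult.comp_L_apply, hj.orthogonal_proj i k hk.symm, Mult.zero_L]
  obtain ⟨U, u, hu, hup, hu'⟩ := hV.exists_isometry (l := atTop)
    (p := fun s : Finset I => Mult.sum s p) hP (fun s => by
      filter_upwards [eventually_ge_atTop s] with t hst
      refine Mult.ext_L fun Z f => ?_
      rw [Mult.comp_L_apply, Mult.sum_L, Mult.sum_L s]
      refine Finset.sum_congr rfl fun i hi => ?_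
      rw [← Mult.comp_L_apply, hps t i (hst hi)]) (fun Z f => by
      obtain ⟨g, hg⟩ := hj.summable Z f
      rw [HasSum, SummationFilter.unconditional_filter] at hg
      exact ⟨g, by simpa only [Mult.sum_L] using hg⟩)
  have huj : ∀ i, (u.comp u.adj).comp (j i) = j i := fun i => by
    have h1 : (Mult.sum {i} p).comp (j i) = j i := Mult.ext_L fun Z f => by
      rw [Mult.comp_L_apply, Mult.sum_L, Finset.sum_singleton, ← Mult.comp_L_apply]
      simp only [p]
      rw [Mult.comp_assoc, hj.isometry i, Mult.comp_id]
    rw [← h1, ← Mult.comp_assoc, hu']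
  have hL : ∀ (Z : V.Obj) (f : V.Hom Z U), HasSum (fun i =>
      ((u.adj.comp (j i)).comp (u.adj.comp (j i)).adj).L Z f) f := by
    intro Z f
    have h1 := (u.adj.continuous_L Z).tendsto _ |>.comp (hup Z (u.L Z f))
    rw [← Mult.comp_L_apply, ← Mult.comp_L_apply, Mult.comp_assoc, Mult.comp_assoc, hu,
      Mult.comp_id, hu, Mult.id_L] at h1
    rw [HasSum, SummationFilter.unconditional_filter]
    refine h1.congr fun s => ?_
    rw [Function.comp_apply, Mult.sum_L, map_sum]
    refine Finset.sum_congr rfl fun i _ => ?_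
    rw [Mult.adj_comp, Mult.adj_adj]
    rfl
  refine ⟨U, fun i => u.adj.comp (j i), fun i => ?_, fun i k h => ?_, hL, fun Z f => ?_⟩
  · rw [Mult.IsIsometry, Mult.adj_comp, Mult.adj_adj, Mult.comp_assoc, ← Mult.comp_assoc u, huj,
      hj.isometry]
  · rw [Mult.adj_comp, Mult.adj_adj, Mult.comp_assoc, ← Mult.comp_assoc u, huj, hj.orthogonal i k h]
  · have h1 := (continuous_adj.tendsto _).comp (hL Z (V.adj f))
    rw [V.adj_adj] at h1
    rw [HasSum]
    refine h1.congr fun s => ?_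
    rw [Function.comp_apply, map_sum]
    refine Finset.sum_congr rfl fun i _ => ?_
    rw [Mult.adj_of_L, V.adj_adj, Mult.adj_comp, Mult.adj_adj]

end IsOrthFamily

end

noncomputable section

open CStarCat

/-! ### Direct limits of sequences -/

namespace Mult

variable {V : CStarCat.{u, v}} {X Y Z : V.Obj}

lemma ofHom_comp (g : V.Hom Y Z) (f : V.Hom X Y) :
    (ofHom g).comp (ofHom f) = ofHom (V.comp g f) :=
  ext_L fun _ h => (V.assoc g f h).symm

lemma ofHom_adj (f : V.Hom X Y) : (ofHom f).adj = ofHom (V.adj f) :=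
  ext_L fun W h => by rw [adj_L, ofHom_R, V.adj_comp, V.adj_adj, ofHom_L]

lemma ofHom_isIsometry {e : V.Hom X X} (he : IsId e) {f : V.Hom X Y}
    (h : V.comp (V.adj f) f = e) : (ofHom f).IsIsometry := by
  rw [IsIsometry, ofHom_adj, ofHom_comp, h]
  exact ext_L fun W g => he.2 _ g

lemma comp_ofHom (m : Mult V Y Z) (f : V.Hom X Y) : m.comp (ofHom f) = ofHom (m.L X f) :=
  ext_L fun _ h => m.L_comp f h

end Mult

section SeqLimit

variable {W : CStarCat.{u, v}} {X : ℕ → W.Obj} (e : ∀ n, W.Hom (X n) (X n))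
  (w : ∀ n, W.Hom (X n) (X (n + 1))) {Y : W.Obj} (a : ∀ n, W.Hom (X n) Y)

/-- The projection of `X n` onto the complement of the previous stage. -/
def seqProj : ∀ n, W.Hom (X n) (X n)
  | 0 => e 0
  | n + 1 => e (n + 1) - W.comp (w n) (W.adj (w n))

/-- The component at stage `n` of the isometry `seqMap` from the limit. -/
def seqIncr (n : ℕ) : W.Hom (X n) Y := W.comp (a n) (seqProj e w n)

/-- Compatible isometries into the sum of a sequence with isometric transition maps. -/
def seqMap : ∀ n, W.Hom (X n) Y
  | 0 => seqIncr e w a 0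
  -- `X (n + 1)` is the range of `w n` plus its complement. The first part goes where stage `n`
  -- went, the complement goes into the unused `(n + 1)`-st copy inside `Y`.
  | n + 1 => W.comp (seqMap n) (W.adj (w n)) + seqIncr e w a (n + 1)

variable {e w a} (he : ∀ n, IsId (e n)) (hw : ∀ n, W.comp (W.adj (w n)) (w n) = e n)
  (haa : ∀ n, W.comp (W.adj (a n)) (a n) = e n)
  (hao : ∀ n m, n ≠ m → W.comp (W.adj (a n)) (a m) = 0)

include he in
lemma adj_seqProj (n : ℕ) : W.adj (seqProj e w n) = seqProj e w n := by
  cases n with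
  | zero => exact (he 0).adj_eq
  | succ n => rw [seqProj, adj_sub, (he _).adj_eq, W.adj_comp, W.adj_adj]

include he hw in
lemma seqProj_comp_self (n : ℕ) : W.comp (seqProj e w n) (seqProj e w n) = seqProj e w n := by
  cases n with
  | zero => exact (he 0).1 _ _
  | succ n =>
    rw [seqProj, sub_comp, (he _).2, comp_sub, (he _).1, W.assoc, ← W.assoc (W.adj (w n)), hw,
      (he n).2, sub_self, sub_zero]

include he hw in
lemma seqIncr_comp (n : ℕ) : W.comp (seqIncr e w a (n + 1)) (w n) = 0 := by
  rw [seqIncr, W.assoc, seqProj, sub_comp, W.assoc, hw, (he _).1, (he _).2, sub_self, comp_zero]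

include he hw in
lemma seqMap_comp (n : ℕ) : W.comp (seqMap e w a (n + 1)) (w n) = seqMap e w a n := by
  rw [seqMap, add_comp, seqIncr_comp he hw, add_zero, W.assoc, hw, (he n).1]

include he hw haa in
lemma adj_comp_seqIncr_self (n : ℕ) :
    W.comp (W.adj (seqIncr e w a n)) (seqIncr e w a n) = seqProj e w n := by
  rw [seqIncr, W.adj_comp, W.assoc, ← W.assoc (W.adj (a n)), haa, (he n).2, adj_seqProj he,
    seqProj_comp_self he hw]

include hao in
-- Stage `n` only uses the copies numbered `0, …, n`.
lemma adj_comp_seqMap {n m : ℕ} (h : n < m) : W.comp (W.adj (a m)) (seqMap e w a n) = 0 := by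
  induction n with
  | zero => rw [seqMap, seqIncr, ← W.assoc, hao _ _ h.ne', zero_comp]
  | succ n ih =>
    rw [seqMap, comp_add, ← W.assoc, ih (by omega), zero_comp, zero_add, seqIncr, ← W.assoc,
      hao _ _ h.ne', zero_comp]

include hao in
lemma adj_seqMap_comp_seqIncr (n : ℕ) :
    W.comp (W.adj (seqMap e w a n)) (seqIncr e w a (n + 1)) = 0 := by
  have h := congrArg W.adj (adj_comp_seqMap (e := e) (w := w) hao (Nat.lt_succ_self n))
  rw [W.adj_comp, W.adj_adj, map_zero] at h
  rw [seqIncr, ← W.assoc, h, zero_comp]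

include he hw haa hao in
lemma adj_seqMap_comp_self (n : ℕ) :
    W.comp (W.adj (seqMap e w a n)) (seqMap e w a n) = e n := by
  induction n with
  | zero => rw [seqMap, adj_comp_seqIncr_self he hw haa, seqProj]
  | succ n ih =>
    have h1 := adj_seqMap_comp_seqIncr (e := e) (w := w) hao n
    have h2 := congrArg W.adj h1
    rw [W.adj_comp, W.adj_adj, map_zero] at h2
    rw [seqMap, adj_add, W.adj_comp, W.adj_adj, add_comp, comp_add, comp_add,
      adj_comp_seqIncr_self he hw haa, W.assoc (w n) _ (seqIncr e w a (n + 1)), h1, comp_zero,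
      add_zero, ← W.assoc (W.adj (seqIncr e w a (n + 1))) _ (W.adj (w n)), h2, zero_comp, zero_add,
      W.assoc, ← W.assoc _ (seqMap e w a n) (W.adj (w n)), ih, (he n).2, seqProj, add_sub_cancel]

include he hw in
-- The range projection of stage `n` is an orthogonal sum of range projections of increments, so its
-- strict convergence becomes a question of summability.
lemma seqMap_comp_adj (n : ℕ) :
    W.comp (seqMap e w a n) (W.adj (seqMap e w a n)) = ∑ k ∈ Finset.range (n + 1),
      W.comp (seqIncr e w a k) (W.adj (seqIncr e w a k)) := by
  induction n with
  | zero => simp [seqMap]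
  | succ n ih =>
    have h1 := seqIncr_comp (a := a) he hw n
    have h2 := congrArg W.adj h1
    rw [W.adj_comp, map_zero] at h2
    rw [Finset.sum_range_succ, ← ih, seqMap, adj_add, W.adj_comp, W.adj_adj, add_comp, comp_add,
      comp_add, W.assoc, ← W.assoc (W.adj (w n)) (w n), hw, (he n).2, W.assoc, h2, comp_zero,
      add_zero, ← W.assoc _ (w n), h1, zero_comp, zero_add]

include he hw haa hao in
lemma seqMap_comp_adj_comp {n m : ℕ} (h : n ≤ m) :
    W.comp (W.comp (seqMap e w a m) (W.adj (seqMap e w a m))) (seqMap e w a n) =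
      seqMap e w a n := by
  obtain ⟨z, hz⟩ : ∃ z, W.comp (seqMap e w a m) z = seqMap e w a n := by
    induction m, h using Nat.le_induction with
    | base => exact ⟨e n, (he n).1 _ _⟩
    | succ m _ ih =>
      obtain ⟨z, hz⟩ := ih
      exact ⟨W.comp (w m) z, by rw [← W.assoc, seqMap_comp he hw, hz]⟩
  rw [← hz, ← W.assoc, W.assoc (seqMap e w a m), adj_seqMap_comp_self he hw haa hao, (he m).1]

end SeqLimit

lemma CStarCat.IsId.ofHom_eq {W : CStarCat.{u, v}} {X : W.Obj} {e : W.Hom X X} (he : IsId e) :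
    Mult.ofHom e = Mult.id X := Mult.ext_L fun _ f => he.2 _ f

/-- Existence of direct limits of sequences, realized inside an orthogonal sum. -/
lemma CStarCat.SubobjectComplete.exists_seqLimit {W : CStarCat.{u, v}} (hW : W.SubobjectComplete)
    {X : ℕ → W.Obj} {e : ∀ n, W.Hom (X n) (X n)} (he : ∀ n, IsId (e n))
    {w : ∀ n, W.Hom (X n) (X (n + 1))} (hw : ∀ n, W.comp (W.adj (w n)) (w n) = e n)
    {Y : W.Obj} {j : ∀ n, Mult W (X n) Y} (hj : IsOrthFamily j) :
    ∃ (U : W.Obj) (c : ∀ n, W.Hom (X n) U), (∀ n, W.comp (W.adj (c n)) (c n) = e n) ∧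
      (∀ n, W.comp (c (n + 1)) (w n) = c n) ∧
      ∀ Z (f : W.Hom Z U),
        Tendsto (fun n => W.comp (W.comp (c n) (W.adj (c n))) f) atTop (𝓝 f) := by
  let a : ∀ n, W.Hom (X n) Y := fun n => (j n).L _ (e n)
  have haa : ∀ n, W.comp (W.adj (a n)) (a n) = e n := fun n => by
    rw [Mult.adj_L_comp, (hj.isometry n).comp_L_adj, (he n).adj_eq, (he n).1]
  have hao : ∀ n m, n ≠ m → W.comp (W.adj (a n)) (a m) = 0 := fun n m h => by
    rw [Mult.adj_of_L, ← Mult.comp_L, ← Mult.comp_L_apply, hj.orthogonal n m h, Mult.zero_L,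
      comp_zero]
  let b := seqMap e w a
  have hbb : ∀ n, W.comp (W.adj (b n)) (b n) = e n := adj_seqMap_comp_self he hw haa hao
  have hle : ∀ {n m}, n ≤ m → W.comp (W.comp (b m) (W.adj (b m))) (b n) = b n :=
    fun h => seqMap_comp_adj_comp he hw haa hao h
  have hja : ∀ n, Mult.ofHom (a n) = j n := fun n => by
    rw [← Mult.comp_ofHom, (he n).ofHom_eq, Mult.comp_id]
  -- The `n`-th increment has range inside that of `j n`, so `Mult.summable_of_le` yields
  -- summability of the `q n`.
  let q : ∀ n, Mult W Y Y := fun n =>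
    Mult.ofHom (W.comp (seqIncr e w a n) (W.adj (seqIncr e w a n)))
  have hdd : ∀ n, W.comp (seqIncr e w a n)
      (W.comp (W.adj (seqIncr e w a n)) (seqIncr e w a n)) = seqIncr e w a n := fun n => by
    rw [adj_comp_seqIncr_self he hw haa, seqIncr, W.assoc, seqProj_comp_self he hw]
  have hq : ∀ n, (q n).IsProjection := fun n => by
    constructor
    · rw [Mult.ofHom_comp, W.assoc, ← W.assoc _ _ (W.adj _), ← W.assoc, hdd]
    · rw [Mult.ofHom_adj, W.adj_comp, W.adj_adj]
  have hqp : ∀ n, (q n).comp ((j n).comp (j n).adj) = q n := fun n => by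
    rw [← hja, Mult.ofHom_adj, Mult.ofHom_comp, Mult.ofHom_comp]
    congr 1
    simp only [seqIncr, W.adj_comp, W.assoc]
    rw [← W.assoc (W.adj (a n)) (a n), haa, (he n).2]
  have hsum : ∀ Z (f : W.Hom Z Y), Summable fun n => (q n).L Z f := fun Z f =>
    Mult.summable_of_le (fun n => (hj.isometry n).isProjection) hj.orthogonal_proj hq hqp
      (hj.summable Z f)
  obtain ⟨U, u, hu, hup, hu'⟩ := hW.exists_isometry (l := (atTop : Filter ℕ))
    (p := fun n => Mult.ofHom (W.comp (b n) (W.adj (b n)))) (fun n => by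
      constructor
      · rw [Mult.ofHom_comp, ← W.assoc _ (b n), hle le_rfl]
      · rw [Mult.ofHom_adj, W.adj_comp, W.adj_adj]) (fun n => by
      filter_upwards [eventually_ge_atTop n] with m hm
      rw [Mult.ofHom_comp]
      congr 1
      have h := congrArg W.adj (hle hm)
      simp only [W.adj_comp, W.adj_adj] at h
      rw [W.assoc, h]) (fun Z f => by
      obtain ⟨g, hg⟩ := hsum Z f
      refine ⟨g, ?_⟩
      -- Stage `n` collects the increments `0, …, n`, a sum over `range (n + 1)`; hence the shift.
      have := hg.tendsto_sum_nat.comp (tendsto_add_atTop_nat 1)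
      refine this.congr fun n => ?_
      simp only [Function.comp_apply, b]
      rw [Mult.ofHom_L, seqMap_comp_adj he hw, map_sum, LinearMap.sum_apply]
      rfl)
  have hub : ∀ n, u.L _ (u.adj.L _ (b n)) = b n := fun n => by
    have := congrArg (fun m => m.L _ (b n)) (hu' n)
    simp only [Mult.comp_L_apply, Mult.ofHom_L, hle le_rfl] at this
    exact this
  have hwb : ∀ n, W.comp (b (n + 1)) (w n) = b n := seqMap_comp he hw
  refine ⟨U, fun n => u.adj.L _ (b n), fun n => ?_, fun n => ?_, fun Z f => ?_⟩
  · rw [Mult.adj_L_comp, Mult.adj_adj, hub, hbb]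
  · rw [← Mult.L_comp, hwb]
  · have h1 := (u.adj.continuous_L Z).tendsto _ |>.comp (hup Z (u.L Z f))
    rw [Mult.comp_L_apply, hu.comp_L_adj, hu.comp_L_adj] at h1
    refine h1.congr fun n => ?_
    simp only [Function.comp_apply]
    rw [Mult.ofHom_L, W.assoc (b n), Mult.L_comp, Mult.comp_L, Mult.adj_of_L, Mult.adj_adj,
      W.assoc]

end

/-! ### Composing and extending full functors; limits of countable inductive systems. -/

noncomputable section

open CStarCat

namespace FullFunctor

/-- Composition of full functors. -/
def comp {U : CStarCat.{u, v}} {V : CStarCat.{u₁, v₁}} {W : CStarCat.{u₂, v₂}}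
    (G : FullFunctor V W) (F : FullFunctor U V) : FullFunctor U W where
  obj X := G.obj (F.obj X)
  map := G.map ∘ₗ F.map
  map_comp g f := by simp only [LinearMap.comp_apply, F.map_comp, G.map_comp]
  map_adj f := by simp only [LinearMap.comp_apply, F.map_adj, G.map_adj]
  norm_map f := by rw [LinearMap.comp_apply, G.norm_map, F.norm_map]
  surj g := ⟨F.inv (G.inv g), by rw [LinearMap.comp_apply, F.map_inv, G.map_inv]⟩

lemma comp_mapMult {U : CStarCat.{u, v}} {V : CStarCat.{u₁, v₁}} {W : CStarCat.{u₂, v₂}}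
    (G : FullFunctor V W) (F : FullFunctor U V) {X Y : U.Obj} (m : Mult U X Y) :
    (G.comp F).mapMult m = G.mapMult (F.mapMult m) :=
  (G.comp F).mult_ext fun f => by
    rw [mapMult_L]
    change G.map (F.map _) = (G.mapMult (F.mapMult m)).L _ (G.map (F.map f))
    rw [mapMult_L, mapMult_L]

variable {V : CStarCat.{u₁, v₁}} {W : CStarCat.{u₂, v₂}}

/-- Naturality of the comparison unitary is extended from morphisms to multipliers, since the
connecting maps of inductive systems are multipliers. -/
lemma splitInclι_comp_mapMult (F : FullFunctor V W) (hW : W.SubobjectComplete) {X Y : V.Obj}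
    (m : Mult V X Y) :
    (F.splitInclι hW Y).comp ((F.splitExt hW).mapMult ((Split.incl V).mapMult m)) =
      (F.mapMult m).comp (F.splitInclι hW X) :=
  (F.splitExt hW).mult_ext fun f => by
    obtain ⟨f, rfl⟩ := (Split.incl V).surj f
    rw [Mult.comp_L_apply, mapMult_L, mapMult_L, splitInclι_L_map, ← mapMult_L,
      Mult.comp_L_apply, splitInclι_L_map, Mult.L_R]

lemma map_isId (F : FullFunctor V W) {X : V.Obj} {e : V.Hom X X} (he : IsId e) :
    IsId (F.map e) :=
  isId_of_end fun f => by
    rw [← F.map_inv f, ← F.map_comp, ← F.map_comp, he.1, he.2]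
    exact ⟨rfl, rfl⟩

section OfCompletion

variable {A : StarCat.{u, v}} {p : ∀ X Y : A.Obj, Seminorm ℂ (A.Hom X Y)} {obj : A.Obj → W.Obj}
  {φ : ∀ X Y : A.Obj, A.Hom X Y →ₗ[ℂ] W.Hom (obj X) (obj Y)}
  (hn : ∀ {X Y : A.Obj} (f : A.Hom X Y), ‖φ X Y f‖ = p X Y f)

/-- The isometric extension of a linear map to the completion. -/
def extC (X Y : A.Obj) : A.CHom p X Y →L[ℂ] W.Hom (obj X) (obj Y) :=
  ContinuousLinearMap.fromCompletion (α := A.SHom p X Y)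
    (LinearMap.mkContinuous (E := A.SHom p X Y) (φ X Y) 1
      (fun f => by rw [one_mul]; exact (hn f).le))

lemma extC_toC {X Y : A.Obj} (f : A.Hom X Y) : extC hn X Y (StarCat.toC p f) = φ X Y f :=
  ContinuousLinearMap.fromCompletion_apply_coe (α := A.SHom p X Y) _ f

lemma norm_extC {X Y : A.Obj} (f : A.CHom p X Y) : ‖extC hn X Y f‖ = ‖f‖ :=
  StarCat.CHom.induction (P := fun f => ‖extC hn X Y f‖ = ‖f‖)
    (isClosed_eq (by fun_prop) (by fun_prop))
    (fun f => by rw [extC_toC, hn, StarCat.norm_toC]) f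

lemma extC_comp (hp : A.IsCStarSeminorm p) (hc : ∀ {X Y Z : A.Obj} (g : A.Hom Y Z) (f : A.Hom X Y),
      φ X Z (A.comp g f) = W.comp (φ Y Z g) (φ X Y f))
    {X Y Z : A.Obj} (g : A.CHom p Y Z) (f : A.CHom p X Y) :
    extC hn X Z (hp.comp g f) = W.comp (extC hn Y Z g) (extC hn X Y f) := by
  refine StarCat.CHom.induction₂
    (P := fun g f => extC hn X Z (hp.comp g f) = W.comp (extC hn Y Z g) (extC hn X Y f))
    (isClosed_eq ((extC hn X Z).continuous.comp (by fun_prop)) (continuous_comp.comp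
      (((extC hn Y Z).continuous.comp continuous_fst).prodMk
        ((extC hn X Y).continuous.comp continuous_snd)))) (fun g f => ?_) g f
  rw [hp.comp_toC, extC_toC, extC_toC, extC_toC, hc]

lemma extC_adj (hp : A.IsCStarSeminorm p) (ha : ∀ {X Y : A.Obj} (f : A.Hom X Y),
      φ Y X (A.adj f) = W.adj (φ X Y f)) {X Y : A.Obj} (f : A.CHom p X Y) :
    extC hn Y X (hp.adj f) = W.adj (extC hn X Y f) := by
  refine StarCat.CHom.induction (P := fun f => extC hn Y X (hp.adj f) = W.adj (extC hn X Y f))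
    (isClosed_eq ((extC hn Y X).continuous.comp (by fun_prop))
      (continuous_adj.comp (extC hn X Y).continuous)) (fun f => ?_) f
  rw [hp.adj_toC, extC_toC, extC_toC, ha]

/-- The range of an isometry from a complete space is closed, and here it is dense. -/
lemma extC_surj (hd : ∀ {X Y : A.Obj}, DenseRange (φ X Y)) {X Y : A.Obj}
    (g : W.Hom (obj X) (obj Y)) : ∃ f, extC hn X Y f = g := by
  have hiso : Isometry (extC hn X Y) := AddMonoidHomClass.isometry_of_norm _ (norm_extC hn)
  have hr := hiso.isClosedEmbedding.isClosed_range
  have hd' : DenseRange (extC hn X Y) := by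
    refine Dense.mono ?_ (hd (X := X) (Y := Y))
    rintro _ ⟨f, rfl⟩
    exact ⟨StarCat.toC p f, extC_toC hn f⟩
  have : g ∈ Set.range (extC hn X Y) := by
    rw [← hr.closure_eq, hd'.closure_range]; trivial
  exact this

/-- A functor defined on a dense subcategory by isometric linear maps. -/
def ofCompletion (hp : A.IsCStarSeminorm p) (hpos : A.IsPositive hp)
    (hc : ∀ {X Y Z : A.Obj} (g : A.Hom Y Z) (f : A.Hom X Y),
      φ X Z (A.comp g f) = W.comp (φ Y Z g) (φ X Y f))
    (ha : ∀ {X Y : A.Obj} (f : A.Hom X Y), φ Y X (A.adj f) = W.adj (φ X Y f))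
    (hd : ∀ {X Y : A.Obj}, DenseRange (φ X Y)) :
    FullFunctor (A.completion hp hpos) W where
  obj := obj
  map {X Y} :=
    { toFun := fun f => extC hn X Y f
      map_add' := fun f g => map_add (extC hn X Y) f g
      map_smul' := fun c f => map_smul (extC hn X Y) c f }
  map_comp g f := extC_comp hn hp hc g f
  map_adj f := extC_adj hn hp ha f
  norm_map f := norm_extC hn f
  surj g := extC_surj hn hd g

end OfCompletion

end FullFunctor

/-- The image of an inductive system under a full functor. -/
def IndSystem.map {E : CStarCat.{u₁, v₁}} {W : CStarCat.{u₂, v₂}} (K : FullFunctor E W)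
    (S : IndSystem E) : IndSystem W where
  I := S.I
  X i := K.obj (S.X i)
  ι h := K.mapMult (S.ι h)
  isometry h := K.mapMult_isIsometry (S.isometry h)
  ι_refl i := by rw [S.ι_refl, K.mapMult_id]
  ι_comp h h' := by rw [← K.mapMult_comp, S.ι_comp]

/-- A direct limit in `W` of the image under `K` of an inductive system in `E`. -/
structure IsLimitCone {E : CStarCat.{u₁, v₁}} {W : CStarCat.{u₂, v₂}} (K : FullFunctor E W)
    (S : IndSystem E) (L : W.Obj) (c : ∀ i, Mult W (K.obj (S.X i)) L) : Prop where
  isometry : ∀ i, (c i).IsIsometry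
  compat : ∀ {i j : S.I} (h : i ≤ j), (c j).comp (K.mapMult (S.ι h)) = c i
  tendsto : ∀ (Z : W.Obj) (f : W.Hom Z L),
    Tendsto (fun i => ((c i).comp (c i).adj).L Z f) atTop (𝓝 f)

/-- Sequences of objects of `E` can be embedded into an orthogonal sum in `W`. -/
def HasSeqSums {E : CStarCat.{u₁, v₁}} {W : CStarCat.{u₂, v₂}} (K : FullFunctor E W) : Prop :=
  ∀ X : ℕ → E.Obj, ∃ (Y : W.Obj) (j : ∀ n, Mult W (K.obj (X n)) Y), IsOrthFamily j

section Limits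

variable {E : CStarCat.{u₁, v₁}} {W : CStarCat.{u₂, v₂}} {K : FullFunctor E W} {S T : IndSystem E}
  {L L' : W.Obj}

/-- A countable directed set has a monotone cofinal sequence, and the limit of that sequence is
carved out of an orthogonal sum of its terms. The cone is then extended to the remaining indices. -/
theorem exists_isLimitCone (hE : E.Unital) (hW : W.SubobjectComplete) (hK : HasSeqSums K)
    (S : IndSystem E) : ∃ (L : W.Obj) (c : ∀ i, Mult W (K.obj (S.X i)) L), IsLimitCone K S L c := by
  choose e he using hE
  obtain ⟨x, hx, hxt⟩ := exists_seq_monotone_tendsto_atTop_atTop S.I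
  have hE' : ∀ n, IsId (K.map (e (S.X (x n)))) := fun n => K.map_isId (he _)
  have hxs : ∀ n, x n ≤ x (n + 1) := fun n => hx n.le_succ
  obtain ⟨Y, j, hj⟩ := hK fun n => S.X (x n)
  -- Since `E` is unital, a connecting multiplier is a genuine morphism, obtained by letting it act
  -- on the identity.
  obtain ⟨L, c, hc1, hc2, hc3⟩ := hW.exists_seqLimit hE'
    (w := fun n => K.map ((S.ι (hxs n)).L _ (e _))) (fun n => by
      have h1 : IsId (e (S.X (x n))) := he _
      rw [← K.map_adj, ← K.map_comp, Mult.adj_L_comp, (S.isometry _).comp_L_adj, h1.adj_eq,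
        h1.1]) hj
  have hw : ∀ n, (Mult.ofHom (c (n + 1))).comp (K.mapMult (S.ι (hxs n))) = Mult.ofHom (c n) :=
    fun n => by
      rw [← hc2 n, ← Mult.ofHom_comp, ← K.mapMult_ofHom, ← Mult.comp_ofHom,
        CStarCat.IsId.ofHom_eq (he _), Mult.comp_id]
  have hw' : ∀ {n m} (h : n ≤ m), (Mult.ofHom (c m)).comp (K.mapMult (S.ι (hx h))) =
      Mult.ofHom (c n) := by
    intro n m h
    induction m, h using Nat.le_induction with
    | base => rw [S.ι_refl, K.mapMult_id, Mult.comp_id]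
    | succ m h ih =>
      rw [← S.ι_comp (hx h) (hxs m), K.mapMult_comp, ← Mult.comp_assoc, hw, ih]
  have hN : ∀ i, ∃ n, i ≤ x n := fun i => (hxt.eventually_ge_atTop i).exists
  choose N hN using hN
  let C : ∀ i, Mult W (K.obj (S.X i)) L := fun i =>
    (Mult.ofHom (c (N i))).comp (K.mapMult (S.ι (hN i)))
  -- The cone map at `i` does not depend on the term of the sequence through which it is defined.
  have key : ∀ i n (h : i ≤ x n), (Mult.ofHom (c n)).comp (K.mapMult (S.ι h)) = C i := by
    have h1 : ∀ i n m (h : i ≤ x n) (h' : i ≤ x m), n ≤ m →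
        (Mult.ofHom (c n)).comp (K.mapMult (S.ι h)) =
          (Mult.ofHom (c m)).comp (K.mapMult (S.ι h')) := by
      intro i n m h h' hnm
      rw [← hw' hnm, Mult.comp_assoc, ← K.mapMult_comp, S.ι_comp]
    intro i n h
    rcases le_total n (N i) with h' | h'
    · exact h1 i n (N i) h (hN i) h'
    · exact (h1 i (N i) n (hN i) h h').symm
  have hCx : ∀ n, C (x n) = Mult.ofHom (c n) := fun n => by
    rw [← key (x n) n le_rfl, S.ι_refl, K.mapMult_id, Mult.comp_id]
  have hCi : ∀ i, (C i).IsIsometry := fun i =>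
    (Mult.ofHom_isIsometry (hE' _) (hc1 _)).comp (K.mapMult_isIsometry (S.isometry _))
  have hcompat : ∀ {i j : S.I} (h : i ≤ j), (C j).comp (K.mapMult (S.ι h)) = C i := fun {i j} h => by
    rw [← key i (N j) (h.trans (hN j)), Mult.comp_assoc, ← K.mapMult_comp, S.ι_comp]
  refine ⟨L, C, hCi, hcompat, fun Z f => ?_⟩
  rw [Metric.tendsto_nhds]
  intro ε hε
  obtain ⟨n, hn⟩ := (Metric.tendsto_nhds.1 (hc3 Z f) (ε / 2) (half_pos hε)).exists
  set P : S.I → Mult W L L := fun i => (C i).comp (C i).adj with hP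
  have hn' : ‖(P (x n)).L Z f - f‖ < ε / 2 := by
    rw [dist_eq_norm] at hn
    simp only [hP, hCx, Mult.ofHom_adj, Mult.ofHom_comp]
    exact hn
  filter_upwards [eventually_ge_atTop (x n)] with i hi
  have hPP : (P i).L Z ((P (x n)).L Z f) = (P (x n)).L Z f := by
    rw [← Mult.comp_L_apply]
    congr 2
    simp only [hP]
    rw [← hcompat hi, Mult.comp_assoc (C i) (K.mapMult _), Mult.comp_assoc (C i),
      ← Mult.comp_assoc (C i).adj (C i), hCi, Mult.id_comp]
  -- For `i ≥ x n` the projection `P i` fixes the range of `P (x n)`, so `P_i f - f = (1 - P_i)(P_{x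
  -- n} f - f)`. Its norm is at most twice a quantity below `ε / 2`.
  have h1 : (P i).L Z f - f = ((P (x n)).L Z f - f) - (P i).L Z ((P (x n)).L Z f - f) := by
    rw [map_sub, hPP]; abel
  rw [dist_eq_norm]
  change ‖(P i).L Z f - f‖ < ε
  rw [h1]
  have h2 := (hCi i).isProjection.norm_L_le ((P (x n)).L Z f - f)
  have h3 := norm_sub_le ((P (x n)).L Z f - f) ((P i).L Z ((P (x n)).L Z f - f))
  linarith

namespace IsLimitCone

variable {c : ∀ i, Mult W (K.obj (S.X i)) L} {c' : ∀ i, Mult W (K.obj (S.X i)) L'}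

/-- The transition multipliers `w` of a system are what the cone maps produce in the limit; this
matches composition of ind-morphisms with composition in `W`. -/
lemma adj_comp (hc : IsLimitCone K S L c) (i j : S.I) :
    (c j).adj.comp (c i) = K.mapMult (S.w i j) := by
  obtain ⟨m, hi, hj⟩ := exists_ge_ge i j
  rw [IndSystem.w_eq hi hj, ← hc.compat hi, ← hc.compat hj, Mult.adj_comp, Mult.comp_assoc,
    ← Mult.comp_assoc (c m).adj, hc.isometry, Mult.id_comp, ← K.mapMult_adj, ← K.mapMult_comp]

/-- On morphisms of the form `c_k c_k^* f` the net is constant from index `k` on, with value `c'_k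
c_k^* f`. Such morphisms approximate every `f`, and the net is contractive. -/
lemma exists_tendsto (hc : IsLimitCone K S L c) (hc' : IsLimitCone K S L' c') (Z : W.Obj)
    (f : W.Hom Z L) : ∃ g, Tendsto (fun i => ((c' i).comp (c i).adj).L Z f) atTop (𝓝 g) := by
  refine (isClosed_setOf_exists_tendsto (T := fun i => ((c' i).comp (c i).adj).L Z) (C := 1)
    (Eventually.of_forall fun i f => ?_)).closure_subset_iff.2 (Set.Subset.refl _) ?_
  · rw [one_mul, Mult.comp_L_apply, (hc'.isometry i).norm_L]
    exact (hc.isometry i).norm_adj_L_le f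
  · refine mem_closure_of_tendsto (hc.tendsto Z f) (Eventually.of_forall fun k => ?_)
    refine ⟨((c' k).comp (c k).adj).L Z f, tendsto_const_nhds.congr' ?_⟩
    filter_upwards [eventually_ge_atTop k] with i hi
    rw [← Mult.comp_L_apply]
    congr 2
    rw [← hc.compat hi, ← hc'.compat hi, Mult.comp_assoc (c i) (K.mapMult _),
      Mult.comp_assoc (c' i) (c i).adj, ← Mult.comp_assoc (c i).adj (c i), hc.isometry,
      Mult.id_comp, Mult.comp_assoc]

/-- Direct limits of the same system embed into each other. -/
theorem isSubobject (hc : IsLimitCone K S L c) (hc' : IsLimitCone K S L' c') :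
    W.IsSubobject L L' := by
  obtain ⟨M, hM, -⟩ := Mult.exists_of_tendsto (l := atTop) (fun i => (c' i).comp (c i).adj)
    zero_le_one (Eventually.of_forall fun i Z f => by
      rw [one_mul, Mult.comp_L_apply, (hc'.isometry i).norm_L]
      exact (hc.isometry i).norm_adj_L_le f) (fun Z f => hc.exists_tendsto hc' Z f) (fun Z f => by
      obtain ⟨g, hg⟩ := hc'.exists_tendsto hc Z (W.adj f)
      refine ⟨W.adj g, (tendsto_adj hg).congr fun i => ?_⟩
      rw [Mult.adj_of_L, W.adj_adj, Mult.adj_comp, Mult.adj_adj])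
  refine ⟨M, Mult.isIsometry_of_adj_comp fun Z g f => ?_⟩
  -- `(M g)^* (M f)` is the limit of `g^* c_i c'_i^* c'_i c_i^* f = g^* c_i c_i^* f`, which tends to
  -- `g^* f`.
  refine tendsto_nhds_unique (tendsto_comp (tendsto_adj (hM Z g)) (hM Z f)) ?_
  refine (tendsto_comp (tendsto_const_nhds (x := W.adj g)) (hc.tendsto Z f)).congr fun i => ?_
  rw [Mult.adj_L_comp, Mult.adj_comp, Mult.adj_adj, ← Mult.comp_L_apply, Mult.comp_assoc,
    ← Mult.comp_assoc (c' i).adj, hc'.isometry, Mult.id_comp]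

lemma tendsto_R (hc : IsLimitCone K S L c) (Z : W.Obj) (f : W.Hom L Z) :
    Tendsto (fun i => ((c i).comp (c i).adj).R Z f) atTop (𝓝 f) := by
  refine Mult.tendsto_R_of_L (m := fun i => (c i).comp (c i).adj) (n := Mult.id L) ?_
  rw [Mult.id_adj]
  refine (hc.tendsto Z (W.adj f)).congr fun i => ?_
  rw [Mult.adj_comp, Mult.adj_adj]

end IsLimitCone

end Limits

end

noncomputable section

open CStarCat

/-! ### The ind-category inside a category with direct limits -/

section ConeMap

variable {E : CStarCat.{u₁, v₁}} {W : CStarCat.{u₂, v₂}} {K : FullFunctor E W}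

/-- The linear map from morphisms of inductive systems to morphisms of their direct limits. -/
def coneMap {S T : IndSystem E} {L M : W.Obj} (c : ∀ i, Mult W (K.obj (S.X i)) L)
    (d : ∀ j, Mult W (K.obj (T.X j)) M) : IndSystem.PreHom S T →ₗ[ℂ] W.Hom L M :=
  IndSystem.lift S T fun i j => (d j).L _ ∘ₗ (c i).adj.R _ ∘ₗ K.map

variable {S T U : IndSystem E} {L M N : W.Obj} {c : ∀ i, Mult W (K.obj (S.X i)) L}
  {d : ∀ j, Mult W (K.obj (T.X j)) M} {b : ∀ k, Mult W (K.obj (U.X k)) N}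

lemma coneMap_of {i : S.I} {j : T.I} (f : E.Hom (S.X i) (T.X j)) :
    coneMap c d (IndSystem.of S T i j f) = (d j).L _ ((c i).adj.R _ (K.map f)) :=
  IndSystem.lift_of _ i j f

lemma coneMap_preComp (hd : IsLimitCone K T M d) (t : IndSystem.PreHom T U)
    (s : IndSystem.PreHom S T) :
    coneMap c b (IndSystem.preComp t s) = W.comp (coneMap d b t) (coneMap c d s) := by
  induction t using IndSystem.PreHom.induction with
  | h0 => simp only [map_zero, LinearMap.zero_apply]
  | hadd t t' ht ht' => simp only [map_add, LinearMap.add_apply, ht, ht']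
  | hof j' k g =>
    induction s using IndSystem.PreHom.induction with
    | h0 => simp only [map_zero]
    | hadd s s' hs hs' => simp only [map_add, hs, hs']
    | hof i j f =>
      rw [IndSystem.preComp_of, coneMap_of, coneMap_of, coneMap_of, K.map_comp, ← K.mapMult_L,
        Mult.R_comp, Mult.L_comp, ← Mult.L_comp, ← Mult.L_comp, ← Mult.comp_L,
        ← Mult.comp_L_apply, hd.adj_comp, Mult.L_R]

lemma coneMap_preAdj (s : IndSystem.PreHom S T) :
    coneMap d c (IndSystem.preAdj s) = W.adj (coneMap c d s) := by
  induction s using IndSystem.PreHom.induction with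
  | h0 => simp only [map_zero]
  | hadd s t hs ht => simp only [map_add, hs, ht]
  | hof i j f =>
    rw [IndSystem.preAdj_of, coneMap_of, coneMap_of, K.map_adj, Mult.adj_of_L, Mult.adj_of_R,
      Mult.adj_adj, Mult.L_R]

/-- A finite sum of contributions from different stages can be collected at one common late stage.
There the norm is visible, as the cone maps are isometries. -/
lemma exists_coneMap_eq (hc : IsLimitCone K S L c) (hd : IsLimitCone K T M d)
    (s : IndSystem.PreHom S T) : ∃ i j, ∀ k, i ≤ k → ∀ l, j ≤ l →
      coneMap c d s = (d l).L _ ((c k).adj.R _ (K.map (IndSystem.comp₀ k l s))) := by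
  induction s using IndSystem.PreHom.induction with
  | h0 =>
    obtain ⟨i⟩ := S.instNonempty
    obtain ⟨j⟩ := T.instNonempty
    exact ⟨i, j, fun k _ l _ => by simp only [map_zero]⟩
  | hof i j f =>
    refine ⟨i, j, fun k hk l hl => ?_⟩
    rw [coneMap_of, IndSystem.comp₀_of, IndSystem.w_of_le hl, ← IndSystem.w_adj,
      IndSystem.w_of_le hk, ← K.mapMult_L, ← K.mapMult_R, ← hc.compat hk, ← hd.compat hl,
      K.mapMult_adj, Mult.adj_comp, Mult.comp_L_apply, Mult.comp_R_apply,
      Mult.L_R (K.mapMult (T.ι hl)) (c k).adj]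
  | hadd s t hs ht =>
    obtain ⟨i, j, h⟩ := hs
    obtain ⟨i', j', h'⟩ := ht
    obtain ⟨i'', hi, hi'⟩ := exists_ge_ge i i'
    obtain ⟨j'', hj, hj'⟩ := exists_ge_ge j j'
    refine ⟨i'', j'', fun k hk l hl => ?_⟩
    simp only [map_add]
    rw [h k (hi.trans hk) l (hj.trans hl), h' k (hi'.trans hk) l (hj'.trans hl)]

lemma norm_coneMap (hc : IsLimitCone K S L c) (hd : IsLimitCone K T M d)
    (s : IndSystem.PreHom S T) : ‖coneMap c d s‖ = IndSystem.indSeminorm S T s := by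
  obtain ⟨i, j, h⟩ := exists_coneMap_eq hc hd s
  obtain ⟨i', j', h'⟩ := IndSystem.exists_indSeminorm_eq s
  obtain ⟨i'', hi, hi'⟩ := exists_ge_ge i i'
  obtain ⟨j'', hj, hj'⟩ := exists_ge_ge j j'
  rw [h _ hi _ hj, h' _ hi' _ hj', (hd.isometry _).norm_L, (hc.isometry _).norm_adj_R, K.norm_map]

/-- `g` is the iterated limit of `d_j d_j^* g c_i c_i^*`, and by fullness of `K` the middle factor
`d_j^* g c_i` comes from `E`. -/
lemma denseRange_coneMap (hc : IsLimitCone K S L c) (hd : IsLimitCone K T M d) :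
    DenseRange (coneMap c d) := by
  intro g
  rw [← closure_closure]
  refine mem_closure_of_tendsto (hd.tendsto _ g) (Eventually.of_forall fun j => ?_)
  refine mem_closure_of_tendsto (hc.tendsto_R _ _) (Eventually.of_forall fun i => ?_)
  refine ⟨IndSystem.of S T i j (K.inv ((d j).adj.L _ ((c i).R _ g))), ?_⟩
  rw [coneMap_of, K.map_inv, Mult.comp_R_apply, Mult.comp_L_apply, ← Mult.L_R (d j),
    ← Mult.L_R (d j), ← Mult.L_R (d j).adj (c i), ← Mult.L_R (d j).adj (c i).adj]

end ConeMap

/-- The functor taking an inductive system to its direct limit. -/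
def indFunctor {E : CStarCat.{u₁, v₁}} {W : CStarCat.{u₂, v₂}} (K : FullFunctor E W)
    (L : IndSystem E → W.Obj) (c : ∀ S i, Mult W (K.obj (S.X i)) (L S))
    (hc : ∀ S, IsLimitCone K S (L S) (c S)) : FullFunctor (indCat₀ E) W :=
  FullFunctor.ofCompletion (obj := L) (φ := fun S T => coneMap (c S) (c T))
    (fun {S T} s => norm_coneMap (hc S) (hc T) s) IndSystem.indSeminorm_isCStar
    IndSystem.indSeminorm_isPositive (fun {_ T _} t s => coneMap_preComp (hc T) t s)
    (fun s => coneMap_preAdj s) (fun {S T} => denseRange_coneMap (hc S) (hc T))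

lemma Mult.IsUnitary.comp_comp_adj {V : CStarCat.{u, v}} {X Y Z : V.Obj} {s : Mult V X Y}
    (hs : s.IsUnitary) (m : Mult V Y Z) : (m.comp s).comp (m.comp s).adj = m.comp m.adj := by
  rw [Mult.adj_comp, Mult.comp_assoc, ← Mult.comp_assoc s, hs.2, Mult.id_comp]

lemma Split.unital {D : CStarCat.{u, v}} (hD : D.Unital) : (Split D).Unital := by
  intro A
  obtain ⟨e, he⟩ := hD (Split.ob A)
  have he' : IsId ((Split.incl D).map e) := (Split.incl D).map_isId he
  refine ⟨(Split.ι A).adj.L _ ((Split.ι A).R _ ((Split.incl D).map e)), ?_⟩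
  refine isId_of_end fun f => ⟨?_, ?_⟩
  · rw [Mult.L_R, ← Mult.comp_L, ← Mult.L_comp, he'.2, (Split.ι_isIsometry A).comp_L_adj]
  · rw [Mult.comp_L, ← Mult.R_comp, he'.1, (Split.ι_isIsometry A).comp_R_adj]

lemma FullFunctor.mapMult_zero {V : CStarCat.{u₁, v₁}} {W : CStarCat.{u₂, v₂}}
    (F : FullFunctor V W) {X Y : V.Obj} :
    F.mapMult (Mult.zero X Y) = Mult.zero (F.obj X) (F.obj Y) :=
  F.mult_ext fun f => by rw [F.mapMult_L, Mult.zero_L, Mult.zero_L, map_zero]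

lemma IsOrthFamily.incl {V : CStarCat.{u, v}} {I : Type*} {X : I → V.Obj} {Y : V.Obj}
    {j : ∀ i, Mult V (X i) Y} (hj : IsOrthFamily j) :
    IsOrthFamily fun i => (Split.incl V).mapMult (j i) where
  isometry i := (Split.incl V).mapMult_isIsometry (hj.isometry i)
  orthogonal i k h := by
    rw [← FullFunctor.mapMult_adj, ← FullFunctor.mapMult_comp, hj.orthogonal i k h,
      FullFunctor.mapMult_zero]
  summable Z f := by
    simp only [← FullFunctor.mapMult_adj, ← FullFunctor.mapMult_comp, Split.incl_mapMult_L]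
    exact ((hj.summable _ _).map (Split.incl V).map (Split.incl V).continuous_map).map
      ((Split.ι Z).R _) ((Split.ι Z).continuous_R _)

/-- The functor from the subobject completion of `D` to that of `V` induced by a functor
from `D` to `V`. -/
def FullFunctor.toSplit {D : CStarCat.{u₁, v₁}} {V : CStarCat.{u₂, v₂}} (J : FullFunctor D V) :
    FullFunctor (Split D) (Split V) :=
  ((Split.incl V).comp J).splitExt (Split.subobjectComplete V)

lemma HasSeqSums.toSplit {D : CStarCat.{u₁, v₁}} {V : CStarCat.{u₂, v₂}} {J : FullFunctor D V}
    (hJ : HasSeqSums J) : HasSeqSums J.toSplit := fun X => by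
  obtain ⟨Y, j, hj⟩ := hJ fun n => Split.ob (X n)
  exact ⟨(Split.incl V).obj Y, _, hj.incl.comp
    fun n => ((Split.incl V).comp J).splitι_isIsometry (Split.subobjectComplete V) (X n)⟩

/-- The induced functor agrees with `J` on objects of `D` only up to the unitary `splitInclι`, so
the cone maps are corrected by it; being unitary, it drops out of the range projections. -/
lemma IsLimitCone.toSplit {D : CStarCat.{u₁, v₁}} {V : CStarCat.{u₂, v₂}} {J : FullFunctor D V}
    {S : IndSystem D} {L : V.Obj} {c : ∀ i, Mult V (J.obj (S.X i)) L} (hc : IsLimitCone J S L c) :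
    IsLimitCone J.toSplit (S.map (Split.incl D)) ((Split.incl V).obj L) fun i =>
      ((Split.incl V).mapMult (c i)).comp
        (((Split.incl V).comp J).splitInclι (Split.subobjectComplete V) (S.X i)) := by
  set J' := (Split.incl V).comp J
  have hu := fun i : S.I => J'.splitInclι_isUnitary (Split.subobjectComplete V) (S.X i)
  refine ⟨fun i => ((Split.incl V).mapMult_isIsometry (hc.isometry i)).comp (hu i).isIsometry,
    fun {i j : S.I} (h : i ≤ j) => ?_, fun Z f => ?_⟩
  · exact (congrArg ((Split.incl V).mapMult (c j)).comp
      (J'.splitInclι_comp_mapMult (Split.subobjectComplete V) (S.ι h))).trans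
      (congrArg (fun m => Mult.comp m (J'.splitInclι (Split.subobjectComplete V) (S.X i)))
        (((congrArg ((Split.incl V).mapMult (c j)).comp
          ((Split.incl V).comp_mapMult J (S.ι h))).trans
          ((Split.incl V).mapMult_comp _ _).symm).trans
          (congrArg (Split.incl V).mapMult (hc.compat h))))
  · have h1 := Split.tendsto_incl_mapMult_L (n := Mult.id L) hc.tendsto f
    rw [FullFunctor.mapMult_id] at h1
    refine h1.congr fun i => congrArg (fun m => Mult.L m Z f) ?_
    rw [FullFunctor.mapMult_comp, FullFunctor.mapMult_adj]
    exact ((hu i).comp_comp_adj _).symm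

/-- If every object of `V` is a subobject of a direct limit of objects of `D`, then the subobject
completion of `V` is the ind-category of the subobject completion of `D`. -/
theorem indCat_split_equivalent {D : CStarCat.{u₁, v₁}} {V : CStarCat.{u₂, v₂}}
    (J : FullFunctor D V) (hD : D.Unital) (hJ : HasSeqSums J)
    (hV : ∀ X : V.Obj, ∃ (S : IndSystem D) (L : V.Obj) (c : ∀ i, Mult V (J.obj (S.X i)) L),
      IsLimitCone J S L c ∧ V.IsSubobject X L) :
    (indCat (Split D)).Equivalent (Split V) := by
  have hW := Split.subobjectComplete V
  choose L c hc using exists_isLimitCone (Split.unital hD) hW hJ.toSplit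
  refine (indFunctor J.toSplit L c hc).split_equivalent hW fun A => ?_
  obtain ⟨S, L', d, hd, m, hm⟩ := hV (Split.ob A)
  -- The limit in which the underlying object of `A` embeds need not be the one chosen for the same
  -- system; limits of one system embed into each other.
  obtain ⟨u, hu⟩ := hd.toSplit.isSubobject (hc (S.map (Split.incl D)))
  exact ⟨S.map (Split.incl D), (u.comp ((Split.incl V).mapMult m)).comp (Split.ι A),
    (hu.comp ((Split.incl V).mapMult_isIsometry hm)).comp (Split.ι_isIsometry A)⟩

end

noncomputable section

open CStarCat

/-! ### Completions of the algebraic tensor product -/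

/-- A `C^*`-seminorm on the algebraic tensor product bounded by the projective seminorm. -/
structure CrossNorm (V₁ : CStarCat.{u₁, v}) (V₂ : CStarCat.{u₂, v}) where
  p : ∀ X Y : (algTensor V₁ V₂).Obj, Seminorm ℂ ((algTensor V₁ V₂).Hom X Y)
  isCStar : (algTensor V₁ V₂).IsCStarSeminorm p
  isPositive : (algTensor V₁ V₂).IsPositive isCStar
  cross : ∀ {X Y : (algTensor V₁ V₂).Obj} (f : V₁.Hom X.1 Y.1) (g : V₂.Hom X.2 Y.2),
    p X Y (f ⊗ₜ[ℂ] g) ≤ ‖f‖ * ‖g‖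

/-- Linear maps extend to completions. -/
def StarCat.mapC {A : StarCat.{u, v}} {p : ∀ X Y : A.Obj, Seminorm ℂ (A.Hom X Y)} {X Y X' Y' : A.Obj}
    (φ : A.Hom X Y →ₗ[ℂ] A.Hom X' Y') (h : ∀ f, p X' Y' (φ f) ≤ p X Y f) :
    A.CHom p X Y →L[ℂ] A.CHom p X' Y' :=
  ContinuousLinearMap.fromCompletion (α := A.SHom p X Y)
    (LinearMap.mkContinuous (E := A.SHom p X Y) (StarCat.toC p ∘ₗ φ) 1
      (fun f => by rw [one_mul]; exact (StarCat.norm_toC (p := p) (φ f)).trans_le (h f)))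

lemma StarCat.mapC_toC {A : StarCat.{u, v}} {p : ∀ X Y : A.Obj, Seminorm ℂ (A.Hom X Y)}
    {X Y X' Y' : A.Obj} (φ : A.Hom X Y →ₗ[ℂ] A.Hom X' Y') (h : ∀ f, p X' Y' (φ f) ≤ p X Y f)
    (f : A.Hom X Y) : StarCat.mapC φ h (StarCat.toC p f) = StarCat.toC p (φ f) :=
  ContinuousLinearMap.fromCompletion_apply_coe (α := A.SHom p X Y) _ f

lemma StarCat.norm_mapC_le {A : StarCat.{u, v}} {p : ∀ X Y : A.Obj, Seminorm ℂ (A.Hom X Y)}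
    {X Y X' Y' : A.Obj} (φ : A.Hom X Y →ₗ[ℂ] A.Hom X' Y') (h : ∀ f, p X' Y' (φ f) ≤ p X Y f)
    (f : A.CHom p X Y) : ‖StarCat.mapC φ h f‖ ≤ ‖f‖ :=
  StarCat.CHom.induction (P := fun f => ‖StarCat.mapC φ h f‖ ≤ ‖f‖)
    (isClosed_le (by fun_prop) (by fun_prop))
    (fun f => by rw [mapC_toC, StarCat.norm_toC, StarCat.norm_toC]; exact h f) f

namespace CrossNorm

variable {V₁ : CStarCat.{u₁, v}} {V₂ : CStarCat.{u₂, v}} (M : CrossNorm V₁ V₂)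

/-- The completed tensor product. -/
def cat : CStarCat.{max u₁ u₂, v} := (algTensor V₁ V₂).completion M.isCStar M.isPositive

/-- The object of the tensor product given by a pair of objects. -/
def ob (X₁ : V₁.Obj) (X₂ : V₂.Obj) : M.cat.Obj := (X₁, X₂)

lemma exists_ob (Z : M.cat.Obj) : ∃ Z₁ Z₂, M.ob Z₁ Z₂ = Z := ⟨Z.1, Z.2, rfl⟩

variable {X₁ Y₁ Z₁ W₁ : V₁.Obj} {X₂ Y₂ Z₂ W₂ : V₂.Obj}

/-- The canonical map from the algebraic tensor product. -/
def can (X₁ Y₁ : V₁.Obj) (X₂ Y₂ : V₂.Obj) :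
    V₁.Hom X₁ Y₁ ⊗[ℂ] V₂.Hom X₂ Y₂ →ₗ[ℂ] M.cat.Hom (M.ob X₁ X₂) (M.ob Y₁ Y₂) where
  toFun t := StarCat.toC (A := algTensor V₁ V₂) M.p (X := (X₁, X₂)) (Y := (Y₁, Y₂)) t
  map_add' s t := map_add (StarCat.toC (A := algTensor V₁ V₂) M.p) s t
  map_smul' c t := map_smul (StarCat.toC (A := algTensor V₁ V₂) M.p) c t

/-- Elementary tensors. -/
def tmul (f : V₁.Hom X₁ Y₁) (g : V₂.Hom X₂ Y₂) : M.cat.Hom (M.ob X₁ X₂) (M.ob Y₁ Y₂) :=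
  M.can X₁ Y₁ X₂ Y₂ (f ⊗ₜ[ℂ] g)

lemma norm_can (t : V₁.Hom X₁ Y₁ ⊗[ℂ] V₂.Hom X₂ Y₂) :
    ‖M.can X₁ Y₁ X₂ Y₂ t‖ = M.p (X₁, X₂) (Y₁, Y₂) t :=
  StarCat.norm_toC (A := algTensor V₁ V₂) (p := M.p) (X := (X₁, X₂)) (Y := (Y₁, Y₂)) t

lemma norm_tmul_le (f : V₁.Hom X₁ Y₁) (g : V₂.Hom X₂ Y₂) : ‖M.tmul f g‖ ≤ ‖f‖ * ‖g‖ :=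
  (M.norm_can _).trans_le (M.cross (X := (X₁, X₂)) (Y := (Y₁, Y₂)) f g)

lemma can_comp (t : V₁.Hom Y₁ Z₁ ⊗[ℂ] V₂.Hom Y₂ Z₂) (s : V₁.Hom X₁ Y₁ ⊗[ℂ] V₂.Hom X₂ Y₂) :
    M.cat.comp (M.can _ _ _ _ t) (M.can _ _ _ _ s) =
      M.can _ _ _ _ ((algTensor V₁ V₂).comp (X := (X₁, X₂)) (Y := (Y₁, Y₂)) (Z := (Z₁, Z₂)) t s) :=
  M.isCStar.comp_toC _ _

lemma can_adj (t : V₁.Hom X₁ Y₁ ⊗[ℂ] V₂.Hom X₂ Y₂) :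
    M.cat.adj (M.can _ _ _ _ t) =
      M.can _ _ _ _ ((algTensor V₁ V₂).adj (X := (X₁, X₂)) (Y := (Y₁, Y₂)) t) :=
  M.isCStar.adj_toC _

lemma tmul_comp (g₁ : V₁.Hom Y₁ Z₁) (g₂ : V₂.Hom Y₂ Z₂) (f₁ : V₁.Hom X₁ Y₁) (f₂ : V₂.Hom X₂ Y₂) :
    M.cat.comp (M.tmul g₁ g₂) (M.tmul f₁ f₂) = M.tmul (V₁.comp g₁ f₁) (V₂.comp g₂ f₂) :=
  M.can_comp _ _

lemma tmul_adj (f₁ : V₁.Hom X₁ Y₁) (f₂ : V₂.Hom X₂ Y₂) :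
    M.cat.adj (M.tmul f₁ f₂) = M.tmul (V₁.adj f₁) (V₂.adj f₂) :=
  M.can_adj _

/-- Elementary tensors as a bilinear map. -/
def tmulₗ : V₁.Hom X₁ Y₁ →L[ℂ] V₂.Hom X₂ Y₂ →L[ℂ] M.cat.Hom (M.ob X₁ X₂) (M.ob Y₁ Y₂) :=
  LinearMap.mkContinuous₂ ((TensorProduct.mk ℂ _ _).compr₂ (M.can X₁ Y₁ X₂ Y₂)) 1
    (fun f g => by rw [one_mul]; exact M.norm_tmul_le f g)

lemma continuous_tmul : Continuous fun x : V₁.Hom X₁ Y₁ × V₂.Hom X₂ Y₂ => M.tmul x.1 x.2 :=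
  M.tmulₗ.continuous₂

lemma induction_can {P : M.cat.Hom (M.ob X₁ X₂) (M.ob Y₁ Y₂) → Prop} (hc : IsClosed {t | P t})
    (h : ∀ t, P (M.can _ _ _ _ t)) (t) : P t :=
  StarCat.CHom.induction (A := algTensor V₁ V₂) (p := M.p) hc h t

lemma induction {P : M.cat.Hom (M.ob X₁ X₂) (M.ob Y₁ Y₂) → Prop} (hc : IsClosed {t | P t})
    (hadd : ∀ s t, P s → P t → P (s + t)) (h : ∀ f g, P (M.tmul f g)) (t) : P t := by
  refine M.induction_can hc (fun t => ?_) t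
  induction t with
  | zero =>
    have := h 0 0
    rwa [tmul, TensorProduct.zero_tmul] at this
  | add s t hs ht => rw [map_add]; exact hadd _ _ hs ht
  | tmul f g => exact h f g

/-- `T` acts on elementary tensors as `m₁ ⊗ m₂`. -/
def IsTensor (m₁ : Mult V₁ X₁ Y₁) (m₂ : Mult V₂ X₂ Y₂)
    (T : Mult M.cat (M.ob X₁ X₂) (M.ob Y₁ Y₂)) : Prop :=
  ∀ (Z₁ : V₁.Obj) (Z₂ : V₂.Obj) (f : V₁.Hom Z₁ X₁) (g : V₂.Hom Z₂ X₂),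
    T.L _ (M.tmul f g) = M.tmul (m₁.L _ f) (m₂.L _ g)

namespace IsTensor

variable {M} {m₁ : Mult V₁ X₁ Y₁} {m₂ : Mult V₂ X₂ Y₂} {T T' : Mult M.cat (M.ob X₁ X₂) (M.ob Y₁ Y₂)}

/-- Elementary tensors have dense span. With uniqueness, a relation suffices in place of an
operation on all multipliers: existence is proved for isometries, and composites and adjoints are
handled by `comp` and `adj`. -/
lemma unique (h : M.IsTensor m₁ m₂ T) (h' : M.IsTensor m₁ m₂ T') : T = T' := by
  refine Mult.ext_L fun Z t => ?_
  obtain ⟨Z₁, Z₂, rfl⟩ := M.exists_ob Z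
  refine M.induction (P := fun t => T.L _ t = T'.L _ t)
    (isClosed_eq (T.continuous_L _) (T'.continuous_L _)) (fun s t hs ht => ?_) (fun f g => ?_) t
  · rw [map_add, map_add, hs, ht]
  · rw [h, h']

lemma comp {n₁ : Mult V₁ Y₁ Z₁} {n₂ : Mult V₂ Y₂ Z₂} {S : Mult M.cat (M.ob Y₁ Y₂) (M.ob Z₁ Z₂)}
    (hS : M.IsTensor n₁ n₂ S) (hT : M.IsTensor m₁ m₂ T) :
    M.IsTensor (n₁.comp m₁) (n₂.comp m₂) (S.comp T) := fun W₁ W₂ f g => by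
  rw [Mult.comp_L_apply, hT, hS, Mult.comp_L_apply, Mult.comp_L_apply]

lemma id : M.IsTensor (Mult.id X₁) (Mult.id X₂) (Mult.id (M.ob X₁ X₂)) := fun _ _ _ _ => rfl

lemma R_tmul (h : M.IsTensor m₁ m₂ T) (f : V₁.Hom Y₁ Z₁) (g : V₂.Hom Y₂ Z₂) :
    T.R _ (M.tmul f g) = M.tmul (m₁.R _ f) (m₂.R _ g) := by
  refine ext_right fun t => ?_
  rw [← T.comp_L]
  refine M.induction (P := fun t => M.cat.comp (M.tmul f g) (T.L _ t) =
    M.cat.comp (M.tmul (m₁.R _ f) (m₂.R _ g)) t) (isClosed_eq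
      ((continuous_comp_left _).comp (T.continuous_L _)) (continuous_comp_left _))
    (fun s t hs ht => ?_) (fun f' g' => ?_) t
  · rw [map_add, comp_add, comp_add, hs, ht]
  · rw [h, tmul_comp, tmul_comp, m₁.comp_L, m₂.comp_L]

lemma adj (h : M.IsTensor m₁ m₂ T) : M.IsTensor m₁.adj m₂.adj T.adj := fun W₁ W₂ f g => by
  rw [Mult.adj_L, tmul_adj, h.R_tmul, tmul_adj, Mult.adj_L, Mult.adj_L]

lemma isIsometry (h : M.IsTensor m₁ m₂ T) (h₁ : m₁.IsIsometry) (h₂ : m₂.IsIsometry) :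
    T.IsIsometry := by
  have h3 := h.adj.comp h
  rw [h₁, h₂] at h3
  exact h3.unique id

end IsTensor

section Exists

/-- The action of `m₁ ⊗ m₂` from the left on the algebraic tensor product. -/
abbrev algL (m₁ : Mult V₁ X₁ Y₁) (m₂ : Mult V₂ X₂ Y₂) (Z₁ : V₁.Obj) (Z₂ : V₂.Obj) :
    V₁.Hom Z₁ X₁ ⊗[ℂ] V₂.Hom Z₂ X₂ →ₗ[ℂ] V₁.Hom Z₁ Y₁ ⊗[ℂ] V₂.Hom Z₂ Y₂ :=
  TensorProduct.map (m₁.L Z₁) (m₂.L Z₂)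

/-- The action of `m₁ ⊗ m₂` from the right on the algebraic tensor product. -/
abbrev algR (m₁ : Mult V₁ X₁ Y₁) (m₂ : Mult V₂ X₂ Y₂) (Z₁ : V₁.Obj) (Z₂ : V₂.Obj) :
    V₁.Hom Y₁ Z₁ ⊗[ℂ] V₂.Hom Y₂ Z₂ →ₗ[ℂ] V₁.Hom X₁ Z₁ ⊗[ℂ] V₂.Hom X₂ Z₂ :=
  TensorProduct.map (m₁.R Z₁) (m₂.R Z₂)

variable {m₁ : Mult V₁ X₁ Y₁} {m₂ : Mult V₂ X₂ Y₂}

lemma can_algL_comp (h : V₁.Hom Z₁ X₁ ⊗[ℂ] V₂.Hom Z₂ X₂) (g : V₁.Hom W₁ Z₁ ⊗[ℂ] V₂.Hom W₂ Z₂) :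
    M.can _ _ _ _ (algL m₁ m₂ _ _ ((algTensor V₁ V₂).comp (X := (W₁, W₂)) (Y := (Z₁, Z₂))
      (Z := (X₁, X₂)) h g)) = M.cat.comp (M.can _ _ _ _ (algL m₁ m₂ _ _ h)) (M.can _ _ _ _ g) := by
  rw [can_comp]
  congr 1
  induction h with
  | zero => simp only [map_zero, LinearMap.zero_apply]
  | add h h' hh hh' => simp only [map_add, LinearMap.add_apply, hh, hh']
  | tmul h h' =>
    induction g with
    | zero => simp only [map_zero]
    | add g g' hg hg' => simp only [map_add, hg, hg']
    | tmul g g' =>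
      simp only [TensorProduct.map_tmul, TensorProduct.map₂_apply_tmul, Mult.L_comp]

lemma can_algR_comp (f : V₁.Hom Z₁ W₁ ⊗[ℂ] V₂.Hom Z₂ W₂) (h : V₁.Hom Y₁ Z₁ ⊗[ℂ] V₂.Hom Y₂ Z₂) :
    M.can _ _ _ _ (algR m₁ m₂ _ _ ((algTensor V₁ V₂).comp (X := (Y₁, Y₂)) (Y := (Z₁, Z₂))
      (Z := (W₁, W₂)) f h)) = M.cat.comp (M.can _ _ _ _ f) (M.can _ _ _ _ (algR m₁ m₂ _ _ h)) := by
  rw [can_comp]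
  congr 1
  induction h with
  | zero => simp only [map_zero]
  | add h h' hh hh' => simp only [map_add, hh, hh']
  | tmul h h' =>
    induction f with
    | zero => simp only [map_zero, LinearMap.zero_apply]
    | add g g' hg hg' => simp only [map_add, LinearMap.add_apply, hg, hg']
    | tmul g g' =>
      simp only [TensorProduct.map_tmul, TensorProduct.map₂_apply_tmul, Mult.R_comp]

lemma can_comp_algL (g : V₁.Hom Y₁ W₁ ⊗[ℂ] V₂.Hom Y₂ W₂) (f : V₁.Hom Z₁ X₁ ⊗[ℂ] V₂.Hom Z₂ X₂) :
    M.cat.comp (M.can _ _ _ _ g) (M.can _ _ _ _ (algL m₁ m₂ _ _ f)) =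
      M.cat.comp (M.can _ _ _ _ (algR m₁ m₂ _ _ g)) (M.can _ _ _ _ f) := by
  rw [can_comp, can_comp]
  congr 1
  induction f with
  | zero => simp only [map_zero]
  | add h h' hh hh' => simp only [map_add, hh, hh']
  | tmul h h' =>
    induction g with
    | zero => simp only [map_zero, LinearMap.zero_apply]
    | add g g' hg hg' => simp only [map_add, LinearMap.add_apply, hg, hg']
    | tmul g g' =>
      simp only [TensorProduct.map_tmul, TensorProduct.map₂_apply_tmul, Mult.comp_L]

lemma adj_can_algL (f : V₁.Hom Z₁ X₁ ⊗[ℂ] V₂.Hom Z₂ X₂) :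
    M.cat.adj (M.can _ _ _ _ (algL m₁ m₂ _ _ f)) =
      M.can _ _ _ _ (algR m₁.adj m₂.adj _ _
        ((algTensor V₁ V₂).adj (X := (Z₁, Z₂)) (Y := (X₁, X₂)) f)) := by
  rw [can_adj]
  congr 1
  induction f with
  | zero => simp only [map_zero]
  | add h h' hh hh' => simp only [map_add, hh, hh']
  | tmul h h' => simp only [TensorProduct.map_tmul, Mult.adj_of_L]

/-- Algebraically `((m₁ ⊗ m₂) f)^* ((m₁ ⊗ m₂) f) = f^* f`, so the `C^*`-identity gives norm
preservation for any `C^*`-seminorm. This lets the action extend to the completion. -/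
lemma norm_can_algL (h₁ : m₁.IsIsometry) (h₂ : m₂.IsIsometry)
    (f : V₁.Hom Z₁ X₁ ⊗[ℂ] V₂.Hom Z₂ X₂) :
    ‖M.can _ _ _ _ (algL m₁ m₂ _ _ f)‖ = ‖M.can _ _ _ _ f‖ := by
  have h := M.cat.norm_adj_comp_self (M.can _ _ _ _ (algL m₁ m₂ _ _ f))
  have e : algR m₁ m₂ Z₁ Z₂ (algR m₁.adj m₂.adj Z₁ Z₂
      ((algTensor V₁ V₂).adj (X := (Z₁, Z₂)) (Y := (X₁, X₂)) f)) =
      (algTensor V₁ V₂).adj (X := (Z₁, Z₂)) (Y := (X₁, X₂)) f := by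
    generalize (algTensor V₁ V₂).adj (X := (Z₁, Z₂)) (Y := (X₁, X₂)) f = g
    induction g using TensorProduct.induction_on with
    | zero => simp only [map_zero]
    | add h h' hh hh' => rw [map_add, map_add, hh, hh']
    | tmul h h' =>
      rw [TensorProduct.map_tmul, TensorProduct.map_tmul, h₁.comp_R_adj, h₂.comp_R_adj]
  rw [adj_can_algL, can_comp_algL, e, ← can_adj, M.cat.norm_adj_comp_self] at h
  exact ((sq_eq_sq₀ (norm_nonneg _) (norm_nonneg _)).1 h).symm

/-- `‖R f‖ ^ 2 = ‖f ∘ L (R f)^*‖ ≤ ‖f‖ ‖R f‖`, as `L` preserves the norm. -/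
lemma norm_can_algR_le (h₁ : m₁.IsIsometry) (h₂ : m₂.IsIsometry)
    (f : V₁.Hom Y₁ Z₁ ⊗[ℂ] V₂.Hom Y₂ Z₂) :
    ‖M.can _ _ _ _ (algR m₁ m₂ _ _ f)‖ ≤ ‖M.can _ _ _ _ f‖ := by
  have h := CStarCat.norm_comp_adj_self (V := M.cat) (M.can _ _ _ _ (algR m₁ m₂ _ _ f))
  rw [can_adj, ← can_comp_algL] at h
  have h' := M.cat.norm_comp_le (M.can _ _ _ _ f) (M.can _ _ _ _ (algL m₁ m₂ _ _
    ((algTensor V₁ V₂).adj (X := (X₁, X₂)) (Y := (Z₁, Z₂)) (algR m₁ m₂ _ _ f))))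
  rw [h, norm_can_algL M h₁ h₂, ← can_adj, M.cat.norm_adj] at h'
  rcases (norm_nonneg (M.can _ _ _ _ (algR m₁ m₂ _ _ f))).eq_or_lt with h0 | h0
  · rw [← h0]; exact norm_nonneg _
  · nlinarith

/-- The tensor product of isometries. -/
theorem exists_isTensor (h₁ : m₁.IsIsometry) (h₂ : m₂.IsIsometry) :
    ∃ T, M.IsTensor m₁ m₂ T := by
  obtain ⟨L, hL, hLn⟩ : ∃ L : ∀ Z : M.cat.Obj,
      M.cat.Hom Z (M.ob X₁ X₂) →L[ℂ] M.cat.Hom Z (M.ob Y₁ Y₂),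
      (∀ Z₁ Z₂ (f : V₁.Hom Z₁ X₁ ⊗[ℂ] V₂.Hom Z₂ X₂), L (M.ob Z₁ Z₂) (M.can _ _ _ _ f) =
        M.can _ _ _ _ (algL m₁ m₂ _ _ f)) ∧ ∀ Z f, ‖L Z f‖ ≤ ‖f‖ := by
    refine ⟨fun Z => StarCat.mapC (A := algTensor V₁ V₂) (p := M.p) (X := Z) (Y := (X₁, X₂))
      (X' := Z) (Y' := (Y₁, Y₂)) (algL m₁ m₂ Z.1 Z.2) fun f => ?_,
      fun Z₁ Z₂ f => StarCat.mapC_toC _ _ _, fun Z f => StarCat.norm_mapC_le _ _ f⟩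
    have := (M.norm_can_algL h₁ h₂ f).le
    rwa [norm_can, norm_can] at this
  obtain ⟨R, hR, hRn⟩ : ∃ R : ∀ Z : M.cat.Obj,
      M.cat.Hom (M.ob Y₁ Y₂) Z →L[ℂ] M.cat.Hom (M.ob X₁ X₂) Z,
      (∀ Z₁ Z₂ (f : V₁.Hom Y₁ Z₁ ⊗[ℂ] V₂.Hom Y₂ Z₂), R (M.ob Z₁ Z₂) (M.can _ _ _ _ f) =
        M.can _ _ _ _ (algR m₁ m₂ _ _ f)) ∧ ∀ Z f, ‖R Z f‖ ≤ ‖f‖ := by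
    refine ⟨fun Z => StarCat.mapC (A := algTensor V₁ V₂) (p := M.p) (X := (Y₁, Y₂)) (Y := Z)
      (X' := (X₁, X₂)) (Y' := Z) (algR m₁ m₂ Z.1 Z.2) fun f => ?_,
      fun Z₁ Z₂ f => StarCat.mapC_toC _ _ _, fun Z f => StarCat.norm_mapC_le _ _ f⟩
    have := M.norm_can_algR_le h₁ h₂ f
    rwa [norm_can, norm_can] at this
  refine ⟨{ L := fun Z => (L Z).toLinearMap
            R := fun Z => (R Z).toLinearMap
            bdd := ⟨1, fun Z => ⟨fun f => ?_, fun f => ?_⟩⟩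
            L_comp := fun {W Z} h g => ?_
            R_comp := fun {W Z} f h => ?_
            comp_L := fun {W Z} g f => ?_ }, fun Z₁ Z₂ f g => ?_⟩
  · rw [one_mul]; exact hLn Z f
  · rw [one_mul]; exact hRn Z f
  · obtain ⟨Z₁, Z₂, rfl⟩ := M.exists_ob Z
    obtain ⟨W₁, W₂, rfl⟩ := M.exists_ob W
    refine M.induction_can (P := fun h => L (M.ob W₁ W₂) (M.cat.comp h g) =
      M.cat.comp (L (M.ob Z₁ Z₂) h) g) (isClosed_eq
        ((L (M.ob W₁ W₂)).continuous.comp (continuous_comp_right _))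
        ((continuous_comp_right _).comp (L (M.ob Z₁ Z₂)).continuous)) (fun h => ?_) h
    refine M.induction_can (P := fun g => L (M.ob W₁ W₂) (M.cat.comp (M.can _ _ _ _ h) g) =
      M.cat.comp (L (M.ob Z₁ Z₂) (M.can _ _ _ _ h)) g) (isClosed_eq
        ((L (M.ob W₁ W₂)).continuous.comp (continuous_comp_left _))
        (continuous_comp_left _)) (fun g => ?_) g
    rw [can_comp, hL, hL, can_algL_comp]
  · obtain ⟨Z₁, Z₂, rfl⟩ := M.exists_ob Z
    obtain ⟨W₁, W₂, rfl⟩ := M.exists_ob W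
    refine M.induction_can (P := fun f => R (M.ob Z₁ Z₂) (M.cat.comp f h) =
      M.cat.comp f (R (M.ob W₁ W₂) h)) (isClosed_eq
        ((R (M.ob Z₁ Z₂)).continuous.comp (continuous_comp_right _))
        (continuous_comp_right _)) (fun f => ?_) f
    refine M.induction_can (P := fun h => R (M.ob Z₁ Z₂) (M.cat.comp (M.can _ _ _ _ f) h) =
      M.cat.comp (M.can _ _ _ _ f) (R (M.ob W₁ W₂) h)) (isClosed_eq
        ((R (M.ob Z₁ Z₂)).continuous.comp (continuous_comp_left _))
        ((continuous_comp_left _).comp (R (M.ob W₁ W₂)).continuous)) (fun h => ?_) h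
    rw [can_comp, hR, hR, can_algR_comp]
  · obtain ⟨Z₁, Z₂, rfl⟩ := M.exists_ob Z
    obtain ⟨W₁, W₂, rfl⟩ := M.exists_ob W
    refine M.induction_can (P := fun g => M.cat.comp g (L (M.ob W₁ W₂) f) =
      M.cat.comp (R (M.ob Z₁ Z₂) g) f) (isClosed_eq (continuous_comp_right _)
        ((continuous_comp_right _).comp (R (M.ob Z₁ Z₂)).continuous)) (fun g => ?_) g
    refine M.induction_can (P := fun f => M.cat.comp (M.can _ _ _ _ g) (L (M.ob W₁ W₂) f) =
      M.cat.comp (R (M.ob Z₁ Z₂) (M.can _ _ _ _ g)) f) (isClosed_eq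
        ((continuous_comp_left _).comp (L (M.ob W₁ W₂)).continuous)
        (continuous_comp_left _)) (fun f => ?_) f
    rw [hL, hR, can_comp_algL]
  · exact (hL _ _ _).trans (congrArg _ (TensorProduct.map_tmul _ _ _ _))

end Exists

end CrossNorm

end

/-! ### Units, strict convergence and orthogonal sums in a completed tensor product. -/

noncomputable section

open CStarCat

namespace CrossNorm

variable {V₁ : CStarCat.{u₁, v}} {V₂ : CStarCat.{u₂, v}} {M : CrossNorm V₁ V₂}
  {X₁ Y₁ Z₁ : V₁.Obj} {X₂ Y₂ Z₂ : V₂.Obj}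

lemma isId_tmul {e₁ : V₁.Hom X₁ X₁} {e₂ : V₂.Hom X₂ X₂} (h₁ : IsId e₁) (h₂ : IsId e₂) :
    IsId (M.tmul e₁ e₂) := by
  refine isId_of_end fun t => ?_
  refine M.induction (P := fun t => M.cat.comp (M.tmul e₁ e₂) t = t ∧
    M.cat.comp t (M.tmul e₁ e₂) = t) ((isClosed_eq (continuous_comp_left _) continuous_id).inter
      (isClosed_eq (continuous_comp_right _) continuous_id)) (fun s t hs ht => ?_) (fun f g => ?_) t
  · rw [comp_add, add_comp, hs.1, hs.2, ht.1, ht.2]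
    exact ⟨rfl, rfl⟩
  · rw [tmul_comp, tmul_comp, h₁.1, h₁.2, h₂.1, h₂.2]
    exact ⟨rfl, rfl⟩

variable (M) in
lemma unital (h₁ : V₁.Unital) (h₂ : V₂.Unital) : M.cat.Unital := fun Z => by
  obtain ⟨Z₁, Z₂, rfl⟩ := M.exists_ob Z
  obtain ⟨e₁, he₁⟩ := h₁ Z₁
  obtain ⟨e₂, he₂⟩ := h₂ Z₂
  exact ⟨M.tmul e₁ e₂, isId_tmul he₁ he₂⟩

/-- Strict convergence of tensor products of bounded nets. -/
lemma tendsto_isTensor {I : Type*} {l : Filter I} {m₁ : I → Mult V₁ X₁ X₁} {m₂ : I → Mult V₂ X₂ X₂}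
    {T : I → Mult M.cat (M.ob X₁ X₂) (M.ob X₁ X₂)} (hT : ∀ i, M.IsTensor (m₁ i) (m₂ i) (T i))
    (hb : ∀ i Z (t : M.cat.Hom Z (M.ob X₁ X₂)), ‖(T i).L Z t‖ ≤ ‖t‖)
    (h₁ : ∀ Z (f : V₁.Hom Z X₁), Tendsto (fun i => (m₁ i).L Z f) l (𝓝 f))
    (h₂ : ∀ Z (f : V₂.Hom Z X₂), Tendsto (fun i => (m₂ i).L Z f) l (𝓝 f))
    (Z : M.cat.Obj) (t : M.cat.Hom Z (M.ob X₁ X₂)) : Tendsto (fun i => (T i).L Z t) l (𝓝 t) := by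
  obtain ⟨Z₁, Z₂, rfl⟩ := M.exists_ob Z
  refine M.induction (P := fun t => Tendsto (fun i => (T i).L _ t) l (𝓝 t))
    (isClosed_setOf_tendsto (T := fun i => (T i).L _) (S := LinearMap.id) (C := 1)
      (Eventually.of_forall fun i f => ?_) fun f => ?_) (fun s t hs ht => ?_) (fun f g => ?_) t
  · rw [one_mul]; exact hb i _ f
  · rw [one_mul]; exact le_rfl
  · simpa only [map_add] using hs.add ht
  · have h3 := ((h₁ Z₁ f).prodMk_nhds (h₂ Z₂ g))
    have h4 := (M.continuous_tmul.tendsto (f, g)).comp h3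
    exact h4.congr fun i => (hT i Z₁ Z₂ f g).symm

/-- The diagonal family `A₁ k ⊗ A₂ k` sits inside `X₁ ⊗ X₂`; orthogonality in the first factor is
enough. Summability is clear on elementary tensors and extends because partial sums are projections.
-/
lemma exists_isOrthFamily {I : Type*} {A₁ : I → V₁.Obj} {A₂ : I → V₂.Obj}
    {j₁ : ∀ k, Mult V₁ (A₁ k) X₁} (h₁ : IsOrthFamily j₁) {j₂ : ∀ k, Mult V₂ (A₂ k) X₂}
    (h₂ : ∀ k, (j₂ k).IsIsometry) :
    ∃ j : ∀ k, Mult M.cat (M.ob (A₁ k) (A₂ k)) (M.ob X₁ X₂), IsOrthFamily j := by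
  have hid : ∀ X : V₂.Obj, (Mult.id X).IsIsometry := fun X => by
    rw [Mult.IsIsometry, Mult.id_adj, Mult.id_comp]
  have hid' : ∀ X : V₁.Obj, (Mult.id X).IsIsometry := fun X => by
    rw [Mult.IsIsometry, Mult.id_adj, Mult.id_comp]
  choose S hS using fun k => M.exists_isTensor (h₁.isometry k) (hid X₂)
  choose T hT using fun k => M.exists_isTensor (hid' (A₁ k)) (h₂ k)
  -- The isometries are `(j₁ k ⊗ 1)(1 ⊗ j₂ k)`; summability is only needed for the first factor `S
  -- k`.
  refine ⟨_, IsOrthFamily.comp (j := S) (s := T) ?_ fun k => (hT k).isIsometry (hid' _) (h₂ k)⟩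
  have hiso : ∀ k, (S k).IsIsometry := fun k => (hS k).isIsometry (h₁.isometry k) (hid _)
  have hort : ∀ i k, i ≠ k → (S i).adj.comp (S k) = Mult.zero _ _ := fun i k h => by
    have h3 := (hS i).adj.comp (hS k)
    rw [h₁.orthogonal i k h] at h3
    refine h3.unique fun Z₁ Z₂ f g => ?_
    rw [Mult.zero_L, Mult.zero_L, tmul, TensorProduct.zero_tmul, map_zero]
  have hp : ∀ k, ((S k).comp (S k).adj).IsProjection := fun k => (hiso k).isProjection
  have ho : ∀ i k, i ≠ k → ((S i).comp (S i).adj).comp ((S k).comp (S k).adj) = Mult.zero _ _ :=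
    fun i k h => by
      rw [Mult.comp_assoc, ← Mult.comp_assoc (S i).adj, hort i k h, Mult.zero_comp, Mult.comp_zero]
  refine ⟨hiso, hort, fun Z t => ?_⟩
  obtain ⟨Z₁, Z₂, rfl⟩ := M.exists_ob Z
  have key : ∀ t : M.cat.Hom (M.ob Z₁ Z₂) (M.ob X₁ X₂), ∃ g, Tendsto (fun s : Finset I =>
      (Mult.sum s fun k => (S k).comp (S k).adj).L _ t) atTop (𝓝 g) := by
    intro t
    refine M.induction (P := fun t => ∃ g, Tendsto (fun s : Finset I =>
      (Mult.sum s fun k => (S k).comp (S k).adj).L _ t) atTop (𝓝 g))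
      (isClosed_setOf_exists_tendsto (T := fun s : Finset I =>
        (Mult.sum s fun k => (S k).comp (S k).adj).L (M.ob Z₁ Z₂)) (C := 1)
        (Eventually.of_forall fun s f => ?_)) ?_ (fun f g => ?_) t
    · rw [one_mul]
      exact (Mult.isProjection_sum hp ho s).norm_L_le f
    · rintro s t ⟨a, ha⟩ ⟨b, hb⟩
      exact ⟨a + b, by simpa only [map_add] using ha.add hb⟩
    · have h3 : Summable fun k => M.tmul (((j₁ k).comp (j₁ k).adj).L _ f) g :=
        (h₁.summable _ f).map ((M.tmulₗ (X₁ := Z₁) (Y₁ := X₁)).flip g).toLinearMap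
          ((M.tmulₗ (X₁ := Z₁) (Y₁ := X₁)).flip g).continuous
      obtain ⟨a, ha⟩ := h3
      rw [HasSum, SummationFilter.unconditional_filter] at ha
      refine ⟨a, ha.congr fun s => ?_⟩
      rw [Mult.sum_L]
      refine Finset.sum_congr rfl fun k _ => ?_
      rw [(hS k).comp (hS k).adj, Mult.id_adj]
      rfl
  obtain ⟨g, hg⟩ := key t
  refine ⟨g, ?_⟩
  rw [HasSum, SummationFilter.unconditional_filter]
  simpa only [Mult.sum_L] using hg

/-! ### Tensor products of functors, inductive systems and direct limits -/

variable {D₁ : CStarCat.{u, v}} {D₂ : CStarCat.{v₁, v}} {N : CrossNorm D₁ D₂}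

/-- The tensor product of functors which preserve the norm of the algebraic tensor products. -/
def tensorFunctor (N : CrossNorm D₁ D₂) (M : CrossNorm V₁ V₂) (J₁ : FullFunctor D₁ V₁)
    (J₂ : FullFunctor D₂ V₂)
    (h : ∀ (X₁ Y₁ : D₁.Obj) (X₂ Y₂ : D₂.Obj) (t : D₁.Hom X₁ Y₁ ⊗[ℂ] D₂.Hom X₂ Y₂),
      ‖M.can _ _ _ _ (TensorProduct.map J₁.map J₂.map t)‖ = ‖N.can _ _ _ _ t‖) :
    FullFunctor N.cat M.cat :=
  FullFunctor.ofCompletion (A := algTensor D₁ D₂) (obj := fun X => M.ob (J₁.obj X.1) (J₂.obj X.2))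
    (φ := fun _ _ => M.can _ _ _ _ ∘ₗ TensorProduct.map J₁.map J₂.map)
    (fun {X Y} t => (h X.1 Y.1 X.2 Y.2 t).trans (N.norm_can t)) N.isCStar N.isPositive
    (fun {X Y Z} g f => by
      rw [LinearMap.comp_apply, LinearMap.comp_apply, LinearMap.comp_apply, can_comp]
      congr 1
      induction g using TensorProduct.induction_on with
      | zero => simp only [map_zero, LinearMap.zero_apply]
      | add g g' hg hg' => simp only [map_add, LinearMap.add_apply, hg, hg']
      | tmul g g' =>
        induction f using TensorProduct.induction_on with
        | zero => simp only [map_zero]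
        | add f f' hf hf' => simp only [map_add, hf, hf']
        | tmul f f' =>
          simp only [TensorProduct.map_tmul, TensorProduct.map₂_apply_tmul, J₁.map_comp,
            J₂.map_comp])
    (fun {X Y} f => by
      rw [LinearMap.comp_apply, LinearMap.comp_apply, can_adj]
      congr 1
      induction f using TensorProduct.induction_on with
      | zero => simp only [map_zero]
      | add f f' hf hf' => simp only [map_add, hf, hf']
      | tmul f f' => simp only [TensorProduct.map_tmul, J₁.map_adj, J₂.map_adj])
    (fun {X Y} => by
      have h1 : DenseRange (M.can (J₁.obj X.1) (J₁.obj Y.1) (J₂.obj X.2) (J₂.obj Y.2)) := fun t =>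
        M.induction_can (P := fun t => t ∈ closure (Set.range (M.can _ _ _ _))) isClosed_closure
          (fun t => subset_closure ⟨t, rfl⟩) t
      have h2 : Function.Surjective (TensorProduct.map (J₁.map (X := X.1) (Y := Y.1))
        (J₂.map (X := X.2) (Y := Y.2))) := TensorProduct.map_surjective J₁.surj J₂.surj
      rw [LinearMap.coe_comp, DenseRange, h2.range_comp]
      exact h1)

section TensorFunctor

variable {J₁ : FullFunctor D₁ V₁} {J₂ : FullFunctor D₂ V₂}
  (h : ∀ (X₁ Y₁ : D₁.Obj) (X₂ Y₂ : D₂.Obj) (t : D₁.Hom X₁ Y₁ ⊗[ℂ] D₂.Hom X₂ Y₂),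
      ‖M.can _ _ _ _ (TensorProduct.map J₁.map J₂.map t)‖ = ‖N.can _ _ _ _ t‖)

lemma tensorFunctor_map_tmul {X₁ Y₁ : D₁.Obj} {X₂ Y₂ : D₂.Obj} (f : D₁.Hom X₁ Y₁)
    (g : D₂.Hom X₂ Y₂) :
    (tensorFunctor N M J₁ J₂ h).map (N.tmul f g) = M.tmul (J₁.map f) (J₂.map g) :=
  FullFunctor.extC_toC (A := algTensor D₁ D₂) (X := (X₁, X₂)) (Y := (Y₁, Y₂)) (p := N.p)
    (obj := fun X => M.ob (J₁.obj X.1) (J₂.obj X.2))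
    (φ := fun _ _ => M.can _ _ _ _ ∘ₗ TensorProduct.map J₁.map J₂.map)
    (fun {X Y} t => (h X.1 Y.1 X.2 Y.2 t).trans (N.norm_can t)) (f ⊗ₜ[ℂ] g)

/-- Identifies the connecting maps of the image of a tensor system with tensor products of the
connecting maps of the two images. -/
lemma tensorFunctor_mapMult {X₁ Y₁ : D₁.Obj} {X₂ Y₂ : D₂.Obj} {m₁ : Mult D₁ X₁ Y₁}
    {m₂ : Mult D₂ X₂ Y₂} {T : Mult N.cat (N.ob X₁ X₂) (N.ob Y₁ Y₂)}
    {T' : Mult M.cat (M.ob (J₁.obj X₁) (J₂.obj X₂)) (M.ob (J₁.obj Y₁) (J₂.obj Y₂))}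
    (hT : N.IsTensor m₁ m₂ T) (hT' : M.IsTensor (J₁.mapMult m₁) (J₂.mapMult m₂) T') :
    (tensorFunctor N M J₁ J₂ h).mapMult T = T' := by
  set F := tensorFunctor N M J₁ J₂ h
  have key : ∀ T'' : Mult M.cat (F.obj (N.ob X₁ X₂)) (F.obj (N.ob Y₁ Y₂)),
      (∀ f g, T''.L _ (F.map (N.tmul f g)) = F.map (N.tmul (m₁.L X₁ f) (m₂.L X₂ g))) →
      F.mapMult T = T'' := by
    intro T'' hT''
    refine F.mult_ext (X := N.ob X₁ X₂) fun t => ?_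
    refine N.induction (P := fun t => (F.mapMult T).L _ (F.map t) = T''.L _ (F.map t))
      (isClosed_eq (((F.mapMult T).continuous_L _).comp F.continuous_map)
        ((T''.continuous_L _).comp F.continuous_map)) (fun s t hs ht => ?_) (fun f g => ?_) t
    · rw [map_add, map_add, map_add, hs, ht]
    · rw [F.mapMult_L, hT, hT'']
  refine key T' fun f g => ?_
  have h1 := tensorFunctor_map_tmul h f g
  have h2 := hT' _ _ (J₁.map f) (J₂.map g)
  rw [J₁.mapMult_L, J₂.mapMult_L] at h2
  exact ((congrArg (T'.L _) h1).trans h2).trans (tensorFunctor_map_tmul h _ _).symm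

lemma hasSeqSums_tensorFunctor (h₁ : HasSeqSums J₁) (h₂ : HasSeqSums J₂) :
    HasSeqSums (tensorFunctor N M J₁ J₂ h) := fun X => by
  obtain ⟨A₁, j₁, hj₁⟩ := h₁ fun n => (X n).1
  obtain ⟨A₂, j₂, hj₂⟩ := h₂ fun n => (X n).2
  obtain ⟨j, hj⟩ := exists_isOrthFamily (M := M) hj₁ hj₂.isometry
  exact ⟨_, j, hj⟩

end TensorFunctor

variable (N) in
/-- The tensor product of inductive systems. -/
def tensorSystem (S : IndSystem D₁) (T : IndSystem D₂) : IndSystem N.cat :=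
  have hw := fun {i j : S.I × T.I} (h : i ≤ j) =>
    N.exists_isTensor (S.isometry h.1) (T.isometry h.2)
  { I := S.I × T.I
    instDirected := ⟨fun a b => by
      obtain ⟨c, hc, hc'⟩ := exists_ge_ge a.1 b.1
      obtain ⟨d, hd, hd'⟩ := exists_ge_ge a.2 b.2
      exact ⟨(c, d), ⟨hc, hd⟩, ⟨hc', hd'⟩⟩⟩
    X := fun i => N.ob (S.X i.1) (T.X i.2)
    ι := fun h => (hw h).choose
    isometry := fun h => (hw h).choose_spec.isIsometry (S.isometry h.1) (T.isometry h.2)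
    ι_refl := fun i => (hw (le_refl i)).choose_spec.unique (by
      rw [S.ι_refl, T.ι_refl]; exact IsTensor.id)
    ι_comp := fun h h' => ((hw h').choose_spec.comp (hw h).choose_spec).unique (by
      rw [S.ι_comp, T.ι_comp]
      exact (hw (h.trans h')).choose_spec) }

lemma tensorSystem_isTensor (S : IndSystem D₁) (T : IndSystem D₂) {i j : S.I × T.I} (h : i ≤ j) :
    N.IsTensor (S.ι h.1) (T.ι h.2) ((N.tensorSystem S T).ι (i := i) (j := j) h) :=
  (N.exists_isTensor (S.isometry h.1) (T.isometry h.2)).choose_spec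

/-- Every object of the target is a subobject of a direct limit of objects of the source. -/
def _root_.FullFunctor.IsIndDense {E : CStarCat.{u₁, v₁}} {W : CStarCat.{u₂, v₂}}
    (K : FullFunctor E W) : Prop :=
  ∀ X : W.Obj, ∃ (S : IndSystem E) (L : W.Obj) (c : ∀ i, Mult W (K.obj (S.X i)) L),
    IsLimitCone K S L c ∧ W.IsSubobject X L

/-- If each `X_i` embeds into a limit `L_i`, then `X₁ ⊗ X₂` embeds into `L₁ ⊗ L₂`, which is the
limit of the tensor system over the product of the index sets. -/
lemma isIndDense_tensorFunctor {J₁ : FullFunctor D₁ V₁} {J₂ : FullFunctor D₂ V₂}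
    (h : ∀ (X₁ Y₁ : D₁.Obj) (X₂ Y₂ : D₂.Obj) (t : D₁.Hom X₁ Y₁ ⊗[ℂ] D₂.Hom X₂ Y₂),
      ‖M.can _ _ _ _ (TensorProduct.map J₁.map J₂.map t)‖ = ‖N.can _ _ _ _ t‖)
    (h₁ : J₁.IsIndDense) (h₂ : J₂.IsIndDense) : (tensorFunctor N M J₁ J₂ h).IsIndDense := by
  intro X
  obtain ⟨X₁, X₂, rfl⟩ := M.exists_ob X
  obtain ⟨S, L₁, c, hc, m₁, hm₁⟩ := h₁ X₁
  obtain ⟨T, L₂, d, hd, m₂, hm₂⟩ := h₂ X₂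
  obtain ⟨m, hm⟩ := M.exists_isTensor hm₁ hm₂
  choose b hb using fun i : S.I × T.I => M.exists_isTensor (hc.isometry i.1) (hd.isometry i.2)
  have hbi : ∀ i, (b i).IsIsometry := fun i =>
    (hb i).isIsometry (hc.isometry i.1) (hd.isometry i.2)
  have ht : Tendsto (fun i : S.I × T.I => i.1) atTop atTop ∧
      Tendsto (fun i : S.I × T.I => i.2) atTop atTop := by
    rw [← Filter.prod_atTop_atTop_eq]
    exact ⟨tendsto_fst, tendsto_snd⟩
  refine ⟨N.tensorSystem S T, M.ob L₁ L₂, b, ⟨hbi, fun {i j : S.I × T.I} hij => ?_, ?_⟩, m,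
    hm.isIsometry hm₁ hm₂⟩
  · obtain ⟨w, hw⟩ := M.exists_isTensor (J₁.mapMult_isIsometry (S.isometry hij.1))
      (J₂.mapMult_isIsometry (T.isometry hij.2))
    have e : (tensorFunctor N M J₁ J₂ h).mapMult ((N.tensorSystem S T).ι (i := i) (j := j) hij) = w :=
      tensorFunctor_mapMult h (tensorSystem_isTensor S T hij) hw
    refine (congrArg (b j).comp e).trans (((hb j).comp hw).unique ?_)
    rw [hc.compat hij.1, hd.compat hij.2]
    exact hb i
  · refine tendsto_isTensor (fun i => (hb i).comp (hb i).adj)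
      (fun i Z t => (hbi i).isProjection.norm_L_le t) (fun Z f => ?_) (fun Z f => ?_)
    · exact (hc.tendsto Z f).comp ht.1
    · exact (hd.tendsto Z f).comp ht.2

end CrossNorm

end

noncomputable section

open UniformSpace

/-! ### Extension of representations from approximating full subcategories -/

/-- The full subcategory of a `*`-category on a family of objects. -/
abbrev StarCat.pull (A : StarCat.{u, v}) {O : Type u₁} (obj : O → A.Obj) : StarCat.{u₁, v} where
  Obj := O
  Hom X Y := A.Hom (obj X) (obj Y)
  comp := A.comp
  adj := A.adj
  assoc := A.assoc
  adj_adj := A.adj_adj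
  adj_comp := A.adj_comp

/-- A representation `ρ` of a full subcategory, approximate factorizations of all objects through
the subcategory, and finitely many vectors in the space of an object `P` of the subcategory. -/
structure StarCat.GNSData (A : StarCat.{u, v}) where
  O : Type u₁
  obj : O → A.Obj
  ρ : (A.pull obj).Rep
  I : A.Obj → Type
  l : ∀ X, Filter (I X)
  neBot : ∀ X, (l X).NeBot
  d : ∀ X, I X → O
  m : ∀ X (i : I X), A.Hom (obj (d X i)) X
  -- The elements `m_i m_i^*` are an approximate unit as seen by `ρ`, between objects of the
  -- subcategory.
  tendsto : ∀ {X : A.Obj} {Q Q' : O} (g : A.Hom X (obj Q')) (f : A.Hom (obj Q) X),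
    Tendsto (fun i => ρ.map (X := Q) (Y := Q')
      (A.comp g (A.comp (A.comp (m X i) (A.adj (m X i))) f))) (l X)
      (𝓝 (ρ.map (X := Q) (Y := Q') (A.comp g f)))
  -- Squares are included so that the approximate unit converges on formal vectors in norm and not
  -- only weakly.
  tendsto_sq : ∀ {X : A.Obj} {Q Q' : O} (g : A.Hom X (obj Q')) (f : A.Hom (obj Q) X),
    Tendsto (fun i => ρ.map (X := Q) (Y := Q')
      (A.comp g (A.comp (A.comp (m X i) (A.adj (m X i)))
        (A.comp (A.comp (m X i) (A.adj (m X i))) f)))) (l X)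
      (𝓝 (ρ.map (X := Q) (Y := Q') (A.comp g f)))
  -- The bound is uniform in `i` and `j`; it becomes a bound for the operator by which `t` acts.
  bdd : ∀ {X Y : A.Obj} (t : A.Hom X Y), ∃ C : ℝ, ∀ i j,
    ‖ρ.map (X := d X i) (Y := d Y j) (A.comp (A.adj (m Y j)) (A.comp t (m X i)))‖ ≤ C
  -- Finitely many vectors are treated at once, because a vector of an algebraic tensor product of
  -- Hilbert spaces involves finitely many from each factor.
  κ : Type v
  [instFintype : Fintype κ]
  P : O
  ξ : κ → ρ.H P

attribute [instance] StarCat.GNSData.instFintype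

namespace StarCat.GNSData

variable {A : StarCat.{u, v}} (D : A.GNSData)

instance (X : A.Obj) : (D.l X).NeBot := D.neBot X

/-- The action of the representation. -/
def r {Q Q' : D.O} : A.Hom (D.obj Q) (D.obj Q') →ₗ[ℂ] (D.ρ.H Q →L[ℂ] D.ρ.H Q') :=
  D.ρ.map (X := Q) (Y := Q')

lemma r_comp {Q Q' Q'' : D.O} (g : A.Hom (D.obj Q') (D.obj Q'')) (f : A.Hom (D.obj Q) (D.obj Q'))
    (ζ : D.ρ.H Q) : D.r (A.comp g f) ζ = D.r g (D.r f ζ) := by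
  have := D.ρ.map_comp (X := Q) (Y := Q') (Z := Q'') g f
  exact congrArg (fun T => T ζ) this

lemma inner_r {Q Q' : D.O} (f : A.Hom (D.obj Q) (D.obj Q')) (ζ : D.ρ.H Q) (η : D.ρ.H Q') :
    ⟪D.r (A.adj f) η, ζ⟫_ℂ = ⟪η, D.r f ζ⟫_ℂ := D.ρ.inner_map (X := Q) (Y := Q') f ζ η

lemma inner_r_left {Q Q' : D.O} (f : A.Hom (D.obj Q) (D.obj Q')) (ζ : D.ρ.H Q) (η : D.ρ.H Q') :
    ⟪D.r f ζ, η⟫_ℂ = ⟪ζ, D.r (A.adj f) η⟫_ℂ := by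
  rw [← D.inner_r, A.adj_adj]

/-- The space of formal vectors `∑ k, f_k ⊗ ξ_k`. -/
def Pre (X : A.Obj) : Type v := D.κ → A.Hom (D.obj D.P) X

instance (X : A.Obj) : AddCommGroup (D.Pre X) :=
  inferInstanceAs (AddCommGroup (D.κ → A.Hom (D.obj D.P) X))

instance (X : A.Obj) : Module ℂ (D.Pre X) :=
  inferInstanceAs (Module ℂ (D.κ → A.Hom (D.obj D.P) X))

variable {X Y Z : A.Obj}

/-- The inner product of formal vectors. -/
def form (f g : D.Pre X) : ℂ := ∑ k, ∑ l, ⟪D.ξ k, D.r (A.comp (A.adj (f k)) (g l)) (D.ξ l)⟫_ℂ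

/-- The vector obtained by mapping a formal vector to the space of an object of the subcategory. -/
def ev {Q : D.O} (a : A.Hom X (D.obj Q)) : D.Pre X →ₗ[ℂ] D.ρ.H Q where
  toFun f := ∑ k, D.r (A.comp a (f k)) (D.ξ k)
  map_add' f g := by
    rw [← Finset.sum_add_distrib]
    refine Finset.sum_congr rfl fun k _ => ?_
    have : (f + g) k = f k + g k := rfl
    rw [this, map_add, map_add, add_apply]
  map_smul' c f := by
    rw [RingHom.id_apply, Finset.smul_sum]
    refine Finset.sum_congr rfl fun k _ => ?_
    have : (c • f) k = c • f k := rfl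
    rw [this, map_smul, map_smul, smul_apply]

lemma ev_apply {Q : D.O} (a : A.Hom X (D.obj Q)) (f : D.Pre X) :
    D.ev a f = ∑ k, D.r (A.comp a (f k)) (D.ξ k) := rfl

lemma inner_ev {Q : D.O} (a : A.Hom X (D.obj Q)) (f g : D.Pre X) : ⟪D.ev a f, D.ev a g⟫_ℂ =
    ∑ k, ∑ l, ⟪D.ξ k, D.r (A.comp (A.adj (f k)) (A.comp (A.comp (A.adj a) a) (g l))) (D.ξ l)⟫_ℂ := by
  rw [ev_apply, ev_apply, sum_inner]
  refine Finset.sum_congr rfl fun k _ => ?_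
  rw [inner_sum]
  refine Finset.sum_congr rfl fun l _ => ?_
  rw [D.inner_r_left, ← D.r_comp, A.adj_comp, A.assoc, A.assoc]

/-- Source of positivity: the form is a limit of genuine inner products, of the vectors `m_i^* f` in
the spaces of `ρ`. All axioms of a semi-inner product follow by passing to the limit. -/
lemma tendsto_inner_ev (f g : D.Pre X) :
    Tendsto (fun i => ⟪D.ev (A.adj (D.m X i)) f, D.ev (A.adj (D.m X i)) g⟫_ℂ) (D.l X)
      (𝓝 (D.form f g)) := by
  simp only [inner_ev]
  refine tendsto_finsetSum _ fun k _ => tendsto_finsetSum _ fun l _ => ?_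
  refine tendsto_const_nhds.inner ?_
  have h := D.tendsto (A.adj (f k)) (g l)
  simp only [A.adj_adj]
  exact ((ContinuousLinearMap.apply ℂ _ (D.ξ l)).continuous.tendsto _).comp h

/-- The semi-inner product on formal vectors. -/
@[reducible]
def core (X : A.Obj) : PreInnerProductSpace.Core ℂ (D.Pre X) where
  inner f g := D.form f g
  conj_inner_symm f g := by
    refine tendsto_nhds_unique ?_ (D.tendsto_inner_ev f g)
    refine ((Complex.continuous_conj.tendsto _).comp (D.tendsto_inner_ev g f)).congr fun i => ?_
    exact inner_conj_symm _ _
  re_inner_nonneg f := by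
    refine ge_of_tendsto ((Complex.continuous_re.tendsto _).comp (D.tendsto_inner_ev f f))
      (Eventually.of_forall fun i => ?_)
    exact inner_self_nonneg (𝕜 := ℂ)
  add_left f g h := by
    refine tendsto_nhds_unique (D.tendsto_inner_ev _ _)
      (((D.tendsto_inner_ev f h).add (D.tendsto_inner_ev g h)).congr fun i => ?_)
    rw [map_add, inner_add_left]
  smul_left f g c := by
    refine tendsto_nhds_unique (D.tendsto_inner_ev _ _)
      (((D.tendsto_inner_ev f g).const_mul _).congr fun i => ?_)
    rw [map_smul, inner_smul_left]

instance (X : A.Obj) : SeminormedAddCommGroup (D.Pre X) :=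
  InnerProductSpace.Core.toSeminormedAddCommGroup (c := D.core X)

instance (X : A.Obj) : InnerProductSpace ℂ (D.Pre X) := InnerProductSpace.ofCore (D.core X)

lemma tendsto_norm_ev (f : D.Pre X) :
    Tendsto (fun i => ‖D.ev (A.adj (D.m X i)) f‖) (D.l X) (𝓝 ‖f‖) := by
  have h := (Complex.continuous_re.tendsto _).comp (D.tendsto_inner_ev f f)
  have h2 := (Real.continuous_sqrt.tendsto _).comp h
  have e : ‖f‖ = √(D.form f f).re := norm_eq_sqrt_re_inner (𝕜 := ℂ) f
  rw [e]
  refine h2.congr fun i => ?_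
  exact (norm_eq_sqrt_re_inner (𝕜 := ℂ) _).symm

/-- The action of morphisms on formal vectors. -/
def act (t : A.Hom X Y) : D.Pre X →ₗ[ℂ] D.Pre Y where
  toFun f := fun k => A.comp t (f k)
  map_add' f g := funext fun k => map_add (A.comp t) (f k) (g k)
  map_smul' c f := funext fun k => map_smul (A.comp t) c (f k)

lemma form_act (t : A.Hom X Y) (f : D.Pre Y) (g : D.Pre X) :
    D.form (D.act (A.adj t) f) g = D.form f (D.act t g) := by
  refine Finset.sum_congr rfl fun k _ => Finset.sum_congr rfl fun l _ => ?_
  change ⟪_, D.r (A.comp (A.adj (A.comp (A.adj t) (f k))) _) _⟫_ℂ =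
    ⟪_, D.r (A.comp _ (A.comp t (g l))) _⟫_ℂ
  rw [A.adj_comp, A.adj_adj, A.assoc]

lemma tendsto_ev_act {Q : D.O} (a : A.Hom X (D.obj Q)) (f : D.Pre X) :
    Tendsto (fun i => D.ev a (D.act (A.comp (D.m X i) (A.adj (D.m X i))) f)) (D.l X)
      (𝓝 (D.ev a f)) :=
  tendsto_finsetSum _ fun k _ =>
    ((ContinuousLinearMap.apply ℂ _ (D.ξ k)).continuous.tendsto _).comp (D.tendsto a (f k))

/-- `‖t f‖` is the limit over `j` of `‖m_j^* t f‖`, which is the limit over `i` of `‖(m_j^* t m_i)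
(m_i^* f)‖`. The compressions of `t` are uniformly bounded, and `‖m_i^* f‖` tends to `‖f‖`. -/
lemma exists_norm_act_le (t : A.Hom X Y) : ∃ C, ∀ f, ‖D.act t f‖ ≤ C * ‖f‖ := by
  obtain ⟨C, hC⟩ := D.bdd t
  refine ⟨C, fun f => le_of_tendsto (D.tendsto_norm_ev _) (Eventually.of_forall fun j => ?_)⟩
  have h1 : Tendsto (fun i => ‖D.ev (A.comp (A.adj (D.m Y j)) t)
      (D.act (A.comp (D.m X i) (A.adj (D.m X i))) f)‖) (D.l X)
      (𝓝 ‖D.ev (A.comp (A.adj (D.m Y j)) t) f‖) := (D.tendsto_ev_act _ f).norm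
  have e1 : D.ev (A.adj (D.m Y j)) (D.act t f) = D.ev (A.comp (A.adj (D.m Y j)) t) f :=
    Finset.sum_congr rfl fun k _ => by rw [A.assoc]; rfl
  rw [e1]
  refine le_of_tendsto_of_tendsto h1 ((D.tendsto_norm_ev f).const_mul C)
    (Eventually.of_forall fun i => ?_)
  have e2 : D.ev (A.comp (A.adj (D.m Y j)) t) (D.act (A.comp (D.m X i) (A.adj (D.m X i))) f) =
      D.r (A.comp (A.adj (D.m Y j)) (A.comp t (D.m X i))) (D.ev (A.adj (D.m X i)) f) := by
    rw [ev_apply, ev_apply, map_sum]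
    refine Finset.sum_congr rfl fun k _ => ?_
    rw [← D.r_comp]
    change D.r (A.comp _ (A.comp _ (f k))) _ = _
    simp only [A.assoc]
  change ‖D.ev _ _‖ ≤ C * ‖D.ev _ _‖
  rw [e2]
  exact (ContinuousLinearMap.le_opNorm _ _).trans
    (mul_le_mul_of_nonneg_right (hC i j) (norm_nonneg _))

/-- With `u = m_i m_i^*` self-adjoint, `‖u f - f‖ ^ 2 = ⟪f, u² f⟫ - 2 Re ⟪f, u f⟫ + ⟪f, f⟫`, and
both pairings tend to `⟪f, f⟫`. This is what makes the extension nondegenerate. -/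
lemma tendsto_act (f : D.Pre X) :
    Tendsto (fun i => D.act (A.comp (D.m X i) (A.adj (D.m X i))) f) (D.l X) (𝓝 f) := by
  have hs : ∀ i, A.adj (A.comp (D.m X i) (A.adj (D.m X i))) =
      A.comp (D.m X i) (A.adj (D.m X i)) := fun i => by rw [A.adj_comp, A.adj_adj]
  have h1 : Tendsto (fun i => D.form f (D.act (A.comp (D.m X i) (A.adj (D.m X i))) f)) (D.l X)
      (𝓝 (D.form f f)) :=
    tendsto_finsetSum _ fun k _ => tendsto_finsetSum _ fun l _ => tendsto_const_nhds.inner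
      (((ContinuousLinearMap.apply ℂ _ (D.ξ l)).continuous.tendsto _).comp
        (D.tendsto (A.adj (f k)) (f l)))
  have h2 : Tendsto (fun i => D.form f (D.act (A.comp (D.m X i) (A.adj (D.m X i)))
      (D.act (A.comp (D.m X i) (A.adj (D.m X i))) f))) (D.l X) (𝓝 (D.form f f)) :=
    tendsto_finsetSum _ fun k _ => tendsto_finsetSum _ fun l _ => tendsto_const_nhds.inner
      (((ContinuousLinearMap.apply ℂ _ (D.ξ l)).continuous.tendsto _).comp
        (D.tendsto_sq (A.adj (f k)) (f l)))
  rw [tendsto_iff_norm_sub_tendsto_zero]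
  have h3 : Tendsto (fun i => ‖D.act (A.comp (D.m X i) (A.adj (D.m X i))) f - f‖ ^ 2) (D.l X)
      (𝓝 0) := by
    have h4 := (((Complex.continuous_re.tendsto _).comp h2).sub
      (((Complex.continuous_re.tendsto _).comp h1).const_mul 2)).add_const (D.form f f).re
    refine (h4.congr fun i => ?_).trans_eq (by congr 1; ring)
    rw [← norm_sub_rev, norm_sub_sq (𝕜 := ℂ), ← inner_self_eq_norm_sq (𝕜 := ℂ) f,
      ← inner_self_eq_norm_sq (𝕜 := ℂ) (D.act _ f)]
    have h5 : ⟪D.act (A.comp (D.m X i) (A.adj (D.m X i))) f,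
        D.act (A.comp (D.m X i) (A.adj (D.m X i))) f⟫_ℂ =
        D.form f (D.act (A.comp (D.m X i) (A.adj (D.m X i)))
          (D.act (A.comp (D.m X i) (A.adj (D.m X i))) f)) := by
      rw [← D.form_act, hs]
      rfl
    rw [h5]
    change (D.form _ _).re - 2 * (D.form _ _).re + (D.form f f).re =
      (D.form f f).re - 2 * (D.form _ _).re + (D.form _ _).re
    ring
  have h4 := (Real.continuous_sqrt.tendsto _).comp h3
  rw [Real.sqrt_zero] at h4
  exact h4.congr fun i => Real.sqrt_sq (norm_nonneg _)

/-- The action of a morphism as a bounded operator. -/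
def actL (t : A.Hom X Y) : D.Pre X →L[ℂ] D.Pre Y :=
  (D.act t).mkContinuousOfExistsBound (D.exists_norm_act_le t)

/-- The extended representation. -/
def rep : A.Rep where
  H X := Completion (D.Pre X)
  map {X Y} :=
    { toFun := fun t => (D.actL t).completion
      map_add' := fun s t => by
        refine ContinuousLinearMap.ext fun x => ?_
        refine Completion.induction_on
          (p := fun x => (D.actL (s + t)).completion x =
            ((D.actL s).completion + (D.actL t).completion) x) x
          (isClosed_eq (ContinuousLinearMap.continuous _) (ContinuousLinearMap.continuous _))
          (fun x => ?_)
        rw [add_apply, ContinuousLinearMap.completion_apply_coe,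
          ContinuousLinearMap.completion_apply_coe, ContinuousLinearMap.completion_apply_coe,
          ← Completion.coe_add]
        exact congrArg _ (funext fun k => LinearMap.map_add₂ A.comp s t (x k))
      map_smul' := fun c t => by
        refine ContinuousLinearMap.ext fun x => ?_
        refine Completion.induction_on
          (p := fun x => (D.actL (c • t)).completion x = (c • (D.actL t).completion) x) x
          (isClosed_eq (ContinuousLinearMap.continuous _) (ContinuousLinearMap.continuous _))
          (fun x => ?_)
        rw [smul_apply, ContinuousLinearMap.completion_apply_coe,
          ContinuousLinearMap.completion_apply_coe, ← Completion.coe_smul]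
        exact congrArg _ (funext fun k => LinearMap.map_smul₂ A.comp c t (x k)) }
  map_comp {X Y Z} g f := by
    refine ContinuousLinearMap.ext fun x => ?_
    refine Completion.induction_on
      (p := fun x => (D.actL (A.comp g f)).completion x =
        ((D.actL g).completion.comp (D.actL f).completion) x) x
      (isClosed_eq (ContinuousLinearMap.continuous _) (ContinuousLinearMap.continuous _))
      (fun x => ?_)
    rw [ContinuousLinearMap.comp_apply, ContinuousLinearMap.completion_apply_coe,
      ContinuousLinearMap.completion_apply_coe, ContinuousLinearMap.completion_apply_coe]
    exact congrArg _ (funext fun k => A.assoc g f (x k))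
  map_adj {X Y} f := by
    change (D.actL (A.adj f)).completion = ContinuousLinearMap.adjoint (D.actL f).completion
    rw [ContinuousLinearMap.eq_adjoint_iff]
    intro x y
    refine Completion.induction_on₂
      (p := fun x y => ⟪(D.actL (A.adj f)).completion x, y⟫_ℂ =
        ⟪x, (D.actL f).completion y⟫_ℂ) x y
      (isClosed_eq
        (((ContinuousLinearMap.continuous _).comp continuous_fst).inner continuous_snd)
        (continuous_fst.inner ((ContinuousLinearMap.continuous _).comp continuous_snd)))
      (fun x y => ?_)
    rw [ContinuousLinearMap.completion_apply_coe, ContinuousLinearMap.completion_apply_coe,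
      Completion.inner_coe, Completion.inner_coe]
    exact D.form_act f x y

/-- The vector of the extended representation given by a formal vector. -/
def toRep (f : D.Pre X) : D.rep.H X := (f : Completion (D.Pre X))

lemma continuous_toRep : Continuous (D.toRep (X := X)) := Completion.continuous_coe (D.Pre X)

lemma rep_induction {p : D.rep.H X → Prop} (hc : IsClosed {x | p x}) (h : ∀ f, p (D.toRep f))
    (x : D.rep.H X) : p x := Completion.induction_on (α := D.Pre X) x hc h

lemma rep_map_coe (t : A.Hom X Y) (f : D.Pre X) :
    D.rep.map t (D.toRep f) = D.toRep (D.act t f) :=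
  ContinuousLinearMap.completion_apply_coe (D.actL t) f

lemma rep_nondegenerate : D.rep.Nondegenerate := by
  intro X
  rw [eq_top_iff]
  rintro x -
  refine D.rep_induction (p := fun x => x ∈ (Submodule.span ℂ
    {η : D.rep.H X | ∃ (f : A.Hom X X) (ξ : D.rep.H X), D.rep.map f ξ = η}).topologicalClosure)
    (Submodule.isClosed_topologicalClosure _) (fun f => ?_) x
  exact mem_closure_of_tendsto ((D.continuous_toRep.tendsto f).comp (D.tendsto_act f))
    (Eventually.of_forall fun i => Submodule.subset_span
      ⟨A.comp (D.m X i) (A.adj (D.m X i)), D.toRep f, D.rep_map_coe _ f⟩)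

/-- The vectors of the original representation corresponding to formal vectors. -/
def toH (Q : D.O) : D.Pre (D.obj Q) →ₗ[ℂ] D.ρ.H Q where
  toFun f := ∑ k, D.r (f k) (D.ξ k)
  map_add' f g := by
    rw [← Finset.sum_add_distrib]
    refine Finset.sum_congr rfl fun k _ => ?_
    have : (f + g) k = f k + g k := rfl
    rw [this, map_add, add_apply]
  map_smul' c f := by
    rw [RingHom.id_apply, Finset.smul_sum]
    refine Finset.sum_congr rfl fun k _ => ?_
    have : (c • f) k = c • f k := rfl
    rw [this, map_smul, smul_apply]

lemma toH_apply {Q : D.O} (f : D.Pre (D.obj Q)) : D.toH Q f = ∑ k, D.r (f k) (D.ξ k) := rfl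

/-- Over an object of the subcategory the form is the inner product of the vectors `∑ ρ(f_k) ξ_k`.
Hence the restricted extension embeds isometrically into `ρ`. -/
lemma norm_toH {Q : D.O} (f : D.Pre (D.obj Q)) : ‖D.toH Q f‖ = ‖f‖ := by
  have h : ⟪D.toH Q f, D.toH Q f⟫_ℂ = ⟪f, f⟫_ℂ := by
    rw [toH_apply, sum_inner]
    refine Finset.sum_congr rfl fun k _ => ?_
    rw [inner_sum]
    refine Finset.sum_congr rfl fun l _ => ?_
    rw [D.inner_r_left, ← D.r_comp]
  rw [norm_eq_sqrt_re_inner (𝕜 := ℂ), norm_eq_sqrt_re_inner (𝕜 := ℂ), h]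

/-- The isometry to the original representation. -/
def isom (Q : D.O) : D.rep.H (D.obj Q) →ₗᵢ[ℂ] D.ρ.H Q where
  toLinearMap := (ContinuousLinearMap.fromCompletion ((D.toH Q).mkContinuous 1
    fun f => by rw [one_mul, norm_toH])).toLinearMap
  norm_map' x := by
    refine Completion.induction_on (p := fun x => ‖ContinuousLinearMap.fromCompletion
      ((D.toH Q).mkContinuous 1 fun f => by rw [one_mul, norm_toH]) x‖ = ‖x‖) x
      (isClosed_eq (ContinuousLinearMap.continuous _).norm continuous_norm) fun f => ?_
    rw [ContinuousLinearMap.fromCompletion_apply_coe, Completion.norm_coe]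
    exact D.norm_toH f

lemma isom_toRep {Q : D.O} (f : D.Pre (D.obj Q)) : D.isom Q (D.toRep f) = D.toH Q f :=
  ContinuousLinearMap.fromCompletion_apply_coe ((D.toH Q).mkContinuous 1
    fun f => by rw [one_mul, norm_toH]) f

lemma isom_map {Q Q' : D.O} (t : A.Hom (D.obj Q) (D.obj Q')) (η : D.rep.H (D.obj Q)) :
    D.isom Q' (D.rep.map t η) = D.r t (D.isom Q η) := by
  refine D.rep_induction (p := fun η => D.isom Q' (D.rep.map t η) = D.r t (D.isom Q η))
    (isClosed_eq ((D.isom Q').continuous.comp (ContinuousLinearMap.continuous _))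
      ((ContinuousLinearMap.continuous _).comp (D.isom Q).continuous)) (fun f => ?_) η
  rw [D.isom_toRep, D.rep_map_coe, D.isom_toRep, toH_apply, toH_apply, map_sum]
  exact Finset.sum_congr rfl fun k _ => D.r_comp t (f k) (D.ξ k)

open Classical in
lemma exists_isom_eq (k : D.κ) (e : A.Hom (D.obj D.P) (D.obj D.P)) :
    ∃ η, D.isom D.P η = D.r e (D.ξ k) := by
  let s : D.κ → A.Hom (D.obj D.P) (D.obj D.P) :=
    fun l => if l = k then e else 0
  refine ⟨D.toRep s, (D.isom_toRep s).trans ?_⟩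
  change ∑ l, D.r (s l) (D.ξ l) = _
  have hs : s k = e := if_pos rfl
  rw [Finset.sum_eq_single k (fun l _ h => ?_) (by simp), hs]
  have : s l = 0 := if_neg h
  rw [this, map_zero, zero_apply]

/-- The morphism `e` acts as an identity on the `ξ k`, so each `ξ k` is the image of the formal
vector `e ⊗ ξ k`. Norms computed on these vectors in `ρ` are thus seen by a nondegenerate
representation of the whole category. -/
lemma exists_rep (e : A.Hom (D.obj D.P) (D.obj D.P)) (he : ∀ k, D.r e (D.ξ k) = D.ξ k) :
    ∃ σ : A.Rep, σ.Nondegenerate ∧ ∃ w : ∀ Q, σ.H (D.obj Q) →ₗᵢ[ℂ] D.ρ.H Q,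
      (∀ Q Q' (t : A.Hom (D.obj Q) (D.obj Q')) η, w Q' (σ.map t η) = D.r t (w Q η)) ∧
        ∀ k, ∃ η, w D.P η = D.ξ k :=
  ⟨D.rep, D.rep_nondegenerate, D.isom, fun _ _ t η => D.isom_map t η, fun k => by
    rw [← he]; exact D.exists_isom_eq k e⟩

end StarCat.GNSData

end

noncomputable section

open CStarCat

/-! ### Boundedness of representations -/

/-- `π e` fixes all vectors `π f ξ`, and these span a dense subspace. -/
lemma StarCat.Rep.map_eq_of_nondegenerate {A : StarCat.{u, v}} {π : A.Rep} (hπ : π.Nondegenerate)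
    {X : A.Obj} {e : A.Hom X X} (he : ∀ f : A.Hom X X, A.comp e f = f) (ζ : π.H X) :
    π.map e ζ = ζ := by
  have h : (Submodule.span ℂ {η : π.H X | ∃ (f : A.Hom X X) (ξ : π.H X),
      π.map f ξ = η}).topologicalClosure ≤
      LinearMap.eqLocus (π.map e : π.H X →ₗ[ℂ] π.H X) LinearMap.id := by
    refine Submodule.topologicalClosure_minimal _ (Submodule.span_le.2 ?_)
      (isClosed_eq (π.map e).continuous continuous_id)
    rintro _ ⟨f, ξ, rfl⟩
    change π.map e (π.map f ξ) = π.map f ξ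
    rw [← ContinuousLinearMap.comp_apply, ← π.map_comp, he]
  rw [hπ X] at h
  exact h (x := ζ) trivial

/-- On endomorphisms this is contractivity of `*`-homomorphisms of `C^*`-algebras; the general case
follows by passing to `f^* f`. -/
lemma CStarCat.norm_rep_map_le {V : CStarCat.{u, v}} (π : V.toStarCat.Rep) {X Y : V.Obj}
    (f : V.Hom X Y) : ‖π.map (X := X) (Y := Y) f‖ ≤ ‖f‖ := by
  let φ : V.End X →⋆ₙₐ[ℂ] (π.H X →L[ℂ] π.H X) :=
    { toFun := fun a => π.map (X := X) (Y := X) a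
      map_smul' := fun c a => map_smul (π.map (X := X) (Y := X)) c a
      map_zero' := map_zero (π.map (X := X) (Y := X))
      map_add' := fun a b => map_add (π.map (X := X) (Y := X)) a b
      map_mul' := fun a b => π.map_comp (X := X) (Y := X) (Z := X) a b
      map_star' := fun a => π.map_adj (X := X) (Y := X) a }
  let x : V.End X := V.comp (V.adj f) f
  have h1 : ‖π.map (X := X) (Y := X) (V.comp (V.adj f) f)‖ ≤ ‖V.comp (V.adj f) f‖ :=
    NonUnitalStarAlgHom.norm_apply_le φ x
  have h2 := π.norm_map_sq (X := X) (Y := Y) f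
  rw [V.norm_adj_comp_self] at h1
  exact (pow_le_pow_iff_left₀ (norm_nonneg _) (norm_nonneg _) two_ne_zero).1 (h2.symm.trans_le h1)

section

variable {V₁ : CStarCat.{u₁, v}} {V₂ : CStarCat.{u₂, v}}

lemma algTensor.norm_map_tmul_le (π : (algTensor V₁ V₂).Rep) {X Y : (algTensor V₁ V₂).Obj}
    (f : V₁.Hom X.1 Y.1) (g : V₂.Hom X.2 Y.2) :
    ‖π.map (X := X) (Y := Y) (f ⊗ₜ[ℂ] g)‖ ≤ ‖f‖ * ‖g‖ := by
  rcases (norm_nonneg f).eq_or_lt with hf | hf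
  · rw [norm_eq_zero.1 hf.symm, TensorProduct.zero_tmul, map_zero]; simp
  rcases (norm_nonneg g).eq_or_lt with hg | hg
  · rw [norm_eq_zero.1 hg.symm, TensorProduct.tmul_zero, map_zero]; simp
  have h := norm_map_tmul_le_one π (X := X) (Y := Y) ((‖f‖ : ℂ)⁻¹ • f) ((‖g‖ : ℂ)⁻¹ • g)
    (by rw [norm_smul, norm_inv, Complex.norm_real, norm_norm, inv_mul_cancel₀ hf.ne'])
    (by rw [norm_smul, norm_inv, Complex.norm_real, norm_norm, inv_mul_cancel₀ hg.ne'])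
  rw [TensorProduct.smul_tmul_smul] at h
  have h' : ‖((‖f‖ : ℂ)⁻¹ * (‖g‖ : ℂ)⁻¹) • π.map (X := X) (Y := Y) (f ⊗ₜ[ℂ] g)‖ ≤ 1 := by
    rw [← map_smul]; exact h
  rw [norm_smul, norm_mul, norm_inv, norm_inv, Complex.norm_real, Complex.norm_real, norm_norm,
    norm_norm, ← mul_inv, inv_mul_le_one₀ (by positivity)] at h'
  exact h'

lemma algTensor.continuous_map_tmul (π : (algTensor V₁ V₂).Rep) (X Y : (algTensor V₁ V₂).Obj) :
    Continuous fun p : V₁.Hom X.1 Y.1 × V₂.Hom X.2 Y.2 =>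
      π.map (X := X) (Y := Y) (p.1 ⊗ₜ[ℂ] p.2) := by
  let B := LinearMap.mkContinuous₂ ((TensorProduct.mk ℂ (V₁.Hom X.1 Y.1) (V₂.Hom X.2 Y.2)).compr₂
    (π.map (X := X) (Y := Y))) 1 (fun f g => by
      rw [one_mul]; exact norm_map_tmul_le π (X := X) (Y := Y) f g)
  exact B.continuous₂

/-- The maximal `C^*`-norm. -/
def CrossNorm.max (V₁ : CStarCat.{u₁, v}) (V₂ : CStarCat.{u₂, v}) : CrossNorm V₁ V₂ where
  p := StarCat.famSeminorm (A := algTensor V₁ V₂)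
    (S := fun π : {π : (algTensor V₁ V₂).Rep // π.Nondegenerate} => π.1) (algTensor.famBdd _)
  isCStar := StarCat.famSeminorm_isCStar _
  isPositive := StarCat.famSeminorm_isPositive _
  cross {X Y} f g := Real.iSup_le (fun π => algTensor.norm_map_tmul_le π.1 (X := X) (Y := Y) f g)
    (by positivity)

/-- The minimal `C^*`-norm. -/
def CrossNorm.min (V₁ : CStarCat.{u₁, v}) (V₂ : CStarCat.{u₂, v}) : CrossNorm V₁ V₂ where
  p := StarCat.famSeminorm (A := algTensor V₁ V₂)
    (S := fun π : {π : V₁.toStarCat.Rep // π.Nondegenerate} ×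
      {π : V₂.toStarCat.Rep // π.Nondegenerate} => tensorRep π.1.1 π.2.1) (algTensor.famBdd _)
  isCStar := StarCat.famSeminorm_isCStar _
  isPositive := StarCat.famSeminorm_isPositive _
  cross {X Y} f g := Real.iSup_le (fun π => algTensor.norm_map_tmul_le _ (X := X) (Y := Y) f g)
    (by positivity)

lemma maxTensor_eq (V₁ : CStarCat.{u₁, v}) (V₂ : CStarCat.{u₂, v}) :
    maxTensor V₁ V₂ = Split (CrossNorm.max V₁ V₂).cat := rfl

lemma minTensor_eq (V₁ : CStarCat.{u₁, v}) (V₂ : CStarCat.{u₂, v}) :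
    minTensor V₁ V₂ = Split (CrossNorm.min V₁ V₂).cat := rfl

end

/-! ### Approximate factorizations -/

/-- Approximate factorizations of all objects through a full subcategory. -/
structure FullFunctor.Approx {D : CStarCat.{u₁, v₁}} {V : CStarCat.{u₂, v₂}} (J : FullFunctor D V) where
  I : V.Obj → Type
  l : ∀ X, Filter (I X)
  neBot : ∀ X, (l X).NeBot
  d : ∀ X, I X → D.Obj
  m : ∀ X (i : I X), V.Hom (J.obj (d X i)) X
  norm_le : ∀ X i, ‖m X i‖ ≤ 1
  tendsto : ∀ X Z (f : V.Hom Z X),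
    Tendsto (fun i => V.comp (V.comp (m X i) (V.adj (m X i))) f) (l X) (𝓝 f)

lemma CStarCat.IsId.norm_le {V : CStarCat.{u, v}} {X : V.Obj} {e : V.Hom X X} (he : IsId e) :
    ‖e‖ ≤ 1 := by
  have h := V.norm_adj_comp_self e
  rw [he.1] at h
  rw [V.norm_adj] at h
  nlinarith [norm_nonneg e, sq_nonneg (‖e‖ - 1)]

/-- If `s : X → L` embeds `X` into a limit with cone maps `c_i`, take `m_i = s^* c_i`, made into a
morphism by the identity of the `i`-th term. Then `m_i m_i^* = s^* c_i c_i^* s` tends strictly to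
`s^* s = 1`. -/
lemma FullFunctor.IsIndDense.nonempty_approx {D : CStarCat.{u₁, v₁}} {V : CStarCat.{u₂, v₂}}
    {J : FullFunctor D V} (hJ : J.IsIndDense) (hD : D.Unital) : Nonempty J.Approx := by
  choose e he using hD
  choose S L c hc s hs using hJ
  have hid : ∀ X, IsId (J.map (e X)) := fun X => J.map_isId (he X)
  have hL : ∀ X i Z (f : V.Hom Z X), V.comp (V.comp ((s X).adj.L _ ((c X i).L _ (J.map (e _))))
      (V.adj ((s X).adj.L _ ((c X i).L _ (J.map (e _)))))) f =
      (s X).adj.L _ (((c X i).comp (c X i).adj).L _ ((s X).L _ f)) := by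
    intro X i Z f
    rw [V.assoc, ← Mult.L_comp, ← Mult.L_comp, Mult.adj_of_L, Mult.adj_of_L, (hid _).adj_eq,
      Mult.adj_adj, ← Mult.comp_L, ← Mult.comp_L, ← V.assoc, (hid _).1, (hid _).2]
    rfl
  refine ⟨⟨fun X => (S X).I, fun X => atTop, fun X => inferInstance, fun X i => (S X).X i,
    fun X i => (s X).adj.L _ ((c X i).L _ (J.map (e _))), fun X i => ?_, fun X Z f => ?_⟩⟩
  · refine ((hs X).norm_adj_L_le _).trans ?_
    rw [((hc X).isometry i).norm_L]
    exact (hid _).norm_le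
  · simp only [hL]
    have h := (((s X).adj.continuous_L Z).tendsto _).comp ((hc X).tendsto Z ((s X).L _ f))
    rwa [← Mult.comp_L_apply, hs X, Mult.id_L] at h

namespace FullFunctor.Approx

variable {D : CStarCat.{u₁, v₁}} {V : CStarCat.{u₂, v₂}} {J : FullFunctor D V} (a : J.Approx)

instance (X : V.Obj) : (a.l X).NeBot := a.neBot X

/-- The approximate unit `m ∘ m^*`. -/
def u (X : V.Obj) (i : a.I X) : V.Hom X X := V.comp (a.m X i) (V.adj (a.m X i))

lemma norm_u_le (X : V.Obj) (i : a.I X) : ‖a.u X i‖ ≤ 1 := by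
  refine (V.norm_comp_le _ _).trans ?_
  rw [V.norm_adj]
  nlinarith [a.norm_le X i, norm_nonneg (a.m X i)]

lemma tendsto_sq {X Z : V.Obj} (f : V.Hom Z X) :
    Tendsto (fun i => V.comp (a.u X i) (V.comp (a.u X i) f)) (a.l X) (𝓝 f) := by
  have h0 : Tendsto (fun i => ‖V.comp (a.u X i) f - f‖) (a.l X) (𝓝 0) :=
    tendsto_iff_norm_sub_tendsto_zero.1 (a.tendsto X Z f)
  rw [tendsto_iff_norm_sub_tendsto_zero]
  have h1 := h0.add h0
  rw [add_zero] at h1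
  refine squeeze_zero (fun _ => norm_nonneg _) (fun i => ?_) h1
  have e : V.comp (a.u X i) (V.comp (a.u X i) f) - f =
      V.comp (a.u X i) (V.comp (a.u X i) f - f) + (V.comp (a.u X i) f - f) := by
    rw [comp_sub]; abel
  rw [e]
  refine (norm_add_le _ _).trans (add_le_add ?_ le_rfl)
  exact (V.norm_comp_le _ _).trans (mul_le_of_le_one_left (norm_nonneg _) (a.norm_u_le X i))

lemma norm_conj_le {X Y : V.Obj} (t : V.Hom X Y) (i : a.I X) (j : a.I Y) :
    ‖V.comp (V.adj (a.m Y j)) (V.comp t (a.m X i))‖ ≤ ‖t‖ := by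
  refine (V.norm_comp_le _ _).trans ?_
  rw [V.norm_adj]
  refine (mul_le_of_le_one_left (norm_nonneg _) (a.norm_le Y j)).trans ?_
  exact (V.norm_comp_le _ _).trans (mul_le_of_le_one_right (norm_nonneg _) (a.norm_le X i))

end FullFunctor.Approx

end

noncomputable section

open CStarCat

/-! ### Comparison of the tensor norms of full subcategories -/

/-- Restriction of a representation along a `*`-functor. -/
abbrev StarCat.Rep.comap {A : StarCat.{u, v}} {B : StarCat.{u₁, v}} (π : A.Rep)
    (obj : B.Obj → A.Obj) (φ : ∀ {X Y : B.Obj}, B.Hom X Y →ₗ[ℂ] A.Hom (obj X) (obj Y))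
    (hc : ∀ {X Y Z : B.Obj} (g : B.Hom Y Z) (f : B.Hom X Y), φ (B.comp g f) = A.comp (φ g) (φ f))
    (ha : ∀ {X Y : B.Obj} (f : B.Hom X Y), φ (B.adj f) = A.adj (φ f)) : B.Rep where
  H X := π.H (obj X)
  map := π.map ∘ₗ φ
  map_comp g f := by rw [LinearMap.comp_apply, hc, π.map_comp]; rfl
  map_adj f := by rw [LinearMap.comp_apply, ha, π.map_adj]; rfl

lemma StarCat.Rep.comap_nondegenerate {A : StarCat.{u, v}} {B : StarCat.{u₁, v}} {π : A.Rep}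
    (hπ : π.Nondegenerate)
    (obj : B.Obj → A.Obj) (φ : ∀ {X Y : B.Obj}, B.Hom X Y →ₗ[ℂ] A.Hom (obj X) (obj Y))
    (hc : ∀ {X Y Z : B.Obj} (g : B.Hom Y Z) (f : B.Hom X Y), φ (B.comp g f) = A.comp (φ g) (φ f))
    (ha : ∀ {X Y : B.Obj} (f : B.Hom X Y), φ (B.adj f) = A.adj (φ f))
    (hs : ∀ X : B.Obj, Function.Surjective (φ (X := X) (Y := X))) :
    (π.comap obj φ hc ha).Nondegenerate := fun X => by
  rw [← hπ (obj X)]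
  congr 2
  ext η
  constructor
  · rintro ⟨f, ξ, h⟩
    exact ⟨φ f, ξ, h⟩
  · rintro ⟨f, ξ, h⟩
    obtain ⟨f, rfl⟩ := hs X f
    exact ⟨f, ξ, h⟩

namespace FullFunctor.Approx

section Single

variable {D : CStarCat.{u₁, v}} {V : CStarCat.{u₂, v}} {J : FullFunctor D V}

lemma continuous_rep (π : D.toStarCat.Rep) {Q Q' : D.Obj} :
    Continuous fun f : V.Hom (J.obj Q) (J.obj Q') => π.map (X := Q) (Y := Q') (J.inv f) :=
  ((π.map (X := Q) (Y := Q')).mkContinuous 1 fun f => by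
    rw [one_mul]; exact norm_rep_map_le π f).continuous.comp J.continuous_inv

/-- The data for extending a representation. -/
def gnsData (a : J.Approx) (π : D.toStarCat.Rep) {κ : Type v} [Fintype κ] {P : D.Obj} (ξ : κ → π.H P) :
    V.toStarCat.GNSData where
  O := D.Obj
  obj := J.obj
  ρ := π.comap (B := V.toStarCat.pull J.obj) (fun Q => Q) (fun {X Y} => J.inv (X := X) (Y := Y))
    (fun g f => J.inv_comp g f) (fun f => J.inv_adj f)
  I := a.I
  l := a.l
  neBot := a.neBot
  d := a.d
  m := a.m
  tendsto {X _ _} g f := ((continuous_rep π).tendsto _).comp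
    (((continuous_comp_left g).tendsto _).comp (a.tendsto X _ f))
  tendsto_sq g f := ((continuous_rep π).tendsto _).comp
    (((continuous_comp_left g).tendsto _).comp (a.tendsto_sq f))
  bdd {_ _} t := ⟨‖t‖, fun i j => (norm_rep_map_le π _).trans
    ((J.norm_inv _).trans_le (a.norm_conj_le t i j))⟩
  κ := κ
  P := P
  ξ := ξ

lemma exists_rep (a : J.Approx) (hD : D.Unital) {π : D.toStarCat.Rep} (hπ : π.Nondegenerate) {κ : Type v}
    [Fintype κ] {P : D.Obj} (ξ : κ → π.H P) :
    ∃ σ : V.toStarCat.Rep, σ.Nondegenerate ∧ ∃ w : ∀ Q, σ.H (J.obj Q) →ₗᵢ[ℂ] π.H Q,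
      (∀ Q Q' (t : D.Hom Q Q') η,
        w Q' (σ.map (X := J.obj Q) (Y := J.obj Q') (J.map t) η) =
          π.map (X := Q) (Y := Q') t (w Q η)) ∧ ∀ k, ∃ η, w P η = ξ k := by
  obtain ⟨e, he⟩ := hD P
  have he' : ∀ ζ : π.H P, π.map (X := P) (Y := P) (J.inv (J.map e)) ζ = ζ := fun ζ => by
    rw [J.inv_map]
    exact StarCat.Rep.map_eq_of_nondegenerate hπ (fun f => he.2 _ f) _
  obtain ⟨σ, hσ, w, hw, hk⟩ : ∃ σ : V.toStarCat.Rep, σ.Nondegenerate ∧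
      ∃ w : ∀ Q, σ.H (J.obj Q) →ₗᵢ[ℂ] π.H Q,
      (∀ Q Q' (t : V.Hom (J.obj Q) (J.obj Q')) η,
        w Q' (σ.map (X := J.obj Q) (Y := J.obj Q') t η) =
          π.map (X := Q) (Y := Q') (J.inv t) (w Q η)) ∧ ∀ k, ∃ η, w P η = ξ k :=
    (a.gnsData π ξ).exists_rep (J.map e) fun k => he' (ξ k)
  exact ⟨σ, hσ, w, fun Q Q' t η => by rw [hw, J.inv_map], hk⟩

end Single

section Pair

variable {D₁ : CStarCat.{u, v}} {D₂ : CStarCat.{v₁, v}} {V₁ : CStarCat.{u₁, v}}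
  {V₂ : CStarCat.{u₂, v}} {J₁ : FullFunctor D₁ V₁} {J₂ : FullFunctor D₂ V₂} {P₁ Q₁ : D₁.Obj}
  {P₂ Q₂ : D₂.Obj}

/-- Elements of the algebraic tensor product are finite sums, so elementary tensors suffice; there
`π` is jointly continuous, being bounded by the product of the norms. -/
lemma tendsto_rep_pair (π : (algTensor D₁ D₂).Rep) {X Q Q'} {X' R R'}
    {ι₁ ι₂ : Type*} {l₁ : Filter ι₁} {l₂ : Filter ι₂} {b₁ : ι₁ → V₁.Hom X X} {b₂ : ι₂ → V₂.Hom X' X'}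
    (h₁ : ∀ Z (f : V₁.Hom Z X), Tendsto (fun i => V₁.comp (b₁ i) f) l₁ (𝓝 f))
    (h₂ : ∀ Z (f : V₂.Hom Z X'), Tendsto (fun i => V₂.comp (b₂ i) f) l₂ (𝓝 f))
    (g : (algTensor V₁ V₂).Hom (X, X') (J₁.obj Q', J₂.obj R'))
    (f : (algTensor V₁ V₂).Hom (J₁.obj Q, J₂.obj R) (X, X')) :
    Tendsto (fun i : ι₁ × ι₂ => π.map (X := (Q, R)) (Y := (Q', R'))
      (TensorProduct.map J₁.inv J₂.inv ((algTensor V₁ V₂).comp (X := (J₁.obj Q, J₂.obj R))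
        (Y := (X, X')) (Z := (J₁.obj Q', J₂.obj R')) g
        ((algTensor V₁ V₂).comp (X := (J₁.obj Q, J₂.obj R))
        (Y := (X, X')) (Z := (X, X')) (b₁ i.1 ⊗ₜ[ℂ] b₂ i.2) f)))) (l₁ ×ˢ l₂)
      (𝓝 (π.map (X := (Q, R)) (Y := (Q', R'))
        (TensorProduct.map J₁.inv J₂.inv ((algTensor V₁ V₂).comp (X := (J₁.obj Q, J₂.obj R))
          (Y := (X, X')) (Z := (J₁.obj Q', J₂.obj R')) g f)))) := by
  induction g using TensorProduct.induction_on with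
  | zero => simp only [map_zero, LinearMap.zero_apply]; exact tendsto_const_nhds
  | add g g' hg hg' => simp only [map_add, LinearMap.add_apply]; exact hg.add hg'
  | tmul g g' =>
    induction f using TensorProduct.induction_on with
    | zero => simp only [map_zero]; exact tendsto_const_nhds
    | add f f' hf hf' => simp only [map_add]; exact hf.add hf'
    | tmul f f' =>
      have h3 : Tendsto (fun i : ι₁ × ι₂ => (J₁.inv (V₁.comp g (V₁.comp (b₁ i.1) f)),
          J₂.inv (V₂.comp g' (V₂.comp (b₂ i.2) f')))) (l₁ ×ˢ l₂)
          (𝓝 (J₁.inv (V₁.comp g f), J₂.inv (V₂.comp g' f'))) :=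
        Tendsto.prodMk_nhds
          (((J₁.continuous_inv.comp (continuous_comp_left g)).tendsto _).comp
            ((h₁ _ f).comp tendsto_fst))
          (((J₂.continuous_inv.comp (continuous_comp_left g')).tendsto _).comp
            ((h₂ _ f').comp tendsto_snd))
      exact ((algTensor.continuous_map_tmul π (Q, R) (Q', R')).tendsto _).comp h3

/-- The data for extending a representation of the algebraic tensor product. -/
def gnsDataPair (a₁ : J₁.Approx) (a₂ : J₂.Approx) (π : (algTensor D₁ D₂).Rep) {κ : Type v} [Fintype κ] {P : D₁.Obj × D₂.Obj}
    (ξ : κ → π.H P) : (algTensor V₁ V₂).GNSData where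
  O := D₁.Obj × D₂.Obj
  obj Q := (J₁.obj Q.1, J₂.obj Q.2)
  ρ := π.comap (B := (algTensor V₁ V₂).pull fun Q : D₁.Obj × D₂.Obj => (J₁.obj Q.1, J₂.obj Q.2))
    (fun Q => Q) (fun {X Y} => TensorProduct.map J₁.inv J₂.inv)
    (fun g f => by
      induction g using TensorProduct.induction_on with
      | zero => simp only [map_zero, LinearMap.zero_apply]
      | add g g' hg hg' => simp only [map_add, LinearMap.add_apply, hg, hg']
      | tmul g g' =>
        induction f using TensorProduct.induction_on with
        | zero => simp only [map_zero]
        | add f f' hf hf' => simp only [map_add, hf, hf']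
        | tmul f f' =>
          simp only [TensorProduct.map_tmul, TensorProduct.map₂_apply_tmul, J₁.inv_comp,
            J₂.inv_comp])
    (fun f => by
      induction f using TensorProduct.induction_on with
      | zero => simp only [map_zero]
      | add f f' hf hf' => simp only [map_add, hf, hf']
      | tmul f f' => simp only [TensorProduct.map_tmul, J₁.inv_adj, J₂.inv_adj])
  I X := a₁.I X.1 × a₂.I X.2
  l X := a₁.l X.1 ×ˢ a₂.l X.2
  neBot X := inferInstance
  d X i := (a₁.d X.1 i.1, a₂.d X.2 i.2)
  m X i := a₁.m X.1 i.1 ⊗ₜ[ℂ] a₂.m X.2 i.2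
  tendsto {X _ _} g f := tendsto_rep_pair π (fun Z f => a₁.tendsto X.1 Z f)
    (fun Z f => a₂.tendsto X.2 Z f) g f
  tendsto_sq {X Q Q'} g f := by
    have h := tendsto_rep_pair (J₁ := J₁) (J₂ := J₂) π
      (b₁ := fun i => V₁.comp (a₁.u X.1 i) (a₁.u X.1 i))
      (b₂ := fun i => V₂.comp (a₂.u X.2 i) (a₂.u X.2 i))
      (fun Z f => by simpa only [V₁.assoc] using a₁.tendsto_sq f)
      (fun Z f => by simpa only [V₂.assoc] using a₂.tendsto_sq f) g f
    refine h.congr fun i => congrArg (fun t => π.map (TensorProduct.map J₁.inv J₂.inv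
      ((algTensor V₁ V₂).comp (X := (J₁.obj Q.1, J₂.obj Q.2)) (Y := X) g t))) ?_
    exact (algTensor V₁ V₂).assoc (W := (J₁.obj Q.1, J₂.obj Q.2)) (X := X) (Y := X) (Z := X)
      (a₁.u X.1 i.1 ⊗ₜ[ℂ] a₂.u X.2 i.2) (a₁.u X.1 i.1 ⊗ₜ[ℂ] a₂.u X.2 i.2) f
  -- The bound comes from a decomposition of `t` into elementary tensors. Each contributes the
  -- product of its norms, for the compressing morphisms are contractions.
  bdd {X Y} t := by
    induction t using TensorProduct.induction_on with
    | zero => exact ⟨0, fun i j => by simp only [map_zero, LinearMap.zero_apply, norm_zero]; exact le_rfl⟩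
    | add s t hs ht =>
      obtain ⟨C, hC⟩ := hs
      obtain ⟨C', hC'⟩ := ht
      refine ⟨C + C', fun i j => ?_⟩
      simp only [map_add, LinearMap.add_apply]
      exact (norm_add_le _ _).trans (add_le_add (hC i j) (hC' i j))
    | tmul s t =>
      refine ⟨‖s‖ * ‖t‖, fun i j => ?_⟩
      refine (algTensor.norm_map_tmul_le π (X := (a₁.d X.1 i.1, a₂.d X.2 i.2))
        (Y := (a₁.d Y.1 j.1, a₂.d Y.2 j.2)) (J₁.inv _) (J₂.inv _)).trans ?_
      rw [J₁.norm_inv, J₂.norm_inv]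
      exact mul_le_mul (a₁.norm_conj_le s i.1 j.1) (a₂.norm_conj_le t i.2 j.2) (norm_nonneg _)
        (norm_nonneg _)
  κ := κ
  P := P
  ξ := ξ

lemma map_inv_map (t : D₁.Hom P₁ Q₁ ⊗[ℂ] D₂.Hom P₂ Q₂) :
    TensorProduct.map J₁.inv J₂.inv (TensorProduct.map J₁.map J₂.map t) = t := by
  have e₁ : J₁.inv ∘ₗ J₁.map (X := P₁) (Y := Q₁) = LinearMap.id := LinearMap.ext J₁.inv_map
  have e₂ : J₂.inv ∘ₗ J₂.map (X := P₂) (Y := Q₂) = LinearMap.id := LinearMap.ext J₂.inv_map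
  rw [← LinearMap.comp_apply, ← TensorProduct.map_comp, e₁, e₂, TensorProduct.map_id,
    LinearMap.id_apply]

lemma exists_rep_pair (a₁ : J₁.Approx) (a₂ : J₂.Approx) (hD₁ : D₁.Unital) (hD₂ : D₂.Unital)
    {π : (algTensor D₁ D₂).Rep} (hπ : π.Nondegenerate) {P : (algTensor D₁ D₂).Obj} (ζ : π.H P) :
    ∃ σ : (algTensor V₁ V₂).Rep, σ.Nondegenerate ∧
      ∃ w : ∀ Q : (algTensor D₁ D₂).Obj, σ.H (J₁.obj Q.1, J₂.obj Q.2) →ₗᵢ[ℂ] π.H Q,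
      (∀ Q Q' (t : (algTensor D₁ D₂).Hom Q Q') η,
        w Q' (σ.map (X := (J₁.obj Q.1, J₂.obj Q.2)) (Y := (J₁.obj Q'.1, J₂.obj Q'.2))
          (TensorProduct.map J₁.map J₂.map t) η) = π.map t (w Q η)) ∧ ∃ η, w P η = ζ := by
  obtain ⟨e₁, he₁⟩ := hD₁ P.1
  obtain ⟨e₂, he₂⟩ := hD₂ P.2
  have hid : ∀ f : (algTensor D₁ D₂).Hom P P,
      (algTensor D₁ D₂).comp (X := P) (Y := P) (Z := P) (e₁ ⊗ₜ[ℂ] e₂) f = f := fun f => by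
    induction f using TensorProduct.induction_on with
    | zero => simp only [map_zero]
    | add f f' hf hf' => simp only [map_add, hf, hf']
    | tmul f f' => exact congrArg₂ (fun a b => a ⊗ₜ[ℂ] b) (he₁.2 _ f) (he₂.2 _ f')
  have he' : π.map (X := P) (Y := P) (TensorProduct.map J₁.inv J₂.inv
      (TensorProduct.map J₁.map J₂.map (e₁ ⊗ₜ[ℂ] e₂))) ζ = ζ := by
    rw [map_inv_map]
    exact StarCat.Rep.map_eq_of_nondegenerate hπ hid ζ
  obtain ⟨σ, hσ, w, hw, hk⟩ : ∃ σ : (algTensor V₁ V₂).Rep, σ.Nondegenerate ∧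
      ∃ w : ∀ Q : (algTensor D₁ D₂).Obj, σ.H (J₁.obj Q.1, J₂.obj Q.2) →ₗᵢ[ℂ] π.H Q,
      (∀ Q Q' (t : (algTensor V₁ V₂).Hom (J₁.obj Q.1, J₂.obj Q.2) (J₁.obj Q'.1, J₂.obj Q'.2)) η,
        w Q' (σ.map (X := (J₁.obj Q.1, J₂.obj Q.2)) (Y := (J₁.obj Q'.1, J₂.obj Q'.2)) t η) =
        π.map (X := Q) (Y := Q') (TensorProduct.map J₁.inv J₂.inv t) (w Q η)) ∧
      ∀ _ : PUnit.{v + 1}, ∃ η, w P η = ζ :=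
    (a₁.gnsDataPair a₂ π (κ := PUnit) (P := P) fun _ => ζ).exists_rep
      (TensorProduct.map J₁.map J₂.map (e₁ ⊗ₜ[ℂ] e₂)) fun _ => he'
  exact ⟨σ, hσ, w, fun Q Q' t η => by rw [hw, map_inv_map], hk PUnit.unit⟩

/-- The extension `σ` depends on the vector `ζ` at which `π t` is evaluated, but the bound for `‖σ(J
t)‖` by the maximal norm does not. -/
lemma norm_rep_le_max (a₁ : J₁.Approx) (a₂ : J₂.Approx) (hD₁ : D₁.Unital) (hD₂ : D₂.Unital)
    {π : (algTensor D₁ D₂).Rep} (hπ : π.Nondegenerate) {X Y : (algTensor D₁ D₂).Obj}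
    (t : (algTensor D₁ D₂).Hom X Y) :
    ‖π.map t‖ ≤ (CrossNorm.max V₁ V₂).p (J₁.obj X.1, J₂.obj X.2) (J₁.obj Y.1, J₂.obj Y.2)
      (TensorProduct.map J₁.map J₂.map t) := by
  refine ContinuousLinearMap.opNorm_le_bound _ (apply_nonneg _ _) fun ζ => ?_
  obtain ⟨σ, hσ, w, hw, η, rfl⟩ := a₁.exists_rep_pair a₂ hD₁ hD₂ hπ ζ
  rw [← hw, LinearIsometry.norm_map, LinearIsometry.norm_map]
  exact ContinuousLinearMap.le_of_opNorm_le _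
    (StarCat.le_famSeminorm (A := algTensor V₁ V₂) (S := fun π :
      {π : (algTensor V₁ V₂).Rep // π.Nondegenerate} => π.1) (algTensor.famBdd _)
      ⟨σ, hσ⟩ (X := (J₁.obj X.1, J₂.obj X.2)) (Y := (J₁.obj Y.1, J₂.obj Y.2))
      (TensorProduct.map J₁.map J₂.map t)) η

/-- Restricting representations along the full functors keeps them nondegenerate and gives `≤`;
`norm_rep_le_max` gives `≥`. -/
lemma max_p_map (a₁ : J₁.Approx) (a₂ : J₂.Approx) (hD₁ : D₁.Unital) (hD₂ : D₂.Unital)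
    {X Y : (algTensor D₁ D₂).Obj} (t : (algTensor D₁ D₂).Hom X Y) :
    (CrossNorm.max V₁ V₂).p (J₁.obj X.1, J₂.obj X.2) (J₁.obj Y.1, J₂.obj Y.2)
      (TensorProduct.map J₁.map J₂.map t) = (CrossNorm.max D₁ D₂).p X Y t := by
  refine le_antisymm (Real.iSup_le (fun π => ?_) (apply_nonneg _ _))
    (Real.iSup_le (fun π => norm_rep_le_max a₁ a₂ hD₁ hD₂ π.2 t) (apply_nonneg _ _))
  let σ : (algTensor D₁ D₂).Rep := π.1.comap (fun Q => (J₁.obj Q.1, J₂.obj Q.2))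
    (fun {X Y} => TensorProduct.map J₁.map J₂.map)
    (fun g f => by
      induction g using TensorProduct.induction_on with
      | zero => simp only [map_zero, LinearMap.zero_apply]
      | add g g' hg hg' => simp only [map_add, LinearMap.add_apply, hg, hg']
      | tmul g g' =>
        induction f using TensorProduct.induction_on with
        | zero => simp only [map_zero]
        | add f f' hf hf' => simp only [map_add, hf, hf']
        | tmul f f' =>
          simp only [TensorProduct.map_tmul, TensorProduct.map₂_apply_tmul, J₁.map_comp,
            J₂.map_comp])
    (fun f => by
      induction f using TensorProduct.induction_on with
      | zero => simp only [map_zero]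
      | add f f' hf hf' => simp only [map_add, hf, hf']
      | tmul f f' => simp only [TensorProduct.map_tmul, J₁.map_adj, J₂.map_adj])
  have hσ : σ.Nondegenerate := StarCat.Rep.comap_nondegenerate π.2 _ _ _ _
    fun X => TensorProduct.map_surjective J₁.surj J₂.surj
  exact StarCat.le_famSeminorm (A := algTensor D₁ D₂) (S := fun π :
      {π : (algTensor D₁ D₂).Rep // π.Nondegenerate} => π.1) (algTensor.famBdd _) ⟨σ, hσ⟩ t

lemma norm_tensorRepAux_apply_le (σ₁ : V₁.toStarCat.Rep) (σ₂ : V₂.toStarCat.Rep)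
    {X Y : (algTensor V₁ V₂).Obj} (t : (algTensor V₁ V₂).Hom X Y)
    (η : σ₁.H X.1 ⊗[ℂ] σ₂.H X.2) :
    ‖tensorRepAux σ₁ σ₂ X Y t η‖ ≤ ‖(tensorRep σ₁ σ₂).map t‖ * ‖η‖ := by
  have h := ContinuousLinearMap.le_opNorm (completionₗ _ _ (tensorRepAux σ₁ σ₂ X Y t)) η
  rwa [completionₗ_coe, UniformSpace.Completion.norm_coe, UniformSpace.Completion.norm_coe] at h

/-- For `ζ = ∑ x_k ⊗ y_k` extend `π₁` along the `x_k` and `π₂` along the `y_k`. The tensor product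
of the two embedding isometries intertwines the tensor representations and has `ζ` in its range. -/
lemma norm_tensorRep_le_min (a₁ : J₁.Approx) (a₂ : J₂.Approx) (hD₁ : D₁.Unital) (hD₂ : D₂.Unital)
    {π₁ : D₁.toStarCat.Rep} (h₁ : π₁.Nondegenerate) {π₂ : D₂.toStarCat.Rep}
    (h₂ : π₂.Nondegenerate) {X Y : (algTensor D₁ D₂).Obj} (t : (algTensor D₁ D₂).Hom X Y) :
    ‖(tensorRep π₁ π₂).map t‖ ≤
      (CrossNorm.min V₁ V₂).p (J₁.obj X.1, J₂.obj X.2) (J₁.obj Y.1, J₂.obj Y.2)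
        (TensorProduct.map J₁.map J₂.map t) := by
  set C := (CrossNorm.min V₁ V₂).p (J₁.obj X.1, J₂.obj X.2) (J₁.obj Y.1, J₂.obj Y.2)
    (TensorProduct.map J₁.map J₂.map t) with hC
  -- A vector of the completed tensor product is not a finite sum, but algebraic tensors are dense.
  suffices key : ∀ ζ : π₁.H X.1 ⊗[ℂ] π₂.H X.2, ‖tensorRepAux π₁ π₂ X Y t ζ‖ ≤ C * ‖ζ‖ by
    refine ContinuousLinearMap.opNorm_le_bound
      (completionₗ _ _ (tensorRepAux π₁ π₂ X Y t)) (apply_nonneg _ _) fun ζ => ?_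
    refine UniformSpace.Completion.induction_on (p := fun ζ =>
      ‖completionₗ _ _ (tensorRepAux π₁ π₂ X Y t) ζ‖ ≤ C * ‖ζ‖) ζ
      (isClosed_le (ContinuousLinearMap.continuous _).norm
        (continuous_const.mul continuous_norm)) fun ζ => ?_
    rw [completionₗ_coe, UniformSpace.Completion.norm_coe, UniformSpace.Completion.norm_coe]
    exact key ζ
  intro ζ
  obtain ⟨S, hS⟩ := TensorProduct.exists_finset ζ
  obtain ⟨σ₁, hσ₁, w₁, hw₁, hk₁⟩ := a₁.exists_rep hD₁ h₁ (κ := S) (P := X.1) fun k => k.1.1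
  obtain ⟨σ₂, hσ₂, w₂, hw₂, hk₂⟩ := a₂.exists_rep hD₂ h₂ (κ := S) (P := X.2) fun k => k.1.2
  choose η₁ hη₁ using hk₁
  choose η₂ hη₂ using hk₂
  set η : σ₁.H (J₁.obj X.1) ⊗[ℂ] σ₂.H (J₂.obj X.2) := ∑ k, η₁ k ⊗ₜ[ℂ] η₂ k with hη
  have e : TensorProduct.mapIsometry (w₁ X.1) (w₂ X.2) η = ζ := by
    rw [hη, map_sum, hS, ← Finset.sum_coe_sort S fun i => i.1 ⊗ₜ[ℂ] i.2]
    refine Finset.sum_congr rfl fun k _ => ?_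
    rw [TensorProduct.mapIsometry_apply, TensorProduct.map_tmul, LinearIsometry.coe_toLinearMap,
      LinearIsometry.coe_toLinearMap, hη₁, hη₂]
  have key : ∀ (t : (algTensor D₁ D₂).Hom X Y) (η : σ₁.H (J₁.obj X.1) ⊗[ℂ] σ₂.H (J₂.obj X.2)),
      TensorProduct.mapIsometry (w₁ Y.1) (w₂ Y.2)
        (tensorRepAux σ₁ σ₂ (J₁.obj X.1, J₂.obj X.2) (J₁.obj Y.1, J₂.obj Y.2)
          (TensorProduct.map J₁.map J₂.map t) η) =
      tensorRepAux π₁ π₂ X Y t (TensorProduct.mapIsometry (w₁ X.1) (w₂ X.2) η) := by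
    intro t η
    induction t using TensorProduct.induction_on with
    | zero => simp only [map_zero, zero_apply]
    | add s t hs ht => simp only [map_add, add_apply, hs, ht]
    | tmul s t =>
      induction η using TensorProduct.induction_on with
      | zero => simp only [map_zero]
      | add η η' h h' => simp only [map_add, h, h']
      | tmul η η' =>
        have e₁ := hw₁ X.1 Y.1 s η
        have e₂ := hw₂ X.2 Y.2 t η'
        rw [TensorProduct.map_tmul, tensorRepAux_tmul, tensorRepAux_tmul,
          TensorProduct.mapIsometry_apply, TensorProduct.mapIsometry_apply, TensorProduct.mapL_tmul,
          TensorProduct.map_tmul, TensorProduct.map_tmul, TensorProduct.mapL_tmul]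
        exact congrArg₂ (fun a b => a ⊗ₜ[ℂ] b) e₁ e₂
  rw [← e, ← key, LinearIsometry.norm_map, LinearIsometry.norm_map]
  refine (norm_tensorRepAux_apply_le σ₁ σ₂ (X := (J₁.obj X.1, J₂.obj X.2))
    (Y := (J₁.obj Y.1, J₂.obj Y.2)) (TensorProduct.map J₁.map J₂.map t) η).trans ?_
  exact mul_le_mul_of_nonneg_right (StarCat.le_famSeminorm (A := algTensor V₁ V₂) (S := fun π :
      {π : V₁.toStarCat.Rep // π.Nondegenerate} × {π : V₂.toStarCat.Rep // π.Nondegenerate} =>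
      tensorRep π.1.1 π.2.1) (algTensor.famBdd _) (⟨σ₁, hσ₁⟩, ⟨σ₂, hσ₂⟩)
      (X := (J₁.obj X.1, J₂.obj X.2)) (Y := (J₁.obj Y.1, J₂.obj Y.2))
      (TensorProduct.map J₁.map J₂.map t)) (norm_nonneg _)

lemma min_p_map (a₁ : J₁.Approx) (a₂ : J₂.Approx) (hD₁ : D₁.Unital) (hD₂ : D₂.Unital)
    {X Y : (algTensor D₁ D₂).Obj} (t : (algTensor D₁ D₂).Hom X Y) :
    (CrossNorm.min V₁ V₂).p (J₁.obj X.1, J₂.obj X.2) (J₁.obj Y.1, J₂.obj Y.2)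
      (TensorProduct.map J₁.map J₂.map t) = (CrossNorm.min D₁ D₂).p X Y t := by
  refine le_antisymm (Real.iSup_le (fun π => ?_) (apply_nonneg _ _))
    (Real.iSup_le (fun π => norm_tensorRep_le_min a₁ a₂ hD₁ hD₂ π.1.2 π.2.2 t) (apply_nonneg _ _))
  let σ₁ : D₁.toStarCat.Rep := π.1.1.comap J₁.obj (fun {X Y} => J₁.map (X := X) (Y := Y))
    (fun g f => J₁.map_comp g f) (fun f => J₁.map_adj f)
  let σ₂ : D₂.toStarCat.Rep := π.2.1.comap J₂.obj (fun {X Y} => J₂.map (X := X) (Y := Y))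
    (fun g f => J₂.map_comp g f) (fun f => J₂.map_adj f)
  have hσ₁ : σ₁.Nondegenerate := StarCat.Rep.comap_nondegenerate π.1.2 _ _ _ _ fun X => J₁.surj
  have hσ₂ : σ₂.Nondegenerate := StarCat.Rep.comap_nondegenerate π.2.2 _ _ _ _ fun X => J₂.surj
  have h := StarCat.le_famSeminorm (A := algTensor D₁ D₂) (S := fun π :
      {π : D₁.toStarCat.Rep // π.Nondegenerate} × {π : D₂.toStarCat.Rep // π.Nondegenerate} =>
      tensorRep π.1.1 π.2.1) (algTensor.famBdd _) (⟨σ₁, hσ₁⟩, ⟨σ₂, hσ₂⟩) t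
  have e : ∀ t : (algTensor D₁ D₂).Hom X Y, tensorRepAux σ₁ σ₂ X Y t =
      tensorRepAux π.1.1 π.2.1 (J₁.obj X.1, J₂.obj X.2) (J₁.obj Y.1, J₂.obj Y.2)
        (TensorProduct.map J₁.map J₂.map t) := fun t => by
    induction t using TensorProduct.induction_on with
    | zero => simp only [map_zero]
    | add s t hs ht => simp only [map_add, hs, ht]
    | tmul s t => rfl
  refine le_trans (le_of_eq ?_) h
  exact congrArg (fun T => ‖completionₗ _ _ T‖) (e t).symm

end Pair

end FullFunctor.Approx

end

noncomputable section

open CStarCat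

/-! ### Finitely presentable objects -/

namespace CStarCat

variable (V : CStarCat.{u, v})

/-- The inclusion of the finitely presentable objects. -/
def finPresIncl : FullFunctor V.finPres V where
  obj X := X.1
  map := LinearMap.id
  map_comp _ _ := rfl
  map_adj _ := rfl
  norm_map _ := rfl
  surj g := ⟨g, rfl⟩

lemma finPres_unital : V.finPres.Unital := fun X => by
  obtain ⟨e, he⟩ := X.2
  exact ⟨e, isId_of_end (V := V.finPres) he⟩

variable {V}

lemma finitelyPresentable_obj {E : CStarCat.{u₁, v₁}} (K : FullFunctor E V) (hE : E.Unital)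
    (X : E.Obj) : V.FinitelyPresentable (K.obj X) := by
  obtain ⟨e, he⟩ := hE X
  exact ⟨K.map e, fun f => ⟨(K.map_isId he).2 _ f, (K.map_isId he).1 _ f⟩⟩

lemma FinitelyPresentable.exists_isId {A : V.Obj} (h : V.FinitelyPresentable A) :
    ∃ e : V.Hom A A, IsId e := by
  obtain ⟨e, he⟩ := h
  exact ⟨e, isId_of_end he⟩

lemma IsDirectSum.isOrthFamily {I : Type} {X : I → V.Obj} {Y : V.Obj}
    {j : ∀ i, Mult V (X i) Y} (h : V.IsDirectSum X Y j) : IsOrthFamily j :=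
  ⟨h.isometry, h.orthogonal, fun Z f => (h.hasSum_L Z f).summable⟩

/-- The inclusion of a full subcategory is bijective on multipliers, so a system with finitely
presentable terms is a system in the subcategory. -/
lemma FinitelyAccessible.isIndDense (hV : V.FinitelyAccessible) : V.finPresIncl.IsIndDense := by
  obtain ⟨P, hP, h⟩ := hV.exists_set
  intro X
  obtain ⟨S, L, U, hS, ⟨c, hc, hcc, hL, -⟩, ⟨m, hm⟩, s, hs⟩ := h X
  let K := V.finPresIncl
  have hK : ∀ {i j : S.I} (hij : i ≤ j), K.mapMult (X := ⟨S.X i, hP _ (hS i)⟩)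
      (Y := ⟨S.X j, hP _ (hS j)⟩) (K.comapMult (S.ι hij)) = S.ι hij :=
    fun hij => K.mapMult_comapMult _
  let T : IndSystem V.finPres :=
    { I := S.I
      X := fun i => ⟨S.X i, hP _ (hS i)⟩
      ι := fun hij => K.comapMult (S.ι hij)
      isometry := fun hij => K.isIsometry_of_mapMult ((hK hij).symm ▸ S.isometry hij)
      ι_refl := fun i => K.mapMult_inj ((hK _).trans ((S.ι_refl i).trans (K.mapMult_id (X := ⟨S.X i, hP _ (hS i)⟩)).symm))
      ι_comp := fun hij hjk => K.mapMult_inj ((K.mapMult_comp _ _).trans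
        ((congrArg₂ Mult.comp (hK hjk) (hK hij)).trans
          ((S.ι_comp hij hjk).trans (hK (hij.trans hjk)).symm))) }
  exact ⟨T, L, c, ⟨hc, fun hij => (congrArg (c _).comp (hK hij)).trans (hcc hij), hL⟩,
    m.comp s, hm.comp hs.isIsometry⟩

end CStarCat

/-! ### Finite accessibility -/

lemma FullFunctor.IsIndDense.toSplit {D : CStarCat.{u₁, v₁}} {V : CStarCat.{u₂, v₂}}
    {J : FullFunctor D V} (hJ : J.IsIndDense) : J.toSplit.IsIndDense := fun A => by
  obtain ⟨S, L, d, hd, m, hm⟩ := hJ (Split.ob A)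
  exact ⟨S.map (Split.incl D), (Split.incl V).obj L, _, hd.toSplit,
    ((Split.incl V).mapMult m).comp (Split.ι A),
    ((Split.incl V).mapMult_isIsometry hm).comp (Split.ι_isIsometry A)⟩

/-- Functors from a unital category take finitely presentable values, so the set of all finitely
presentable objects can serve as the generating set. -/
lemma CStarCat.finitelyAccessible_of_isIndDense {E : CStarCat.{u₁, v₁}} {W : CStarCat.{u₂, v₂}}
    {K : FullFunctor E W} (hE : E.Unital) (hK : K.IsIndDense) (hW : W.CountablyAdditive) :
    W.FinitelyAccessible := by
  refine ⟨hW, {X | W.FinitelyPresentable X}, fun X hX => hX, fun X => ?_⟩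
  obtain ⟨S, L, c, hc, h⟩ := hK X
  refine ⟨S.map K, L, X, fun i => finitelyPresentable_obj K hE _, ⟨c, hc.isometry, hc.compat,
    hc.tendsto, fun Z f => hc.tendsto_R _ f⟩, h, Mult.id X, ?_⟩
  constructor <;> rw [Mult.id_adj, Mult.id_comp]

/-- The sum of the `X₁ i ⊗ X₂ i` is cut out of the tensor product of the two sums as its diagonal
part; objects of the completion are subobjects of such tensors. -/
lemma CrossNorm.countablyAdditive {V₁ : CStarCat.{u₁, v}} {V₂ : CStarCat.{u₂, v}}
    (M : CrossNorm V₁ V₂) (h₁ : V₁.CountablyAdditive) (h₂ : V₂.CountablyAdditive) :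
    (Split M.cat).CountablyAdditive := by
  refine ⟨Split.subobjectComplete _, fun I _ X => ?_⟩
  choose X₁ X₂ hX using fun i => M.exists_ob (Split.ob (X i))
  obtain ⟨Y₁, j₁, hj₁⟩ := h₁.directSums I X₁
  obtain ⟨Y₂, j₂, hj₂⟩ := h₂.directSums I X₂
  obtain ⟨j, hj⟩ := exists_isOrthFamily (M := M) hj₁.isOrthFamily hj₂.isometry
  have key : ∀ X' : I → M.cat.Obj, (∀ i, M.ob (X₁ i) (X₂ i) = X' i) →
      ∃ j : ∀ i, Mult M.cat (X' i) (M.ob Y₁ Y₂), IsOrthFamily j := by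
    intro X' h
    obtain rfl : (fun i => M.ob (X₁ i) (X₂ i)) = X' := funext h
    exact ⟨j, hj⟩
  obtain ⟨j', hj'⟩ := key _ hX
  exact (hj'.incl.comp fun i => Split.ι_isIsometry (X i)).exists_isDirectSum
    (Split.subobjectComplete _)

/-! ### The finitely presentable objects of a finitely accessible category -/

/-- Polar decomposition: `x^* x` is invertible, hence so is its square root `|x|`, and `b = |x|⁻¹`.
-/
lemma exists_star_mul_mul_self_eq {A : Type*} [NonUnitalCStarAlgebra A] {e : A}
    (he : ∀ a, e * a = a ∧ a * e = a) (x : A) (hx : ‖star x * x - e‖ < 1) :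
    ∃ b : A, star b * (star x * x) * b = e := by
  obtain ⟨s, hs, hss⟩ := exists_selfAdjoint_root x
  let _ : NormedRing A :=
    { (inferInstance : NonUnitalNormedRing A) with
      one := e
      one_mul := fun a => (he a).1
      mul_one := fun a => (he a).2 }
  have h1 : IsUnit (star x * x) := by
    have h2 : ‖(1 : A) - star x * x‖ < 1 := by rw [norm_sub_rev]; exact hx
    have := (Units.oneSub _ h2).isUnit
    rwa [Units.val_oneSub, sub_sub_cancel] at this
  have h3 : IsUnit s := by
    rw [← isUnit_pow_iff two_ne_zero, sq, hss]
    exact h1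
  obtain ⟨w, rfl⟩ := h3
  refine ⟨↑w⁻¹, ?_⟩
  have h4 : star (↑w⁻¹ : A) * w = 1 := by
    have h5 : star ((w : A) * ↑w⁻¹) = star (1 : A) := by rw [Units.mul_inv]
    rw [star_mul, hs] at h5
    have h6 : star (1 : A) = 1 := by
      have h7 : e * star e = star e := (he (star e)).1
      have h8 := congrArg star h7
      rw [star_mul, star_star] at h8
      exact h7.symm.trans h8
    rw [h5, h6]
  rw [← hss, ← mul_assoc, h4, one_mul, Units.mul_inv]
  rfl

/-- Only essential surjectivity is at stake. Let `A` have an identity `e` and an isometry `m` into a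
limit. The morphisms `x = c_i^* m e` satisfy `x^* x → e` in norm, because `e` is a morphism and
strict convergence can be evaluated at it. At a late stage `x` is corrected to an isometry into an
object of `E`, whose range projection splits in `E`. -/
theorem CStarCat.finPres_equivalent {E : CStarCat.{u₁, v₁}} {W : CStarCat.{u₂, v₂}}
    {K : FullFunctor E W} (hE : E.Unital) (hEs : E.SubobjectComplete) (hK : K.IsIndDense) :
    E.Equivalent W.finPres := by
  let F : FullFunctor E W.finPres :=
    { obj := fun X => ⟨K.obj X, finitelyPresentable_obj K hE X⟩
      map := fun {X Y} => K.map (X := X) (Y := Y)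
      map_comp := fun g f => K.map_comp g f
      map_adj := fun f => K.map_adj f
      norm_map := fun f => K.norm_map f
      surj := fun {X Y} => K.surj (X := X) (Y := Y) }
  have key : ∀ A : W.Obj, W.FinitelyPresentable A → ∃ X, W.Isomorphic (K.obj X) A := by
    intro A hA
    obtain ⟨e, he⟩ := hA.exists_isId
    obtain ⟨S, L, c, hc, m, hm⟩ := hK A
    have h1 : Tendsto (fun i => W.comp (W.adj ((c i).adj.L _ (m.L _ e))) ((c i).adj.L _ (m.L _ e)))
        atTop (𝓝 e) := by
      have h2 := ((continuous_comp_left (W.adj (m.L _ e))).tendsto _).comp (hc.tendsto _ (m.L _ e))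
      have h3 : W.comp (W.adj (m.L _ e)) (m.L _ e) = e := by
        rw [Mult.adj_of_L, ← Mult.comp_L, ← Mult.comp_L_apply, hm, Mult.id_L, he.adj_eq, he.1]
      rw [h3] at h2
      refine h2.congr fun i => ?_
      rw [Function.comp_apply, Mult.adj_of_L (c i).adj, Mult.adj_adj, ← Mult.comp_L]
      rfl
    obtain ⟨i, hi⟩ := ((Metric.tendsto_nhds.1 h1) 1 one_pos).exists
    rw [dist_eq_norm] at hi
    set x := (c i).adj.L _ (m.L _ e)
    -- Positivity in a `C^*`-category replaces `x` by an endomorphism `g` with `x^* x = g^* g`, so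
    -- the correction is found inside one `C^*`-algebra.
    obtain ⟨g, hg⟩ := W.pos x
    rw [hg] at hi
    obtain ⟨b, hb⟩ := exists_star_mul_mul_self_eq (A := W.End A) (e := e)
      (fun a => ⟨he.2 _ a, he.1 _ a⟩) g hi
    let b' : W.Hom A A := b
    have hv : W.comp (W.adj (W.comp x b')) (W.comp x b') = e := by
      rw [W.adj_comp, W.assoc, ← W.assoc (W.adj x), hg, ← W.assoc]
      exact hb
    have hV : (Mult.ofHom (W.comp x b')).IsIsometry := Mult.ofHom_isIsometry he hv
    have hp := K.comapMult_isProjection hV.isProjection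
    obtain ⟨U, ι, hι, hιp⟩ := hEs _ _ hp
    refine ⟨U, _, Mult.isUnitary_adj_comp hV (K.mapMult_isIsometry hι) ?_⟩
    rw [← K.mapMult_adj, ← K.mapMult_comp, hιp, K.mapMult_comapMult]
  refine F.equivalent fun Y => ?_
  obtain ⟨X, m, hm⟩ := key Y.1 Y.2
  refine ⟨X, W.finPresIncl.comapMult (X := F.obj X) (Y := Y) m,
    W.finPresIncl.isUnitary_of_mapMult ?_⟩
  have e := W.finPresIncl.mapMult_comapMult (X := F.obj X) (Y := Y) m
  exact e.symm ▸ hm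

end

noncomputable section

open CStarCat

/-! ### Sequential sums from finite sums and direct limits -/

namespace Mult

variable {V : CStarCat.{u, v}} {X Y Z : V.Obj} {I : Type*}

lemma sum_adj (s : Finset I) (m : I → Mult V X Y) : (sum s m).adj = sum s fun i => (m i).adj :=
  ext_L fun W f => by rw [adj_L, sum_R, sum_L, map_sum]; rfl

end Mult

lemma CStarCat.IsDirectSum.mult_ext {V : CStarCat.{u, v}} {I : Type} {X : I → V.Obj} {Y Z : V.Obj}
    {ι : ∀ i, Mult V (X i) Y} (h : V.IsDirectSum X Y ι) {M N : Mult V Y Z}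
    (hMN : ∀ i, M.comp (ι i) = N.comp (ι i)) : M = N := Mult.ext_L fun W f => by
  have h1 := (h.hasSum_L W f).map (M.L W) (M.continuous_L W)
  have h2 := (h.hasSum_L W f).map (N.L W) (N.continuous_L W)
  refine h1.unique (h2.congr_fun ?_)
  intro i
  rw [Function.comp_apply, Function.comp_apply, ← Mult.comp_L_apply, ← Mult.comp_L_apply,
    ← Mult.comp_assoc, ← Mult.comp_assoc, hMN]

/-- The isometry is `∑ j_i ι_i^*`, a finite sum of multipliers. -/
lemma CStarCat.IsDirectSum.exists_isIsometry {V : CStarCat.{u, v}} {I : Type} [Fintype I]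
    {X : I → V.Obj} {Y Z : V.Obj} {ι : ∀ i, Mult V (X i) Y} (h : V.IsDirectSum X Y ι)
    {j : ∀ i, Mult V (X i) Z} (hj : ∀ i, (j i).IsIsometry)
    (ho : ∀ i k, i ≠ k → (j i).adj.comp (j k) = Mult.zero _ _) :
    ∃ w : Mult V Y Z, w.IsIsometry ∧ ∀ i, w.comp (ι i) = j i := by
  have key : ∀ {A B : V.Obj} {a : ∀ i, Mult V (X i) A} {b : ∀ i, Mult V (X i) B},
      (∀ i, (a i).IsIsometry) → (∀ i k, i ≠ k → (a i).adj.comp (a k) = Mult.zero _ _) →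
      ∀ k, (Mult.sum Finset.univ fun i => (b i).comp (a i).adj).comp (a k) = b k := by
    intro A B a b ha ho k
    refine Mult.ext_L fun W f => ?_
    rw [Mult.comp_L_apply, Mult.sum_L, Finset.sum_eq_single k (fun i _ hik => ?_) (by simp),
      Mult.comp_L_apply, ← Mult.comp_L_apply (a k).adj, ha k, Mult.id_L]
    rw [Mult.comp_L_apply, ← Mult.comp_L_apply (a i).adj, ho i k hik, Mult.zero_L, map_zero]
  refine ⟨Mult.sum Finset.univ fun i => (j i).comp (ι i).adj, h.mult_ext fun i => ?_,
    key h.isometry h.orthogonal⟩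
  rw [Mult.comp_assoc, key h.isometry h.orthogonal, Mult.sum_adj, Mult.id_comp]
  simp only [Mult.adj_comp, Mult.adj_adj]
  exact key hj ho i

/-- The finite partial sums of a sequence form an inductive system, and its limit contains all terms
orthogonally. -/
lemma hasSeqSums_of_isLimitCone {E : CStarCat.{u₁, v₁}} {W : CStarCat.{u₂, v₂}}
    {K : FullFunctor E W}
    (hE : ∀ (n : ℕ) (X : Fin n → E.Obj), ∃ (D : E.Obj) (ι : ∀ i, Mult E (X i) D),
      E.IsDirectSum X D ι)
    (hK : ∀ S : IndSystem E, ∃ (L : W.Obj) (c : ∀ i, Mult W (K.obj (S.X i)) L),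
      IsLimitCone K S L c) : HasSeqSums K := by
  intro X
  -- `Y n` is the sum of the first `n` terms `X 0, …, X (n - 1)`, with `Y 0` the empty sum.
  choose Y κ hκ using fun n => hE n fun k => X k
  choose w hw hwκ using fun n m (h : n ≤ m) => (hκ n).exists_isIsometry
    (j := fun k => κ m (Fin.castLE h k)) (fun k => (hκ m).isometry _)
    (fun i k hik => (hκ m).orthogonal (Fin.castLE h i) (Fin.castLE h k)
      fun e => hik (Fin.castLE_injective h e))
  let T : IndSystem E :=
    { I := ℕ
      X := Y
      ι := fun {n m} h => w n m h
      isometry := fun {n m} h => hw n m h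
      ι_refl := fun n => (hκ n).mult_ext fun k => by
        rw [hwκ, Mult.id_comp]; rfl
      ι_comp := fun {n m p} h h' => (hκ n).mult_ext fun k => by
        rw [Mult.comp_assoc, hwκ, hwκ, hwκ]; rfl }
  obtain ⟨L, c, hc⟩ := hK T
  have hcompat : ∀ {n m : ℕ} (h : n ≤ m), (c m).comp (K.mapMult (w n m h)) = c n :=
    fun {n m} h => hc.compat (i := n) (j := m) h
  -- `X k` first appears in `Y (k + 1)`, as its last summand.
  let j : ∀ k, Mult W (K.obj (X k)) L := fun k =>
    (c (k + 1)).comp (K.mapMult (κ (k + 1) (Fin.last k)))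
  have hj : ∀ k n (h : k < n), j k = (c n).comp (K.mapMult (κ n ⟨k, h⟩)) := by
    intro k n h
    change (c (k + 1)).comp (K.mapMult (κ (k + 1) (Fin.last k))) = _
    rw [← hcompat h, Mult.comp_assoc, ← K.mapMult_comp, hwκ]
    rfl
  have hci : ∀ n, (c n).IsIsometry := hc.isometry
  have hiso : ∀ k, (j k).IsIsometry := fun k =>
    (hci (k + 1)).comp (K.mapMult_isIsometry ((hκ (k + 1)).isometry (Fin.last k)))
  have hort : ∀ i k, i ≠ k → (j i).adj.comp (j k) = Mult.zero _ _ := by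
    intro i k hik
    rw [hj i (max i k + 1) (by omega), hj k (max i k + 1) (by omega), Mult.adj_comp,
      Mult.comp_assoc, ← Mult.comp_assoc (c _).adj, hci, Mult.id_comp, ← K.mapMult_adj,
      ← K.mapMult_comp, (hκ _).orthogonal _ _ (by simpa using hik), K.mapMult_zero]
  have hp : ∀ k, ((j k).comp (j k).adj).IsProjection := fun k => (hiso k).isProjection
  have ho : ∀ i k, i ≠ k → ((j i).comp (j i).adj).comp ((j k).comp (j k).adj) = Mult.zero _ _ :=
    fun i k h => by
      rw [Mult.comp_assoc, ← Mult.comp_assoc (j i).adj, hort i k h, Mult.zero_comp, Mult.comp_zero]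
  have hzero : ∀ n k, n ≤ k → (j k).adj.comp (c n) = Mult.zero _ _ := by
    intro n k h
    refine (congrArg (j k).adj.comp (hcompat (h.trans k.le_succ))).symm.trans ?_
    change ((c (k + 1)).comp (K.mapMult (κ (k + 1) (Fin.last k)))).adj.comp _ = _
    rw [Mult.adj_comp, Mult.comp_assoc, ← Mult.comp_assoc (c _).adj, hci, Mult.id_comp,
      ← K.mapMult_adj, ← K.mapMult_comp]
    have e : (κ (k + 1) (Fin.last k)).adj.comp (w n (k + 1) (h.trans k.le_succ)) =
        Mult.zero _ _ := (hκ n).mult_ext fun i => by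
      rw [Mult.comp_assoc, hwκ, Mult.zero_comp]
      refine (hκ (k + 1)).orthogonal _ _ fun e => ?_
      have := congrArg Fin.val e
      have h2 := i.2
      simp only [Fin.val_last, Fin.val_castLE] at this
      omega
    rw [e, K.mapMult_zero]
    rfl
  refine ⟨L, j, hiso, hort, fun Z f => ?_⟩
  -- Applied to a morphism cut down to stage `n`, only the terms with `k < n` survive, so the sum is
  -- finite; such morphisms approximate `f`.
  have h1 := mem_closure_of_tendsto (hc.tendsto Z f) (s := {f | ∃ g, Tendsto (fun s : Finset ℕ =>
      (Mult.sum s fun k => (j k).comp (j k).adj).L Z f) atTop (𝓝 g)}) <| by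
    refine Eventually.of_forall fun n => ?_
    have h2 : Summable fun k => ((j k).comp (j k).adj).L Z (((c n).comp (c n).adj).L Z f) := by
      refine summable_of_ne_finset_zero (s := Finset.range n) fun k hk => ?_
      have hnk : n ≤ k := by simpa using hk
      rw [← Mult.comp_L_apply, Mult.comp_assoc, ← Mult.comp_assoc (j k).adj, hzero n k hnk,
        Mult.zero_comp, Mult.comp_zero, Mult.zero_L]
    obtain ⟨g, hg⟩ := h2
    rw [HasSum, SummationFilter.unconditional_filter] at hg
    exact ⟨g, by simpa only [Mult.sum_L] using hg⟩
  rw [IsClosed.closure_eq] at h1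
  · obtain ⟨g, hg⟩ := h1
    refine ⟨g, ?_⟩
    rw [HasSum, SummationFilter.unconditional_filter]
    simpa only [Mult.sum_L] using hg
  · refine isClosed_setOf_exists_tendsto (T := fun s : Finset ℕ =>
        (Mult.sum s fun k => (j k).comp (j k).adj).L Z) (C := 1)
        (Eventually.of_forall fun s f => ?_)
    rw [one_mul]
    exact (Mult.isProjection_sum hp ho s).norm_L_le f

/-! ### Objects as constant inductive systems -/

lemma IsLimitCone.incl {E : CStarCat.{u₁, v₁}} {W : CStarCat.{u₂, v₂}} {K : FullFunctor E W}
    {S : IndSystem E} {L : W.Obj} {c : ∀ i, Mult W (K.obj (S.X i)) L} (hc : IsLimitCone K S L c) :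
    IsLimitCone ((Split.incl W).comp K) S ((Split.incl W).obj L)
      fun i => (Split.incl W).mapMult (c i) := by
  refine ⟨fun i => (Split.incl W).mapMult_isIsometry (hc.isometry i), fun {i j} h => ?_,
    fun Z f => ?_⟩
  · exact ((congrArg ((Split.incl W).mapMult (c j)).comp
      ((Split.incl W).comp_mapMult K (S.ι h))).trans
      ((Split.incl W).mapMult_comp _ _).symm).trans (congrArg (Split.incl W).mapMult (hc.compat h))
  · have h1 := Split.tendsto_incl_mapMult_L (n := Mult.id L) hc.tendsto f
    rw [FullFunctor.mapMult_id] at h1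
    exact h1.congr fun i => congrArg (fun m => Mult.L m Z f)
      (((Split.incl W).mapMult_comp _ _).trans (congrArg _ ((Split.incl W).mapMult_adj (c i))))

lemma HasSeqSums.incl {E : CStarCat.{u₁, v₁}} {W : CStarCat.{u₂, v₂}} {K : FullFunctor E W}
    (hK : HasSeqSums K) : HasSeqSums ((Split.incl W).comp K) := fun X => by
  obtain ⟨Y, j, hj⟩ := hK X
  exact ⟨_, _, hj.incl⟩

namespace IndSystem

variable {V : CStarCat.{u, v}} {S T U : IndSystem V}

/-- The constant inductive system. -/
def const (X : V.Obj) : IndSystem V where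
  I := Unit
  X _ := X
  ι _ := Mult.id X
  isometry _ := by rw [Mult.IsIsometry, Mult.id_adj, Mult.id_comp]
  ι_refl _ := rfl
  ι_comp _ _ := Mult.id_comp _

lemma const_w (X : V.Obj) (i j : (const X).I) : (const X).w i j = Mult.id X :=
  w_self (S := const X) i

/-- The ind-object given by an inductive system. -/
def toObj (S : IndSystem V) : (indCat₀ V).Obj := S

/-- The morphism of ind-objects represented by a morphism at a given stage. -/
def toInd (S T : IndSystem V) (i : S.I) (j : T.I) :
    V.Hom (S.X i) (T.X j) →ₗ[ℂ] (indCat₀ V).Hom (toObj S) (toObj T) :=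
  StarCat.toC (A := indStar V) (fun S T => indSeminorm S T) ∘ₗ of S T i j

lemma toInd_comp {i : S.I} {j j' : T.I} {k : U.I} (g : V.Hom (T.X j') (U.X k))
    (f : V.Hom (S.X i) (T.X j)) : (indCat₀ V).comp (toInd T U j' k g) (toInd S T i j f) =
      toInd S U i k (V.comp g ((T.w j j').L (S.X i) f)) :=
  (indSeminorm_isCStar.comp_toC (A := indStar V) (of T U j' k g) (of S T i j f)).trans
    (congrArg _ (preComp_of g f))

lemma toInd_comp_self {i : S.I} {j : T.I} {k : U.I} (g : V.Hom (T.X j) (U.X k))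
    (f : V.Hom (S.X i) (T.X j)) : (indCat₀ V).comp (toInd T U j k g) (toInd S T i j f) =
      toInd S U i k (V.comp g f) :=
  (toInd_comp g f).trans (congrArg (fun h => toInd S U i k (V.comp g h)) <| by
    rw [w_self, Mult.id_L])

lemma toInd_adj {i : S.I} {j : T.I} (f : V.Hom (S.X i) (T.X j)) :
    (indCat₀ V).adj (toInd S T i j f) = toInd T S j i (V.adj f) :=
  (indSeminorm_isCStar.adj_toC (A := indStar V) (of S T i j f)).trans (congrArg _ (preAdj_of f))

/-- The seminorm is the supremum of the norms of the components, so components determine the element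
of the completion. -/
lemma toC_eq {s t : PreHom S T} (h : ∀ k l, comp₀ k l s = comp₀ k l t) :
    StarCat.toC (A := indStar V) (fun S T => indSeminorm S T) s =
      StarCat.toC (A := indStar V) (fun S T => indSeminorm S T) t := by
  rw [← sub_eq_zero, ← map_sub, ← norm_eq_zero, StarCat.norm_toC]
  refine le_antisymm (indSeminorm_le _ fun k l => ?_) (apply_nonneg _ _)
  rw [map_sub, h, sub_self, norm_zero]

lemma toInd_ι {i : S.I} {j j' : T.I} (h : j ≤ j') (f : V.Hom (S.X i) (T.X j)) :
    toInd S T i j' ((T.ι h).L _ f) = toInd S T i j f := by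
  have h' : ∀ (k : S.I) (l : T.I), comp₀ k l (of S T i j' ((T.ι h).L _ f)) =
      comp₀ k l (of S T i j f) := fun k l => by
    rw [comp₀_of, comp₀_of, ← Mult.L_R, ← Mult.comp_L_apply, ← w_of_le h, w_comp h]
  exact toC_eq h'

lemma hom_induction {P : (indCat₀ V).Hom (toObj S) (toObj T) → Prop} (hc : IsClosed {f | P f})
    (h0 : P 0) (hadd : ∀ f g, P f → P g → P (f + g)) (h : ∀ i j f, P (toInd S T i j f))
    (f : (indCat₀ V).Hom (toObj S) (toObj T)) : P f := by
  refine StarCat.CHom.induction (A := indStar V) (P := P) hc (fun s => ?_) f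
  have h1 : ∀ s : PreHom S T, P (StarCat.toC (A := indStar V) (fun S T => indSeminorm S T) s) := by
    intro s
    induction s using PreHom.induction with
    | h0 =>
      exact (map_zero (StarCat.toC (A := indStar V) (fun S T => indSeminorm S T)
        (X := S) (Y := T))).symm ▸ h0
    | hof i j f => exact h i j f
    | hadd s t hs ht =>
      exact (map_add (StarCat.toC (A := indStar V) (fun S T => indSeminorm S T)
        (X := S) (Y := T)) s t).symm ▸ hadd _ _ hs ht
  exact h1 s

lemma norm_toInd_const {X Y : V.Obj} (i : (const X).I) (j : (const Y).I) (f : V.Hom X Y) :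
    ‖toInd (const X) (const Y) i j f‖ = ‖f‖ := by
  have h1 : ∀ k l, comp₀ k l (of (const X) (const Y) i j f) = f := fun k l => by
    refine (comp₀_of (S := const X) (T := const Y) k l f).trans ?_
    rw [const_w, const_w]
    rfl
  refine (StarCat.norm_toC (A := indStar V) (p := fun S T => indSeminorm S T)
    (X := const X) (Y := const Y) (of (const X) (const Y) i j f)).trans ?_
  obtain ⟨k, l, h⟩ := exists_indSeminorm_eq (of (const X) (const Y) i j f)
  exact (h k le_rfl l le_rfl).trans (congrArg _ (h1 k l))

variable (V) in
/-- The functor taking an object to the constant inductive system. -/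
def constFunctor : FullFunctor V (indCat₀ V) where
  obj X := toObj (const X)
  map {X Y} := toInd (const X) (const Y) () ()
  map_comp g f := (toInd_comp_self (S := const _) (T := const _) (U := const _) g f).symm
  map_adj f := (toInd_adj (S := const _) (T := const _) f).symm
  norm_map {X Y} f := norm_toInd_const (X := X) (Y := Y) () () f
  surj {X Y} g := by
    -- Constant systems have a single stage, so the closed range of this isometry already contains
    -- all representable morphisms.
    have h1 : IsClosed (Set.range (toInd (const X) (const Y) () ())) :=
      (AddMonoidHomClass.isometry_of_norm (toInd (const X) (const Y) () ())
        (norm_toInd_const (X := X) (Y := Y) () ())).isClosedEmbedding.isClosed_range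
    refine hom_induction (P := fun g => ∃ f, toInd (const X) (const Y) () () f = g) h1 ⟨0, map_zero _⟩
      ?_ (fun i j f => ⟨f, rfl⟩) g
    rintro _ _ ⟨f, rfl⟩ ⟨g, rfl⟩
    exact ⟨f + g, map_add _ _ _⟩

/-- The `i`-th cone map is represented by the identity of `S.X i`, seen as a map from the constant
system into stage `i`; unitality of `V` is what provides it. -/
lemma exists_isLimitCone_constFunctor (hV : V.Unital) (S : IndSystem V) :
    ∃ c : ∀ i, Mult (indCat₀ V) ((constFunctor V).obj (S.X i)) (toObj S),
      IsLimitCone (constFunctor V) S (toObj S) c := by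
  choose e he using fun i => hV (S.X i)
  let a : ∀ i, (indCat₀ V).Hom ((constFunctor V).obj (S.X i)) (toObj S) :=
    fun i => toInd (const (S.X i)) S () i (e i)
  have ha' : ∀ i, (indCat₀ V).adj (a i) = toInd S (const (S.X i)) i () (e i) := fun i =>
    (toInd_adj (S := const (S.X i)) (T := S) (i := ()) (j := i) (e i)).trans
      (congrArg (toInd S (const (S.X i)) i ()) (CStarCat.IsId.adj_eq (he i)))
  have hcomp : ∀ i (Y : V.Obj) (f : V.Hom Y (S.X i)),
      (indCat₀ V).comp (a i) ((constFunctor V).map f) = toInd (const Y) S () i f :=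
    fun i Y f => (toInd_comp_self (S := const Y) (T := const (S.X i)) (U := S)
      (i := ()) (j := ()) (k := i) (e i) f).trans (congrArg (toInd (const Y) S () i) ((he i).2 _ f))
  have ha : ∀ i, (indCat₀ V).comp ((indCat₀ V).adj (a i)) (a i) = (constFunctor V).map (e i) := by
    intro i
    refine (congrArg (fun f => (indCat₀ V).comp f (a i)) (ha' i)).trans
      ((toInd_comp_self (S := const (S.X i)) (T := S) (U := const (S.X i))
        (i := ()) (j := i) (k := ()) (e i) (e i)).trans ?_)
    exact congrArg (toInd (const (S.X i)) (const (S.X i)) () ()) ((he i).2 _ (e i))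
  have hi : ∀ i, (Mult.ofHom (a i)).IsIsometry := fun i =>
    Mult.ofHom_isIsometry ((constFunctor V).map_isId (he i)) (ha i)
  refine ⟨fun i => Mult.ofHom (a i), hi, fun {i j} h => ?_, fun Z f => ?_⟩
  · refine (constFunctor V).mult_ext fun f => ?_
    rw [Mult.comp_L_apply, FullFunctor.mapMult_L]
    refine (hcomp j _ _).trans (Eq.trans ?_ (hcomp i _ f).symm)
    exact toInd_ι (S := const (S.X i)) (i := ()) h f
  · obtain ⟨T, rfl⟩ : ∃ T : IndSystem V, toObj T = Z := ⟨Z, rfl⟩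
    refine hom_induction (P := fun f => Tendsto (fun i =>
      ((Mult.ofHom (a i)).comp (Mult.ofHom (a i)).adj).L (toObj T) f) atTop (𝓝 f)) ?_ ?_ ?_ ?_ f
    · refine isClosed_setOf_tendsto (T := fun i =>
        ((Mult.ofHom (a i)).comp (Mult.ofHom (a i)).adj).L (toObj T)) (S := LinearMap.id) (C := 1)
        (Eventually.of_forall fun i f => ?_) fun f => ?_
      · rw [one_mul]; exact (hi i).isProjection.norm_L_le f
      · rw [one_mul]; exact le_rfl
    · simp only [map_zero]; exact tendsto_const_nhds
    · intro f g hf hg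
      simpa only [map_add] using hf.add hg
    · intro k j f
      -- A morphism represented at stage `j` of the target is fixed exactly by the `i`-th range
      -- projection as soon as `i ≥ j`.
      refine tendsto_const_nhds.congr' ?_
      filter_upwards [eventually_ge_atTop j] with i hij
      have h1 : (indCat₀ V).comp ((indCat₀ V).adj (a i)) (toInd T S k j f) =
          toInd T (const (S.X i)) k () ((S.ι hij).L _ f) := by
        refine (congrArg (fun g => (indCat₀ V).comp g (toInd T S k j f)) (ha' i)).trans
          ((toInd_comp (S := T) (T := S) (U := const (S.X i)) (i := k) (j := j) (j' := i)
            (k := ()) (e i) f).trans (congrArg (toInd T (const (S.X i)) k ()) ?_))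
        exact ((he i).2 _ _).trans (congrArg (fun m => Mult.L m _ f) (w_of_le hij))
      have h2 : (indCat₀ V).comp (a i) (toInd T (const (S.X i)) k () ((S.ι hij).L _ f)) =
          toInd T S k j f := by
        refine (toInd_comp_self (S := T) (T := const (S.X i)) (U := S) (i := k) (j := ())
          (k := i) (e i) ((S.ι hij).L _ f)).trans ?_
        exact (congrArg (toInd T S k i) ((he i).2 _ _)).trans (toInd_ι hij f)
      rw [Mult.comp_L_apply, Mult.ofHom_adj, Mult.ofHom_L, Mult.ofHom_L]
      exact ((congrArg ((indCat₀ V).comp (a i)) h1).trans h2).symm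

end IndSystem

/-- The embedding of a category into its ind-category. -/
def indIncl (V : CStarCat.{u, v}) : FullFunctor V (indCat V) :=
  (Split.incl (indCat₀ V)).comp (IndSystem.constFunctor V)

lemma isIndDense_indIncl {V : CStarCat.{u, v}} (hV : V.Unital) : (indIncl V).IsIndDense := fun A => by
  obtain ⟨c, hc⟩ := IndSystem.exists_isLimitCone_constFunctor hV (Split.ob A)
  exact ⟨_, _, _, hc.incl, Split.ι A, Split.ι_isIsometry A⟩

lemma hasSeqSums_indIncl {V : CStarCat.{u, v}} (hV : V.FinitelyAdditive) :
    HasSeqSums (indIncl V) :=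
  (hasSeqSums_of_isLimitCone (fun n X => hV.directSums (Fin n) X) fun S =>
    ⟨S.toObj, IndSystem.exists_isLimitCone_constFunctor hV.unital S⟩).incl

end

/-! ### Assembling the tensor product theorems. -/

noncomputable section

open CStarCat

variable {D₁ : CStarCat.{u, v}} {D₂ : CStarCat.{v₁, v}} {V₁ : CStarCat.{u₁, v}}
  {V₂ : CStarCat.{u₂, v}} {J₁ : FullFunctor D₁ V₁} {J₂ : FullFunctor D₂ V₂}

lemma CrossNorm.norm_max_map (h₁ : J₁.IsIndDense) (h₂ : J₂.IsIndDense) (hD₁ : D₁.Unital)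
    (hD₂ : D₂.Unital) (X₁ Y₁ : D₁.Obj) (X₂ Y₂ : D₂.Obj)
    (t : D₁.Hom X₁ Y₁ ⊗[ℂ] D₂.Hom X₂ Y₂) :
    ‖(CrossNorm.max V₁ V₂).can _ _ _ _ (TensorProduct.map J₁.map J₂.map t)‖ =
      ‖(CrossNorm.max D₁ D₂).can _ _ _ _ t‖ := by
  obtain ⟨a₁⟩ := h₁.nonempty_approx hD₁
  obtain ⟨a₂⟩ := h₂.nonempty_approx hD₂
  exact (norm_can _ _).trans ((FullFunctor.Approx.max_p_map a₁ a₂ hD₁ hD₂ (X := (X₁, X₂))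
    (Y := (Y₁, Y₂)) t).trans (norm_can _ _).symm)

lemma CrossNorm.norm_min_map (h₁ : J₁.IsIndDense) (h₂ : J₂.IsIndDense) (hD₁ : D₁.Unital)
    (hD₂ : D₂.Unital) (X₁ Y₁ : D₁.Obj) (X₂ Y₂ : D₂.Obj)
    (t : D₁.Hom X₁ Y₁ ⊗[ℂ] D₂.Hom X₂ Y₂) :
    ‖(CrossNorm.min V₁ V₂).can _ _ _ _ (TensorProduct.map J₁.map J₂.map t)‖ =
      ‖(CrossNorm.min D₁ D₂).can _ _ _ _ t‖ := by
  obtain ⟨a₁⟩ := h₁.nonempty_approx hD₁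
  obtain ⟨a₂⟩ := h₂.nonempty_approx hD₂
  exact (norm_can _ _).trans ((FullFunctor.Approx.min_p_map a₁ a₂ hD₁ hD₂ (X := (X₁, X₂))
    (Y := (Y₁, Y₂)) t).trans (norm_can _ _).symm)

/-- A tensor product of finitely accessible categories is finitely accessible, with finitely
presentable part the tensor product of the finitely presentable parts. -/
theorem CrossNorm.finitelyAccessible {M : CrossNorm V₁ V₂} {N : CrossNorm V₁.finPres V₂.finPres}
    (h : ∀ (X₁ Y₁ : V₁.finPres.Obj) (X₂ Y₂ : V₂.finPres.Obj)
      (t : V₁.finPres.Hom X₁ Y₁ ⊗[ℂ] V₂.finPres.Hom X₂ Y₂),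
      ‖M.can _ _ _ _ (TensorProduct.map V₁.finPresIncl.map V₂.finPresIncl.map t)‖ =
        ‖N.can _ _ _ _ t‖)
    (h₁ : V₁.FinitelyAccessible) (h₂ : V₂.FinitelyAccessible) :
    (Split M.cat).FinitelyAccessible ∧ (Split M.cat).finPres.Equivalent (Split N.cat) := by
  have hN := Split.unital (N.unital (finPres_unital V₁) (finPres_unital V₂))
  have hF := (isIndDense_tensorFunctor h h₁.isIndDense h₂.isIndDense).toSplit
  exact ⟨finitelyAccessible_of_isIndDense hN hF
      (M.countablyAdditive h₁.countablyAdditive h₂.countablyAdditive),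
    (finPres_equivalent hN (Split.subobjectComplete _) hF).symm⟩

/-- The ind-category of a tensor product of unital categories is the tensor product of any
categories in which these are dense. -/
theorem CrossNorm.indCat_equivalent {N : CrossNorm D₁ D₂} {M : CrossNorm V₁ V₂}
    (h : ∀ (X₁ Y₁ : D₁.Obj) (X₂ Y₂ : D₂.Obj) (t : D₁.Hom X₁ Y₁ ⊗[ℂ] D₂.Hom X₂ Y₂),
      ‖M.can _ _ _ _ (TensorProduct.map J₁.map J₂.map t)‖ = ‖N.can _ _ _ _ t‖)
    (hD₁ : D₁.Unital) (hD₂ : D₂.Unital) (hs₁ : HasSeqSums J₁) (hs₂ : HasSeqSums J₂)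
    (h₁ : J₁.IsIndDense) (h₂ : J₂.IsIndDense) :
    (indCat (Split N.cat)).Equivalent (Split M.cat) :=
  indCat_split_equivalent (tensorFunctor N M J₁ J₂ h) (N.unital hD₁ hD₂)
    (hasSeqSums_tensorFunctor h hs₁ hs₂) (isIndDense_tensorFunctor h h₁ h₂)

/-- The maximal tensor product of ind-categories. -/
theorem indCat_maxTensor_equivalent (h₁ : J₁.IsIndDense) (h₂ : J₂.IsIndDense) (hD₁ : D₁.Unital)
    (hD₂ : D₂.Unital) (hs₁ : HasSeqSums J₁) (hs₂ : HasSeqSums J₂) :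
    (indCat (maxTensor D₁ D₂)).Equivalent (maxTensor V₁ V₂) := by
  rw [maxTensor_eq, maxTensor_eq]
  exact CrossNorm.indCat_equivalent (N := .max D₁ D₂) (M := .max V₁ V₂)
    (CrossNorm.norm_max_map h₁ h₂ hD₁ hD₂) hD₁ hD₂ hs₁ hs₂ h₁ h₂

/-- The minimal tensor product of ind-categories. -/
theorem indCat_minTensor_equivalent (h₁ : J₁.IsIndDense) (h₂ : J₂.IsIndDense) (hD₁ : D₁.Unital)
    (hD₂ : D₂.Unital) (hs₁ : HasSeqSums J₁) (hs₂ : HasSeqSums J₂) :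
    (indCat (minTensor D₁ D₂)).Equivalent (minTensor V₁ V₂) := by
  rw [minTensor_eq, minTensor_eq]
  exact CrossNorm.indCat_equivalent (N := .min D₁ D₂) (M := .min V₁ V₂)
    (CrossNorm.norm_min_map h₁ h₂ hD₁ hD₂) hD₁ hD₂ hs₁ hs₂ h₁ h₂

end

theorem mainTheorem8 (V₁ : CStarCat.{u₁, v}) (V₂ : CStarCat.{u₂, v}) :
    -- the maximal tensor product
    (V₁.FinitelyAccessible → V₂.FinitelyAccessible →
      (maxTensor V₁ V₂).FinitelyAccessible ∧
      (maxTensor V₁ V₂).finPres.Equivalent (maxTensor V₁.finPres V₂.finPres)) ∧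
    (V₁.FinitelyAdditive → V₂.FinitelyAdditive →
      (indCat (maxTensor V₁ V₂)).Equivalent (maxTensor (indCat V₁) (indCat V₂))) ∧
    -- the minimal tensor product
    (V₁.FinitelyAccessible → V₂.FinitelyAccessible →
      (minTensor V₁ V₂).FinitelyAccessible ∧
      (minTensor V₁ V₂).finPres.Equivalent (minTensor V₁.finPres V₂.finPres)) ∧
    (V₁.FinitelyAdditive → V₂.FinitelyAdditive →
      (indCat (minTensor V₁ V₂)).Equivalent (minTensor (indCat V₁) (indCat V₂))) := by
  refine ⟨fun h₁ h₂ => ?_, fun h₁ h₂ => ?_, fun h₁ h₂ => ?_, fun h₁ h₂ => ?_⟩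
  · rw [maxTensor_eq, maxTensor_eq]
    exact CrossNorm.finitelyAccessible (M := .max V₁ V₂) (N := .max V₁.finPres V₂.finPres)
      (CrossNorm.norm_max_map h₁.isIndDense h₂.isIndDense (CStarCat.finPres_unital V₁)
        (CStarCat.finPres_unital V₂)) h₁ h₂
  -- The dense unital subcategory of `indCat V_i` is `V_i` itself; finite additivity provides the
  -- orthogonal sums of sequences.
  · exact indCat_maxTensor_equivalent (isIndDense_indIncl h₁.unital) (isIndDense_indIncl h₂.unital)
      h₁.unital h₂.unital (hasSeqSums_indIncl h₁) (hasSeqSums_indIncl h₂)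
  · rw [minTensor_eq, minTensor_eq]
    exact CrossNorm.finitelyAccessible (M := .min V₁ V₂) (N := .min V₁.finPres V₂.finPres)
      (CrossNorm.norm_min_map h₁.isIndDense h₂.isIndDense (CStarCat.finPres_unital V₁)
        (CStarCat.finPres_unital V₂)) h₁ h₂
  · exact indCat_minTensor_equivalent (isIndDense_indIncl h₁.unital) (isIndDense_indIncl h₂.unital)
      h₁.unital h₂.unital (hasSeqSums_indIncl h₁) (hasSeqSums_indIncl h₂)
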